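/- All spaces are over $\mathbb C$. For a graded space $W=\coprod_c W_{[c]}$ put $W'=\coprod_c W_{[c]}^*$ and $\overline W=\prod_c W_{[c]}$; finite sums of homogeneous operators on $W$ act on $\overline W$ componentwise. "Converges" for a series in $\overline W$ means that, after pairing with each $w'\in W'$, the multiple series of complex numbers (indexed by the modes) converges absolutely. **Algebras and bimodules.** A *meromorphic open-string vertex algebra* (MOSVA) is a $\mathbb Z$-graded space $V=\coprod_n V_{(n)}$ with $V_{(n)}=0$ for $n\ll 0$, a linear map $Y_V:V\otimes V\to V[[x,x^{-1}]]$ and a vacuum $\mathbf 1\in V$ such that, with $\mathbf d_V$ the weight operator and $D_Vv=\lim_{x\to0}\frac{d}{dx}Y_V(v,x)\mathbf 1$: $[\mathbf d_V,Y_V(v,x)]=x\frac{d}{dx}Y_V(v,x)+Y_V(\mathbf d_Vv,x)$; $Y_V(\mathbf 1,x)=1_V$; $Y_V(u,x)\mathbf 1\in V[[x]]$ with constant term $u$; $\frac d{dx}Y_V(v,x)=Y_V(D_Vv,x)=[D_V,Y_V(v,x)]$; $\langle v',Y_V(u_1,z_1)\cdots Y_V(u_n,z_n)v\rangle$ converges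 absolutely for $|z_1|>\cdots>|z_n|>0$ to a rational function with the only possible poles at $z_i=0$, $z_i=z_j$; $\langle v',Y_V(Y_V(u_1,z_1-z_2)u_2,z_2)v\rangle$ converges absolutely for $|z_2|>|z_1-z_2|>0$ to a rational function with the only possible poles at $z_1=0$, $z_2=0$, $z_1=z_2$, and equals $\langle v',Y_V(u_1,z_1)Y_V(u_2,z_2)v\rangle$ for $|z_1|>|z_2|>|z_1-z_2|>0$. A *$V$-bimodule* is a $\mathbb C$-graded space $W$ with $W_{[c]}=0$ for $\operatorname{Re}c\ll0$, with the weight operator $\mathbf d_W$, an operator $D_W$ of weight $1$, and maps $Y_W^L:V\otimes W\to W[[x,x^{-1}]]$, $Y_W^R:W\otimes V\to W[[x,x^{-1}]]$ satisfying all the analogous axioms of a left and of a right module ($\mathbf d$- and $D$-formulas, $Y_W^L(\mathbf 1,x)=1_W$, creation property of $Y_W^R$, rationality and associativity) and the compatibility conditions: $\langle w',Y_W^L(u_1,z_1)\cdots Y_W^L(u_n,z_n)Y_W^R(w,z_{n+1})Y_V(u_{n+1},z_{n+2})\cdots Y_V(u_{n+k-1},z_{n+k})u_{n+k}\rangle$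 converges absolutely for $|z_1|>\cdots>|z_{n+k}|>0$ to a rational function with the only possible poles at $z_i=0$, $z_i=z_j$; and $\langle w',Y_W^L(u,z_1)Y_W^R(w,z_2)v\rangle$ (for $|z_1|>|z_2|>0$) and $\langle w',Y_W^R(Y_W^L(u,z_1-z_2)w,z_2)v\rangle$ (for $|z_2|>|z_1-z_2|>0$) converge absolutely to a common rational function with the only possible poles at $z_1=0$, $z_2=0$, $z_1=z_2$. Put $Y_W^{s(R)}(v,x)w=e^{xD_W}Y_W^R(w,-x)v$. *Pole-order conditions*: the order of the pole $z_1=0$ of the rational function determined by $\langle v',Y_V(u_1,z_1)Y_V(u_2,z_2)v\rangle$ is bounded by a number depending only on $u_1,v$; that for $\langle w',Y_W^L(u_1,z_1)Y_W^L(u_2,z_2)w\rangle$ only on $u_1,w$; that for $\langle w',Y_W^R(w,z_1)Y_V(u_1,z_2)u_2\rangle$ only on $u_2,w$; that for $\langle w',Y_W^L(u_1,z_1)Y_W^R(w,z_2)u_2\rangle$ only on $u_1,u_2$. **Cochains.** Let $F_n\mathbb C$ be the set of $n$-tuples of distinct complex numbers. Let $\widetilde W_{z_1,\dots,z_n}$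 be the space of maps $f:F_n\mathbb C\to\overline W$ for which there are integers $p_{ij}$ and $g\in W[[x_1,\dots,x_n]]$ such that, for every $w'$, $\langle w',g\rangle$ is a polynomial and $\prod_{i<j}(z_i-z_j)^{p_{ij}}\langle w',f(z)\rangle=\langle w',g(z)\rangle$ on $F_n\mathbb C$ ("$\overline W$-valued rational functions"). $\hat C_0^n(V,W)$ is the set of linear maps $\Phi:V^{\otimes n}\to\widetilde W_{z_1,\dots,z_n}$ with (i) $\langle w',\Phi(\cdots\otimes D_Vv_i\otimes\cdots)(z)\rangle=\partial_{z_i}\langle w',\Phi(v_1\otimes\cdots\otimes v_n)(z)\rangle$ and $\langle w',D_W\Phi(v_1\otimes\cdots\otimes v_n)(z)\rangle=\sum_i\partial_{z_i}\langle w',\Phi(v_1\otimes\cdots\otimes v_n)(z)\rangle$; (ii) $\langle w',t^{\mathbf d_W}\Phi(v_1\otimes\cdots\otimes v_n)(z)\rangle=\langle w',\Phi(t^{\mathbf d_V}v_1\otimes\cdots\otimes t^{\mathbf d_V}v_n)(tz)\rangle$ for $t\in\mathbb C^\times$. For $m\ge1$, $\hat C^n_m(V,W)$ is the set of $\Phi\in\hat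 C^n_0(V,W)$ that are *composable with $m$ vertex operators*: for all $\alpha_0\ge0$, $\alpha_1,\dots,\alpha_n\ge1$ with $\alpha_0+\cdots+\alpha_n=m+n$, all $0\le l_0\le\alpha_0$ and all $u^{(i)}_s\in V$, the series $$Y_W^L(u_1^{(0)},z_1^{(0)})\cdots Y_W^L(u_{l_0}^{(0)},z_{l_0}^{(0)})Y_W^{s(R)}(u_{l_0+1}^{(0)},z_{l_0+1}^{(0)})\cdots Y_W^{s(R)}(u_{\alpha_0}^{(0)},z_{\alpha_0}^{(0)})\,\Phi\Big(\bigotimes_{i=1}^nY_V(u_1^{(i)},z_1^{(i)}-\zeta_i)\cdots Y_V(u_{\alpha_i}^{(i)},z_{\alpha_i}^{(i)}-\zeta_i)\mathbf 1\Big)(\zeta_1,\dots,\zeta_n)$$ converges absolutely when $|z^{(0)}_1|>\cdots>|z^{(0)}_{\alpha_0}|>|\zeta_i|+|z^{(i)}_t-\zeta_i|$, $|z^{(i)}_1-\zeta_i|>\cdots>|z^{(i)}_{\alpha_i}-\zeta_i|$ and $|\zeta_i-\zeta_j|>|z_s^{(i)}-\zeta_i|+|z_t^{(j)}-\zeta_j|$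 ($1\le i<j\le n$), to a rational function of the $z^{(i)}_s$ ($0\le i\le n$) that does not depend on the $\zeta_i$, whose only possible poles are at the coincidences of two of the variables $z_s^{(i)}$, $z_t^{(j)}$, with order bounded by a number depending only on $u_s^{(i)}$ and $u_t^{(j)}$. **Coboundary.** Let $E(\cdot)$ denote the $\overline W$-valued rational function obtained by analytic extension from the sum of a convergent series. For $\Phi\in\hat C_m^n(V,W)$ with $m,n\ge1$, define linear maps from $V^{\otimes(n+1)}$ to $\widetilde W_{z_1,\dots,z_{n+1}}$ by $$(E_W^{(1,0)}\circ_2\Phi)(v_1\otimes\cdots\otimes v_{n+1})=E\big(Y_W^L(v_1,z_1)\Phi(v_2\otimes\cdots\otimes v_{n+1})(z_2,\dots,z_{n+1})\big),$$ $$(\Phi\circ_iE_V^{(2)})(v_1\otimes\cdots\otimes v_{n+1})=E\big(\Phi(v_1\otimes\cdots\otimes Y_V(v_i,z_i-\zeta)Y_V(v_{i+1},z_{i+1}-\zeta)\mathbf 1\otimes\cdots\otimes v_{n+1})(z_1,\dots,z_{i-1},\zeta,z_{i+2},\dots,z_{n+1})\big),$$ $$(E_W^{(0,1)}\circ_2\Phi)(v_1\otimes\cdots\otimes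 v_{n+1})=E\big(Y_W^{s(R)}(v_{n+1},z_{n+1})\Phi(v_1\otimes\cdots\otimes v_n)(z_1,\dots,z_n)\big);$$ the series converge absolutely when, respectively, $|z_1|>|z_i|$ for all $i\ge2$; $|z_j-\zeta|>|z_i-\zeta|>|z_{i+1}-\zeta|$ for all $j\ne i,i+1$; $|z_{n+1}|>|z_i|$ for all $i\le n$. Put $$\hat\delta_m^n\Phi=E_W^{(1,0)}\circ_2\Phi+\sum_{i=1}^n(-1)^i\,\Phi\circ_iE_V^{(2)}+(-1)^{n+1}E_W^{(0,1)}\circ_2\Phi .$$ **Theorem.** Let $V$ be a MOSVA and $W$ a $V$-bimodule, both satisfying the pole-order conditions, and let $m\ge2$, $n\ge1$. Then, for every $\Phi\in\hat C_m^n(V,W)$, the compositions above are well defined for $\Phi$ and $\hat\delta_m^n\Phi\in\hat C_{m-1}^{n+1}(V,W)$; they are also well defined for $\hat\delta_m^n\Phi$, and $$\hat\delta_{m-1}^{n+1}\big(\hat\delta_m^n\Phi\big)=0 .$$ -/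

import Mathlib

noncomputable section

namespace MOSVACohomology

open scoped DirectSum

/-! ## Graded spaces, graded duals and algebraic completions -/

section Graded

variable {ι : Type*} [DecidableEq ι] {W : Type*} [AddCommGroup W] [Module ℂ W]

/-- The algebraic completion `∏ c, W_[c]` of a graded space `W = ∐ c, W_[c]`. -/
abbrev Completion (gr : ι → Submodule ℂ W) : Type _ := ∀ c, gr c

/-- The graded dual `∐ c, (W_[c])^*`. -/
abbrev GradedDual (gr : ι → Submodule ℂ W) : Type _ := ⨁ c, Module.Dual ℂ (gr c)

variable (gr : ι → Submodule ℂ W)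

/-- The pairing of the graded dual with the algebraic completion. -/
def barPairing (w' : GradedDual gr) (x : Completion gr) : ℂ :=
  DirectSum.toModule ℂ ι ℂ (fun c => LinearMap.applyₗ (x c)) w'

variable [DirectSum.Decomposition gr]

/-- The pairing of the graded dual with the graded space itself. -/
def pairing (w' : GradedDual gr) (w : W) : ℂ :=
  barPairing gr w' (fun c => DirectSum.decompose gr w c)

/-- The operator that acts on the component of degree `c` as multiplication by `r c`. -/
def scaleOp (r : ι → ℂ) : W →ₗ[ℂ] W :=
  (DirectSum.toModule ℂ ι W (fun c => r c • (gr c).subtype)) ∘ₗ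
    (DirectSum.decomposeLinearEquiv gr : W →ₗ[ℂ] ⨁ c, gr c)

/-- Extension to the completion, by formal linearity, of a finite sum of homogeneous operators on
`W`: the component of degree `c` of the image of `x` is `∑ b, π_c (L (x b))`, a finite sum. -/
def extendOp (L : W → W) (x : Completion gr) : Completion gr :=
  fun c => ∑ᶠ b : ι, DirectSum.decompose gr (L (x b : W)) c

end Graded

/-! ## Regions and rational functions -/

/-- The product of the differences `z i - z j` over all ordered pairs `i ≠ j`. -/
def diffProd {ι : Type*} [Fintype ι] [DecidableEq ι] (z : ι → ℂ) : ℂ :=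
  ∏ i, ∏ j ∈ Finset.univ.erase i, (z i - z j)

/-- `f` is a rational function with the only possible poles at `z i = 0` and `z i = z j`. -/
def RationalAwayZero {n : ℕ} (f : (Fin n → ℂ) → ℂ) : Prop :=
  ∃ (N : ℕ) (h : MvPolynomial (Fin n) ℂ), ∀ z : Fin n → ℂ,
    Function.Injective z → (∀ i, z i ≠ 0) →
      f z * ((∏ i, z i) * diffProd z) ^ N = MvPolynomial.eval z h

/-- The region `|z_1| > ... > |z_n| > 0`. -/
def Decreasing {n : ℕ} (z : Fin n → ℂ) : Prop :=
  (∀ i j : Fin n, i < j → ‖z j‖ < ‖z i‖) ∧ ∀ i, z i ≠ 0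

/-! ## Meromorphic open-string vertex algebras

A vertex operator map is given by its modes: `Y_V(u, x) v = ∑ k, (Y k u v) x ^ (-k-1)`. All
convergence statements are about multiple series of complex numbers indexed by the modes, and
`HasSum` in `ℂ` is absolute convergence. -/

/-- Meromorphic open-string vertex algebras. -/
structure MOSVA {V : Type*} [AddCommGroup V] [Module ℂ V]
    (gr : ℤ → Submodule ℂ V) [DirectSum.Decomposition gr] where
  Y : ℤ → V →ₗ[ℂ] V →ₗ[ℂ] V
  vac : V
  lower_bound : ∃ B : ℤ, ∀ n < B, gr n = ⊥
  d_comm : ∀ (k : ℤ) (u v : V),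
    scaleOp gr (fun n => (n : ℂ)) (Y k u v) - Y k u (scaleOp gr (fun n => (n : ℂ)) v) =
      (-(k : ℂ) - 1) • Y k u v + Y k (scaleOp gr (fun n => (n : ℂ)) u) v
  identity : ∀ (k : ℤ) (v : V), Y k vac v = if k = -1 then v else 0
  creation_reg : ∀ (k : ℤ) (u : V), 0 ≤ k → Y k u vac = 0
  creation_lim : ∀ u : V, Y (-1) u vac = u
  D_deriv : ∀ (k : ℤ) (u v : V), (-(k : ℂ)) • Y (k - 1) u v = Y k (Y (-2) u vac) v
  D_comm : ∀ (k : ℤ) (u v : V),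
    (-(k : ℂ)) • Y (k - 1) u v = Y (-2) (Y k u v) vac - Y k u (Y (-2) v vac)
  rationality_prod : ∀ (n : ℕ) (u : Fin n → V) (v : V) (v' : GradedDual gr),
    ∃ f : (Fin n → ℂ) → ℂ, RationalAwayZero f ∧ ∀ z, Decreasing z →
      HasSum (fun k : Fin n → ℤ =>
        pairing gr v' (Fin.foldr n (fun i x => Y (k i) (u i) x) v) * ∏ i, z i ^ (-k i - 1)) (f z)
  rationality_iter : ∀ (u₁ u₂ v : V) (v' : GradedDual gr),
    ∃ f : (Fin 2 → ℂ) → ℂ, RationalAwayZero f ∧ ∀ z₁ z₂ : ℂ,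
      0 < ‖z₁ - z₂‖ → ‖z₁ - z₂‖ < ‖z₂‖ →
      HasSum (fun k : ℤ × ℤ => pairing gr v' (Y k.2 (Y k.1 u₁ u₂) v) *
        ((z₁ - z₂) ^ (-k.1 - 1) * z₂ ^ (-k.2 - 1))) (f ![z₁, z₂])
  assoc : ∀ (u₁ u₂ v : V) (v' : GradedDual gr) (z₁ z₂ : ℂ),
    ‖z₂‖ < ‖z₁‖ → ‖z₁ - z₂‖ < ‖z₂‖ → 0 < ‖z₁ - z₂‖ →
      ∑' k : ℤ × ℤ, pairing gr v' (Y k.1 u₁ (Y k.2 u₂ v)) *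
        (z₁ ^ (-k.1 - 1) * z₂ ^ (-k.2 - 1)) =
      ∑' k : ℤ × ℤ, pairing gr v' (Y k.2 (Y k.1 u₁ u₂) v) *
        ((z₁ - z₂) ^ (-k.1 - 1) * z₂ ^ (-k.2 - 1))

section Modules

variable {V : Type*} [AddCommGroup V] [Module ℂ V] {grV : ℤ → Submodule ℂ V}
  [DirectSum.Decomposition grV]

/-- The operator `D_V v = lim_{x → 0} d/dx Y_V(v, x) 1`. -/
def MOSVA.D (A : MOSVA grV) (v : V) : V := A.Y (-2) v A.vac

/-- The series `a k₁ k₂`, weighted by `z₁ ^ (-k₁-1) z₂ ^ (-k₂-1)`, converges absolutely when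
`|z₁| > |z₂| > 0` to a rational function with the only possible poles at `z₁ = 0`, `z₂ = 0`,
`z₁ = z₂`, for which the order of the pole `z₁ = 0` is at most `C`. -/
def PoleOrderLE (a : ℤ → ℤ → ℂ) (C : ℕ) : Prop :=
  ∃ (N : ℕ) (h : MvPolynomial (Fin 2) ℂ), ∀ z₁ z₂ : ℂ, ‖z₂‖ < ‖z₁‖ → 0 < ‖z₂‖ →
    HasSum (fun k : ℤ × ℤ => a k.1 k.2 * (z₁ ^ (-k.1 - 1) * z₂ ^ (-k.2 - 1)))
      (MvPolynomial.eval ![z₁, z₂] h / (z₁ ^ C * z₂ ^ N * (z₁ - z₂) ^ N))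

/-- The pole-order condition for a meromorphic open-string vertex algebra. -/
def MOSVA.PoleOrderCondition (A : MOSVA grV) : Prop :=
  ∀ u₁ v : V, ∃ C : ℕ, ∀ (v' : GradedDual grV) (u₂ : V),
    PoleOrderLE (fun k₁ k₂ => pairing grV v' (A.Y k₁ u₁ (A.Y k₂ u₂ v))) C

/-! ## Left modules, right modules, bimodules -/

/-- Left modules. The operator `d_W` is multiplication by the weight. -/
structure LeftModule (A : MOSVA grV) {W : Type*} [AddCommGroup W] [Module ℂ W]
    (gr : ℂ → Submodule ℂ W) [DirectSum.Decomposition gr] where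
  D : W →ₗ[ℂ] W
  D_weight : ∀ (c : ℂ) (w : W), w ∈ gr c → D w ∈ gr (c + 1)
  lower_bound : ∃ B : ℝ, ∀ c : ℂ, c.re < B → gr c = ⊥
  YL : ℤ → V →ₗ[ℂ] W →ₗ[ℂ] W
  left_d_comm : ∀ (k : ℤ) (u : V) (w : W),
    scaleOp gr (fun c => c) (YL k u w) - YL k u (scaleOp gr (fun c => c) w) =
      YL k (scaleOp grV (fun n => (n : ℂ)) u) w + (-(k : ℂ) - 1) • YL k u w
  left_identity : ∀ (k : ℤ) (w : W), YL k A.vac w = if k = -1 then w else 0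
  left_D_deriv : ∀ (k : ℤ) (u : V) (w : W), (-(k : ℂ)) • YL (k - 1) u w = YL k (A.D u) w
  left_D_comm : ∀ (k : ℤ) (u : V) (w : W),
    (-(k : ℂ)) • YL (k - 1) u w = D (YL k u w) - YL k u (D w)
  left_rationality_prod : ∀ (n : ℕ) (u : Fin n → V) (w : W) (w' : GradedDual gr),
    ∃ f : (Fin n → ℂ) → ℂ, RationalAwayZero f ∧ ∀ z, Decreasing z →
      HasSum (fun k : Fin n → ℤ =>
        pairing gr w' (Fin.foldr n (fun i x => YL (k i) (u i) x) w) * ∏ i, z i ^ (-k i - 1)) (f z)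
  left_rationality_iter : ∀ (u₁ u₂ : V) (w : W) (w' : GradedDual gr),
    ∃ f : (Fin 2 → ℂ) → ℂ, RationalAwayZero f ∧ ∀ z₁ z₂ : ℂ,
      0 < ‖z₁ - z₂‖ → ‖z₁ - z₂‖ < ‖z₂‖ →
      HasSum (fun k : ℤ × ℤ => pairing gr w' (YL k.2 (A.Y k.1 u₁ u₂) w) *
        ((z₁ - z₂) ^ (-k.1 - 1) * z₂ ^ (-k.2 - 1))) (f ![z₁, z₂])
  left_assoc : ∀ (u₁ u₂ : V) (w : W) (w' : GradedDual gr) (z₁ z₂ : ℂ),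
    ‖z₂‖ < ‖z₁‖ → ‖z₁ - z₂‖ < ‖z₂‖ → 0 < ‖z₁ - z₂‖ →
      ∑' k : ℤ × ℤ, pairing gr w' (YL k.1 u₁ (YL k.2 u₂ w)) *
        (z₁ ^ (-k.1 - 1) * z₂ ^ (-k.2 - 1)) =
      ∑' k : ℤ × ℤ, pairing gr w' (YL k.2 (A.Y k.1 u₁ u₂) w) *
        ((z₁ - z₂) ^ (-k.1 - 1) * z₂ ^ (-k.2 - 1))

/-- Right modules, with `Y_W^R(w, x) v = ∑ k, (YR k w v) x ^ (-k-1)`. -/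
structure RightModule (A : MOSVA grV) {W : Type*} [AddCommGroup W] [Module ℂ W]
    (gr : ℂ → Submodule ℂ W) [DirectSum.Decomposition gr] where
  D : W →ₗ[ℂ] W
  D_weight : ∀ (c : ℂ) (w : W), w ∈ gr c → D w ∈ gr (c + 1)
  lower_bound : ∃ B : ℝ, ∀ c : ℂ, c.re < B → gr c = ⊥
  YR : ℤ → W →ₗ[ℂ] V →ₗ[ℂ] W
  right_d_comm : ∀ (k : ℤ) (w : W) (v : V),
    scaleOp gr (fun c => c) (YR k w v) - YR k w (scaleOp grV (fun n => (n : ℂ)) v) =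
      YR k (scaleOp gr (fun c => c) w) v + (-(k : ℂ) - 1) • YR k w v
  right_creation_reg : ∀ (k : ℤ) (w : W), 0 ≤ k → YR k w A.vac = 0
  right_creation_lim : ∀ w : W, YR (-1) w A.vac = w
  right_D_deriv : ∀ (k : ℤ) (w : W) (v : V), (-(k : ℂ)) • YR (k - 1) w v = YR k (D w) v
  right_D_comm : ∀ (k : ℤ) (w : W) (v : V),
    (-(k : ℂ)) • YR (k - 1) w v = D (YR k w v) - YR k w (A.D v)
  right_rationality_prod : ∀ (n : ℕ) (w : W) (u : Fin n → V) (v : V) (w' : GradedDual gr),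
    ∃ f : (Fin (n + 1) → ℂ) → ℂ, RationalAwayZero f ∧ ∀ z, Decreasing z →
      HasSum (fun k : Fin (n + 1) → ℤ =>
        pairing gr w' (YR (k 0) w (Fin.foldr n (fun i x => A.Y (k i.succ) (u i) x) v)) *
          ∏ i, z i ^ (-k i - 1)) (f z)
  right_rationality_iter : ∀ (w : W) (u₁ u₂ : V) (w' : GradedDual gr),
    ∃ f : (Fin 2 → ℂ) → ℂ, RationalAwayZero f ∧ ∀ z₁ z₂ : ℂ,
      0 < ‖z₁ - z₂‖ → ‖z₁ - z₂‖ < ‖z₂‖ →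
      HasSum (fun k : ℤ × ℤ => pairing gr w' (YR k.2 (YR k.1 w u₁) u₂) *
        ((z₁ - z₂) ^ (-k.1 - 1) * z₂ ^ (-k.2 - 1))) (f ![z₁, z₂])
  right_assoc : ∀ (w : W) (u₁ u₂ : V) (w' : GradedDual gr) (z₁ z₂ : ℂ),
    ‖z₂‖ < ‖z₁‖ → ‖z₁ - z₂‖ < ‖z₂‖ → 0 < ‖z₁ - z₂‖ →
      ∑' k : ℤ × ℤ, pairing gr w' (YR k.1 w (A.Y k.2 u₁ u₂)) *
        (z₁ ^ (-k.1 - 1) * z₂ ^ (-k.2 - 1)) =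
      ∑' k : ℤ × ℤ, pairing gr w' (YR k.2 (YR k.1 w u₁) u₂) *
        ((z₁ - z₂) ^ (-k.1 - 1) * z₂ ^ (-k.2 - 1))

/-- Bimodules: a left and a right module structure with the same grading and the same operators
`d_W`, `D_W` that are compatible. -/
structure Bimodule (A : MOSVA grV) {W : Type*} [AddCommGroup W] [Module ℂ W]
    (gr : ℂ → Submodule ℂ W) [DirectSum.Decomposition gr]
    extends LeftModule A gr, RightModule A gr where
  compat_rationality : ∀ (n p : ℕ) (u : Fin n → V) (w : W) (t : Fin p → V) (v : V)
    (w' : GradedDual gr),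
    ∃ f : (Fin (n + (p + 1)) → ℂ) → ℂ, RationalAwayZero f ∧ ∀ z, Decreasing z →
      HasSum (fun k : Fin (n + (p + 1)) → ℤ =>
        pairing gr w' (Fin.foldr n (fun i x => YL (k (Fin.castAdd (p + 1) i)) (u i) x)
          (YR (k (Fin.natAdd n 0)) w
            (Fin.foldr p (fun i x => A.Y (k (Fin.natAdd n i.succ)) (t i) x) v))) *
          ∏ i, z i ^ (-k i - 1)) (f z)
  compat_assoc : ∀ (u v : V) (w : W) (w' : GradedDual gr),
    ∃ f : (Fin 2 → ℂ) → ℂ, RationalAwayZero f ∧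
      (∀ z₁ z₂ : ℂ, ‖z₂‖ < ‖z₁‖ → 0 < ‖z₂‖ →
        HasSum (fun k : ℤ × ℤ => pairing gr w' (YL k.1 u (YR k.2 w v)) *
          (z₁ ^ (-k.1 - 1) * z₂ ^ (-k.2 - 1))) (f ![z₁, z₂])) ∧
      (∀ z₁ z₂ : ℂ, ‖z₁ - z₂‖ < ‖z₂‖ → 0 < ‖z₁ - z₂‖ →
        HasSum (fun k : ℤ × ℤ => pairing gr w' (YR k.2 (YL k.1 u w) v) *
          ((z₁ - z₂) ^ (-k.1 - 1) * z₂ ^ (-k.2 - 1))) (f ![z₁, z₂]))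

variable {A : MOSVA grV} {W : Type*} [AddCommGroup W] [Module ℂ W]
  {gr : ℂ → Submodule ℂ W} [DirectSum.Decomposition gr]

/-- The pole-order condition for a bimodule. -/
def Bimodule.PoleOrderCondition (M : Bimodule A gr) : Prop :=
  (∀ (u₁ : V) (w : W), ∃ C : ℕ, ∀ (w' : GradedDual gr) (u₂ : V),
    PoleOrderLE (fun k₁ k₂ => pairing gr w' (M.YL k₁ u₁ (M.YL k₂ u₂ w))) C) ∧
  (∀ (u₂ : V) (w : W), ∃ C : ℕ, ∀ (w' : GradedDual gr) (u₁ : V),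
    PoleOrderLE (fun k₁ k₂ => pairing gr w' (M.YR k₁ w (A.Y k₂ u₁ u₂))) C) ∧
  (∀ u₁ u₂ : V, ∃ C : ℕ, ∀ (w' : GradedDual gr) (w : W),
    PoleOrderLE (fun k₁ k₂ => pairing gr w' (M.YL k₁ u₁ (M.YR k₂ w u₂))) C)

/-- The modes of `Y_W^{s(R)}(v, x) w = e^{x D_W} Y_W^R(w, -x) v`: the coefficient of `x ^ (-k-1)`.
The sum is finite since `YR l w v = 0` for large `l`. -/
def Bimodule.YS (M : Bimodule A gr) (k : ℤ) (v : V) (w : W) : W :=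
  ∑ᶠ j : ℕ, ((-1 : ℂ) ^ (-(k + j) - 1) / (Nat.factorial j : ℂ)) • (M.D ^ j) (M.YR (k + j) w v)

/-! ## Rational functions with values in the completion -/

/-- The configuration space `F_n ℂ` of injective `n`-tuples of complex numbers. -/
abbrev Conf (n : ℕ) : Type := Fin n ↪ ℂ

/-- `f` is a rational function on `F_n ℂ` with values in the completion and with the only possible
poles at `z i = z j`: there are exponents `p i j` and a formal power series `g` with
coefficients in `W` such that, for every `w'`, the series `⟨w', g⟩` is a polynomial `h` and
`∏_{i < j} (z i - z j) ^ p i j * ⟨w', f z⟩ = h z`. In particular each `⟨w', f z⟩` is a rational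
function with the only possible poles at `z i = z j`. -/
def IsBarRational (gr : ℂ → Submodule ℂ W) [DirectSum.Decomposition gr] {n : ℕ}
    (f : Conf n → Completion gr) : Prop :=
  ∃ (p : Fin n → Fin n → ℕ) (g : (Fin n →₀ ℕ) → W), ∀ w' : GradedDual gr,
    ∃ h : MvPolynomial (Fin n) ℂ, (∀ k, h.coeff k = pairing gr w' (g k)) ∧
      ∀ z : Conf n,
        (∏ i, ∏ j ∈ Finset.Ioi i, (z i - z j) ^ p i j) * barPairing gr w' (f z) =
          MvPolynomial.eval z h

/-- Linear maps from `V^{⊗ n}`, that is, `n`-linear maps on `V`, to functions on `F_n ℂ` with values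
in the completion of `W`. -/
abbrev Cochain (V : Type*) [AddCommGroup V] [Module ℂ V] {W : Type*} [AddCommGroup W] [Module ℂ W]
    (gr : ℂ → Submodule ℂ W) (n : ℕ) : Type _ :=
  MultilinearMap ℂ (fun _ : Fin n => V) (Conf n → Completion gr)

/-- Value at `z`, set to zero off the configuration space; used only to take derivatives at points
of the (open) configuration space. -/
def evalAt {n : ℕ} (f : Conf n → Completion gr) (z : Fin n → ℂ) : Completion gr :=
  open Classical in if h : Function.Injective z then f ⟨z, h⟩ else 0

/-- The `D`-derivative property. -/
def DDerivativeProperty (M : Bimodule A gr) {n : ℕ} (Φ : Cochain V gr n) : Prop :=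
  (∀ (i : Fin n) (v : Fin n → V) (w' : GradedDual gr) (z : Conf n),
    HasDerivAt (fun t => barPairing gr w' (evalAt (Φ v) (Function.update z i t)))
      (barPairing gr w' (Φ (Function.update v i (A.D (v i))) z)) (z i)) ∧
  (∀ (v : Fin n → V) (w' : GradedDual gr) (z : Conf n),
    barPairing gr w' (extendOp gr M.D (Φ v z)) =
      ∑ i, deriv (fun t => barPairing gr w' (evalAt (Φ v) (Function.update z i t))) (z i))

/-- The `d`-conjugation property:
`⟨w', t^{d_W} Φ(v_1 ⊗ ... ⊗ v_n)(z)⟩ = ⟨w', Φ(t^{d_V} v_1 ⊗ ... ⊗ t^{d_V} v_n)(t z)⟩`. -/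
def DConjugationProperty (grV : ℤ → Submodule ℂ V) [DirectSum.Decomposition grV] {n : ℕ}
    (Φ : Cochain V gr n) : Prop :=
  ∀ (v : Fin n → V) (w' : GradedDual gr) (t : ℂ) (z y : Conf n), t ≠ 0 → (∀ i, y i = t * z i) →
    barPairing gr w' (fun c => (t ^ c) • Φ v z c) =
      barPairing gr w' (Φ (fun i => scaleOp grV (fun k : ℤ => t ^ k) (v i)) y)

/-- The region of convergence for composability: the `z⁰ j` are the variables of the operators acting
on the value of `Φ`, the `z i j` those of the operators in the `i`-th argument of `Φ`, the `ζ i` the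
arguments of the value of `Φ`. -/
def ComposableRegion {n a : ℕ} {α : Fin n → ℕ} (z₀ : Fin a → ℂ) (z : ∀ i, Fin (α i) → ℂ)
    (ζ : Fin n → ℂ) : Prop :=
  (∀ s t : Fin a, s < t → ‖z₀ t‖ < ‖z₀ s‖) ∧
  (∀ (s : Fin a) (i : Fin n) (t : Fin (α i)), ‖ζ i‖ + ‖z i t - ζ i‖ < ‖z₀ s‖) ∧
  (∀ (i : Fin n) (s t : Fin (α i)), s < t → ‖z i t - ζ i‖ < ‖z i s - ζ i‖) ∧
  (∀ (i j : Fin n) (s : Fin (α i)) (t : Fin (α j)), i ≠ j →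
    ‖z i s - ζ i‖ + ‖z j t - ζ j‖ < ‖ζ i - ζ j‖)

/-- The tuple consisting of all entries of `x₀` and of `x`. -/
def joinVars {X : Type*} {n a : ℕ} {α : Fin n → ℕ} (x₀ : Fin a → X) (x : ∀ i, Fin (α i) → X) :
    (Fin a ⊕ (Σ i, Fin (α i))) → X :=
  Sum.elim x₀ (fun s : Σ i, Fin (α i) => x s.1 s.2)

/-- The product of `(z x - z y) ^ p (u x) (u y)` over all ordered pairs `x ≠ y`. -/
def poleProd {ι : Type*} [Fintype ι] [DecidableEq ι] (p : V → V → ℕ) (u : ι → V) (z : ι → ℂ) : ℂ :=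
  ∏ x, ∏ y ∈ Finset.univ.erase x, (z x - z y) ^ p (u x) (u y)

/-- `Φ` is composable with `m` vertex operators: for all `a ≥ 0` and `α 1, ..., α n ≥ 1` of sum `m + n`
and all `l ≤ a`, the series
`Y^L(u⁰_1, z⁰_1) ⋯ Y^L(u⁰_l, z⁰_l) Y^{s(R)}(u⁰_{l+1}, z⁰_{l+1}) ⋯ Y^{s(R)}(u⁰_a, z⁰_a)
Φ(⊗_i Y_V(u^i_1, z^i_1 - ζ_i) ⋯ Y_V(u^i_{α i}, z^i_{α i} - ζ_i) 1)(ζ_1, ..., ζ_n)`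
converges absolutely in the region to a rational function of the `z` that is independent of the `ζ`,
with the only possible poles along the diagonals, where the order of the pole at `z_x = z_y`
is bounded by a number that depends only on `u_x` and `u_y`. -/
def Composable (M : Bimodule A gr) (m : ℕ) {n : ℕ} (Φ : Cochain V gr n) : Prop :=
  ∃ p : V → V → ℕ, ∀ (a : ℕ) (α : Fin n → ℕ), (∀ i, 1 ≤ α i) → a + ∑ i, α i = m + n →
    ∀ l ≤ a, ∀ (u₀ : Fin a → V) (u : ∀ i, Fin (α i) → V) (w' : GradedDual gr),
    ∃ h : MvPolynomial (Fin a ⊕ (Σ i, Fin (α i))) ℂ,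
      ∀ (z₀ : Fin a → ℂ) (z : ∀ i, Fin (α i) → ℂ) (ζ : Conf n), ComposableRegion z₀ z ζ →
        HasSum (fun k : (Fin a → ℤ) × (∀ i, Fin (α i) → ℤ) =>
          barPairing gr w'
            (Fin.foldr a
              (fun j x => extendOp gr (fun w =>
                if (j : ℕ) < l then M.YL (k.1 j) (u₀ j) w else M.YS (k.1 j) (u₀ j) w) x)
              (Φ (fun i => Fin.foldr (α i) (fun j x => A.Y (k.2 i j) (u i j) x) A.vac) ζ)) *
          ((∏ j, z₀ j ^ (-k.1 j - 1)) * ∏ i, ∏ j, (z i j - ζ i) ^ (-k.2 i j - 1)))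
        (MvPolynomial.eval (joinVars z₀ z) h / poleProd p (joinVars u₀ u) (joinVars z₀ z))

/-- The space `Ĉ_m^n(V, W)` of cochains: linear maps from `V^{⊗ n}` to rational functions with values
in the completion that have the `D`-derivative and `d`-conjugation properties and, when `m ≥ 1`, are
composable with `m` vertex operators. -/
def cochains (M : Bimodule A gr) (m n : ℕ) : Set (Cochain V gr n) :=
  {Φ | (∀ v, IsBarRational gr (Φ v)) ∧ DDerivativeProperty M Φ ∧ DConjugationProperty grV Φ ∧
    (1 ≤ m → Composable M m Φ)}

/-! ## Compositions and the coboundary operator -/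

/-- `Ψ` is `E_W^{(1,0)} ∘₂ Φ`: for all `v_1, ..., v_{n+1}`, the series
`Y_W^L(v_1, z_1) Φ(v_2 ⊗ ... ⊗ v_{n+1})(z_2, ..., z_{n+1})` converges absolutely when `|z_1| > |z_i|`
for all `i ≥ 2`, and the rational function it determines is `Ψ(v_1 ⊗ ... ⊗ v_{n+1})`. -/
def IsLeftComp (M : Bimodule A gr) {n : ℕ} (Φ : Cochain V gr n) (Ψ : Cochain V gr (n + 1)) : Prop :=
  ∀ v : Fin (n + 1) → V, IsBarRational gr (Ψ v) ∧
    ∀ z : Conf (n + 1), (∀ i : Fin n, ‖z i.succ‖ < ‖z 0‖) → ∀ w' : GradedDual gr,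
      HasSum (fun k : ℤ =>
        barPairing gr w' (extendOp gr (M.YL k (v 0))
          (Φ (fun i => v i.succ) ((Fin.succEmb n).trans z))) * z 0 ^ (-k - 1))
        (barPairing gr w' (Ψ v z))

/-- `Ψ` is `E_W^{(0,1)} ∘₂ Φ`: for all `v_1, ..., v_{n+1}`, the series
`Y_W^{s(R)}(v_{n+1}, z_{n+1}) Φ(v_1 ⊗ ... ⊗ v_n)(z_1, ..., z_n)` converges absolutely when
`|z_{n+1}| > |z_i|` for all `i ≤ n`, and the rational function it determines is
`Ψ(v_1 ⊗ ... ⊗ v_{n+1})`. -/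
def IsRightComp (M : Bimodule A gr) {n : ℕ} (Φ : Cochain V gr n) (Ψ : Cochain V gr (n + 1)) :
    Prop :=
  ∀ v : Fin (n + 1) → V, IsBarRational gr (Ψ v) ∧
    ∀ z : Conf (n + 1), (∀ i : Fin n, ‖z i.castSucc‖ < ‖z (Fin.last n)‖) → ∀ w' : GradedDual gr,
      HasSum (fun k : ℤ =>
        barPairing gr w' (extendOp gr (M.YS k (v (Fin.last n)))
          (Φ (fun i => v i.castSucc) (Fin.castSuccEmb.trans z))) * z (Fin.last n) ^ (-k - 1))
        (barPairing gr w' (Ψ v z))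

/-- `Ψ` is `Φ ∘_i E_V^{(2)}`: for all `v_1, ..., v_{n+1}`, the series
`Φ(v_1 ⊗ ... ⊗ Y_V(v_i, z_i - ζ) Y_V(v_{i+1}, z_{i+1} - ζ) 1 ⊗ ... ⊗ v_{n+1})(z_1, ..., ζ, ..., z_{n+1})`
converges absolutely when `|z_j - ζ| > |z_i - ζ| > |z_{i+1} - ζ|` for all `j ≠ i, i + 1`, and the
rational function it determines is `Ψ(v_1 ⊗ ... ⊗ v_{n+1})`. Below, `y` is the tuple
`(z_1, ..., z_{i-1}, ζ, z_{i+2}, ..., z_{n+1})`. -/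
def IsMidComp (A : MOSVA grV) {n : ℕ} (i : Fin n) (Φ : Cochain V gr n) (Ψ : Cochain V gr (n + 1)) :
    Prop :=
  ∀ v : Fin (n + 1) → V, IsBarRational gr (Ψ v) ∧
    ∀ (z : Conf (n + 1)) (y : Conf n), (∀ j, j ≠ i → y j = z (i.succ.succAbove j)) →
      ‖z i.succ - y i‖ < ‖z i.castSucc - y i‖ →
      (∀ j, j ≠ i → ‖z i.castSucc - y i‖ < ‖y j - y i‖) → ∀ w' : GradedDual gr,
      HasSum (fun k : ℤ × ℤ =>
        barPairing gr w'
          (Φ (Function.update (fun j => v (i.succ.succAbove j)) i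
            (A.Y k.1 (v i.castSucc) (A.Y k.2 (v i.succ) A.vac))) y) *
          ((z i.castSucc - y i) ^ (-k.1 - 1) * (z i.succ - y i) ^ (-k.2 - 1)))
        (barPairing gr w' (Ψ v z))

open Classical in
/-- `E_W^{(1,0)} ∘₂ Φ`; zero if it is not defined. -/
def leftComp (M : Bimodule A gr) {n : ℕ} (Φ : Cochain V gr n) : Cochain V gr (n + 1) :=
  if h : ∃ Ψ, IsLeftComp M Φ Ψ then h.choose else 0

open Classical in
/-- `E_W^{(0,1)} ∘₂ Φ`; zero if it is not defined. -/
def rightComp (M : Bimodule A gr) {n : ℕ} (Φ : Cochain V gr n) : Cochain V gr (n + 1) :=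
  if h : ∃ Ψ, IsRightComp M Φ Ψ then h.choose else 0

open Classical in
/-- `Φ ∘_i E_V^{(2)}`; zero if it is not defined. -/
def midComp (A : MOSVA grV) {n : ℕ} (i : Fin n) (Φ : Cochain V gr n) : Cochain V gr (n + 1) :=
  if h : ∃ Ψ, IsMidComp A i Φ Ψ then h.choose else 0

/-- All the compositions that enter the coboundary of `Φ` are (uniquely) defined. -/
def CompositionsDefined (M : Bimodule A gr) {n : ℕ} (Φ : Cochain V gr n) : Prop :=
  (∃! Ψ, IsLeftComp M Φ Ψ) ∧ (∀ i : Fin n, ∃! Ψ, IsMidComp A i Φ Ψ) ∧ (∃! Ψ, IsRightComp M Φ Ψ)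

/-- The coboundary operator
`E_W^{(1,0)} ∘₂ Φ + ∑_{i=1}^n (-1)^i Φ ∘_i E_V^{(2)} + (-1)^{n+1} E_W^{(0,1)} ∘₂ Φ`
(the index `i` below starts at `0`). -/
def coboundary (M : Bimodule A gr) {n : ℕ} (Φ : Cochain V gr n) : Cochain V gr (n + 1) :=
  leftComp M Φ + ∑ i : Fin n, (-1 : ℂ) ^ ((i : ℕ) + 1) • midComp A i Φ +
    (-1 : ℂ) ^ (n + 1) • rightComp M Φ

end Modules

end MOSVACohomology

end

noncomputable section

set_option linter.unusedSectionVars false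

namespace MOSVACohomology

open Function
open MvPolynomial (eval eval_X eval_rename coeff_smul monomial X pderiv eval_C continuous_eval)
open Fin (tail cons succAboveCases last val_castSucc val_last val_zero tail_cons cons_zero elim0
  lastCases prod_univ_two prod_univ_succ insertNth_apply_same insertNth_apply_succAbove
  sum_univ_succAbove succAbove_castSucc_self foldr foldr_succ)
open Finset (univ sum_congr mem_univ range sum_add_distrib prod_congr prod_mul_distrib smul_sum
  sum_mul mem_range single_le_sum Ioi Iio sum_insert prod_insert sum_sub_distrib prod_empty
  sum_eq_single mul_sum mem_erase ne_of_mem_erase prod_pow mem_filter HasAntidiagonal add_sum_erase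
  prod_pow_eq_pow_sum)
open DirectSum (decompose Decomposition decompose_of_mem_ne decompose_of_mem_same decompose_add
  decompose_smul)
open Module (Dual End)
open Filter (eventually_all eventually_gt_atTop atTop)
open Equiv (prodComm prodComm_apply funSplitAt ofBijective trans_apply)
open Pi (single)
open LinearMap (ker)
open Sum (elim elim_inl elim_inr)
open Submodule (span_induction)
open Nat (factorial factorial_succ)
open Matrix (cons_val_zero cons_val_one)
open scoped DirectSum Topology

lemma _root_.HasSum.of_eq {K : Type*} {f g : K → ℂ} {a : ℂ} (hf : HasSum f a) (h : ∀ k, f k = g k) :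
    HasSum g a :=
  (funext h : f = g) ▸ hf

lemma hasSum_of_single {K : Type*} {f : K → ℂ} {a : ℂ} (k : K) (h : ∀ l, l ≠ k → f l = 0) (ha : f k
    = a) : HasSum f a :=
  ha ▸ hasSum_single k h

/-! ## Uniqueness of Laurent coefficients -/

/-- The functions `e k` on `T` are independent with respect to absolutely convergent series. -/
def Independent {K X : Type*} (e : K → X → ℂ) (T : Set X) : Prop :=
  ∀ c : K → ℂ, (∀ x ∈ T, HasSum (fun k => c k * e k x) 0) → c = 0

lemma Independent.eq {K X : Type*} {e : K → X → ℂ} {T : Set X} (h : Independent e T) {c d : K → ℂ}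
    {f : X → ℂ} (hc : ∀ x ∈ T, HasSum (fun k => c k * e k x) (f x)) (hd : ∀ x ∈ T, HasSum (fun k =>
    d k * e k x) (f x)) : c = d := by
  refine sub_eq_zero.mp (h (c - d) fun x hx => ?_); simpa [sub_mul] using (hc x hx).sub (hd x hx)

lemma Independent.comp_equiv {K L X Y : Type*} {e : K → X → ℂ} {T : Set X} (he : Independent e T) (σ
    : L ≃ K) (τ : Y → X) {f : L → Y → ℂ} {S : Set Y} (hS : ∀ x ∈ T, ∃ y ∈ S, τ y = x) (hf : ∀ l, ∀ y
    ∈ S, f l y = e (σ l) (τ y)) : Independent f S := by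
  intro c hc
  have := he (c ∘ σ.symm) fun x hx => by
    obtain ⟨y, hy, rfl⟩ := hS x hx; refine σ.hasSum_iff.mp ?_
    refine (hc y hy).of_eq fun l => ?_; simp [hf l y hy]
  ext l; simpa using congrFun this (σ l)

/-- Iterated sums determine the coefficients of an absolutely convergent double series. -/
lemma Independent.refine {K L X Y : Type*} {e : K → X → ℂ} {T : Set X} {f : L → Y → ℂ} {S : Set Y}
    (he : Independent e T) (hf : Independent f S) {c G : K × L → ℂ} {F : X → Y → ℂ} {g : L → X → ℂ}
    (hc : ∀ x ∈ T, ∀ y ∈ S, HasSum (fun k : K × L => c k * (e k.1 x * f k.2 y)) (F x y)) (h1 : ∀ x ∈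
    T, ∀ y ∈ S, HasSum (fun l => g l x * f l y) (F x y)) (h2 : ∀ x ∈ T, ∀ l, HasSum (fun k => G (k,
    l) * e k x) (g l x)) : c = G := by
  have hl : ∀ l, ∃ y ∈ S, f l y ≠ 0 := by
    intro l; by_contra h; push Not at h
    classical
    have := hf (single l 1) fun y hy =>
      hasSum_of_single l (fun k hk => by simp [hk]) (by simp [h y hy])
    simpa using congrFun this l
  have key : ∀ x ∈ T, ∀ l, HasSum (fun k => c (k, l) * e k x) (∑' k, c (k, l) * e k x) := by
    intro x hx l; obtain ⟨y, hy, hne⟩ := hl l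
    have h2 := ((hc x hx y hy).summable.comp_injective (i := fun k : K => (k, l)) (fun a b h => by
      simpa using h)).mul_right (f l y)⁻¹
    refine Summable.hasSum (h2.congr fun k => ?_); simp only [comp]; field_simp
  have h0 : ∀ x ∈ T, (fun l => ∑' k, c (k, l) * e k x) = fun l => g l x := by
    intro x hx; refine hf.eq (f := F x) (fun y hy => ?_) (fun y hy => h1 x hx y hy)
    have h2 := (prodComm L K).hasSum_iff.mpr (hc x hx y hy); refine h2.prod_fiberwise (fun l => ?_)
    simpa [mul_assoc] using (key x hx l).mul_right (f l y)
  ext ⟨k, l⟩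
  have := he.eq (c := fun k => c (k, l)) (d := fun k => G (k, l)) (f := g l) (fun x hx => by
      have h1 := key x hx l; rwa [congrFun (h0 x hx) l] at h1) (fun x hx => h2 x hx l)
  exact congrFun this k

lemma Independent.prod {K L X Y : Type*} {e : K → X → ℂ} {T : Set X} {f : L → Y → ℂ} {S : Set Y} (he
    : Independent e T) (hf : Independent f S) : Independent (fun (k : K × L) (x : X × Y) => e k.1
    x.1 * f k.2 x.2) (T ×ˢ S) := fun c hc =>
  he.refine hf (G := 0) (F := 0) (g := 0) (fun x hx y hy => hc (x, y) ⟨hx, hy⟩) (by simp) (by simp)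

/-- The circle of radius `r`. -/
def circ (r : ℝ) : Set ℂ := {x | ‖x‖ = r}

/-- The integral formula for Laurent coefficients. -/
lemma two_pi_mul_coeff {r : ℝ} (hr : 0 < r) {c : ℤ → ℂ} {f : ℂ → ℂ} (hc : ∀ x ∈ circ r, HasSum (fun
    k => c k * x ^ k) (f x)) (m : ℤ) : ∫ θ in (0:ℝ)..(2 * Real.pi), f (circleMap 0 r θ) * circleMap
    0 r θ ^ (-m) = 2 * Real.pi * c m := by
  have hs : Summable (fun k => ‖c k‖ * r ^ k) := by
    have := (hc r (by simp [circ, hr.le])).summable.norm; simpa [abs_of_pos hr] using this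
  have hne : ∀ θ : ℝ, circleMap 0 r θ ≠ 0 := fun θ => circleMap_ne_center hr.ne'
  have hnorm : ∀ θ : ℝ, ‖circleMap 0 r θ‖ = r := fun θ => by simp [abs_of_pos hr]
  have key : HasSum (fun k => ∫ θ in (0:ℝ)..(2 * Real.pi), c k * circleMap 0 r θ ^ (k - m)) (∫ θ in
    (0:ℝ)..(2 * Real.pi), f (circleMap 0 r θ) * circleMap 0 r θ ^ (-m)) := by
    refine intervalIntegral.hasSum_integral_of_dominated_convergence (fun k _ => ‖c k‖ * r ^ (k -
      m)) ?_ ?_ ?_ ?_ ?_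
    · intro k; refine Continuous.aestronglyMeasurable ?_; refine continuous_const.mul ?_
      exact (continuous_circleMap 0 r).zpow₀ _ (fun θ => Or.inl (hne θ))
    · intro k; refine Filter.Eventually.of_forall fun θ _ => ?_; rw [norm_mul, norm_zpow, hnorm]
    · refine Filter.Eventually.of_forall fun θ _ => ?_
      refine (hs.mul_right (r ^ (-m))).congr fun k => ?_
      rw [mul_assoc, ← zpow_add₀ hr.ne', sub_eq_add_neg]
    · exact intervalIntegrable_const
    · refine Filter.Eventually.of_forall fun θ _ => ?_
      have := (hc (circleMap 0 r θ) (hnorm θ)).mul_right (circleMap 0 r θ ^ (-m))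
      refine this.of_eq fun k => ?_; rw [mul_assoc, ← zpow_add₀ (hne θ), sub_eq_add_neg]
  have hint : ∀ k : ℤ, k ≠ m → ∫ θ in (0:ℝ)..(2 * Real.pi), c k * circleMap 0 r θ ^ (k - m) = 0 := by
    intro k hk; have h1 := circleIntegral.integral_sub_zpow_of_ne (n := k - m - 1) (by omega) 0 0 r
    simp only [circleIntegral, deriv_circleMap, sub_zero, smul_eq_mul] at h1
    rw [intervalIntegral.integral_const_mul]
    have h2 : ∀ θ : ℝ, circleMap 0 r θ * Complex.I * circleMap 0 r θ ^ (k - m - 1) = Complex.I *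
      circleMap 0 r θ ^ (k - m) := by
      intro θ; rw [zpow_sub_one₀ (hne θ)]; field_simp [hne θ]
    simp only [h2, intervalIntegral.integral_const_mul] at h1; rcases mul_eq_zero.mp h1 with h | h
    · exact absurd h Complex.I_ne_zero
    · rw [h, mul_zero]
  have h3 := hasSum_single m (f := fun k => ∫ θ in (0:ℝ)..(2 * Real.pi), c k * circleMap 0 r θ ^ (k
    - m)) (fun k hk => hint k hk)
  rw [key.unique h3]; simp

lemma independent_zpow {r : ℝ} (hr : 0 < r) : Independent (fun (k : ℤ) (x : ℂ) => x ^ k) (circ r) :=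
    by
  intro c hc; ext m; have h := two_pi_mul_coeff hr (f := fun _ => 0) hc m
  have hpi := Real.pi_ne_zero; simpa [hpi, eq_comm] using h

/-- Cauchy's estimate. -/
lemma norm_coeff_le {r : ℝ} (hr : 0 < r) {c : ℤ → ℂ} {f : ℂ → ℂ} (hc : ∀ x ∈ circ r, HasSum (fun k
    => c k * x ^ k) (f x)) {C : ℝ} (hC : ∀ x ∈ circ r, ‖f x‖ ≤ C) (m : ℤ) : ‖c m‖ * r ^ m ≤ C := by
  have hnorm : ∀ θ : ℝ, ‖circleMap 0 r θ‖ = r := fun θ => by simp [abs_of_pos hr]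
  have h1 : ‖∫ θ in (0:ℝ)..(2 * Real.pi), f (circleMap 0 r θ) * circleMap 0 r θ ^ (-m)‖ ≤ C * r ^
    (-m) * |2 * Real.pi - 0| := by
    refine intervalIntegral.norm_integral_le_of_norm_le_const fun θ _ => ?_
    rw [norm_mul, norm_zpow, hnorm]
    exact mul_le_mul_of_nonneg_right (hC _ (hnorm θ)) (by positivity)
  have hpi := Real.pi_pos
  rw [two_pi_mul_coeff hr hc m, norm_mul, sub_zero, abs_of_pos (by positivity)] at h1
  have h2 : ‖(2 * Real.pi : ℂ)‖ = 2 * Real.pi := by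
    rw [norm_mul, Complex.norm_real, Real.norm_of_nonneg hpi.le]; simp
  rw [h2, mul_comm, mul_le_mul_iff_left₀ (by positivity)] at h1
  calc ‖c m‖ * r ^ m ≤ C * r ^ (-m) * r ^ m := mul_le_mul_of_nonneg_right h1 (by positivity)
    _ = C := by rw [zpow_neg]; field_simp

lemma independent_zpow_neg {r : ℝ} (hr : 0 < r) : Independent (fun (k : ℤ) (x : ℂ) => x ^ (-k - 1))
    (circ r) :=
  (independent_zpow hr).comp_equiv (⟨fun k => -k - 1, fun k => -k - 1, fun k => by ring, fun k => by
    ring⟩ : ℤ ≃ ℤ) id (fun x hx => ⟨x, hx, rfl⟩) (fun _ _ _ => rfl)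

lemma independent_torus : ∀ {n : ℕ} {r : Fin n → ℝ}, (∀ i, 0 < r i) → Independent (fun (k : Fin n →
    ℤ) (x : Fin n → ℂ) => ∏ i, x i ^ (-k i - 1)) {x | ∀ i, ‖x i‖ = r i} := by
  intro n
  induction n with
  | zero =>
    intro r _ c hc; ext k; have := (hc elim0 (fun i => i.elim0)).unique (hasSum_unique _)
    dsimp only at this; rw [Finset.univ_eq_empty, prod_empty, mul_one] at this
    rw [Subsingleton.elim k (@default (Fin 0 → ℤ) Unique.instInhabited)]; exact this.symm
  | succ n ih =>
    intro r hr
    refine ((independent_zpow_neg (hr 0)).prod (ih (r := fun i => r i.succ) (fun i => hr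
      _))).comp_equiv (Fin.consEquiv (fun _ => ℤ)).symm (fun x : Fin (n+1) → ℂ => (x 0, fun i => x
      i.succ)) ?_ ?_
    · rintro ⟨x, y⟩ ⟨hx, hy⟩; refine ⟨cons x y, ?_, by simp⟩; intro i
      refine Fin.cases ?_ (fun i => ?_) i
      · simpa [circ] using hx
      · simpa using hy i
    · intro k x _; rw [prod_univ_succ]; rfl

/-! ## Multiple Laurent expansions -/

section Laurent

variable {ι : Type*} [Fintype ι]

/-- The Laurent monomial with exponent `k`. -/
def monom (x : ι → ℂ) (k : ι → ℤ) : ℂ := ∏ i, x i ^ k i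

/-- `f` is on `Ω` the sum of an absolutely convergent Laurent series that has only nonnegative powers
of the variables in `I` and for which the sum of the absolute values is at most `m`. -/
def LaurentOn (I : Set ι) (Ω : Set (ι → ℂ)) (f : (ι → ℂ) → ℂ) (m : (ι → ℂ) → ℝ) : Prop :=
  ∃ c : (ι → ℤ) → ℂ, (∀ k, c k ≠ 0 → ∀ i ∈ I, 0 ≤ k i) ∧ ∀ x ∈ Ω, HasSum (fun k => c k * monom x k)
    (f x) ∧ ∑' k, ‖c k * monom x k‖ ≤ m x

variable {I : Set ι} {Ω : Set (ι → ℂ)} {f g : (ι → ℂ) → ℂ} {m m' : (ι → ℂ) → ℝ}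

lemma LaurentOn.congr (h : LaurentOn I Ω f m) (hfg : ∀ x ∈ Ω, f x = g x) : LaurentOn I Ω g m := by
  obtain ⟨c, h1, h2⟩ := h; exact ⟨c, h1, fun x hx => by rw [← hfg x hx]; exact h2 x hx⟩

lemma monom_add {x : ι → ℂ} (hx : ∀ i ∉ I, x i ≠ 0) {j k : ι → ℤ} (hj : ∀ i ∈ I, 0 ≤ j i) (hk : ∀ i
    ∈ I, 0 ≤ k i) : monom x (j + k) = monom x j * monom x k := by
  rw [monom, monom, monom, ← prod_mul_distrib]; refine prod_congr rfl fun i _ => ?_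
  by_cases hi : i ∈ I
  · refine zpow_add' (Or.inr ?_); have := hj i hi; have := hk i hi; omega
  · exact zpow_add₀ (hx i hi) _ _

lemma LaurentOn.monomial (k : ι → ℤ) (hk : ∀ i ∈ I, 0 ≤ k i) (a : ℂ) : LaurentOn I Ω (fun x => a *
    monom x k) (fun x => ‖a * monom x k‖) := by
  classical
  refine ⟨Pi.single k a, ?_, fun x _ => ⟨?_, ?_⟩⟩
  · intro l hl
    by_cases h : l = k
    · subst h; exact hk
    · simp [h] at hl
  · exact hasSum_of_single k (fun l hl => by simp [hl]) (by simp)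
  · rw [tsum_eq_single k]
    · simp
    · intro l hl; simp [hl]

lemma LaurentOn.add (hf : LaurentOn I Ω f m) (hg : LaurentOn I Ω g m') : LaurentOn I Ω (fun x => f x
    + g x) (fun x => m x + m' x) := by
  obtain ⟨c, h1, h2⟩ := hf; obtain ⟨d, h3, h4⟩ := hg; refine ⟨c + d, ?_, fun x hx => ⟨?_, ?_⟩⟩
  · intro k hk
    by_cases h : c k = 0
    exacts [h3 k (by simpa [h] using hk), h1 k h]
  · simpa [add_mul] using (h2 x hx).1.add (h4 x hx).1
  · refine le_trans ?_ (add_le_add (h2 x hx).2 (h4 x hx).2); have s1 := (h2 x hx).1.summable.norm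
    have s2 := (h4 x hx).1.summable.norm; rw [← s1.tsum_add s2]
    refine Summable.tsum_le_tsum (fun k => ?_) ?_ (s1.add s2)
    · simpa [add_mul] using norm_add_le (c k * monom x k) (d k * monom x k)
    · exact (((h2 x hx).1.add (h4 x hx).1).summable.norm).congr fun k => by simp [add_mul]

lemma hasSum_mul_of_hasSum {K L : Type*} {u : K → ℂ} {v : L → ℂ} {a b : ℂ} (hu : HasSum u a) (hv :
    HasSum v b) : HasSum (fun p : K × L => u p.1 * v p.2) (a * b) :=
  HasSum.mul hu hv (summable_mul_of_summable_norm hu.summable.norm hv.summable.norm)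

lemma LaurentOn.mul (hΩ : ∀ x ∈ Ω, ∀ i ∉ I, x i ≠ 0) (hf : LaurentOn I Ω f m) (hg : LaurentOn I Ω g
    m') : LaurentOn I Ω (fun x => f x * g x) (fun x => m x * m' x) := by
  obtain ⟨c, h1, h2⟩ := hf; obtain ⟨d, h3, h4⟩ := hg
  have term : ∀ x ∈ Ω, ∀ k j : ι → ℤ, c j * d (k - j) * monom x k = (c j * monom x j) * (d (k - j) *
    monom x (k - j)) := by
    intro x hx k j
    by_cases hc : c j = 0
    · simp [hc]
    by_cases hd : d (k - j) = 0
    · simp [hd]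
    have := monom_add (hΩ x hx) (h1 j hc) (h3 _ hd); rw [add_sub_cancel] at this; rw [this]; ring
  let σ : (ι → ℤ) × (ι → ℤ) ≃ (ι → ℤ) × (ι → ℤ) := ⟨fun p => (p.2, p.1 - p.2), fun p => (p.1 + p.2,
    p.1), fun p => by simp, fun p => by simp⟩
  have s1 := fun x hx => (h2 x hx).1.summable.norm; have s2 := fun x hx => (h4 x hx).1.summable.norm
  have hsum : ∀ x ∈ Ω, HasSum (fun p : (ι → ℤ) × (ι → ℤ) => c p.2 * d (p.1 - p.2) * monom x p.1) (f
    x * g x) := by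
    intro x hx; have h5 := hasSum_mul_of_hasSum (h2 x hx).1 (h4 x hx).1; rw [← σ.hasSum_iff] at h5
    refine h5.of_eq fun p => ?_; rw [term x hx _ _]; rfl
  have hnorm : ∀ x ∈ Ω, HasSum (fun p : (ι → ℤ) × (ι → ℤ) =>
      ‖c p.2 * d (p.1 - p.2) * monom x p.1‖)
      ((∑' k, ‖c k * monom x k‖) * ∑' k, ‖d k * monom x k‖) := by
    intro x hx
    have h6 := (s1 x hx).mul_of_nonneg (s2 x hx) (fun _ => norm_nonneg _) (fun _ => norm_nonneg _)
    have h5 := (s1 x hx).hasSum.mul (s2 x hx).hasSum h6; rw [← σ.hasSum_iff] at h5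
    convert! h5 using 1
    ext p; rw [term x hx _ _, norm_mul]; rfl
  refine ⟨fun k => ∑' j, c j * d (k - j), ?_, fun x hx => ⟨?_, ?_⟩⟩
  · intro k hk i hi; by_contra hneg; refine hk ?_
    convert! tsum_zero with j
    by_contra hne; have hc := h1 j (left_ne_zero_of_mul hne) i hi
    have hd := h3 _ (right_ne_zero_of_mul hne) i hi; simp only [Pi.sub_apply] at hd; omega
  · have := (hsum x hx).prod_fiberwise (fun k => ((hsum x hx).summable.prod_factor k).hasSum)
    simpa [tsum_mul_right] using this
  · have h5 := (hnorm x hx).prod_fiberwise (fun k => ((hnorm x hx).summable.prod_factor k).hasSum)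
    refine le_trans (le_trans ?_ h5.tsum_eq.le) (mul_le_mul (h2 x hx).2 (h4 x hx).2 (tsum_nonneg fun
      _ => norm_nonneg _) (le_trans (tsum_nonneg fun _ => norm_nonneg _) (h2 x hx).2))
    have h6 : ∀ k, ‖(∑' j, c j * d (k - j)) * monom x k‖ ≤ ∑' j, ‖c j * d (k - j) * monom x k‖ := by
      intro k; rw [← tsum_mul_right]
      exact norm_tsum_le_tsum_norm ((hnorm x hx).summable.prod_factor k)
    exact Summable.tsum_le_tsum h6 (Summable.of_nonneg_of_le (fun _ => norm_nonneg _) h6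
      h5.summable) h5.summable

lemma LaurentOn.nonneg (hf : LaurentOn I Ω f m) : ∀ x ∈ Ω, 0 ≤ m x := by
  obtain ⟨c, h1, h2⟩ := hf
  exact fun x hx => le_trans (tsum_nonneg fun _ => norm_nonneg _) (h2 x hx).2

lemma LaurentOn.const (a : ℂ) : LaurentOn I Ω (fun _ => a) (fun _ => ‖a‖) := by
  simpa [monom] using LaurentOn.monomial (Ω := Ω) (I := I) (0 : ι → ℤ) (by simp) a

lemma LaurentOn.pow (hΩ : ∀ x ∈ Ω, ∀ i ∉ I, x i ≠ 0) (hf : LaurentOn I Ω f m) (n : ℕ) : LaurentOn I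
    Ω (fun x => f x ^ n) (fun x => m x ^ n) := by
  induction n with
  | zero => simpa using LaurentOn.const (I := I) (Ω := Ω) 1
  | succ n ih => simpa [pow_succ] using ih.mul hΩ hf

/-- The geometric series. -/
lemma LaurentOn.inv_one_sub (hΩ : ∀ x ∈ Ω, ∀ i ∉ I, x i ≠ 0) (hf : LaurentOn I Ω f m) (hm : ∀ x ∈ Ω,
    m x < 1) : LaurentOn I Ω (fun x => (1 - f x)⁻¹) (fun x => (1 - m x)⁻¹) := by
  have hnn := hf.nonneg
  have hfm : ∀ x ∈ Ω, ‖f x‖ ≤ m x := by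
    obtain ⟨c, h1, h2⟩ := hf; intro x hx; rw [← (h2 x hx).1.tsum_eq]
    exact (norm_tsum_le_tsum_norm (h2 x hx).1.summable.norm).trans (h2 x hx).2
  choose c h1 h2 using fun n : ℕ => hf.pow hΩ n
  have hS : ∀ x ∈ Ω, Summable (fun p : ℕ × (ι → ℤ) => ‖c p.1 p.2 * monom x p.2‖) := by
    intro x hx; rw [summable_prod_of_nonneg (fun _ => norm_nonneg _)]
    refine ⟨fun n => (h2 n x hx).1.summable.norm, ?_⟩
    exact Summable.of_nonneg_of_le (fun _ => tsum_nonneg fun _ => norm_nonneg _) (fun n => (h2 n x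
      hx).2) (summable_geometric_of_lt_one (hnn x hx) (hm x hx))
  have hsum : ∀ x ∈ Ω, HasSum (fun p : (ι → ℤ) × ℕ => c p.2 p.1 * monom x p.1) (1 - f x)⁻¹ := by
    intro x hx; have h3 := (hS x hx).of_norm.hasSum
    have h4 := h3.prod_fiberwise (fun n => (h2 n x hx).1)
    have h5 := hasSum_geometric_of_norm_lt_one (lt_of_le_of_lt (hfm x hx) (hm x hx))
    rw [h4.unique h5] at h3; rw [← (prodComm (ι → ℤ) ℕ).hasSum_iff] at h3; exact h3
  have hnorm : ∀ x ∈ Ω, ∑' p : (ι → ℤ) × ℕ, ‖c p.2 p.1 * monom x p.1‖ ≤ (1 - m x)⁻¹ := by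
    intro x hx; rw [← (prodComm ℕ (ι → ℤ)).tsum_eq]
    simp only [prodComm_apply, Prod.fst_swap, Prod.snd_swap]
    rw [(hS x hx).tsum_prod' (fun n => (h2 n x hx).1.summable.norm), ← tsum_geometric_of_lt_one (hnn
      x hx) (hm x hx)]
    exact Summable.tsum_le_tsum (fun n => (h2 n x hx).2) (hS x hx).prod
      (summable_geometric_of_lt_one (hnn x hx) (hm x hx))
  refine ⟨fun k => ∑' n, c n k, ?_, fun x hx => ⟨?_, ?_⟩⟩
  · intro k hk i hi; by_contra hneg; refine hk ?_
    convert! tsum_zero with n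
    by_contra hne; exact hneg (h1 n k hne i hi)
  · have := (hsum x hx).prod_fiberwise (fun k => ((hsum x hx).summable.prod_factor k).hasSum)
    simpa [tsum_mul_right] using this
  · have hs := (hsum x hx).summable.norm
    have h6 : ∀ k, ‖(∑' n, c n k) * monom x k‖ ≤ ∑' n, ‖c n k * monom x k‖ := by
      intro k; rw [← tsum_mul_right]; exact norm_tsum_le_tsum_norm (hs.prod_factor k)
    refine le_trans ?_ (hnorm x hx); rw [hs.tsum_prod' (fun k => hs.prod_factor k)]
    exact Summable.tsum_le_tsum h6 (Summable.of_nonneg_of_le (fun _ => norm_nonneg _) h6 hs.prod)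
      hs.prod

/-- `f` is on `Ω` the sum of an absolutely convergent Laurent series with only nonnegative powers
of the variables in `I`. -/
def HasLaurent (I : Set ι) (Ω : Set (ι → ℂ)) (f : (ι → ℂ) → ℂ) : Prop := ∃ m, LaurentOn I Ω f m

lemma HasLaurent.congr (h : HasLaurent I Ω f) (hfg : ∀ x ∈ Ω, f x = g x) : HasLaurent I Ω g := by
  obtain ⟨m, h⟩ := h; exact ⟨m, h.congr hfg⟩

lemma HasLaurent.const (a : ℂ) : HasLaurent I Ω (fun _ => a) := ⟨_, LaurentOn.const a⟩

lemma LaurentOn.coord_zpow {i : ι} {k : ℤ} (hk : i ∈ I → 0 ≤ k) : LaurentOn I Ω (fun x => x i ^ k)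
    (fun x => ‖x i ^ k‖) := by
  classical
  have := LaurentOn.monomial (Ω := Ω) (I := I) (single i k) (fun j hj => by
    by_cases h : j = i
    · subst h; simpa using hk hj
    · simp [h]) 1
  simpa [monom, Pi.single_apply, apply_ite (fun n : ℤ => (_ : ℂ) ^ n), Finset.prod_ite_eq'] using this

lemma LaurentOn.coord (i : ι) : LaurentOn I Ω (fun x => x i) (fun x => ‖x i‖) := by
  simpa using LaurentOn.coord_zpow (I := I) (Ω := Ω) (i := i) fun _ => zero_le_one

lemma LaurentOn.coord_inv {i : ι} (hi : i ∉ I) : LaurentOn I Ω (fun x => (x i)⁻¹) (fun x => ‖x i‖⁻¹)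
    := by
  simpa using LaurentOn.coord_zpow (Ω := Ω) (k := -1) fun h => absurd h hi

lemma HasLaurent.add (hf : HasLaurent I Ω f) (hg : HasLaurent I Ω g) : HasLaurent I Ω (fun x => f x
    + g x) := by
  obtain ⟨m, hf⟩ := hf; obtain ⟨m', hg⟩ := hg; exact ⟨_, hf.add hg⟩

lemma HasLaurent.mul (hΩ : ∀ x ∈ Ω, ∀ i ∉ I, x i ≠ 0) (hf : HasLaurent I Ω f) (hg : HasLaurent I Ω
    g) : HasLaurent I Ω (fun x => f x * g x) := by
  obtain ⟨m, hf⟩ := hf; obtain ⟨m', hg⟩ := hg; exact ⟨_, hf.mul hΩ hg⟩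

/-- The algebra of the functions with a Laurent expansion. -/
def HasLaurent.algebra (hΩ : ∀ x ∈ Ω, ∀ i ∉ I, x i ≠ 0) : Subalgebra ℂ ((ι → ℂ) → ℂ) where
  carrier := {f | HasLaurent I Ω f}
  mul_mem' := .mul hΩ
  add_mem' := .add
  algebraMap_mem' := .const

/-- The coefficients of a Laurent expansion, in the normalization used for modes. -/
lemma HasLaurent.exists_coeff (h : HasLaurent I Ω f) : ∃ c : (ι → ℤ) → ℂ, ∀ x ∈ Ω, HasSum (fun k =>
    c k * ∏ i, x i ^ (-k i - 1)) (f x) := by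
  obtain ⟨m, c, _, hc⟩ := h
  let σ : (ι → ℤ) ≃ (ι → ℤ) := ⟨fun k i => -k i - 1, fun k i => -k i - 1, fun k => by ext; simp,
    fun k => by ext; simp⟩
  exact ⟨fun k => c (σ k), fun x hx => σ.hasSum_iff.mpr (hc x hx).1⟩

/-- The inverse of a function `a - b` for which `a⁻¹` has a Laurent expansion and `b` is small
compared to `a`. -/
lemma HasLaurent.inv_sub (hΩ : ∀ x ∈ Ω, ∀ i ∉ I, x i ≠ 0) {a b : (ι → ℂ) → ℂ} {mb : (ι → ℂ) → ℝ} (ha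
    : LaurentOn I Ω (fun x => (a x)⁻¹) fun x => ‖a x‖⁻¹) (hb : LaurentOn I Ω b mb) (h : ∀ x ∈ Ω, mb
    x < ‖a x‖) : HasLaurent I Ω (fun x => (a x - b x)⁻¹) := by
  have h0 : ∀ x ∈ Ω, 0 < ‖a x‖ := fun x hx => (hb.nonneg x hx).trans_lt (h x hx)
  have h1 := (ha.mul hΩ hb).inv_one_sub hΩ fun x hx => by
    rw [inv_mul_lt_iff₀ (h0 x hx), mul_one]; exact h x hx
  refine HasLaurent.congr ⟨_, ha.mul hΩ h1⟩ fun x hx => ?_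
  rw [← mul_inv, mul_sub, mul_one, mul_inv_cancel_left₀ (norm_pos_iff.mp (h0 x hx))]

end Laurent

/-! ## Expansions in one variable with coefficients in an algebra of functions -/

section Exp

variable {P : Type*} (𝓐 : Subalgebra ℂ (P → ℂ)) (Dom : Set (P × ℂ))

/-- `f y ξ` has on `Dom` a Laurent expansion in `ξ`, with finitely many negative powers, with
coefficients in `𝓐`. -/
def ExpOn (f : P → ℂ → ℂ) : Prop :=
  ∃ (K : ℕ) (a : ℕ → P → ℂ), (∀ j, a j ∈ 𝓐) ∧ ∀ y ξ, (y, ξ) ∈ Dom → HasSum (fun j => a j y * ξ ^ j)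
    (ξ ^ K * f y ξ)

variable {𝓐 Dom} {f g : P → ℂ → ℂ}

lemma ExpOn.congr (h : ExpOn 𝓐 Dom f) (hfg : ∀ y ξ, (y, ξ) ∈ Dom → f y ξ = g y ξ) : ExpOn 𝓐 Dom g :=
    by
  obtain ⟨K, a, h1, h2⟩ := h; exact ⟨K, a, h1, fun y ξ hy => by rw [← hfg y ξ hy]; exact h2 y ξ hy⟩

lemma ExpOn.monomial {b : P → ℂ} (hb : b ∈ 𝓐) (K k : ℕ) (h : ∀ y ξ, (y, ξ) ∈ Dom → b y * ξ ^ k = ξ ^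
    K * f y ξ) : ExpOn 𝓐 Dom f := by
  refine ⟨K, fun j => if j = k then b else 0, fun j => ?_, fun y ξ hy => ?_⟩
  · dsimp only; split_ifs
    exacts [hb, 𝓐.zero_mem]
  · exact hasSum_of_single k (fun j hj => by simp [hj]) (by simpa using h y ξ hy)

lemma ExpOn.coeff {b : P → ℂ} (hb : b ∈ 𝓐) : ExpOn 𝓐 Dom (fun y _ => b y) :=
  .monomial hb 0 0 (by simp)

lemma ExpOn.const (b : ℂ) : ExpOn 𝓐 Dom (fun _ _ => b) :=
  ExpOn.coeff (b := fun _ => b) (𝓐.algebraMap_mem b)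

lemma ExpOn.var : ExpOn 𝓐 Dom (fun _ ξ => ξ) := .monomial 𝓐.one_mem 0 1 (by simp)

lemma ExpOn.var_inv (h0 : ∀ y ξ, (y, ξ) ∈ Dom → ξ ≠ 0) : ExpOn 𝓐 Dom (fun _ ξ => ξ⁻¹) :=
  .monomial 𝓐.one_mem 1 0 fun y ξ hy => by simp [h0 y ξ hy]

lemma ExpOn.shift {K : ℕ} {a : ℕ → P → ℂ} (h1 : ∀ j, a j ∈ 𝓐) (h2 : ∀ y ξ, (y, ξ) ∈ Dom → HasSum
    (fun j => a j y * ξ ^ j) (ξ ^ K * f y ξ)) (L : ℕ) : ∃ a' : ℕ → P → ℂ, (∀ j, a' j ∈ 𝓐) ∧ ∀ y ξ,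
    (y, ξ) ∈ Dom → HasSum (fun j => a' j y * ξ ^ j) (ξ ^ (L + K) * f y ξ) := by
  refine ⟨fun j => if L ≤ j then a (j - L) else 0, fun j => ?_, fun y ξ hy => ?_⟩
  · dsimp only; split_ifs
    exacts [h1 _, 𝓐.zero_mem]
  · have h3 := (h2 y ξ hy).mul_left (ξ ^ L); rw [← mul_assoc, ← pow_add] at h3
    have hinj : Injective (fun j : ℕ => j + L) := fun _ _ h => by simpa using h
    refine (hinj.hasSum_iff ?_).mp ?_
    · intro j hj; have : ¬ L ≤ j := fun h => hj ⟨j - L, by simp [h]⟩; simp [this]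
    · refine h3.of_eq fun j => ?_; simp [pow_add]; ring

lemma ExpOn.add (hf : ExpOn 𝓐 Dom f) (hg : ExpOn 𝓐 Dom g) : ExpOn 𝓐 Dom (fun y ξ => f y ξ + g y ξ)
    := by
  obtain ⟨K, a, h1, h2⟩ := hf; obtain ⟨L, b, h3, h4⟩ := hg
  obtain ⟨a', h1', h2'⟩ := ExpOn.shift h1 h2 L; obtain ⟨b', h3', h4'⟩ := ExpOn.shift h3 h4 K
  refine ⟨L + K, a' + b', fun j => 𝓐.add_mem (h1' j) (h3' j), fun y ξ hy => ?_⟩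
  have := (h2' y ξ hy).add (h4' y ξ hy); rw [add_comm K L, ← mul_add] at this
  simpa [add_mul] using this

lemma ExpOn.mul (hf : ExpOn 𝓐 Dom f) (hg : ExpOn 𝓐 Dom g) : ExpOn 𝓐 Dom (fun y ξ => f y ξ * g y ξ)
    := by
  obtain ⟨K, a, h1, h2⟩ := hf; obtain ⟨L, b, h3, h4⟩ := hg
  refine ⟨K + L, fun n => ∑ i ∈ range (n + 1), a i * b (n - i), fun j => 𝓐.sum_mem fun i _ =>
    𝓐.mul_mem (h1 _) (h3 _), fun y ξ hy => ?_⟩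
  have := hasSum_sum_range_mul_of_summable_norm (h2 y ξ hy).summable.norm (h4 y ξ hy).summable.norm
  rw [(h2 y ξ hy).tsum_eq, (h4 y ξ hy).tsum_eq] at this
  have e : ξ ^ K * f y ξ * (ξ ^ L * g y ξ) = ξ ^ (K + L) * (f y ξ * g y ξ) := by ring
  rw [e] at this; refine this.of_eq fun n => ?_
  simp only [Finset.sum_apply, Pi.mul_apply, sum_mul]; refine sum_congr rfl fun i hi => ?_
  have : ξ ^ n = ξ ^ i * ξ ^ (n - i) := by
    rw [← pow_add, Nat.add_sub_cancel' (Nat.lt_succ_iff.mp (Finset.mem_range.mp hi))]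
  rw [this]; ring

variable (𝓐 Dom) in
/-- The algebra of the functions with an expansion in `ξ`. -/
def ExpOn.algebra : Subalgebra ℂ (P × ℂ → ℂ) where
  carrier := {f | ExpOn 𝓐 Dom fun y ξ => f (y, ξ)}
  mul_mem' := .mul
  add_mem' := .add
  algebraMap_mem' := .const

lemma ExpOn.inv_sub {a b : P → ℂ} (ha : (fun y => (a y)⁻¹) ∈ 𝓐) (hb : b ∈ 𝓐) (h : ∀ y ξ, (y, ξ) ∈
    Dom → ‖b y * ξ‖ < ‖a y‖) : ExpOn 𝓐 Dom (fun y ξ => (a y - b y * ξ)⁻¹) := by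
  refine ⟨0, fun j => (fun y => (a y)⁻¹) ^ (j + 1) * b ^ j, fun j =>
    𝓐.mul_mem (𝓐.pow_mem ha _) (𝓐.pow_mem hb _), fun y ξ hy => ?_⟩
  have h1 := h y ξ hy
  have ha0 : a y ≠ 0 := fun h0 => by
    rw [h0, norm_zero] at h1; exact absurd h1 (not_lt.mpr (norm_nonneg _))
  have h2 : ‖(a y)⁻¹ * (b y * ξ)‖ < 1 := by
    rw [norm_mul, norm_inv, inv_mul_lt_iff₀ (norm_pos_iff.mpr ha0), mul_one]; exact h1
  have h3 := (hasSum_geometric_of_norm_lt_one h2).mul_left (a y)⁻¹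
  have e : (a y)⁻¹ * (1 - (a y)⁻¹ * (b y * ξ))⁻¹ = ξ ^ 0 * (a y - b y * ξ)⁻¹ := by
    rw [← mul_inv, mul_sub, mul_one, mul_inv_cancel_left₀ ha0, pow_zero, one_mul]
  rw [e] at h3; refine h3.of_eq fun j => ?_; simp only [Pi.mul_apply, Pi.pow_apply]; ring

lemma ExpOn.exists_coeff (h0 : ∀ y ξ, (y, ξ) ∈ Dom → ξ ≠ 0) (hf : ExpOn 𝓐 Dom f) : ∃ a : ℤ → P → ℂ,
    (∀ j, a j ∈ 𝓐) ∧ ∀ y ξ, (y, ξ) ∈ Dom → HasSum (fun j => a j y * ξ ^ j) (f y ξ) := by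
  obtain ⟨K, a, h1, h2⟩ := hf
  refine ⟨fun j => if 0 ≤ j + K then a (j + K).toNat else 0, fun j => ?_, fun y ξ hy => ?_⟩
  · dsimp only; split_ifs
    exacts [h1 _, 𝓐.zero_mem]
  · have hξ := h0 y ξ hy; have h3 := (h2 y ξ hy).mul_left (ξ ^ K)⁻¹
    rw [inv_mul_cancel_left₀ (pow_ne_zero K hξ)] at h3
    have hinj : Injective (fun j : ℕ => (j : ℤ) - K) := fun _ _ h => by simpa using h
    refine (hinj.hasSum_iff ?_).mp ?_
    · intro j hj; have : ¬ 0 ≤ j + K := fun h => hj ⟨(j + K).toNat, by simp [h]⟩; simp [this]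
    · refine h3.of_eq fun j => ?_
      have : ξ ^ ((j : ℤ) - K) = (ξ ^ K)⁻¹ * ξ ^ j := by
        rw [zpow_sub₀ hξ, zpow_natCast, zpow_natCast]; field_simp
      simp [this]; ring

end Exp

/-! ## Rational functions -/

section RegOff

variable {σ : Type*}

/-- The algebra of the functions that are polynomials divided by a power of `q` where `q ≠ 0`. -/
def RegOff (q : MvPolynomial σ ℂ) : Subalgebra ℂ ((σ → ℂ) → ℂ) where
  carrier := {f | ∃ (N : ℕ) (h : MvPolynomial σ ℂ), ∀ z, eval z q ≠ 0 → f z * eval z q ^ N = eval z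
    h}
  mul_mem' := by
    rintro f g ⟨N, h, hf⟩ ⟨L, k, hg⟩; refine ⟨N + L, h * k, fun z hz => ?_⟩
    rw [map_mul, ← hf z hz, ← hg z hz, Pi.mul_apply]; ring
  add_mem' := by
    rintro f g ⟨N, h, hf⟩ ⟨L, k, hg⟩; refine ⟨N + L, h * q ^ L + k * q ^ N, fun z hz => ?_⟩
    rw [map_add, map_mul, map_mul, map_pow, map_pow, ← hf z hz, ← hg z hz, Pi.add_apply]; ring
  algebraMap_mem' a := ⟨0, MvPolynomial.C a, fun z _ => by simp⟩

lemma mem_regOff {q : MvPolynomial σ ℂ} {f : (σ → ℂ) → ℂ} : f ∈ RegOff q ↔ ∃ (N : ℕ) (h :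
    MvPolynomial σ ℂ), ∀ z, eval z q ≠ 0 → f z * eval z q ^ N = eval z h := Iff.rfl

variable {q : MvPolynomial σ ℂ}

lemma RegOff.congr {f g : (σ → ℂ) → ℂ} (hf : f ∈ RegOff q) (h : ∀ z, eval z q ≠ 0 → f z = g z) : g ∈
    RegOff q := by
  obtain ⟨N, p, hp⟩ := hf; exact ⟨N, p, fun z hz => by rw [← h z hz]; exact hp z hz⟩

lemma RegOff.poly (h : MvPolynomial σ ℂ) : (fun z => eval z h) ∈ RegOff q :=
  ⟨0, h, fun z _ => by simp⟩

lemma RegOff.inv_of_dvd {r : MvPolynomial σ ℂ} (h : r ∣ q) : (fun z => (eval z r)⁻¹) ∈ RegOff q :=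
    by
  obtain ⟨s, rfl⟩ := h; refine ⟨1, s, fun z hz => ?_⟩; rw [map_mul] at hz ⊢
  have := left_ne_zero_of_mul hz; field_simp

lemma RegOff.div {r : MvPolynomial σ ℂ} (N : ℕ) (h : r ∣ q ^ N) {f : (σ → ℂ) → ℂ} {p : MvPolynomial
    σ ℂ} (hf : ∀ z, eval z q ≠ 0 → f z * eval z r = eval z p) : f ∈ RegOff q := by
  obtain ⟨s, hs⟩ := h; refine ⟨N, p * s, fun z hz => ?_⟩
  rw [← map_pow, hs, map_mul, map_mul, ← hf z hz]; ring

lemma eval_eq_zero_of_eventually [Finite σ] {h : MvPolynomial σ ℂ} {z₀ : σ → ℂ} (hz : ∀ᶠ z in 𝓝 z₀,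
    eval z h = 0) : h = 0 := by
  have := Fintype.ofFinite σ; rw [Metric.eventually_nhds_iff_ball] at hz; obtain ⟨ε, hε, hz⟩ := hz
  refine MvPolynomial.funext_set (fun i => Metric.ball (z₀ i) ε) (fun i => ?_) fun x hx => ?_
  · exact infinite_of_mem_nhds (z₀ i) (Metric.ball_mem_nhds _ hε)
  · rw [map_zero]; refine hz x ?_; rw [ball_pi _ hε]; exact hx

lemma eventually_eval_ne [Finite σ] {z₀ : σ → ℂ} (hz : eval z₀ q ≠ 0) : ∀ᶠ z in 𝓝 z₀, eval z q ≠ 0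
    :=
  (continuous_eval q).continuousAt.eventually_ne hz

/-- The identity principle for rational functions. -/
lemma RegOff.eq_of_eventually [Finite σ] {f g : (σ → ℂ) → ℂ} (hf : f ∈ RegOff q) (hg : g ∈ RegOff q)
    {z₀ : σ → ℂ} (h : ∀ᶠ z in 𝓝 z₀, eval z q ≠ 0 → f z = g z) {z : σ → ℂ} (hz : eval z q ≠ 0) : f z
    = g z := by
  obtain ⟨N, p, hp⟩ := sub_mem hf hg
  have h0 : q * p = 0 := by
    refine eval_eq_zero_of_eventually (z₀ := z₀) (h.mono fun z hz => ?_)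
    by_cases hq : eval z q = 0
    · simp [hq]
    · rw [map_mul, ← hp z hq, Pi.sub_apply, hz hq]; simp
  have hp0 : p = 0 := by
    rcases mul_eq_zero.mp h0 with h | h
    exacts [absurd (by simp [h]) hz, h]
  have := hp z hz; rw [hp0, map_zero] at this
  exact sub_eq_zero.mp ((mul_eq_zero.mp this).resolve_right (pow_ne_zero _ hz))

lemma hasDerivAt_eval_line [Finite σ] (h : MvPolynomial σ ℂ) (d : σ → ℂ) (z : σ → ℂ) (t : ℂ) :
    HasDerivAt (fun t : ℂ => eval (z + t • d) h) (∑ᶠ i, d i * eval (z + t • d) (pderiv i h)) t := by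
  classical
  have := Fintype.ofFinite σ; rw [finsum_eq_sum_of_fintype]
  induction h using MvPolynomial.induction_on with
  | C a => simpa using hasDerivAt_const t a
  | add p q hp hq => simpa [mul_add, sum_add_distrib] using hp.fun_add hq
  | mul_X p s hp =>
    have h1 : HasDerivAt (fun t : ℂ => (z + t • d) s) (d s) t := by
      simpa using ((hasDerivAt_id t).mul_const (d s)).const_add (z s)
    have h2 := hp.fun_mul h1; simp only [map_mul, eval_X]
    convert! h2 using 1
    simp only [Derivation.leibniz, MvPolynomial.pderiv_X, smul_eq_mul, map_add, map_mul, eval_X,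
      mul_add, sum_add_distrib, sum_mul]
    rw [add_comm]; congr 1
    · refine sum_congr rfl fun i _ => by ring
    · rw [sum_eq_single s]
      · simp; ring
      · intro i _ hi; simp [hi.symm]
      · simp

/-- A function in `RegOff q` has derivatives along all directions, which depend linearly on the
direction and are in `RegOff q`. -/
lemma RegOff.exists_deriv [Finite σ] {f : (σ → ℂ) → ℂ} (hf : f ∈ RegOff q) : ∃ g : σ → (σ → ℂ) → ℂ,
    (∀ i, g i ∈ RegOff q) ∧ ∀ z, eval z q ≠ 0 → ∀ d : σ → ℂ, HasDerivAt (fun t : ℂ => f (z + t • d))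
    (∑ᶠ i, d i * g i z) 0 := by
  classical
  have := Fintype.ofFinite σ; obtain ⟨N, p, hp⟩ := hf
  refine ⟨fun i z => (eval z (pderiv i p) * eval z (q ^ N) - eval z p * eval z (pderiv i (q ^ N))) /
    eval z (q ^ N) ^ 2, fun i => ?_, fun z hz d => ?_⟩
  · refine ⟨N * 2, pderiv i p * q ^ N - p * pderiv i (q ^ N), fun z hz => ?_⟩
    simp only [map_sub, map_mul, map_pow]
    rw [pow_mul, div_mul_cancel₀ _ (pow_ne_zero _ (pow_ne_zero _ hz))]
  · have h1 := hasDerivAt_eval_line p d z 0; have h2 := hasDerivAt_eval_line (q ^ N) d z 0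
    have hz' : eval (z + (0:ℂ) • d) (q ^ N) ≠ 0 := by simpa using pow_ne_zero N hz
    have h3 := h1.fun_div h2 hz'
    have hev : (fun t : ℂ => f (z + t • d)) =ᶠ[𝓝 0] fun t => eval (z + t • d) p / eval (z + t • d)
      (q ^ N) := by
      have hc : ContinuousAt (fun t : ℂ => z + t • d) 0 := by fun_prop
      have h4 := eventually_eval_ne hz
      have h5 : ∀ᶠ t : ℂ in 𝓝 0, eval (z + t • d) q ≠ 0 := hc.eventually (by simpa using h4)
      filter_upwards [h5] with t ht
      rw [← hp _ ht, map_pow, mul_div_cancel_right₀ _ (pow_ne_zero _ ht)]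
    refine (h3.congr_of_eventuallyEq hev).congr_deriv ?_
    simp only [finsum_eq_sum_of_fintype, zero_smul, add_zero]
    rw [sum_mul, mul_sum, ← sum_sub_distrib, Finset.sum_div]
    refine sum_congr rfl fun i _ => by ring

end RegOff

/-! ## Configuration spaces -/

/-- The polynomial `∏_{i ≠ j} (X i - X j)`. -/
def diffPoly (ι : Type*) [Fintype ι] [DecidableEq ι] : MvPolynomial ι ℂ :=
  ∏ i, ∏ j ∈ univ.erase i, (X i - X j)

section Diff

variable {ι : Type*} [Fintype ι] [DecidableEq ι]

/-- The rational functions whose only poles are at coincidences of two coordinates. -/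
abbrev RatFun (n : ℕ) : Subalgebra ℂ ((Fin n → ℂ) → ℂ) := RegOff (diffPoly (Fin n))

lemma eval_diffPoly (z : ι → ℂ) : eval z (diffPoly ι) = diffProd z := by
  simp [diffPoly, diffProd, map_prod]

lemma diffProd_ne_zero {z : ι → ℂ} : diffProd z ≠ 0 ↔ Injective z := by
  simp only [diffProd, ne_eq, Finset.prod_eq_zero_iff, not_exists, not_and, mem_univ, forall_const,
    mem_erase, sub_eq_zero]
  constructor
  · intro h i j hij; by_contra hne; exact h i j ⟨fun h => hne h.symm, trivial⟩ hij
  · intro h i j hij he; exact hij.1 (h he).symm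

lemma eval_diffPoly_ne {z : ι → ℂ} : eval z (diffPoly ι) ≠ 0 ↔ Injective z := by
  rw [eval_diffPoly, diffProd_ne_zero]

lemma eventually_injective {z : ι → ℂ} (hz : Injective z) : ∀ᶠ w in 𝓝 z, Injective w := by
  filter_upwards [eventually_eval_ne (eval_diffPoly_ne.mpr hz)] with w hw
  exact eval_diffPoly_ne.mp hw

lemma diff_dvd_diffPoly {i j : ι} (h : i ≠ j) : (X i - X j : MvPolynomial ι ℂ) ∣ diffPoly ι := by
  refine dvd_trans ?_ (Finset.dvd_prod_of_mem _ (mem_univ i))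
  exact Finset.dvd_prod_of_mem (fun j => (X i - X j : MvPolynomial ι ℂ)) (Finset.mem_erase.mpr
    ⟨h.symm, mem_univ j⟩)

lemma inv_diff_mem_regOff {i j : ι} (h : i ≠ j) : (fun z : ι → ℂ => (z i - z j)⁻¹) ∈ RegOff
    (diffPoly ι) := by
  simpa using RegOff.inv_of_dvd (diff_dvd_diffPoly h)

lemma coord_mem_regOff {σ : Type*} {q : MvPolynomial σ ℂ} (i : σ) : (fun z : σ → ℂ => z i) ∈ RegOff
    q := by
  simpa using RegOff.poly (q := q) (X i)

/-- The functions `z i` and the inverses of their differences are in the algebra `S`. -/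
def Separated {P ι : Type*} (S : Subalgebra ℂ (P → ℂ)) (z : ι → P → ℂ) : Prop :=
  (∀ i, z i ∈ S) ∧ ∀ i j, i ≠ j → (fun x => (z i x - z j x)⁻¹) ∈ S

/-- The composition of a rational function with diagonal poles with functions in an algebra `S`. -/
lemma exists_comp_regOff {P : Type*} {S : Subalgebra ℂ (P → ℂ)} {f : (ι → ℂ) → ℂ} (hf : f ∈ RegOff
    (diffPoly ι)) {z : ι → P → ℂ} (hz : Separated S z) : ∃ g ∈ S, ∀ x, Injective (fun i => z i x) →
    g x = f (fun i => z i x) := by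
  obtain ⟨N, h, hf⟩ := hf
  have hp : ∀ p : MvPolynomial ι ℂ, (fun x => eval (fun i => z i x) p) ∈ S := fun p => by
    induction p using MvPolynomial.induction_on with
    | C a => simp only [eval_C]; exact S.algebraMap_mem a
    | add p q hp hq => simp only [map_add]; exact S.add_mem hp hq
    | mul_X p s hp => simp only [map_mul, eval_X]; exact S.mul_mem hp (hz.1 s)
  refine ⟨_, S.mul_mem (hp h) (S.pow_mem (S.prod_mem (t := univ) fun i _ => S.prod_mem (t :=
    univ.erase i) fun j hj => hz.2 i j (ne_of_mem_erase hj).symm) N), fun x hx => ?_⟩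
  have h2 := eval_diffPoly_ne.mpr hx; simp only [Pi.mul_apply, Pi.pow_apply, Finset.prod_apply]
  rw [← hf _ h2, eval_diffPoly]; rw [eval_diffPoly] at h2
  have h3 : (∏ i, ∏ j ∈ univ.erase i, (z i x - z j x)⁻¹) = (diffProd fun i => z i x)⁻¹ := by
    simp [diffProd]
  rw [h3, inv_pow, mul_inv_cancel_right₀ (pow_ne_zero _ h2)]

lemma HasLaurent.comp_regOff {κ : Type*} [Fintype κ] {I : Set κ} {Ω : Set (κ → ℂ)} (hΩ : ∀ x ∈ Ω, ∀
    i ∉ I, x i ≠ 0) {f : (ι → ℂ) → ℂ} (hf : f ∈ RegOff (diffPoly ι)) {z : ι → (κ → ℂ) → ℂ} (hz :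
    Separated (HasLaurent.algebra hΩ) z) (hinj : ∀ x ∈ Ω, Injective (fun i => z i x)) : HasLaurent I
    Ω (fun x => f (fun i => z i x)) := by
  obtain ⟨g, hg, h⟩ := exists_comp_regOff hf hz
  exact HasLaurent.congr hg fun x hx => h x (hinj x hx)

lemma ExpOn.comp_regOff {P : Type*} {𝓐 : Subalgebra ℂ (P → ℂ)} {Dom : Set (P × ℂ)} {f : (ι → ℂ) → ℂ}
    (hf : f ∈ RegOff (diffPoly ι)) {z : ι → P → ℂ → ℂ} (hz : Separated (ExpOn.algebra 𝓐 Dom) fun i p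
    => z i p.1 p.2) (hinj : ∀ y ξ, (y, ξ) ∈ Dom → Injective (fun i => z i y ξ)) : ExpOn 𝓐 Dom (fun y
    ξ => f (fun i => z i y ξ)) := by
  obtain ⟨g, hg, h⟩ := exists_comp_regOff hf hz
  exact ExpOn.congr hg fun y ξ hy => h (y, ξ) (hinj y ξ hy)

variable {V : Type*}

/-- The polynomial whose values are given by `poleProd`. -/
def polePoly (p : V → V → ℕ) (u : ι → V) : MvPolynomial ι ℂ :=
  ∏ x, ∏ y ∈ univ.erase x, (X x - X y) ^ p (u x) (u y)

lemma eval_polePoly (p : V → V → ℕ) (u : ι → V) (z : ι → ℂ) : eval z (polePoly p u) = poleProd p u z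
    := by
  simp [polePoly, poleProd, map_prod]

lemma polePoly_dvd (p : V → V → ℕ) (u : ι → V) : ∃ N, polePoly p u ∣ diffPoly ι ^ N := by
  refine ⟨∑ x, ∑ y, p (u x) (u y), ?_⟩; rw [diffPoly, ← prod_pow]
  refine Finset.prod_dvd_prod_of_dvd _ _ fun x _ => ?_; rw [← prod_pow]
  refine Finset.prod_dvd_prod_of_dvd _ _ fun y _ => pow_dvd_pow _ ?_
  exact (single_le_sum (f := fun y => p (u x) (u y)) (fun _ _ => Nat.zero_le _) (mem_univ y)).trans
    (single_le_sum (f := fun x => ∑ y, p (u x) (u y)) (fun _ _ => Nat.zero_le _) (mem_univ x))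

lemma poleProd_ne_zero (p : V → V → ℕ) (u : ι → V) {z : ι → ℂ} (hz : Injective z) : poleProd p u z ≠
    0 := by
  obtain ⟨N, s, hs⟩ := polePoly_dvd p u; have h1 := pow_ne_zero N (eval_diffPoly_ne.mpr hz)
  rw [← map_pow, hs, map_mul, eval_polePoly] at h1; exact left_ne_zero_of_mul h1

lemma poleProd_comp_equiv {κ : Type*} [Fintype κ] [DecidableEq κ] (p : V → V → ℕ) (e : κ ≃ ι) (u : ι
    → V) (z : ι → ℂ) : poleProd p (u ∘ e) (z ∘ e) = poleProd p u z := by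
  rw [poleProd, poleProd, ← e.prod_comp]; refine prod_congr rfl fun x _ => ?_
  have : univ.erase (e x) = (univ.erase x).map e.toEmbedding := by ext y; simp
  rw [this, Finset.prod_map]; rfl

lemma poleProd_mem_regOff {f : (ι → ℂ) → ℂ} (p : V → V → ℕ) (u : ι → V) {h : MvPolynomial ι ℂ} (hf :
    ∀ z, Injective z → f z * poleProd p u z = eval z h) : f ∈ RegOff (diffPoly ι) := by
  obtain ⟨N, hN⟩ := polePoly_dvd p u
  exact RegOff.div (p := h) N hN fun z hz => by
    rw [eval_polePoly]; exact hf z (eval_diffPoly_ne.mp hz)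

end Diff

/-! ## Homogeneous operators on graded spaces -/

section Graded

variable {ι : Type*} [DecidableEq ι] {W : Type*} [AddCommGroup W] [Module ℂ W]

lemma barPairing_add_left (gr : ι → Submodule ℂ W) (w₁ w₂ : GradedDual gr) (x : Completion gr) :
    barPairing gr (w₁ + w₂) x = barPairing gr w₁ x + barPairing gr w₂ x := map_add _ _ _

lemma barPairing_smul_left (gr : ι → Submodule ℂ W) (a : ℂ) (w₁ : GradedDual gr) (x : Completion gr)
    : barPairing gr (a • w₁) x = a * barPairing gr w₁ x := map_smul _ _ _

lemma barPairing_zero_left (gr : ι → Submodule ℂ W) (x : Completion gr) : barPairing gr 0 x = 0 :=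
    map_zero _

lemma barPairing_of (gr : ι → Submodule ℂ W) (c : ι) (φ : Dual ℂ (gr c)) (x : Completion gr) :
    barPairing gr (DirectSum.of (fun c => Dual ℂ (gr c)) c φ) x = φ (x c) := by
  have := DirectSum.toModule_lof ℂ (M := fun c => Dual ℂ (gr c)) (N := ℂ) (φ := fun c =>
    LinearMap.applyₗ (x c)) c φ
  exact this

lemma gradedDual_induction {gr : ι → Submodule ℂ W} {P : GradedDual gr → Prop} (h0 : P 0) (hof : ∀ c
    φ, P (DirectSum.of (fun c => Dual ℂ (gr c)) c φ)) (hadd : ∀ x y, P x → P y → P (x + y)) (w' :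
    GradedDual gr) : P w' :=
  DirectSum.induction_on w' h0 hof hadd

/-- The pairing with `w'` as a linear functional on the completion. -/
def barPairingL (gr : ι → Submodule ℂ W) (w' : GradedDual gr) : Completion gr →ₗ[ℂ] ℂ :=
  LinearMap.applyₗ w' ∘ₗ (DFinsupp.lsum ℂ).toLinearMap ∘ₗ LinearMap.pi fun c => LinearMap.applyₗ ∘ₗ
    LinearMap.proj c

lemma barPairing_add (gr : ι → Submodule ℂ W) (w' : GradedDual gr) (x y : Completion gr) :
    barPairing gr w' (x + y) = barPairing gr w' x + barPairing gr w' y :=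
  (barPairingL gr w').map_add x y

lemma barPairing_smul (gr : ι → Submodule ℂ W) (w' : GradedDual gr) (a : ℂ) (x : Completion gr) :
    barPairing gr w' (a • x) = a * barPairing gr w' x :=
  (barPairingL gr w').map_smul a x

lemma barPairing_zero (gr : ι → Submodule ℂ W) (w' : GradedDual gr) : barPairing gr w' 0 = 0 :=
  (barPairingL gr w').map_zero

lemma completion_ext {gr : ι → Submodule ℂ W} {x y : Completion gr} (h : ∀ w', barPairing gr w' x =
    barPairing gr w' y) : x = y := by
  funext c; rw [← sub_eq_zero, ← Module.forall_dual_apply_eq_zero_iff ℂ]; intro φ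
  have := h (DirectSum.of (fun c => Dual ℂ (gr c)) c φ); rw [barPairing_of, barPairing_of] at this
  rw [map_sub, this, sub_self]

lemma gradedDual_ext {gr : ι → Submodule ℂ W} {w₁ w₂ : GradedDual gr} (h : ∀ x, barPairing gr w₁ x =
    barPairing gr w₂ x) : w₁ = w₂ := by
  classical
  refine DFinsupp.ext fun c => LinearMap.ext fun a => ?_
  have key : ∀ w : GradedDual gr, barPairing gr w (single c a) = w c a := by
    refine gradedDual_induction (by simp [barPairing_zero_left]) ?_ ?_
    · intro d φ; rw [barPairing_of]
      by_cases hd : d = c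
      · subst hd; simp
      · rw [Pi.single_eq_of_ne hd, DirectSum.of_eq_of_ne _ _ _ (Ne.symm hd)]; simp
    · intro x y hx hy; rw [barPairing_add_left, hx, hy]; rfl
  have := h (single c a); rwa [key, key] at this

variable {gr : ι → Submodule ℂ W} [Decomposition gr]

lemma scaleOp_of_mem (r : ι → ℂ) {c : ι} {w : W} (hw : w ∈ gr c) : scaleOp gr r w = r c • w := by
  lift w to gr c using hw
  simp [scaleOp, DirectSum.decomposeLinearEquiv, ← DirectSum.lof_eq_of ℂ]

lemma graded_induction (gr : ι → Submodule ℂ W) [Decomposition gr] {P : W → Prop} (hom : ∀ c, ∀ w ∈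
    gr c, P w) (hadd : ∀ x y, P x → P y → P (x + y)) (h0 : P 0) (w : W) : P w :=
  DirectSum.Decomposition.inductionOn gr h0 (fun {c} w => hom c w w.2) hadd w

lemma decompose_scaleOp (r : ι → ℂ) (w : W) (c : ι) : (decompose gr (scaleOp gr r w) c : W) = r c •
    (decompose gr w c : W) := by
  induction w using graded_induction gr with
  | hom d w hw =>
    rw [scaleOp_of_mem r hw]
    by_cases h : d = c
    · subst h
      rw [decompose_of_mem_same _ hw, decompose_of_mem_same _ ((gr d).smul_mem _ hw)]
    · rw [decompose_of_mem_ne _ hw h, decompose_of_mem_ne _ ((gr d).smul_mem _ hw) h, smul_zero]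
  | hadd x y hx hy => simp [DirectSum.decompose_add, hx, hy]
  | h0 => simp

lemma mem_of_decompose {w : W} {c : ι} (h : ∀ d, d ≠ c → (decompose gr w d : W) = 0) : w ∈ gr c :=
    by
  classical
  rw [← DirectSum.sum_support_decompose gr w]; refine (gr c).sum_mem fun d _ => ?_
  by_cases hd : d = c
  · subst hd; exact (decompose gr w d).2
  · rw [h d hd]; exact (gr c).zero_mem

lemma mem_of_scaleOp {r : ι → ℂ} {w : W} {a : ℂ} {c : ι} (hr : ∀ d, r d = a → d = c) (h : scaleOp gr
    r w = a • w) : w ∈ gr c := by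
  refine mem_of_decompose fun d hd => ?_; have h1 := decompose_scaleOp (gr := gr) r w d
  rw [h, decompose_smul, DirectSum.smul_apply, Submodule.coe_smul, ← sub_eq_zero, ← sub_smul] at h1
  refine (smul_eq_zero.mp h1).resolve_left fun h2 => hd (hr d ?_); rw [sub_eq_zero] at h2
  exact h2.symm

end Graded

section Ops

variable {W : Type*} [AddCommGroup W] [Module ℂ W] {gr : ℂ → Submodule ℂ W}
  [Decomposition gr]

/-- Operators that shift the weight by `s`. -/
def HomOp (gr : ℂ → Submodule ℂ W) (s : ℂ) (L : W →ₗ[ℂ] W) : Prop :=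
  ∀ c, ∀ w ∈ gr c, L w ∈ gr (c + s)

/-- Finite sums of homogeneous operators. -/
def FinOp (gr : ℂ → Submodule ℂ W) : Submodule ℂ (W →ₗ[ℂ] W) :=
  Submodule.span ℂ {L | ∃ s, HomOp gr s L}

lemma HomOp.finOp {s : ℂ} {L : W →ₗ[ℂ] W} (h : HomOp gr s L) : L ∈ FinOp gr :=
  Submodule.subset_span ⟨s, h⟩


lemma HomOp.extendOp_apply {s : ℂ} {L : W →ₗ[ℂ] W} (h : HomOp gr s L) (x : Completion gr) (c : ℂ) :
    (extendOp gr L x c : W) = L (x (c - s)) := by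
  have hmem : L (x (c - s)) ∈ gr c := by simpa using h _ _ (x (c - s)).2
  rw [extendOp, finsum_eq_single _ (c - s)]
  · exact decompose_of_mem_same gr hmem
  · intro b hb; refine Subtype.ext ?_
    exact decompose_of_mem_ne gr (h _ _ (x b).2) (fun he => hb (by rw [← he]; ring))

lemma FinOp.support {L : W →ₗ[ℂ] W} (h : L ∈ FinOp gr) (c : ℂ) : ∀ᶠ T : Finset ℂ in atTop, ∀ (x :
    Completion gr) (b : ℂ), b ∉ T → decompose gr (L (x b : W)) c = 0 := by
  induction h using span_induction with
  | mem L hL =>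
    obtain ⟨s, hs⟩ := hL; filter_upwards [Filter.eventually_ge_atTop {c - s}] with T hT x b hb
    refine Subtype.ext (decompose_of_mem_ne gr (hs _ _ (x b).2) fun he => hb ?_)
    exact hT (by simp [← he])
  | zero => simp
  | add L₁ L₂ _ _ h₁ h₂ => filter_upwards [h₁, h₂] with T h₁ h₂ x b hb; simp [h₁ x b hb, h₂ x b hb]
  | smul a L _ h => filter_upwards [h] with T h x b hb; simp [DirectSum.smul_apply, h x b hb]

lemma FinOp.extendOp_sum {L : W →ₗ[ℂ] W} (h : L ∈ FinOp gr) (c : ℂ) : ∀ᶠ T : Finset ℂ in atTop, ∀ x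
    : Completion gr, extendOp gr L x c = ∑ b ∈ T, decompose gr (L (x b : W)) c :=
  (FinOp.support h c).mono fun T hT x => finsum_eq_sum_of_support_subset _ fun b hb =>
    by_contra fun hb' => hb (hT x b hb')

lemma extendOp_add_op {L₁ L₂ : W →ₗ[ℂ] W} (h₁ : L₁ ∈ FinOp gr) (h₂ : L₂ ∈ FinOp gr) (x : Completion
    gr) : extendOp gr (L₁ + L₂ : W →ₗ[ℂ] W) x = extendOp gr L₁ x + extendOp gr L₂ x := by
  funext c; obtain ⟨T, k, k₁, k₂⟩ := ((FinOp.extendOp_sum (add_mem h₁ h₂) c).and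
    ((FinOp.extendOp_sum h₁ c).and (FinOp.extendOp_sum h₂ c))).exists
  rw [Pi.add_apply, k, k₁, k₂, ← sum_add_distrib]; simp

lemma extendOp_smul_op {L : W →ₗ[ℂ] W} (h : L ∈ FinOp gr) (a : ℂ) (x : Completion gr) : extendOp gr
    (a • L : W →ₗ[ℂ] W) x = a • extendOp gr L x := by
  funext c; obtain ⟨T, k, k₁⟩ := ((FinOp.extendOp_sum (Submodule.smul_mem _ a h) c).and
    (FinOp.extendOp_sum h c)).exists
  rw [Pi.smul_apply, k, k₁, smul_sum]; simp [DirectSum.smul_apply]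

lemma extendOp_add {L : W →ₗ[ℂ] W} (h : L ∈ FinOp gr) (x y : Completion gr) : extendOp gr L (x + y)
    = extendOp gr L x + extendOp gr L y := by
  funext c; obtain ⟨T, k⟩ := (FinOp.extendOp_sum h c).exists
  rw [Pi.add_apply, k, k, k, ← sum_add_distrib]; simp

lemma extendOp_smul {L : W →ₗ[ℂ] W} (h : L ∈ FinOp gr) (a : ℂ) (x : Completion gr) : extendOp gr L
    (a • x) = a • extendOp gr L x := by
  funext c; obtain ⟨T, k⟩ := (FinOp.extendOp_sum h c).exists
  rw [Pi.smul_apply, k, k, smul_sum]; simp [DirectSum.smul_apply]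

lemma extendOp_zero_op (x : Completion gr) : extendOp gr (0 : W →ₗ[ℂ] W) x = 0 := by
  funext c; simp [extendOp]

lemma HomOp.comp {s t : ℂ} {L K : W →ₗ[ℂ] W} (hL : HomOp gr s L) (hK : HomOp gr t K) : HomOp gr (t +
    s) (L ∘ₗ K) := fun c w hw => by
  rw [← add_assoc]; exact hL _ _ (hK _ _ hw)

lemma FinOp.comp {L K : W →ₗ[ℂ] W} (hL : L ∈ FinOp gr) (hK : K ∈ FinOp gr) : L ∘ₗ K ∈ FinOp gr := by
  induction hL using span_induction with
  | mem L hL =>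
    obtain ⟨s, hs⟩ := hL
    induction hK using span_induction with
    | mem K hK => obtain ⟨t, ht⟩ := hK; exact (hs.comp ht).finOp
    | zero => simp
    | add K₁ K₂ _ _ h₁ h₂ => rw [LinearMap.comp_add]; exact add_mem h₁ h₂
    | smul a K _ h => rw [LinearMap.comp_smul]; exact Submodule.smul_mem _ a h
  | zero => simp
  | add L₁ L₂ _ _ h₁ h₂ => rw [LinearMap.add_comp]; exact add_mem h₁ h₂
  | smul a L _ h => rw [LinearMap.smul_comp]; exact Submodule.smul_mem _ a h

lemma extendOp_comp {L K : W →ₗ[ℂ] W} (hL : L ∈ FinOp gr) (hK : K ∈ FinOp gr) (x : Completion gr) :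
    extendOp gr (L ∘ₗ K : W →ₗ[ℂ] W) x = extendOp gr L (extendOp gr K x) := by
  induction hL using span_induction with
  | mem L hL =>
    obtain ⟨s, hs⟩ := hL
    induction hK using span_induction with
    | mem K hK =>
      obtain ⟨t, ht⟩ := hK; funext c; refine Subtype.ext ?_
      rw [(hs.comp ht).extendOp_apply, hs.extendOp_apply, ht.extendOp_apply, LinearMap.comp_apply,
        sub_sub, add_comm s t]
    | zero =>
      have := extendOp_smul hs.finOp 0 (0 : Completion gr); rw [zero_smul, zero_smul] at this
      rw [LinearMap.comp_zero, extendOp_zero_op, this]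
    | add K₁ K₂ hK₁ hK₂ h₁ h₂ =>
      rw [LinearMap.comp_add, extendOp_add_op (FinOp.comp hs.finOp hK₁) (FinOp.comp hs.finOp hK₂),
        h₁, h₂, extendOp_add_op hK₁ hK₂, extendOp_add hs.finOp]
    | smul a K hK h =>
      rw [LinearMap.comp_smul, extendOp_smul_op (FinOp.comp hs.finOp hK), h, extendOp_smul_op hK,
        extendOp_smul hs.finOp]
  | zero => rw [LinearMap.zero_comp, extendOp_zero_op, extendOp_zero_op]
  | add L₁ L₂ hL₁ hL₂ h₁ h₂ =>
    rw [LinearMap.add_comp, extendOp_add_op (FinOp.comp hL₁ hK) (FinOp.comp hL₂ hK), h₁, h₂,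
      extendOp_add_op hL₁ hL₂]
  | smul a L hL h =>
    rw [LinearMap.smul_comp, extendOp_smul_op (FinOp.comp hL hK), h, extendOp_smul_op hL]

lemma HomOp.exists_adjoint {s : ℂ} {L : W →ₗ[ℂ] W} (h : HomOp gr s L) (c : ℂ) (φ : Dual ℂ (gr c)) :
    ∃ ψ : Dual ℂ (gr (c - s)), ∀ x : Completion gr, barPairing gr (DirectSum.of (fun c => Dual ℂ (gr
    c)) (c - s) ψ) x = barPairing gr (DirectSum.of (fun c => Dual ℂ (gr c)) c φ) (extendOp gr L x)
    := by
  have hm : ∀ w ∈ gr (c - s), L w ∈ gr c := fun w hw => by simpa using h _ w hw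
  refine ⟨φ ∘ₗ L.restrict hm, fun x => ?_⟩; rw [barPairing_of, barPairing_of, LinearMap.comp_apply]
  congr 1; refine Subtype.ext ?_; rw [h.extendOp_apply]; rfl

lemma FinOp.exists_adjoint {L : W →ₗ[ℂ] W} (h : L ∈ FinOp gr) (w' : GradedDual gr) : ∃ w'' :
    GradedDual gr, ∀ x, barPairing gr w'' x = barPairing gr w' (extendOp gr L x) := by
  induction h using span_induction with
  | mem L hL =>
    obtain ⟨s, hs⟩ := hL
    induction w' using gradedDual_induction with
    | h0 => exact ⟨0, fun x => by simp [barPairing_zero_left]⟩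
    | hof c φ => obtain ⟨ψ, hψ⟩ := hs.exists_adjoint c φ; exact ⟨_, hψ⟩
    | hadd x y hx hy =>
      obtain ⟨a, ha⟩ := hx; obtain ⟨b, hb⟩ := hy
      exact ⟨a + b, fun z => by rw [barPairing_add_left, barPairing_add_left, ha, hb]⟩
  | zero => exact ⟨0, fun x => by rw [extendOp_zero_op, barPairing_zero, barPairing_zero_left]⟩
  | add L₁ L₂ hL₁ hL₂ h₁ h₂ =>
    obtain ⟨a, ha⟩ := h₁; obtain ⟨b, hb⟩ := h₂
    exact ⟨a + b, fun x => by
      rw [barPairing_add_left, ha, hb, extendOp_add_op hL₁ hL₂, barPairing_add]⟩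
  | smul r L hL h =>
    obtain ⟨a, ha⟩ := h
    exact ⟨r • a, fun x => by rw [barPairing_smul_left, ha, extendOp_smul_op hL, barPairing_smul]⟩

open Classical in
/-- The adjoint of a finite sum of homogeneous operators on the graded dual. -/
def adj (L : W →ₗ[ℂ] W) (w' : GradedDual gr) : GradedDual gr :=
  if h : L ∈ FinOp gr then (FinOp.exists_adjoint h w').choose else 0

lemma barPairing_adj {L : W →ₗ[ℂ] W} (h : L ∈ FinOp gr) (w' : GradedDual gr) (x : Completion gr) :
    barPairing gr (adj L w') x = barPairing gr w' (extendOp gr L x) := by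
  rw [adj, dif_pos h]; exact (FinOp.exists_adjoint h w').choose_spec x

lemma HomOp.adj_of {s : ℂ} {L : W →ₗ[ℂ] W} (h : HomOp gr s L) (c : ℂ) (φ : Dual ℂ (gr c)) : ∃ ψ :
    Dual ℂ (gr (c - s)), adj L (DirectSum.of (fun c => Dual ℂ (gr c)) c φ) = DirectSum.of (fun c =>
    Dual ℂ (gr c)) (c - s) ψ := by
  obtain ⟨ψ, hψ⟩ := h.exists_adjoint c φ
  exact ⟨ψ, gradedDual_ext fun x => by rw [barPairing_adj h.finOp, hψ]⟩

lemma adj_add {L : W →ₗ[ℂ] W} (h : L ∈ FinOp gr) (x y : GradedDual gr) : adj L (x + y) = adj L x +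
    adj L y :=
  gradedDual_ext fun z => by simp only [barPairing_adj h, barPairing_add_left]

lemma adj_add_op {L K : W →ₗ[ℂ] W} (h : L ∈ FinOp gr) (hK : K ∈ FinOp gr) (x : GradedDual gr) : adj
    (L + K) x = adj L x + adj K x :=
  gradedDual_ext fun z => by
    simp only [barPairing_adj h, barPairing_adj hK, barPairing_adj (add_mem h hK),
      barPairing_add_left, extendOp_add_op h hK, barPairing_add]

lemma adj_smul_op {L : W →ₗ[ℂ] W} (h : L ∈ FinOp gr) (a : ℂ) (x : GradedDual gr) : adj (a • L) x = a
    • adj L x :=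
  gradedDual_ext fun z => by
    simp only [barPairing_adj h, barPairing_adj (Submodule.smul_mem _ a h), barPairing_smul_left,
      extendOp_smul_op h, barPairing_smul]

lemma adj_zero_op (x : GradedDual gr) : adj (0 : W →ₗ[ℂ] W) x = 0 :=
  gradedDual_ext fun z => by
    rw [barPairing_adj (zero_mem _), extendOp_zero_op, barPairing_zero, barPairing_zero_left]

lemma adj_comp {L K : W →ₗ[ℂ] W} (h : L ∈ FinOp gr) (hK : K ∈ FinOp gr) (x : GradedDual gr) : adj (L
    ∘ₗ K) x = adj K (adj L x) :=
  gradedDual_ext fun z => by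
    simp only [barPairing_adj h, barPairing_adj hK, barPairing_adj (FinOp.comp h hK), extendOp_comp
      h hK]

lemma extendOp_decompose {L : W →ₗ[ℂ] W} (h : L ∈ FinOp gr) (w : W) : extendOp gr L (fun c =>
    decompose gr w c) = fun c => decompose gr (L w) c := by
  induction h using span_induction with
  | mem L hL =>
    obtain ⟨s, hs⟩ := hL; funext c; refine Subtype.ext ?_; rw [hs.extendOp_apply]
    induction w using graded_induction gr with
    | hom d w hw =>
      by_cases hd : d = c - s
      · subst hd; have := hs _ w hw; rw [sub_add_cancel] at this
        rw [decompose_of_mem_same _ hw, decompose_of_mem_same _ this]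
      · rw [decompose_of_mem_ne _ hw hd, decompose_of_mem_ne _ (hs _ w hw)
          (fun h => hd (by rw [← h]; ring)), map_zero]
    | hadd x y hx hy => simp [hx, hy]
    | h0 => simp
  | zero => funext c; simp [extendOp]
  | add L₁ L₂ hL₁ hL₂ h₁ h₂ => rw [extendOp_add_op hL₁ hL₂, h₁, h₂]; funext c; simp
  | smul a L hL h => rw [extendOp_smul_op hL, h]; funext c; simp [DirectSum.smul_apply]

lemma pairing_adj {L : W →ₗ[ℂ] W} (h : L ∈ FinOp gr) (w' : GradedDual gr) (w : W) : pairing gr (adj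
    L w') w = pairing gr w' (L w) := by
  rw [pairing, barPairing_adj h, extendOp_decompose h, pairing]

/-- The pairing with `w'` as a linear functional. -/
def pairingL (gr : ℂ → Submodule ℂ W) [Decomposition gr] (w' : GradedDual gr) :
    W →ₗ[ℂ] ℂ where
  toFun := pairing gr w'
  map_add' x y := by rw [pairing, pairing, pairing, ← barPairing_add]; congr 1; funext c; simp
  map_smul' a x := by
    rw [pairing, pairing, RingHom.id_apply, smul_eq_mul, ← barPairing_smul]
    congr 1; funext c; simp [DirectSum.smul_apply]

lemma pairingL_apply (w' : GradedDual gr) (w : W) : pairingL gr w' w = pairing gr w' w := rfl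

end Ops

section Modes

variable {V : Type*} [AddCommGroup V] [Module ℂ V] {grV : ℤ → Submodule ℂ V}
  [Decomposition grV] {A : MOSVA grV} {W : Type*} [AddCommGroup W] [Module ℂ W]
  {gr : ℂ → Submodule ℂ W} [Decomposition gr]

lemma MOSVA.Y_mem (A : MOSVA grV) {k n d : ℤ} {u v : V} (hu : u ∈ grV n) (hv : v ∈ grV d) : A.Y k u
    v ∈ grV (d + (n - k - 1)) := by
  have h := A.d_comm k u v
  rw [scaleOp_of_mem _ hu, scaleOp_of_mem _ hv, map_smul, map_smul, LinearMap.smul_apply] at h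
  refine mem_of_scaleOp (r := fun n : ℤ => (n : ℂ)) (a := ((d + (n - k - 1) : ℤ) : ℂ)) (fun e he => by exact_mod_cast he) ?_
  rw [sub_eq_iff_eq_add] at h; rw [h, ← add_smul, ← add_smul]; congr 1; push_cast; ring

lemma mem_of_weight {a b c k : ℂ} {w : W} (h : scaleOp gr (fun c => c) w - a • w = b • w + (-k - 1)
    • w) (hc : c = b + (-k - 1) + a := by ring) : w ∈ gr c := by
  refine mem_of_scaleOp (fun e he => he) ?_
  rw [sub_eq_iff_eq_add] at h; rw [h, hc, ← add_smul, ← add_smul]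

lemma Bimodule.YL_mem (M : Bimodule A gr) {k n : ℤ} {c : ℂ} {u : V} {w : W} (hu : u ∈ grV n) (hw : w
    ∈ gr c) : M.YL k u w ∈ gr (c + (n - k - 1)) :=
  mem_of_weight (a := c) (b := n) (by simpa only [scaleOp_of_mem _ hu, scaleOp_of_mem _ hw, map_smul,
    LinearMap.smul_apply] using M.left_d_comm k u w)

lemma Bimodule.YR_mem (M : Bimodule A gr) {k n : ℤ} {c : ℂ} {v : V} {w : W} (hv : v ∈ grV n) (hw : w
    ∈ gr c) : M.YR k w v ∈ gr (c + (n - k - 1)) :=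
  mem_of_weight (a := n) (b := c) (by simpa only [scaleOp_of_mem _ hv, scaleOp_of_mem _ hw, map_smul,
    LinearMap.smul_apply] using M.right_d_comm k w v)

lemma Bimodule.homOp_D (M : Bimodule A gr) : HomOp gr 1 M.D := M.D_weight

lemma Bimodule.homOp_D_pow (M : Bimodule A gr) (j : ℕ) : HomOp gr j (M.D ^ j) := by
  induction j with
  | zero => intro c w hw; simpa using hw
  | succ j ih =>
    rw [pow_succ]; have := ih.comp M.homOp_D; rw [add_comm] at this; exact_mod_cast this

lemma Bimodule.homOp_YL (M : Bimodule A gr) {k n : ℤ} {u : V} (hu : u ∈ grV n) : HomOp gr (n - k -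
    1) (M.YL k u) := fun _ _ hw => M.YL_mem hu hw

lemma Bimodule.YL_mem_finOp (M : Bimodule A gr) (k : ℤ) (u : V) : M.YL k u ∈ FinOp gr := by
  induction u using graded_induction grV with
  | hom n u hu => exact (M.homOp_YL hu).finOp
  | hadd x y hx hy => rw [map_add]; exact add_mem hx hy
  | h0 => simp

lemma Bimodule.YR_trunc (M : Bimodule A gr) (w : W) (v : V) : ∃ K : ℤ, ∀ k ≥ K, M.YR k w v = 0 := by
  obtain ⟨B, hB⟩ := M.lower_bound; rw [← Filter.eventually_atTop]
  induction w using graded_induction gr with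
  | hom c w hw =>
    induction v using graded_induction grV with
    | hom n v hv =>
      obtain ⟨K, hK⟩ := exists_int_gt (c.re + n - B)
      filter_upwards [Filter.eventually_ge_atTop K] with k hk
      have h1 := M.YR_mem (k := k) hv hw; rw [hB] at h1
      · simpa using h1
      · have : (K : ℝ) ≤ k := by exact_mod_cast hk
        simp only [Complex.add_re, Complex.sub_re, Complex.intCast_re, Complex.one_re]; linarith
    | hadd x y hx hy => filter_upwards [hx, hy] with k h1 h2; simp [h1, h2]
    | h0 => simp
  | hadd x y hx hy => filter_upwards [hx, hy] with k h1 h2; simp [h1, h2]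
  | h0 => simp

/-- The coefficients in the modes of `Y_W^{s(R)}`. -/
def ysCoeff (k : ℤ) (j : ℕ) : ℂ := (-1 : ℂ) ^ (-(k + j) - 1) / (factorial j : ℂ)

lemma Bimodule.YS_eq_sum (M : Bimodule A gr) (w : W) (v : V) (k : ℤ) : ∀ᶠ J in atTop, M.YS k v w = ∑
    j ∈ range J, ysCoeff k j • (M.D ^ j) (M.YR (k + j) w v) := by
  obtain ⟨K, hK⟩ := M.YR_trunc w v
  filter_upwards [Filter.eventually_ge_atTop (K - k).toNat] with J hJ
  refine finsum_eq_sum_of_support_subset _ fun j hj => ?_; by_contra hj'; refine hj ?_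
  simp only [Finset.coe_range, Set.mem_Iio, not_lt] at hj'; dsimp only
  rw [hK _ (by omega), map_zero, smul_zero]

/-- The modes of `Y_W^{s(R)}` as linear maps. -/
def Bimodule.YSL (M : Bimodule A gr) (k : ℤ) : V →ₗ[ℂ] W →ₗ[ℂ] W :=
  LinearMap.mk₂ ℂ (fun v w => M.YS k v w) (fun v₁ v₂ w => by
      obtain ⟨J, h, h₁, h₂⟩ := ((M.YS_eq_sum w (v₁ + v₂) k).and ((M.YS_eq_sum w v₁ k).and
        (M.YS_eq_sum w v₂ k))).exists
      simp [h, h₁, h₂, sum_add_distrib])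
    (fun a v w => by
      obtain ⟨J, h, h₁⟩ := ((M.YS_eq_sum w (a • v) k).and (M.YS_eq_sum w v k)).exists
      simp [h, h₁, smul_sum, smul_comm a])
    (fun v w₁ w₂ => by
      obtain ⟨J, h, h₁, h₂⟩ := ((M.YS_eq_sum (w₁ + w₂) v k).and ((M.YS_eq_sum w₁ v k).and
        (M.YS_eq_sum w₂ v k))).exists
      simp [h, h₁, h₂, sum_add_distrib])
    (fun a v w => by
      obtain ⟨J, h, h₁⟩ := ((M.YS_eq_sum (a • w) v k).and (M.YS_eq_sum w v k)).exists
      simp [h, h₁, smul_sum, smul_comm a])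

lemma Bimodule.YSL_apply (M : Bimodule A gr) (k : ℤ) (v : V) (w : W) : M.YSL k v w = M.YS k v w :=
    rfl

lemma Bimodule.homOp_YS (M : Bimodule A gr) {k n : ℤ} {v : V} (hv : v ∈ grV n) : HomOp gr (n - k -
    1) (M.YSL k v) := by
  intro c w hw; obtain ⟨J, h⟩ := (M.YS_eq_sum w v k).exists; rw [M.YSL_apply, h]
  refine Submodule.sum_mem _ fun j _ => Submodule.smul_mem _ _ ?_
  have := M.homOp_D_pow j _ _ (M.YR_mem (k := k + j) hv hw); convert this using 2; push_cast; ring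

lemma Bimodule.YS_mem_finOp (M : Bimodule A gr) (k : ℤ) (u : V) : M.YSL k u ∈ FinOp gr := by
  induction u using graded_induction grV with
  | hom n u hu => exact (M.homOp_YS hu).finOp
  | hadd x y hx hy => rw [map_add]; exact add_mem hx hy
  | h0 => simp

lemma Bimodule.D_mem_finOp (M : Bimodule A gr) : M.D ∈ FinOp gr := M.homOp_D.finOp

lemma Bimodule.YS_D_comm (M : Bimodule A gr) (k : ℤ) (v : V) (w : W) : M.D (M.YS k v w) - M.YS k v
    (M.D w) = M.YS k (A.D v) w := by
  obtain ⟨J, h, h₁, h₂⟩ := ((M.YS_eq_sum w (A.D v) k).and ((M.YS_eq_sum w v k).and (M.YS_eq_sum (M.D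
    w) v k))).exists
  rw [h, h₁, h₂, map_sum, ← sum_sub_distrib]
  refine sum_congr rfl fun j _ => ?_
  have e : M.D ((M.D ^ j) (M.YR (k + j) w v)) = (M.D ^ j) (M.D (M.YR (k + j) w v)) := by
    rw [← Module.End.mul_apply, ← Module.End.mul_apply, ← pow_succ', ← pow_succ]
  have e2 : M.YR (k + j) w (A.D v) = M.D (M.YR (k + j) w v) - M.YR (k + j) (M.D w) v := by
    rw [← M.right_D_deriv, M.right_D_comm]; abel
  rw [map_smul, e, e2, map_sub, smul_sub]

lemma Bimodule.YS_D_deriv (M : Bimodule A gr) (k : ℤ) (v : V) (w : W) : (-(k : ℂ)) • M.YS (k - 1) v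
    w = M.YS k (A.D v) w := by
  obtain ⟨J₁, h₁⟩ := Filter.eventually_atTop.mp (M.YS_eq_sum w v (k - 1))
  obtain ⟨J, h⟩ := Filter.eventually_atTop.mp (M.YS_eq_sum w (A.D v) k)
  obtain ⟨K, hK⟩ := M.YR_trunc w v; set N := J + J₁ + (K - k + 1).toNat with hN
  rw [h N (by omega), h₁ (N + 1) (by omega), smul_sum]
  set T : ℕ → W := fun j => ysCoeff (k - 1) j • (M.D ^ j) (M.YR (k - 1 + j) w v) with hT
  have hTN : T N = 0 := by rw [hT]; dsimp only; rw [hK _ (by omega), map_zero, smul_zero]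
  have hsplit : ∀ j : ℕ, ysCoeff k j • (M.D ^ j) (M.YR (k + j) w (A.D v)) = ((j + 1 : ℕ) : ℂ) • T (j
    + 1) - (k + j : ℂ) • T j := by
    intro j
    have e2 : M.YR (k + j) w (A.D v) = M.D (M.YR (k + j) w v) + ((k + j : ℤ) : ℂ) • M.YR (k - 1 + j)
      w v := by
      have := M.right_D_comm (k + j) w v; rw [eq_sub_iff_add_eq] at this
      rw [← this, show k - 1 + (j:ℤ) = k + j - 1 by ring, neg_smul]; abel
    have e3 : (M.D ^ j) (M.D (M.YR (k + j) w v)) = (M.D ^ (j + 1)) (M.YR (k + j) w v) := by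
      rw [pow_succ]; rfl
    have hf : (factorial j : ℂ) ≠ 0 := by exact_mod_cast Nat.factorial_ne_zero j
    have hj : ((j : ℂ) + 1) ≠ 0 := by exact_mod_cast Nat.succ_ne_zero j
    rw [e2, map_add, smul_add, map_smul, e3, hT]; simp only [smul_smul]
    have e5 : k - 1 + ((j + 1 : ℕ) : ℤ) = k + j := by push_cast; ring
    have e6 : ∀ (a b : ℂ) (x y : W), a • x - b • y = a • x + (-b) • y := fun a b x y => by
      rw [neg_smul, sub_eq_add_neg]
    rw [e6, e5]; congr 2
    · rw [ysCoeff, ysCoeff, factorial_succ,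
        show k - 1 + ((j + 1 : ℕ) : ℤ) = k + j by push_cast; ring]
      push_cast; field_simp
    · rw [ysCoeff, ysCoeff, show -(k + (j:ℤ)) - 1 = -(k - 1 + j) - 1 - 1 by ring, zpow_sub_one₀ (by
        norm_num : (-1:ℂ) ≠ 0)]
      push_cast; ring
  rw [sum_congr rfl fun j _ => hsplit j, sum_sub_distrib]
  have e4 := Finset.sum_range_succ' (fun j : ℕ => (j : ℂ) • T j) N
  simp only [Nat.cast_zero, zero_smul, add_zero] at e4
  rw [← e4, Finset.sum_range_succ (fun j : ℕ => (j : ℂ) • T j), hTN, smul_zero, add_zero, ←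
    sum_sub_distrib]
  change ∑ i ∈ range (N + 1), (-(k:ℂ)) • T i = _
  rw [Finset.sum_range_succ, hTN, smul_zero, add_zero]; refine sum_congr rfl fun j _ => ?_
  rw [← sub_smul]; congr 1; ring

end Modes

variable {V : Type*} [AddCommGroup V] [Module ℂ V] {grV : ℤ → Submodule ℂ V}
  [Decomposition grV] {A : MOSVA grV} {W : Type*} [AddCommGroup W] [Module ℂ W]
  {gr : ℂ → Submodule ℂ W} [Decomposition gr] {n J : ℕ} {M : Bimodule A gr}
  {p : V → V → ℕ} {Φ Ψ : Cochain V gr n}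

/-! ## Correlation functions of cochains -/

/-- The matrix coefficients of a cochain. -/
def cor (Ψ : Cochain V gr n) (w' : GradedDual gr) (v : Fin n → V) (z : Fin n → ℂ) : ℂ :=
  barPairing gr w' (evalAt (Ψ v) z)

lemma evalAt_of_injective (f : Conf n → Completion gr) {z : Fin n → ℂ} (hz : Injective z) : evalAt f
    z = f ⟨z, hz⟩ := dif_pos hz

lemma cor_of_injective (Ψ : Cochain V gr n) (w' : GradedDual gr) (v : Fin n → V) {z : Fin n → ℂ} (hz
    : Injective z) : cor Ψ w' v z = barPairing gr w' (Ψ v ⟨z, hz⟩) := by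
  rw [cor, evalAt_of_injective _ hz]

lemma cor_conf (Ψ : Cochain V gr n) (w' : GradedDual gr) (v : Fin n → V) (z : Conf n) : cor Ψ w' v z
    = barPairing gr w' (Ψ v z) := cor_of_injective Ψ w' v z.injective

lemma cor_add_left (Ψ : Cochain V gr n) (w₁ w₂ : GradedDual gr) (v : Fin n → V) (z : Fin n → ℂ) :
    cor Ψ (w₁ + w₂) v z = cor Ψ w₁ v z + cor Ψ w₂ v z :=
  barPairing_add_left _ _ _ _

lemma cor_smul_left (Ψ : Cochain V gr n) (a : ℂ) (w₁ : GradedDual gr) (v : Fin n → V) (z : Fin n →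
    ℂ) : cor Ψ (a • w₁) v z = a * cor Ψ w₁ v z :=
  barPairing_smul_left _ _ _ _

lemma cor_zero_left (Ψ : Cochain V gr n) (v : Fin n → V) (z : Fin n → ℂ) : cor Ψ 0 v z = 0 :=
  barPairing_zero_left _ _

lemma evalAt_add (f g : Conf n → Completion gr) (z : Fin n → ℂ) : evalAt (f + g) z = evalAt f z +
    evalAt g z := by
  unfold evalAt; split_ifs <;> simp

lemma evalAt_smul (a : ℂ) (f : Conf n → Completion gr) (z : Fin n → ℂ) : evalAt (a • f) z = a •
    evalAt f z := by
  unfold evalAt; split_ifs <;> simp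

lemma cor_update_add (Ψ : Cochain V gr n) (w' : GradedDual gr) (v : Fin n → V) (i : Fin n) (x y : V)
    (z : Fin n → ℂ) : cor Ψ w' (update v i (x + y)) z = cor Ψ w' (update v i x) z + cor Ψ w' (update
    v i y) z := by
  rw [cor, Ψ.map_update_add, evalAt_add, barPairing_add]; rfl

lemma cor_update_smul (Ψ : Cochain V gr n) (w' : GradedDual gr) (v : Fin n → V) (i : Fin n) (a : ℂ)
    (x : V) (z : Fin n → ℂ) : cor Ψ w' (update v i (a • x)) z = a * cor Ψ w' (update v i x) z := by
  rw [cor, Ψ.map_update_smul, evalAt_smul, barPairing_smul]; rfl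

lemma cor_update_zero (Ψ : Cochain V gr n) (w' : GradedDual gr) (v : Fin n → V) (i : Fin n) (z : Fin
    n → ℂ) : cor Ψ w' (update v i 0) z = 0 := by
  have := cor_update_smul Ψ w' v i 0 0 z; rwa [zero_smul, zero_mul] at this

lemma cor_eq_zero (Ψ : Cochain V gr n) (w' : GradedDual gr) {v : Fin n → V} (i : Fin n) (h : v i =
    0) (z : Fin n → ℂ) : cor Ψ w' v z = 0 := by
  rw [← update_eq_self i v, h, cor_update_zero]

lemma cor_add (Ψ Φ : Cochain V gr n) (w' : GradedDual gr) (v : Fin n → V) (z : Fin n → ℂ) : cor (Ψ +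
    Φ) w' v z = cor Ψ w' v z + cor Φ w' v z := by
  rw [cor, add_apply, evalAt_add, barPairing_add]; rfl

lemma cor_smul (a : ℂ) (Ψ : Cochain V gr n) (w' : GradedDual gr) (v : Fin n → V) (z : Fin n → ℂ) :
    cor (a • Ψ) w' v z = a * cor Ψ w' v z := by
  rw [cor, smul_apply, evalAt_smul, barPairing_smul]; rfl

lemma cor_zero (w' : GradedDual gr) (v : Fin n → V) (z : Fin n → ℂ) : cor (0 : Cochain V gr n) w' v
    z = 0 := by
  have := cor_smul 0 (0 : Cochain V gr n) w' v z; rwa [zero_smul, zero_mul] at this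

lemma cor_adj (Ψ : Cochain V gr n) {L : W →ₗ[ℂ] W} (h : L ∈ FinOp gr) (w' : GradedDual gr) (v : Fin
    n → V) (z : Fin n → ℂ) : cor Ψ (adj L w') v z = barPairing gr w' (extendOp gr L (evalAt (Ψ v)
    z)) :=
  barPairing_adj h _ _

lemma cochain_ext {Ψ Φ : Cochain V gr n} (h : ∀ w' v z, Injective z → cor Ψ w' v z = cor Φ w' v z) :
    Ψ = Φ := by
  refine MultilinearMap.ext fun v => ?_; funext z; refine completion_ext fun w' => ?_
  rw [← cor_conf, ← cor_conf]; exact h w' v z z.injective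

lemma hom_induction (grV : ℤ → Submodule ℂ V) [Decomposition grV] {P : (Fin n → V) → Prop} (hom : ∀
    (v : Fin n → V) (d : Fin n → ℤ), (∀ i, v i ∈ grV (d i)) → P v) (hadd : ∀ v i x y, P (update v i
    x) → P (update v i y) → P (update v i (x + y))) (v : Fin n → V) : P v := by
  suffices H : ∀ s : Finset (Fin n), ∀ v : Fin n → V, (∀ i ∉ s, ∃ d, v i ∈ grV d) → P v from
    H univ v (by simp)
  intro s
  induction s using Finset.induction_on with
  | empty => intro v hv; choose d hd using fun i => hv i (by simp); exact hom v d hd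
  | insert a s ha ih =>
    intro v hv; rw [← update_eq_self a v]
    have h0 : ∀ x : V, (∃ d, x ∈ grV d) → P (update v a x) := by
      intro x hx; refine ih _ fun i hi => ?_
      by_cases hia : i = a
      · subst hia; simpa using hx
      · rw [update_of_ne hia]; exact hv i (by simp [hi, hia])
    exact graded_induction grV (P := fun x => P (update v a x)) (fun c x hx => h0 x ⟨c, hx⟩) (fun x
      y => hadd v a x y) (h0 0 ⟨0, Submodule.zero_mem _⟩) (v a)

/-- The pole orders are bounded by `p`. -/
def PoleBound (p : V → V → ℕ) (Ψ : Cochain V gr n) : Prop :=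
  ∀ (v : Fin n → V) (w' : GradedDual gr), ∃ h : MvPolynomial (Fin n) ℂ, ∀ z, Injective z → cor Ψ w'
    v z * poleProd p v z = eval z h

lemma PoleBound.mem_regOff (h : PoleBound p Ψ) (w' : GradedDual gr) (v : Fin n → V) : cor Ψ w' v ∈
    RatFun n := by
  obtain ⟨q, hq⟩ := h v w'; exact poleProd_mem_regOff p v hq

/-- Homogeneous elements of the graded dual. -/
abbrev dualOf (gr : ℂ → Submodule ℂ W) (c : ℂ) (φ : Dual ℂ (gr c)) : GradedDual gr :=
  DirectSum.of (fun c => Dual ℂ (gr c)) c φ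

/-- The conditions on a cochain, in terms of its matrix coefficients. -/
structure Regular (M : Bimodule A gr) (p : V → V → ℕ) (Ψ : Cochain V gr n) : Prop where
  poleBound : PoleBound p Ψ
  hasDerivAt : ∀ i v w' z, Injective z → HasDerivAt (fun t => cor Ψ w' v (update z i t)) (cor Ψ w'
    (update v i (A.D (v i))) z) (z i)
  sum_D : ∀ v w' z, Injective z → cor Ψ (adj M.D w') v z = ∑ i, cor Ψ w' (update v i (A.D (v i))) z
  homogeneous : ∀ (v : Fin n → V) (d : Fin n → ℤ), (∀ i, v i ∈ grV (d i)) → ∀ c φ (t : ℂ) z, t ≠ 0 →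
    Injective z → t ^ c * cor Ψ (dualOf gr c φ) v z = t ^ (∑ i, d i) * cor Ψ (dualOf gr c φ) v (t •
    z)

lemma Regular.mem_regOff (h : Regular M p Ψ) (w' : GradedDual gr) (v : Fin n → V) : cor Ψ w' v ∈
    RatFun n := h.poleBound.mem_regOff w' v

/-! ## Faces -/

/-- The possible positions of an additional vertex operator. -/
inductive FaceKind (n : ℕ)
  | left : FaceKind n
  | right : FaceKind n
  | mid (i : Fin n) : FaceKind n

namespace FaceKind

/-- The position of the additional variable. -/
def pos : FaceKind n → Fin (n + 1)
  | left => 0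
  | right => last n
  | mid i => i.castSucc

/-- The center of the expansion. -/
def ctr : FaceKind n → (Fin n → ℂ) → ℂ
  | left, _ => 0
  | right, _ => 0
  | mid i, y => y i

/-- The region of convergence. -/
def Reg : FaceKind n → ℂ → (Fin n → ℂ) → Prop
  | left, t, y => t ≠ 0 ∧ ∀ j, ‖y j‖ < ‖t‖
  | right, t, y => t ≠ 0 ∧ ∀ j, ‖y j‖ < ‖t‖
  | mid i, t, y => t ≠ y i ∧ ∀ j, j ≠ i → ‖t - y i‖ < ‖y j - y i‖

/-- The action of a mode on the graded dual. -/
def wT (M : Bimodule A gr) : FaceKind n → ℤ → V → GradedDual gr → GradedDual gr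
  | left, k, u, w' => adj (M.YL k u) w'
  | right, k, u, w' => adj (M.YSL k u) w'
  | mid _, _, _, w' => w'

/-- The action of a mode on the arguments. -/
def vT (A : MOSVA grV) : FaceKind n → ℤ → V → (Fin n → V) → Fin n → V
  | left, _, _, v => v
  | right, _, _, v => v
  | mid i, k, u, v => update v i (A.Y k u (v i))

end FaceKind

open FaceKind

variable {κ : FaceKind n} {w : Fin J → FaceKind n} {ζ : Fin n → ℂ}

/-- Insertion of an entry in a tuple. -/
abbrev ins {X : Type*} (p : Fin (n + 1)) (x : X) (y : Fin n → X) : Fin (n + 1) → X :=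
  Fin.insertNth (α := fun _ => X) p x y

lemma ins_self {X : Type*} (p : Fin (n + 1)) (z : Fin (n + 1) → X) : ins p (z p) (fun j => z
    (p.succAbove j)) = z := Fin.insertNth_self_removeNth p z

lemma ins_injective {X : Type*} {p : Fin (n + 1)} {x : X} {y : Fin n → X} (hy : Injective y) (hx : ∀
    j, y j ≠ x) : Injective (ins p x y) := by
  intro i j
  refine succAboveCases p ?_ (fun i => ?_) i <;> refine succAboveCases p ?_ (fun j => ?_) j
  · simp
  · simpa using fun h => absurd h.symm (hx j)
  · simpa using fun h => absurd h (hx i)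
  · simpa using fun h => hy h

lemma injective_removeNth {X : Type*} {z : Fin (n + 1) → X} (p : Fin (n + 1)) (hz : Injective z) :
    Injective (fun j => z (p.succAbove j)) :=
  hz.comp Fin.succAbove_right_injective

lemma update_ins_self {X : Type*} (p : Fin (n + 1)) (x x' : X) (y : Fin n → X) : update (ins p x y)
    p x' = ins p x' y := by
  ext i; refine succAboveCases p ?_ (fun i => ?_) i <;> simp

lemma update_ins_succAbove {X : Type*} (p : Fin (n + 1)) (x x' : X) (y : Fin n → X) (j : Fin n) :
    update (ins p x y) (p.succAbove j) x' = ins p x (update y j x') := by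
  ext i; refine succAboveCases p ?_ (fun i => ?_) i
  · simp
  · by_cases h : i = j
    · subst h; simp
    · simp [h]

lemma FaceKind.Reg.injective {t : ℂ} {y : Fin n → ℂ} (h : κ.Reg t y) (hy : Injective y) : Injective
    (ins κ.pos t y) := by
  refine ins_injective hy fun j hj => ?_
  cases κ with
  | left | right => exact absurd (h.2 j) (by simp [hj])
  | mid i =>
    by_cases hji : j = i
    · subst hji; exact h.1 hj.symm
    · exact absurd (h.2 j hji) (by simp [hj])

lemma FaceKind.isOpen_reg (κ : FaceKind n) : IsOpen {z : Fin (n + 1) → ℂ | κ.Reg (z κ.pos) (fun j =>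
    z (κ.pos.succAbove j))} := by
  cases κ with
  | left | right =>
    simp only [Reg, Set.ofPred_and, Set.ofPred_forall]
    exact (isOpen_ne_fun (by fun_prop) (by fun_prop)).inter (isOpen_iInter_of_finite fun j =>
      isOpen_lt (by fun_prop) (by fun_prop))
  | mid i =>
    simp only [Reg, Set.ofPred_and, Set.ofPred_forall]
    exact (isOpen_ne_fun (by fun_prop) (by fun_prop)).inter (isOpen_iInter_of_finite fun j =>
      isOpen_iInter_of_finite fun _ => isOpen_lt (by fun_prop) (by fun_prop))

lemma FaceKind.reg_ofReal_norm {x : ℂ} {y : Fin n → ℂ} : κ.Reg (κ.ctr y + (‖x‖ : ℝ)) y ↔ κ.Reg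
    (κ.ctr y + x) y := by
  cases κ <;> simp [Reg, ctr]

/-- The region contains a neighbourhood of an annulus. -/
lemma FaceKind.exists_annulus (κ : FaceKind n) {t : ℂ} {y : Fin n → ℂ} (h : κ.Reg t y) : ∃ r₁ r₂ :
    ℝ, 0 < r₁ ∧ r₁ < ‖t - κ.ctr y‖ ∧ ‖t - κ.ctr y‖ < r₂ ∧ ∀ᶠ y' in 𝓝 y, ∀ x : ℂ, r₁ ≤ ‖x‖ → ‖x‖ ≤ r₂
    → κ.Reg (κ.ctr y' + x) y' := by
  have hR : 0 < ‖t - κ.ctr y‖ := norm_pos_iff.mpr (by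
    cases κ <;> simpa [ctr, sub_eq_zero] using h.1)
  have h0 := reg_ofReal_norm.mpr (show κ.Reg (κ.ctr y + (t - κ.ctr y)) y by simpa using h)
  generalize ‖t - κ.ctr y‖ = R at hR h0 ⊢
  have hc : Continuous fun q : (Fin n → ℂ) × ℝ => ins κ.pos (κ.ctr q.1 + q.2) q.1 := by
    refine Continuous.finInsertNth κ.pos ?_ continuous_fst; cases κ <;> unfold ctr <;> fun_prop
  have h1 := (hc.continuousAt (x := (y, R))).eventually_mem
    (κ.isOpen_reg.mem_nhds (by simpa using h0))
  rw [nhds_prod_eq] at h1; obtain ⟨pa, ha, pb, hb, h2⟩ := Filter.eventually_prod_iff.mp h1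
  obtain ⟨δ, hδ, h3⟩ := Metric.eventually_nhds_iff.mp (hb.and (eventually_gt_nhds hR))
  refine ⟨R - δ / 2, R + δ / 2, (h3 ?_).2, by linarith, by linarith, ha.mono fun y' h4 x h5 h6 => ?_⟩
  · rw [Real.dist_eq, abs_lt]; constructor <;> linarith
  · rw [← reg_ofReal_norm]; simpa using h2 h4 (h3 (y := ‖x‖) (by
      rw [Real.dist_eq, abs_lt]; constructor <;> linarith)).1

lemma FaceKind.exists_circle (κ : FaceKind n) {y : Fin n → ℂ} (hy : Injective y) : ∃ ρ > 0, ∀ᶠ y' in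
    𝓝 y, ∀ x : ℂ, ‖x‖ = ρ → κ.Reg (κ.ctr y' + x) y' := by
  have h : ∃ t, κ.Reg t y := by
    cases κ with
    | left | right =>
      have h0 : (0 : ℝ) < ∑ j, ‖y j‖ + 1 := by positivity
      refine ⟨(∑ j, ‖y j‖ + 1 : ℝ), by exact_mod_cast h0.ne', fun j => ?_⟩
      rw [Complex.norm_of_nonneg h0.le]
      exact (single_le_sum (f := fun j => ‖y j‖) (fun _ _ => norm_nonneg _) (mem_univ j)).trans_lt
        (lt_add_one _)
    | mid i =>
      have : ∀ᶠ ρ in 𝓝[>] (0 : ℝ), ∀ j, j ≠ i → ρ < ‖y j - y i‖ := by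
        simp only [eventually_all]; intro j hj
        exact eventually_nhdsWithin_of_eventually_nhds (eventually_lt_nhds (norm_pos_iff.mpr
          (sub_ne_zero.mpr fun h => hj (hy h))))
      obtain ⟨ρ, h2, h3 : 0 < ρ⟩ := (this.and self_mem_nhdsWithin).exists
      exact ⟨y i + ρ, by simpa using h3.ne', by simpa [abs_of_pos h3] using h2⟩
  obtain ⟨t, h⟩ := h; obtain ⟨r₁, r₂, h0, h1, h2, h3⟩ := κ.exists_annulus h
  exact ⟨_, h0.trans h1, h3.mono fun y' h x hx => h x (by rw [hx]; exact h1.le)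
    (by rw [hx]; exact h2.le)⟩

lemma exists_injective (n : ℕ) : ∃ y : Fin n → ℂ, Injective y :=
  ⟨fun i => ((i : ℕ) : ℂ), fun _ _ h => Fin.ext (Nat.cast_injective (R := ℂ) h)⟩

/-- Functions that agree on the region of a face are equal. -/
lemma FaceKind.eq_of_reg (κ : FaceKind n) {F G : (Fin (n + 1) → ℂ) → ℂ} (hF : F ∈ RatFun (n + 1))
    (hG : G ∈ RatFun (n + 1)) (h : ∀ t y, Injective y → κ.Reg t y → F (ins κ.pos t y) = G (ins κ.pos
    t y)) {z : Fin (n + 1) → ℂ} (hz : Injective z) : F z = G z := by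
  obtain ⟨y, hy⟩ := exists_injective n; obtain ⟨ρ, hρ, h1⟩ := κ.exists_circle hy
  have h2 := h1.self_of_nhds (ρ : ℂ) (by simp [abs_of_pos hρ])
  refine RegOff.eq_of_eventually hF hG (z₀ := ins κ.pos (κ.ctr y + ρ) y) ?_ (eval_diffPoly_ne.mpr hz)
  have h3 : ∀ᶠ z in 𝓝 (ins κ.pos (κ.ctr y + ρ) y),
      κ.Reg (z κ.pos) (fun j => z (κ.pos.succAbove j)) :=
    κ.isOpen_reg.mem_nhds (by simpa using h2)
  filter_upwards [h3] with z hz hz'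
  have := h _ _ (injective_removeNth κ.pos (eval_diffPoly_ne.mp hz')) hz; rwa [ins_self] at this

lemma Separated.ins {P : Type*} {S : Subalgebra ℂ (P → ℂ)} {z : Fin n → P → ℂ} {x : P → ℂ} (h :
    Separated S z) (hx : x ∈ S) (hd : ∀ j, (fun a => (x a - z j a)⁻¹) ∈ S) (q : Fin (n + 1)) :
    Separated S fun i a => ins q (x a) (fun j => z j a) i := by
  refine ⟨fun i => ?_, fun i j => ?_⟩
  · refine succAboveCases q ?_ (fun i => ?_) i
    · simpa using hx
    · simpa using h.1 i
  · refine succAboveCases q ?_ (fun i => ?_) i <;> refine succAboveCases q ?_ (fun j => ?_) j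
    · simp
    · intro _; simpa using hd j
    · intro _; simpa [Pi.neg_def, ← inv_neg] using S.neg_mem (hd i)
    · intro e; simpa using h.2 i j fun e' => e (by rw [e'])

lemma ExpOn.comp_ins {F : (Fin (n + 1) → ℂ) → ℂ} (hF : F ∈ RatFun (n + 1)) {Dom : Set ((Fin n → ℂ) ×
    ℂ)} {x : (Fin n → ℂ) → ℂ → ℂ} (p : Fin (n + 1)) (hx : ExpOn (RatFun n) Dom x) (hd : ∀ j, ExpOn
    (RatFun n) Dom fun y ξ => (x y ξ - y j)⁻¹) (hinj : ∀ y ξ, (y, ξ) ∈ Dom → Injective (ins p (x y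
    ξ) y)) : ExpOn (RatFun n) Dom fun y ξ => F (ins p (x y ξ) y) := by
  exact ExpOn.comp_regOff hF (z := fun i y ξ => ins p (x y ξ) y i) (Separated.ins (z := fun j (q :
    (Fin n → ℂ) × ℂ) => q.1 j) (x := fun q => x q.1 q.2) ⟨fun i => ExpOn.coeff (coord_mem_regOff i),
    fun i j h => ExpOn.coeff (inv_diff_mem_regOff h)⟩ hx hd p) hinj

/-- Expansion of rational functions in the region of a face. -/
lemma FaceKind.exists_expansion (κ : FaceKind n) {F : (Fin (n + 1) → ℂ) → ℂ} (hF : F ∈ RatFun (n +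
    1)) : ∃ a : ℤ → (Fin n → ℂ) → ℂ, (∀ k, a k ∈ RatFun n) ∧ ∀ t y, Injective y → κ.Reg t y → HasSum
    (fun k => a k y * (t - κ.ctr y) ^ (-k - 1)) (F (ins κ.pos t y)) := by
  have hout : ∀ p : Fin (n + 1), ∃ a : ℤ → (Fin n → ℂ) → ℂ, (∀ k, a k ∈ RatFun n) ∧ ∀ t y, Injective
    y → (t ≠ 0 ∧ ∀ j, ‖y j‖ < ‖t‖) → HasSum (fun k => a k y * (t - 0) ^ (-k - 1)) (F (ins p t y)) :=
    by
    intro p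
    let Dom : Set ((Fin n → ℂ) × ℂ) := {q | Injective q.1 ∧ q.2 ≠ 0 ∧ ∀ j, ‖q.1 j * q.2‖ < 1}
    have h0 : ∀ y ξ, (y, ξ) ∈ Dom → ξ ≠ 0 := fun y ξ h => h.2.1
    obtain ⟨a, ha, hs⟩ := (ExpOn.comp_ins hF p (ExpOn.var_inv (𝓐 := RatFun n) h0) (fun j => by
      refine (ExpOn.var.mul (ExpOn.inv_sub (a := fun _ => 1) (by
        rw [inv_one]; exact (RatFun n).one_mem) (coord_mem_regOff j) fun y ξ h => by
        simpa using h.2.2 j)).congr fun y ξ h => ?_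
      have h3 := h0 y ξ h
      rw [show ξ⁻¹ - y j = ξ⁻¹ * (1 - y j * ξ) by field_simp, mul_inv, inv_inv])
      fun y ξ h => ins_injective h.1 fun j hj => by
        have : ‖y j * ξ‖ < 1 := h.2.2 j
        rw [hj, inv_mul_cancel₀ h.2.1, norm_one] at this
        exact lt_irrefl _ this).exists_coeff h0
    let σ : ℤ ≃ ℤ := ⟨fun k => k + 1, fun k => k - 1, fun k => by ring, fun k => by ring⟩
    refine ⟨fun k => a (k + 1), fun k => ha _, fun t y hy h => ?_⟩
    have h4 := hs y t⁻¹ ⟨hy, inv_ne_zero h.1, fun j => by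
      rw [norm_mul, norm_inv, ← div_eq_mul_inv, div_lt_one (norm_pos_iff.mpr h.1)]; exact h.2 j⟩
    rw [inv_inv, ← σ.hasSum_iff] at h4; refine h4.of_eq fun k => ?_
    simp only [comp, σ, Equiv.coe_fn_mk, inv_zpow', neg_add, sub_eq_add_neg, neg_zero, add_zero]
  cases κ with
  | left | right => exact hout _
  | mid i =>
    let Dom : Set ((Fin n → ℂ) × ℂ) := {q | Injective q.1 ∧ q.2 ≠ 0 ∧ ∀ j, j ≠ i → ‖q.2‖ < ‖q.1 j -
      q.1 i‖}
    have h0 : ∀ y ξ, (y, ξ) ∈ Dom → ξ ≠ 0 := fun y ξ h => h.2.1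
    obtain ⟨a, ha, hs⟩ := (ExpOn.comp_ins hF i.castSucc (Dom := Dom) (x := fun y ξ => y i + ξ)
      ((ExpOn.coeff (coord_mem_regOff i)).add ExpOn.var) (fun j => by
        by_cases hj : j = i
        · subst hj; simpa using ExpOn.var_inv (𝓐 := RatFun n) h0
        · refine (ExpOn.inv_sub (a := fun y => y i - y j) (b := fun _ => -1) (inv_diff_mem_regOff
            (Ne.symm hj)) ((RatFun n).algebraMap_mem (-1)) fun y ξ h => by
              rw [norm_mul, norm_neg, norm_one, one_mul, norm_sub_rev]
              exact h.2.2 j hj).congr fun y ξ _ => ?_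
          congr 1; ring) fun y ξ h =>
        Reg.injective (κ := .mid i) ⟨fun e => h.2.1 (by simpa using e), fun j hj => by
          simpa using h.2.2 j hj⟩ h.1).exists_coeff h0
    let σ : ℤ ≃ ℤ := ⟨fun k => -k - 1, fun k => -k - 1, fun k => by ring, fun k => by ring⟩
    refine ⟨fun k => a (-k - 1), fun k => ha _, fun t y hy h => ?_⟩
    have h4 := hs y (t - y i) ⟨hy, sub_ne_zero.mpr h.1, h.2⟩
    rw [add_sub_cancel, ← σ.hasSum_iff] at h4; exact h4

/-- An expansion that holds locally on circles holds on the whole region of a face. -/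
lemma FaceKind.extend (κ : FaceKind n) {F : (Fin (n + 1) → ℂ) → ℂ} (hF : F ∈ RatFun (n + 1)) {b : ℤ
    → (Fin n → ℂ) → ℂ} (hb : ∀ k, b k ∈ RatFun n) {y₀ : Fin n → ℂ} (h : ∀ᶠ y in 𝓝 y₀, ∃ ρ > 0, ∀ x :
    ℂ, ‖x‖ = ρ → κ.Reg (κ.ctr y + x) y ∧ HasSum (fun k => b k y * x ^ (-k - 1)) (F (ins κ.pos (κ.ctr
    y + x) y))) {t : ℂ} {y : Fin n → ℂ} (hy : Injective y) (ht : κ.Reg t y) : HasSum (fun k => b k y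
    * (t - κ.ctr y) ^ (-k - 1)) (F (ins κ.pos t y)) := by
  obtain ⟨a, ha, hs⟩ := κ.exists_expansion hF
  have hab : ∀ k, ∀ y, Injective y → a k y = b k y := by
    intro k y hy
    refine RegOff.eq_of_eventually (ha k) (hb k) (z₀ := y₀) ?_ (eval_diffPoly_ne.mpr hy)
    filter_upwards [h] with y h1 hy
    obtain ⟨ρ, hρ, h1⟩ := h1
    have := (independent_zpow_neg hρ).eq (c := fun k => a k y) (d := fun k => b k y) (f := fun x =>
      F (ins κ.pos (κ.ctr y + x) y)) (fun x hx => ?_) (fun x hx => (h1 x hx).2)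
    · exact congrFun this k
    · have := hs _ _ (eval_diffPoly_ne.mp hy) (h1 x hx).1; rwa [add_sub_cancel_left] at this
  refine (hs t y hy ht).of_eq fun k => ?_; rw [hab k y hy]

/-- `Z` is the composition of `Ψ` with an additional vertex operator. -/
def Face (M : Bimodule A gr) (κ : FaceKind n) (Ψ : Cochain V gr n) (Z : Cochain V gr (n + 1)) :
    Prop :=
  ∀ (u : V) (v : Fin n → V) (w' : GradedDual gr) (t : ℂ) (y : Fin n → ℂ), Injective y → κ.Reg t y →
    HasSum (fun k : ℤ => cor Ψ (κ.wT M k u w') (κ.vT A k u v) y * (t - κ.ctr y) ^ (-k - 1)) (cor Z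
    w' (ins κ.pos u v) (ins κ.pos t y))

lemma Face.unique {Z Z' : Cochain V gr (n + 1)} {p p' : V → V → ℕ} (h : Face M κ Ψ Z) (h' : Face M κ
    Ψ Z') (hZ : PoleBound p Z) (hZ' : PoleBound p' Z') : Z = Z' := by
  refine cochain_ext fun w' v z hz => ?_
  refine κ.eq_of_reg (hZ.mem_regOff w' v) (hZ'.mem_regOff w' v) (fun t y hy ht => ?_) hz
  have h1 := h (v κ.pos) (fun j => v (κ.pos.succAbove j)) w' t y hy ht
  have h2 := h' (v κ.pos) (fun j => v (κ.pos.succAbove j)) w' t y hy ht; rw [ins_self] at h1 h2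
  exact h1.unique h2

/-! ## Homogeneous polynomials and representable functionals -/

section Poly

variable {σ : Type*}

/-- The polynomial `h (t X)`. -/
def scalePoly (t : ℂ) (h : MvPolynomial σ ℂ) : MvPolynomial σ ℂ :=
  ∑ k ∈ h.support, monomial k (t ^ k.degree * h.coeff k)

lemma coeff_scalePoly (t : ℂ) (h : MvPolynomial σ ℂ) (k : σ →₀ ℕ) : (scalePoly t h).coeff k = t ^
    k.degree * h.coeff k := by
  classical
  simp only [scalePoly, MvPolynomial.coeff_sum, MvPolynomial.coeff_monomial]
  rw [Finset.sum_ite_eq']; split_ifs with hk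
  · rfl
  · rw [MvPolynomial.notMem_support_iff.mp hk, mul_zero]

lemma eval_scalePoly [Fintype σ] (t : ℂ) (h : MvPolynomial σ ℂ) (z : σ → ℂ) : eval z (scalePoly t h)
    = eval (t • z) h := by
  rw [MvPolynomial.eval_eq' (t • z), scalePoly, map_sum]; refine sum_congr rfl fun k _ => ?_
  rw [MvPolynomial.eval_monomial, Finsupp.prod_fintype _ _ (fun _ => pow_zero _)]
  simp only [Pi.smul_apply, smul_eq_mul, mul_pow, prod_mul_distrib]
  rw [prod_pow_eq_pow_sum, ← Finsupp.degree_eq_sum]; ring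

lemma eq_of_eval_injective {ι : Type*} [Fintype ι] [DecidableEq ι] {h h' : MvPolynomial ι ℂ} (H : ∀
    z, Injective z → eval z h = eval z h') (hne : ∃ z : ι → ℂ, Injective z) : h = h' := by
  obtain ⟨z₀, hz₀⟩ := hne; rw [← sub_eq_zero]; refine eval_eq_zero_of_eventually (z₀ := z₀) ?_
  filter_upwards [eventually_injective hz₀] with z hz
  rw [map_sub, H z hz, sub_self]

lemma exp_cpow_ofReal (x : ℝ) (a : ℂ) : Complex.exp x ^ a = Complex.exp (x * a) := by
  rw [Complex.cpow_def_of_ne_zero (Complex.exp_ne_zero _), Complex.log_exp]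
  · simpa using Real.pi_pos
  · simpa using Real.pi_pos.le

lemma eq_of_exp_mul {a b : ℂ} (h : ∀ x : ℝ, Complex.exp (x * a) = Complex.exp (x * b)) : a = b := by
  have key : ∀ c : ℂ, HasDerivAt (fun x : ℝ => Complex.exp (x * c)) c 0 := by
    intro c
    have h1 : HasDerivAt (fun x : ℝ => (x : ℂ) * c) c 0 := by
      simpa using (Complex.ofRealCLM.hasDerivAt (x := (0:ℝ))).mul_const c
    simpa using h1.cexp
  refine (key a).unique ?_; rw [funext h]; exact key b

lemma degree_of_homogeneous {h : MvPolynomial (Fin n) ℂ} {a : ℂ} {b : ℤ} (H : ∀ t : ℂ, t ≠ 0 → ∀ z,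
    Injective z → t ^ a * eval z h = t ^ b * eval (t • z) h) {k : Fin n →₀ ℕ} (hk : h.coeff k ≠ 0) :
    a = b + k.degree := by
  refine eq_of_exp_mul fun x => ?_; have hx := Complex.exp_ne_zero (x : ℂ)
  have h1 : MvPolynomial.C (Complex.exp x ^ a) * h = MvPolynomial.C (Complex.exp x ^ b) * scalePoly
    (Complex.exp x) h := by
    refine eq_of_eval_injective (fun z hz => ?_) (exists_injective n)
    rw [map_mul, map_mul, eval_C, eval_C, eval_scalePoly]; exact H _ hx z hz
  have h2 := congrArg (MvPolynomial.coeff k) h1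
  rw [MvPolynomial.coeff_C_mul, MvPolynomial.coeff_C_mul, coeff_scalePoly, ← mul_assoc] at h2
  have h3 := mul_right_cancel₀ hk h2
  rw [exp_cpow_ofReal, ← zpow_natCast, ← zpow_add₀ hx, ← Complex.cpow_intCast, exp_cpow_ofReal] at h3
  rw [h3]; push_cast; rfl

/-- The degree of the polynomial `diffPoly`. -/
def diffDegree (n : ℕ) : ℕ := ∑ i : Fin n, (univ.erase i).card

lemma diffProd_smul (t : ℂ) (z : Fin n → ℂ) : diffProd (t • z) = t ^ diffDegree n * diffProd z := by
  simp only [diffProd, Pi.smul_apply, smul_eq_mul, ← mul_sub, prod_mul_distrib, Finset.prod_const,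
    diffDegree, prod_pow_eq_pow_sum]

lemma isHomogeneous_diffPoly (n : ℕ) : (diffPoly (Fin n)).IsHomogeneous (diffDegree n) := by
  refine MvPolynomial.IsHomogeneous.prod _ _ _ fun i _ => ?_
  have := MvPolynomial.IsHomogeneous.prod (univ.erase i) (fun j => (X i - X j : MvPolynomial (Fin n)
    ℂ)) (fun _ => 1) (fun j _ => (MvPolynomial.isHomogeneous_X ℂ i).sub
    (MvPolynomial.isHomogeneous_X ℂ j))
  simpa using this

/-- If the functions `F φ`, which depend linearly on a functional `φ` on `E`, have numerators with
bounded support and are determined by values of functionals that are evaluations, then the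
coefficients of the numerators are evaluations. -/
lemma exists_rep_coeff {n N : ℕ} {E : Type*} [AddCommGroup E] [Module ℂ E] {F : Dual ℂ E → (Fin n →
    ℂ) → ℂ} (hadd : ∀ φ ψ z, Injective z → F (φ + ψ) z = F φ z + F ψ z) (hsmul : ∀ (a : ℂ) φ z,
    Injective z → F (a • φ) z = a * F φ z) (K : Finset (Fin n →₀ ℕ)) (hF : ∀ φ, ∃ H : MvPolynomial
    (Fin n) ℂ, (∀ k ∉ K, H.coeff k = 0) ∧ ∀ z, Injective z → F φ z * diffProd z ^ N = eval z H) {J :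
    Type*} {b : J → Dual ℂ (Dual ℂ E)} (hb : ∀ j, ∃ e, ∀ φ, b j φ = φ e) (hbF : ∀ φ, (∀ j, b j φ =
    0) ↔ ∀ z, Injective z → F φ z = 0) : ∃ e : (Fin n →₀ ℕ) → E, (∀ k ∉ K, e k = 0) ∧ ∀ φ, ∃ H :
    MvPolynomial (Fin n) ℂ, (∀ k, H.coeff k = φ (e k)) ∧ ∀ z, Injective z → F φ z * diffProd z ^ N =
    eval z H := by
  classical
  choose H hK hH using hF
  let T : Dual ℂ E →ₗ[ℂ] (K → ℂ) :=
    { toFun := fun φ k => (H φ).coeff k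
      map_add' := fun φ ψ => by
        have : H (φ + ψ) = H φ + H ψ := eq_of_eval_injective (fun z hz => by
          rw [map_add, ← hH _ z hz, ← hH _ z hz, ← hH _ z hz, hadd _ _ z hz, add_mul])
          (exists_injective n)
        funext k; simp [this]
      map_smul' := fun a φ => by
        have : H (a • φ) = a • H φ := eq_of_eval_injective (fun z hz => by
          rw [MvPolynomial.smul_eval, ← hH _ z hz, ← hH _ z hz, hsmul _ _ z hz, mul_assoc])
          (exists_injective n)
        funext k; simp [this] }
  have hker : ∀ φ, T φ = 0 ↔ ∀ j, b j φ = 0 := by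
    intro φ; rw [hbF]; constructor
    · intro h z hz
      have h0 : H φ = 0 := by
        ext k
        by_cases hk : k ∈ K
        · exact congrFun h ⟨k, hk⟩
        · simpa using hK φ k hk
      have h1 := hH φ z hz; rw [h0, map_zero] at h1
      exact (mul_eq_zero.mp h1).resolve_right (pow_ne_zero _ (diffProd_ne_zero.mpr hz))
    · intro h
      have h0 : H φ = 0 := eq_of_eval_injective (fun z hz => by
        rw [← hH φ z hz, h z hz]; simp) (exists_injective n)
      funext k; simp [T, h0]
  have hle : ∀ j, ker T ≤ ker (b j) := fun j φ h => (hker φ).mp h j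
  have hfin : FiniteDimensional ℂ (Dual ℂ E ⧸ ker T) := T.quotKerEquivRange.symm.finiteDimensional
  have hrep : ∀ k : K, ∃ e : E, ∀ φ, (H φ).coeff k = φ e := by
    intro k
    have hk : ((ker T).liftQ (LinearMap.proj k ∘ₗ T) fun φ h => by
        have h : T φ = 0 := h; simp [h]) ∈ Submodule.span ℂ
        (Set.range fun j => (ker T).liftQ (b j) (hle j)) := by
      refine FiniteDimensional.mem_span_of_iInf_ker_le_ker fun x hx => ?_
      obtain ⟨φ, rfl⟩ := Submodule.Quotient.mk_surjective _ x; rw [Submodule.mem_iInf] at hx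
      have : T φ = 0 := (hker φ).mpr fun j => by simpa using hx j
      simp [this]
    obtain ⟨e, he⟩ := Submodule.span_le (p := (LinearMap.range (Dual.eval ℂ E)).comap (ker
      T).mkQ.dualMap).mpr (by
        rintro _ ⟨j, rfl⟩; obtain ⟨e, he⟩ := hb j
        exact ⟨e, LinearMap.ext fun φ => by simpa using (he φ).symm⟩) hk
    exact ⟨e, fun φ => by simpa [T] using (LinearMap.congr_fun he φ).symm⟩
  choose e he using hrep
  refine ⟨fun k => if hk : k ∈ K then e ⟨k, hk⟩ else 0, fun k hk => by simp [hk], fun φ =>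
    ⟨H φ, fun k => ?_, hH φ⟩⟩
  by_cases hk : k ∈ K
  · simpa [hk] using he ⟨k, hk⟩ φ
  · simpa [hk] using hK φ k hk

lemma exists_rep_value {n N : ℕ} {E : Type*} [AddCommGroup E] [Module ℂ E] {F : Dual ℂ E → (Fin n →
    ℂ) → ℂ} (K : Finset (Fin n →₀ ℕ)) {e : (Fin n →₀ ℕ) → E} (h0 : ∀ k ∉ K, e k = 0) (h : ∀ φ, ∃ H :
    MvPolynomial (Fin n) ℂ, (∀ k, H.coeff k = φ (e k)) ∧ ∀ z, Injective z → F φ z * diffProd z ^ N =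
    eval z H) {z : Fin n → ℂ} (hz : Injective z) : ∃ x : E, ∀ φ, F φ z = φ x := by
  refine ⟨(diffProd z ^ N)⁻¹ • ∑ k ∈ K, (∏ i, z i ^ k i) • e k, fun φ => ?_⟩
  obtain ⟨H, hH, hF⟩ := h φ; have hne := pow_ne_zero N (diffProd_ne_zero.mpr hz)
  rw [eq_comm, map_smul, smul_eq_mul, inv_mul_eq_iff_eq_mul₀ hne, mul_comm, hF z hz,
    MvPolynomial.eval_eq', map_sum]
  rw [← Finset.sum_subset (s₁ := H.support) (s₂ := K)]
  · refine sum_congr rfl fun k _ => ?_; rw [map_smul, hH k, smul_eq_mul, mul_comm]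
  · intro k hk; by_contra hk'; rw [MvPolynomial.mem_support_iff, hH, h0 k hk', map_zero] at hk
    exact hk rfl
  · intro k _ hk; rw [MvPolynomial.notMem_support_iff, hH] at hk; rw [map_smul, hk, smul_zero]

end Poly

lemma dualOf_add (c : ℂ) (φ ψ : Dual ℂ (gr c)) : dualOf gr c (φ + ψ) = dualOf gr c φ + dualOf gr c ψ
    := map_add _ _ _

lemma dualOf_smul (c a : ℂ) (φ : Dual ℂ (gr c)) : dualOf gr c (a • φ) = a • dualOf gr c φ := by
  simp only [dualOf, ← DirectSum.lof_eq_of ℂ, map_smul]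

lemma exists_numerator (p : V → V → ℕ) (v : Fin n → V) : ∃ N, ∀ (f : (Fin n → ℂ) → ℂ) (h :
    MvPolynomial (Fin n) ℂ), (∀ z, Injective z → f z * poleProd p v z = eval z h) → ∃ H :
    MvPolynomial (Fin n) ℂ, ∀ z, Injective z → f z * diffProd z ^ N = eval z H := by
  obtain ⟨N, s, hs⟩ := polePoly_dvd p v; refine ⟨N, fun f h hf => ⟨h * s, fun z hz => ?_⟩⟩
  rw [map_mul, ← hf z hz, ← eval_diffPoly, ← map_pow, hs, map_mul, eval_polePoly]; ring

/-- The support of the numerator of a homogeneous rational function. -/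
lemma degree_numerator {F : (Fin n → ℂ) → ℂ} {N : ℕ} {H : MvPolynomial (Fin n) ℂ} {c : ℂ} {d : ℤ}
    (hF : ∀ z, Injective z → F z * diffProd z ^ N = eval z H) (hhom : ∀ (t : ℂ) z, t ≠ 0 → Injective
    z → t ^ c * F z = t ^ d * F (t • z)) {k : Fin n →₀ ℕ} (hk : H.coeff k ≠ 0) : c - k.degree = d -
    (diffDegree n * N : ℕ) := by
  have := degree_of_homogeneous (a := c + (diffDegree n * N : ℕ)) (b := d) (h := H) (fun t ht z hz
    => ?_) hk
  · linear_combination this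
  · have hz' : Injective (t • z) := fun i j hij => hz (by simpa [ht] using hij)
    rw [← hF z hz, ← hF _ hz', diffProd_smul, Complex.cpow_add _ _ ht, Complex.cpow_natCast,
      mul_pow, ← pow_mul]
    linear_combination (t ^ (diffDegree n * N) * diffProd z ^ N) * hhom t z ht hz

lemma exists_degree_finset (n : ℕ) (c : ℂ) (S : Finset ℂ) : ∃ K : Finset (Fin n →₀ ℕ), ∀ k, c -
    (k.degree : ℂ) ∈ S → k ∈ K := by
  classical
  have hfin : {k : Fin n →₀ ℕ | c - (k.degree : ℂ) ∈ S}.Finite := by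
    obtain ⟨B, hB⟩ := exists_nat_gt (∑ s ∈ S, ‖c - s‖)
    refine (Finsupp.finite_of_degree_le B).subset fun k hk => ?_
    have h1 : ‖c - (c - (k.degree : ℂ))‖ ≤ ∑ s ∈ S, ‖c - s‖ := single_le_sum (f := fun s => ‖c - s‖)
      (fun _ _ => norm_nonneg _) hk
    rw [sub_sub_cancel, Complex.norm_natCast] at h1; exact_mod_cast (h1.trans_lt hB).le
  exact ⟨hfin.toFinset, fun k hk => by simpa using hk⟩

lemma exists_support_bound (hΨ : Regular M p Ψ) (v : Fin n → V) : ∃ (N : ℕ) (S : Finset ℂ), ∀ c φ, ∃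
    H : MvPolynomial (Fin n) ℂ, (∀ k, H.coeff k ≠ 0 → c - (k.degree : ℂ) ∈ S) ∧ ∀ z, Injective z →
    cor Ψ (dualOf gr c φ) v z * diffProd z ^ N = eval z H := by
  classical
  induction v using hom_induction grV with
  | hom v d hd =>
    obtain ⟨N, hN⟩ := exists_numerator p v
    refine ⟨N, {((∑ i, d i : ℤ) : ℂ) - (diffDegree n * N : ℕ)}, fun c φ => ?_⟩
    obtain ⟨h, hh⟩ := hΨ.poleBound v (dualOf gr c φ); obtain ⟨H, hH⟩ := hN _ h hh
    exact ⟨H, fun k hk => by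
      rw [Finset.mem_singleton]
      exact degree_numerator hH (fun t z ht hz => hΨ.homogeneous v d hd c φ t z ht hz) hk, hH⟩
  | hadd v i x y hx hy =>
    obtain ⟨N₁, S₁, h₁⟩ := hx; obtain ⟨N₂, S₂, h₂⟩ := hy
    refine ⟨N₁ + N₂, S₁.image (fun s : ℂ => s - ((diffDegree n * N₂ : ℕ) : ℂ)) ∪ S₂.image (fun s : ℂ
      => s - ((diffDegree n * N₁ : ℕ) : ℂ)), fun c φ => ?_⟩
    obtain ⟨H₁, k₁, e₁⟩ := h₁ c φ; obtain ⟨H₂, k₂, e₂⟩ := h₂ c φ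
    have hsupp : ∀ (H : MvPolynomial (Fin n) ℂ) (N : ℕ) (S : Finset ℂ), (∀ k, H.coeff k ≠ 0 → c -
      (k.degree : ℂ) ∈ S) → ∀ k, (H * diffPoly (Fin n) ^ N).coeff k ≠ 0 → c - (k.degree : ℂ) ∈
      S.image (fun s : ℂ => s - ((diffDegree n * N : ℕ) : ℂ)) := by
      intro H N S hS k hk; rw [MvPolynomial.coeff_mul] at hk
      obtain ⟨q, hq, hne⟩ := Finset.exists_ne_zero_of_sum_ne_zero hk
      rw [Finset.HasAntidiagonal.mem_antidiagonal] at hq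
      have h3 := ((isHomogeneous_diffPoly n).pow N) (right_ne_zero_of_mul hne)
      replace h3 : q.2.degree = diffDegree n * N := by
        rw [Finsupp.degree_eq_weight_one (R := ℕ)]; exact h3
      rw [Finset.mem_image]; refine ⟨_, hS q.1 (left_ne_zero_of_mul hne), ?_⟩
      rw [← hq, map_add, ← h3]; push_cast; ring
    refine ⟨H₁ * diffPoly (Fin n) ^ N₂ + H₂ * diffPoly (Fin n) ^ N₁, fun k hk => ?_, fun z hz => ?_⟩
    · rw [MvPolynomial.coeff_add] at hk; rw [Finset.mem_union]
      by_cases h : (H₁ * diffPoly (Fin n) ^ N₂).coeff k = 0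
      · rw [h, zero_add] at hk; exact Or.inr (hsupp _ _ _ k₂ _ hk)
      · exact Or.inl (hsupp _ _ _ k₁ _ h)
    · rw [cor_update_add, map_add, map_mul, map_mul, map_pow, map_pow, eval_diffPoly, ← e₁ z hz, ←
        e₂ z hz]
      ring

lemma exists_diffProd_eq (n : ℕ) : ∃ s : ℂ, s ≠ 0 ∧ ∀ z : Fin n → ℂ, diffProd z = s * ∏ i, ∏ j ∈ Ioi
    i, (z i - z j) ^ 2 := by
  refine ⟨∏ i : Fin n, ∏ j ∈ Ioi i, (-1 : ℂ), ?_, fun z => ?_⟩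
  · exact Finset.prod_ne_zero_iff.mpr fun i _ => Finset.prod_ne_zero_iff.mpr fun j _ => by norm_num
  · have h1 : ∀ i : Fin n, univ.erase i = Iio i ∪ Ioi i := by
      intro i; ext j; simp [lt_or_lt_iff_ne]
    have h2 : ∀ i : Fin n, Disjoint (Iio i) (Ioi i) := fun i => by
      rw [Finset.disjoint_left]; intro j; simp; exact fun h => h.le
    simp only [diffProd, h1, Finset.prod_union (h2 _), prod_mul_distrib]
    have h3 : ∏ i : Fin n, ∏ j ∈ Iio i, (z i - z j) = ∏ i : Fin n, ∏ j ∈ Ioi i, (z j - z i) :=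
      Finset.prod_comm' (by simp)
    rw [h3, ← prod_mul_distrib, ← prod_mul_distrib]; refine prod_congr rfl fun i _ => ?_
    rw [← prod_mul_distrib, ← prod_mul_distrib]; refine prod_congr rfl fun j _ => by ring

lemma Regular.isBarRational (hΨ : Regular M p Ψ) (v : Fin n → V) : IsBarRational gr (Ψ v) := by
  classical
  obtain ⟨N, S, hS⟩ := exists_support_bound hΨ v
  have hrep : ∀ c, ∃ e : (Fin n →₀ ℕ) → gr c, (∀ k, c - (k.degree : ℂ) ∉ S → e k = 0) ∧ ∀ φ, ∃ H :
    MvPolynomial (Fin n) ℂ, (∀ k, H.coeff k = φ (e k)) ∧ ∀ z, Injective z → cor Ψ (dualOf gr c φ) v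
    z * diffProd z ^ N = eval z H := by
    intro c; obtain ⟨K, hK⟩ := exists_degree_finset n c S
    have := exists_rep_coeff (N := N) (F := fun φ z => cor Ψ (dualOf gr c φ) v z) (fun φ ψ z _ => by
      rw [dualOf_add, cor_add_left]) (fun a φ z _ => by rw [dualOf_smul, cor_smul_left])
      (K.filter fun k => c - (k.degree : ℂ) ∈ S) (fun φ => ?_) (J := Conf n)
      (b := fun z => LinearMap.applyₗ (Ψ v z c)) (fun z => ⟨Ψ v z c, fun φ => rfl⟩) (fun φ => ?_)
    · obtain ⟨e, h1, h2⟩ := this; exact ⟨e, fun k hk => h1 k (by simp [hk]), h2⟩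
    · obtain ⟨H, h1, h2⟩ := hS c φ; refine ⟨H, fun k hk => ?_, h2⟩; by_contra hne
      exact hk (Finset.mem_filter.mpr ⟨hK k (h1 k hne), h1 k hne⟩)
    · have h3 : ∀ z (hz : Injective z), cor Ψ (dualOf gr c φ) v z = φ (Ψ v ⟨z, hz⟩ c) := fun z hz =>
        by rw [cor_of_injective _ _ _ hz, barPairing_of]
      constructor
      · intro h z hz; rw [h3 z hz]; exact h ⟨z, hz⟩
      · intro h z; have := h z z.injective; rw [h3 z z.injective] at this; exact this
  choose e he0 he using hrep; obtain ⟨s, hs, hdiff⟩ := exists_diffProd_eq n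
  let g : (Fin n →₀ ℕ) → W := fun k =>
    (s ^ N)⁻¹ • ∑ c ∈ S.image (fun s => s + (k.degree : ℂ)), (e c k : W)
  have hg : ∀ k c φ, pairing gr (dualOf gr c φ) (g k) = (s ^ N)⁻¹ * φ (e c k) := by
    intro k c φ; rw [← pairingL_apply, map_smul, smul_eq_mul, map_sum, sum_eq_single c]
    · rw [pairingL_apply, pairing, barPairing_of, DirectSum.decompose_coe, DirectSum.of_eq_same]
    · intro d _ hd
      rw [pairingL_apply, pairing, barPairing_of, DirectSum.decompose_coe, DirectSum.of_eq_of_ne _ _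
        _ (Ne.symm hd), map_zero]
    · intro hc; rw [he0 c k fun h => hc (Finset.mem_image.mpr ⟨_, h, by ring⟩)]; simp
  refine ⟨fun _ _ => 2 * N, g, fun w' => ?_⟩
  induction w' using gradedDual_induction with
  | h0 => exact ⟨0, fun k => by simp [pairing, barPairing_zero_left], fun z => by
      simp [barPairing_zero_left]⟩
  | hof c φ =>
    obtain ⟨H, h1, h2⟩ := he c φ; refine ⟨(s ^ N)⁻¹ • H, fun k => ?_, fun z => ?_⟩
    · rw [coeff_smul, h1, hg, smul_eq_mul]
    · rw [MvPolynomial.smul_eval, ← h2 z z.injective, hdiff, cor_conf, mul_pow]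
      simp only [pow_mul, prod_pow]; field_simp
  | hadd x y hx hy =>
    obtain ⟨h, h1, h2⟩ := hx; obtain ⟨k, h3, h4⟩ := hy
    refine ⟨h + k, fun l => ?_, fun z => ?_⟩
    · rw [MvPolynomial.coeff_add, h1, h3]; exact (barPairing_add_left _ _ _ _).symm
    · rw [barPairing_add_left, mul_add, h2, h4, map_add]

/-! ## Differentiation of Laurent series -/

lemma zpow_le_add_zpow {r₁ r₂ x : ℝ} (h₁ : 0 < r₁) (h : r₁ ≤ x) (h₂ : x ≤ r₂) (k : ℤ) : x ^ k ≤ r₁ ^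
    k + r₂ ^ k := by
  have hx : 0 < x := h₁.trans_le h; rcases le_or_gt 0 k with hk | hk
  · lift k to ℕ using hk
    simp only [zpow_natCast]; have := pow_le_pow_left₀ hx.le h₂ k
    have : 0 ≤ r₁ ^ k := by positivity
    linarith
  · obtain ⟨m, rfl⟩ : ∃ m : ℕ, k = -m := ⟨k.natAbs, by omega⟩; simp only [zpow_neg, zpow_natCast]
    have := inv_anti₀ (by positivity) (pow_le_pow_left₀ h₁.le h m)
    have : 0 ≤ (r₂ ^ m)⁻¹ := by have := hx.trans_le h₂; positivity
    linarith

lemma hasSum_deriv_laurent {a : ℤ → ℂ} {f : ℂ → ℂ} {r₁ r₂ : ℝ} (h0 : 0 < r₁) (h : ∀ x : ℂ, r₁ ≤ ‖x‖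
    → ‖x‖ ≤ r₂ → HasSum (fun k => a k * x ^ (-k - 1)) (f x)) {x₀ : ℂ} (h₁ : r₁ < ‖x₀‖) (h₂ : ‖x₀‖ <
    r₂) : HasSum (fun k : ℤ => a k * (((-k - 1 : ℤ) : ℂ) * x₀ ^ (-k - 1 - 1))) (deriv f x₀) := by
  have h3 := (h₁.trans h₂); have hr₂ : 0 < r₂ := h0.trans h3
  have hU : IsOpen {x : ℂ | r₁ < ‖x‖ ∧ ‖x‖ < r₂} := (isOpen_lt continuous_const
    continuous_norm).inter (isOpen_lt continuous_norm continuous_const)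
  have hne : ∀ x ∈ {x : ℂ | r₁ < ‖x‖ ∧ ‖x‖ < r₂}, x ≠ 0 := fun x hx h => by
    have := hx.1; rw [h, norm_zero] at this; linarith
  have s1 := (h r₁ (by simp [abs_of_pos h0]) (by simpa [abs_of_pos h0] using h3.le)).summable.norm
  have s2 := (h r₂ (by simpa [abs_of_pos hr₂] using h3.le) (by simp [abs_of_pos hr₂])).summable.norm
  have key := Complex.hasSum_deriv_of_summable_norm (F := fun (k : ℤ) x => a k * x ^ (-k - 1))
    (s1.add s2) (fun k x hx => ?_) hU (fun k x hx => ?_) (z := x₀) ⟨h₁, h₂⟩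
  · have e : deriv (fun w => ∑' k : ℤ, a k * w ^ (-k - 1)) x₀ = deriv f x₀ := by
      refine Filter.EventuallyEq.deriv_eq ?_
      filter_upwards [hU.mem_nhds ⟨h₁, h₂⟩] with x hx
      exact (h x hx.1.le hx.2.le).tsum_eq
    rw [e] at key; refine key.of_eq fun k => ?_; rw [deriv_const_mul_field, deriv_zpow]
  · exact ((differentiableAt_zpow.mpr (Or.inl (hne x hx))).const_mul _).differentiableWithinAt
  · simp only [norm_mul, norm_zpow, Complex.norm_real, Real.norm_of_nonneg h0.le,
      Real.norm_of_nonneg hr₂.le, ← mul_add]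
    exact mul_le_mul_of_nonneg_left (zpow_le_add_zpow h0 hx.1.le hx.2.le _) (norm_nonneg _)

lemma hasSum_deriv_param {a : ℤ → ℂ → ℂ} {f : ℂ → ℂ → ℂ} {r₁ r₂ ε C : ℝ} (h0 : 0 < r₁) (hε : 0 < ε)
    (ha : ∀ k, DifferentiableOn ℂ (a k) (Metric.ball 0 ε)) (h : ∀ s ∈ Metric.ball (0 : ℂ) ε, ∀ x :
    ℂ, r₁ ≤ ‖x‖ → ‖x‖ ≤ r₂ → HasSum (fun k => a k s * x ^ (-k - 1)) (f s x)) (hC : ∀ s ∈ Metric.ball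
    (0 : ℂ) ε, ∀ x : ℂ, r₁ ≤ ‖x‖ → ‖x‖ ≤ r₂ → ‖f s x‖ ≤ C) {x₀ : ℂ} (h₁ : r₁ < ‖x₀‖) (h₂ : ‖x₀‖ <
    r₂) : HasSum (fun k : ℤ => deriv (a k) 0 * x₀ ^ (-k - 1)) (deriv (fun s => f s x₀) 0) := by
  have h3 := h₁.trans h₂; have hx₀ : 0 < ‖x₀‖ := h0.trans h₁; have hr₂ : 0 < r₂ := h0.trans h3
  have hbound : ∀ r, r₁ ≤ r → r ≤ r₂ → ∀ s ∈ Metric.ball (0 : ℂ) ε, ∀ k : ℤ, ‖a k s‖ * r ^ (-k - 1)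
    ≤ C := by
    intro r hr hr' s hs k
    have := norm_coeff_le (h0.trans_le hr) (c := fun k => a (-k - 1) s) (f := f s) (C := C)
      (fun x hx => ?_) (fun x hx => hC s hs x (by rw [hx]; exact hr) (by rw [hx]; exact hr'))
      (-k - 1)
    · simpa using this
    · have h4 := h s hs x (by rw [hx]; exact hr) (by rw [hx]; exact hr')
      let σ : ℤ ≃ ℤ := ⟨fun k => -k - 1, fun k => -k - 1, fun k => by ring, fun k => by ring⟩
      rw [← σ.hasSum_iff] at h4; refine h4.of_eq fun k => ?_; simp [σ]
  let u : ℤ → ℝ := fun k => C * (min ((‖x₀‖ / r₁) ^ (-k - 1)) ((‖x₀‖ / r₂) ^ (-k - 1)))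
  have hu : Summable u := by
    refine Summable.mul_left C ?_; refine Summable.of_nat_of_neg_add_one ?_ ?_
    · refine Summable.of_nonneg_of_le (fun k => by positivity) (fun k => min_le_left _ _) ?_
      have h5 : r₁ / ‖x₀‖ < 1 := (div_lt_one hx₀).mpr h₁
      refine ((summable_geometric_of_lt_one (by positivity) h5).mul_left (r₁ / ‖x₀‖)).congr fun k =>
        ?_
      rw [← inv_div r₁, inv_zpow', ← pow_succ', ← zpow_natCast]; congr 1; push_cast; ring
    · refine Summable.of_nonneg_of_le (fun k => by positivity) (fun k => min_le_right _ _) ?_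
      have h5 : ‖x₀‖ / r₂ < 1 := (div_lt_one hr₂).mpr h₂
      refine (summable_geometric_of_lt_one (by positivity) h5).congr fun k => ?_
      rw [← zpow_natCast]; congr 1; ring
  have key := Complex.hasSum_deriv_of_summable_norm (F := fun (k : ℤ) s => a k s * x₀ ^ (-k - 1)) hu
    (fun k => (ha k).mul_const _) Metric.isOpen_ball (fun k s hs => ?_) (z := 0)
    (Metric.mem_ball_self hε)
  · have e : deriv (fun w => ∑' k : ℤ, a k w * x₀ ^ (-k - 1)) 0 = deriv (fun s => f s x₀) 0 := by
      refine Filter.EventuallyEq.deriv_eq ?_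
      filter_upwards [Metric.isOpen_ball.mem_nhds (Metric.mem_ball_self hε)] with s hs
      exact (h s hs x₀ h₁.le h₂.le).tsum_eq
    rw [e] at key; refine key.of_eq fun k => ?_
    rw [deriv_mul_const ((ha k).differentiableAt (Metric.isOpen_ball.mem_nhds (Metric.mem_ball_self
      hε)))]
  · rw [norm_mul, norm_zpow]; have hC0 : 0 ≤ C := (norm_nonneg _).trans (hC s hs x₀ h₁.le h₂.le)
    have aux : ∀ r, r₁ ≤ r → r ≤ r₂ → ‖a k s‖ * ‖x₀‖ ^ (-k - 1) ≤ C * (‖x₀‖ / r) ^ (-k - 1) := by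
      intro r hr hr'; have hr0 := h0.trans_le hr
      rw [div_zpow, ← mul_div_assoc, le_div_iff₀ (by positivity)]
      nlinarith [hbound r hr hr' s hs k, zpow_pos hx₀ (-k - 1)]
    dsimp only [u]; rw [mul_min_of_nonneg _ _ hC0]
    exact le_min (aux r₁ le_rfl h3.le) (aux r₂ h3.le le_rfl)

/-! ## Existence of faces -/

/-- The coefficients of the series that defines a face. -/
def faceTerm (M : Bimodule A gr) (κ : FaceKind n) (Ψ : Cochain V gr n) (k : ℤ) (u : V)
    (v : Fin n → V) (w' : GradedDual gr) (y : Fin n → ℂ) : ℂ :=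
  cor Ψ (κ.wT M k u w') (κ.vT A k u v) y

variable (M κ Ψ)

lemma adj_smul {L : W →ₗ[ℂ] W} (h : L ∈ FinOp gr) (a : ℂ) (x : GradedDual gr) : adj L (a • x) = a •
    adj L x :=
  gradedDual_ext fun z => by simp only [barPairing_adj h, barPairing_smul_left]

lemma faceTerm_lin_left (k : ℤ) (u : V) (v : Fin n → V) (a b : ℂ) (w₁ w₂ : GradedDual gr) (y : Fin n
    → ℂ) : faceTerm M κ Ψ k u v (a • w₁ + b • w₂) y = a * faceTerm M κ Ψ k u v w₁ y + b * faceTerm M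
    κ Ψ k u v w₂ y := by
  cases κ <;> simp only [faceTerm, wT, adj_add (M.YL_mem_finOp _ _), adj_smul (M.YL_mem_finOp _ _),
    adj_add (M.YS_mem_finOp _ _), adj_smul (M.YS_mem_finOp _ _), cor_add_left, cor_smul_left]

lemma faceTerm_lin_op (k : ℤ) (a b : ℂ) (u₁ u₂ : V) (v : Fin n → V) (w' : GradedDual gr) (y : Fin n
    → ℂ) : faceTerm M κ Ψ k (a • u₁ + b • u₂) v w' y = a * faceTerm M κ Ψ k u₁ v w' y + b * faceTerm
    M κ Ψ k u₂ v w' y := by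
  have hL := fun u => M.YL_mem_finOp k u
  have hS := fun u => M.YS_mem_finOp k u
  cases κ <;> simp only [faceTerm, wT, vT, map_add, map_smul, LinearMap.add_apply,
    LinearMap.smul_apply, cor_update_add, cor_update_smul, cor_add_left, cor_smul_left,
    adj_add_op (Submodule.smul_mem _ a (hL u₁)) (Submodule.smul_mem _ b (hL u₂)),
    adj_add_op (Submodule.smul_mem _ a (hS u₁)) (Submodule.smul_mem _ b (hS u₂)),
    adj_smul_op (hL _), adj_smul_op (hS _)]

lemma FaceKind.vT_update (κ : FaceKind n) (k : ℤ) (u : V) (v : Fin n → V) (j : Fin n) : ∃ f : V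
    →ₗ[ℂ] V, ∀ x, κ.vT A k u (update v j x) = update (κ.vT A k u v) j (f x) := by
  cases κ with
  | left | right => exact ⟨LinearMap.id, fun x => rfl⟩
  | mid i =>
    by_cases h : j = i
    · subst h; exact ⟨A.Y k u, fun x => by simp [vT]⟩
    · exact ⟨LinearMap.id, fun x => by
        simp only [vT, LinearMap.id_apply]; rw [update_of_ne (Ne.symm h), update_comm h]⟩

lemma faceTerm_lin_update (k : ℤ) (u : V) (v : Fin n → V) (j : Fin n) (a b : ℂ) (x x' : V) (w' :
    GradedDual gr) (y : Fin n → ℂ) : faceTerm M κ Ψ k u (update v j (a • x + b • x')) w' y = a *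
    faceTerm M κ Ψ k u (update v j x) w' y + b * faceTerm M κ Ψ k u (update v j x') w' y := by
  obtain ⟨f, hf⟩ := κ.vT_update (A := A) k u v j
  simp only [faceTerm, hf, map_add, map_smul, cor_update_add, cor_update_smul]

lemma MOSVA.D_Y (A : MOSVA grV) (k : ℤ) (u v : V) : A.D (A.Y k u v) = A.Y k (A.D u) v + A.Y k u (A.D
    v) := by
  have h1 := A.D_comm k u v; have h2 := A.D_deriv k u v; rw [h2, eq_sub_iff_add_eq] at h1
  exact h1.symm

lemma Bimodule.D_comp_YL (M : Bimodule A gr) (k : ℤ) (u : V) : M.D ∘ₗ M.YL k u = M.YL k u ∘ₗ M.D +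
    M.YL k (A.D u) := by
  ext w; have h1 := M.left_D_comm k u w; rw [M.left_D_deriv, eq_sub_iff_add_eq] at h1
  simp only [LinearMap.comp_apply, LinearMap.add_apply, ← h1]; abel

lemma Bimodule.D_comp_YSL (M : Bimodule A gr) (k : ℤ) (u : V) : M.D ∘ₗ M.YSL k u = M.YSL k u ∘ₗ M.D
    + M.YSL k (A.D u) := by
  ext w; have h1 := M.YS_D_comm k u w; rw [sub_eq_iff_eq_add] at h1
  simp only [LinearMap.comp_apply, LinearMap.add_apply, M.YSL_apply, h1]; abel

lemma faceTerm_D (k : ℤ) (u : V) (v : Fin n → V) (w' : GradedDual gr) (y : Fin n → ℂ) : faceTerm M κ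
    Ψ k (A.D u) v w' y = -(k : ℂ) * faceTerm M κ Ψ (k - 1) u v w' y := by
  cases κ with
  | left =>
    have h : M.YL k (A.D u) = (-(k : ℂ)) • M.YL (k - 1) u := by
      ext w; exact (M.left_D_deriv k u w).symm
    simp only [faceTerm, wT, vT, h, adj_smul_op (M.YL_mem_finOp _ _), cor_smul_left]
  | right =>
    have h : M.YSL k (A.D u) = (-(k : ℂ)) • M.YSL (k - 1) u := by
      ext w; exact (M.YS_D_deriv k u w).symm
    simp only [faceTerm, wT, vT, h, adj_smul_op (M.YS_mem_finOp _ _), cor_smul_left]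
  | mid i =>
    have h : A.Y k (A.D u) (v i) = (-(k : ℂ)) • A.Y (k - 1) u (v i) := (A.D_deriv k u (v i)).symm
    simp only [faceTerm, wT, vT, h, cor_update_smul]

variable {M κ Ψ}

lemma faceTerm_adj_D (hΨ : Regular M p Ψ) (k : ℤ) (u : V) (v : Fin n → V) (w' : GradedDual gr) {y :
    Fin n → ℂ} (hy : Injective y) : faceTerm M κ Ψ k u v (adj M.D w') y = faceTerm M κ Ψ k (A.D u) v
    w' y + ∑ j, faceTerm M κ Ψ k u (update v j (A.D (v j))) w' y := by
  cases κ with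
  | left =>
    simp only [faceTerm, wT, vT]
    rw [← adj_comp M.D_mem_finOp (M.YL_mem_finOp _ _), M.D_comp_YL, adj_add_op (FinOp.comp
      (M.YL_mem_finOp _ _) M.D_mem_finOp) (M.YL_mem_finOp _ _), cor_add_left, adj_comp
      (M.YL_mem_finOp _ _) M.D_mem_finOp, hΨ.sum_D v _ y hy, add_comm]
  | right =>
    simp only [faceTerm, wT, vT]
    rw [← adj_comp M.D_mem_finOp (M.YS_mem_finOp _ _), M.D_comp_YSL, adj_add_op (FinOp.comp
      (M.YS_mem_finOp _ _) M.D_mem_finOp) (M.YS_mem_finOp _ _), cor_add_left, adj_comp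
      (M.YS_mem_finOp _ _) M.D_mem_finOp, hΨ.sum_D v _ y hy, add_comm]
  | mid i =>
    simp only [faceTerm, wT, vT]
    rw [hΨ.sum_D _ _ y hy, ← add_sum_erase _ _ (mem_univ i), ← add_sum_erase (a := i) _ (fun j =>
      cor Ψ w' (update (update v j (A.D (v j))) i (A.Y k u (update v j (A.D (v j)) i))) y) (mem_univ
      i), ← add_assoc]
    congr 1
    · simp only [update_self, update_idem, A.D_Y, cor_update_add]
    · refine sum_congr rfl fun j hj => ?_; have hj := ne_of_mem_erase hj
      rw [update_of_ne hj, update_of_ne (Ne.symm hj), update_comm hj]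

/-- The derivative of the coefficients, where the center of the expansion may move. -/
lemma hasDerivAt_faceTerm (hΨ : Regular M p Ψ) (k : ℤ) (u : V) (v : Fin n → V) (w' : GradedDual gr)
    {y : Fin n → ℂ} (hy : Injective y) (j : Fin n) : HasDerivAt (fun t => faceTerm M κ Ψ k u v w'
    (update y j t)) (faceTerm M κ Ψ k u (update v j (A.D (v j))) w' y + if κ.ctr (single j 1) = 0
    then 0 else faceTerm M κ Ψ k (A.D u) v w' y) (y j) := by
  refine (hΨ.hasDerivAt j (κ.vT A k u v) (κ.wT M k u w') y hy).congr_deriv ?_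
  cases κ with
  | left | right => simp [faceTerm, ctr, vT]
  | mid i =>
    by_cases h : j = i
    · subst h
      simp only [faceTerm, ctr, vT, wT, Pi.single_eq_same, one_ne_zero, if_false, update_self,
        update_idem, A.D_Y, cor_update_add]
      rw [add_comm]
    · simp only [faceTerm, ctr, vT, wT, Pi.single_eq_of_ne (Ne.symm h), if_true, add_zero]
      rw [update_of_ne h, update_of_ne (Ne.symm h), update_comm h]

lemma faceTerm_homogeneous (hΨ : Regular M p Ψ) {u : V} {v : Fin n → V} {e : ℤ} {d : Fin n → ℤ} (hu
    : u ∈ grV e) (hv : ∀ i, v i ∈ grV (d i)) (c : ℂ) (φ : Dual ℂ (gr c)) {t : ℂ} (ht : t ≠ 0) {y :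
    Fin n → ℂ} (hy : Injective y) (k : ℤ) : t ^ c * faceTerm M κ Ψ k u v (dualOf gr c φ) y = t ^ (e
    + ∑ i, d i) * (t ^ (-k - 1) * faceTerm M κ Ψ k u v (dualOf gr c φ) (t • y)) := by
  have hout : ∀ L : W →ₗ[ℂ] W, HomOp gr (e - k - 1) L → t ^ c * cor Ψ (adj L (dualOf gr c φ)) v y =
    t ^ (e + ∑ i, d i) * (t ^ (-k - 1) * cor Ψ (adj L (dualOf gr c φ)) v (t • y)) := by
    intro L hL; obtain ⟨ψ, hψ⟩ := hL.adj_of c φ; have h1 := hΨ.homogeneous v d hv _ ψ t y ht hy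
    rw [dualOf, hψ]
    have h2 : t ^ c = t ^ (e - k - 1) * t ^ (c - ((e : ℂ) - k - 1)) := by
      rw [← Complex.cpow_intCast, ← Complex.cpow_add _ _ ht]; congr 1; push_cast; ring
    rw [h2, mul_assoc, h1, ← mul_assoc, ← mul_assoc, ← zpow_add₀ ht, ← zpow_add₀ ht]; congr 2; ring
  cases κ with
  | left => exact hout _ (M.homOp_YL hu)
  | right => exact hout _ (M.homOp_YS hu)
  | mid i =>
    simp only [faceTerm, wT, vT]
    have hv' : ∀ j, update v i (A.Y k u (v i)) j ∈ grV (update d i (d i + (e - k - 1)) j) := by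
      intro j
      by_cases h : j = i
      · subst h; simpa using A.Y_mem hu (hv j)
      · simpa [h] using hv j
    rw [hΨ.homogeneous _ _ hv' c φ t y ht hy, ← mul_assoc, ← zpow_add₀ ht]; congr 2
    rw [Finset.sum_update_of_mem (mem_univ i), ← add_sum_erase _ d (mem_univ i),
      Finset.sdiff_singleton_eq_erase]
    ring

lemma faceTerm_rep (k : ℤ) (u : V) (v : Fin n → V) (c : ℂ) (y : Fin n → ℂ) : ∃ x : gr c, ∀ φ,
    faceTerm M κ Ψ k u v (dualOf gr c φ) y = φ x := by
  have hout : ∀ L : W →ₗ[ℂ] W, L ∈ FinOp gr → ∃ x : gr c, ∀ φ, cor Ψ (adj L (dualOf gr c φ)) v y = φ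
    x := fun L hL =>
    ⟨_, fun φ => by rw [cor_adj _ hL, barPairing_of]⟩
  cases κ with
  | left => exact hout _ (M.YL_mem_finOp k u)
  | right => exact hout _ (M.YS_mem_finOp k u)
  | mid i => exact ⟨_, fun φ => by simp only [faceTerm, wT]; rw [cor, barPairing_of]⟩

lemma faceTerm_mem_regOff (hΨ : Regular M p Ψ) (k : ℤ) (u : V) (v : Fin n → V) (w' : GradedDual gr)
    : faceTerm M κ Ψ k u v w' ∈ RatFun n :=
  hΨ.mem_regOff _ _

lemma FaceKind.reg_smul (κ : FaceKind n) {s t : ℂ} {y : Fin n → ℂ} (hs : s ≠ 0) (h : κ.Reg t y) :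
    κ.Reg (s * t) (s • y) := by
  have hs' := norm_pos_iff.mpr hs
  cases κ with
  | left | right => exact ⟨mul_ne_zero hs h.1, fun j => by simpa [norm_mul, hs'] using h.2 j⟩
  | mid i => exact ⟨by simpa [hs] using h.1, fun j hj => by
      simpa [← mul_sub, norm_mul, hs'] using h.2 j hj⟩

lemma FaceKind.ctr_smul (κ : FaceKind n) (s : ℂ) (y : Fin n → ℂ) : κ.ctr (s • y) = s * κ.ctr y := by
  cases κ <;> simp [ctr]

lemma smul_ins (q : Fin (n + 1)) (s t : ℂ) (y : Fin n → ℂ) : s • ins q t y = ins q (s * t) (s • y)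
    := by
  ext i; refine succAboveCases q ?_ (fun i => ?_) i <;> simp

lemma RegOff.comp_smul {f : (Fin n → ℂ) → ℂ} (hf : f ∈ RatFun n) {s : ℂ} (hs : s ≠ 0) : (fun z => f
    (s • z)) ∈ RatFun n := by
  obtain ⟨N, h, hf⟩ := hf; refine ⟨N, ((s ^ diffDegree n) ^ N)⁻¹ • scalePoly s h, fun z hz => ?_⟩
  have hz' : eval (s • z) (diffPoly (Fin n)) ≠ 0 := by
    rw [eval_diffPoly] at hz ⊢; rw [diffProd_smul]; positivity
  rw [MvPolynomial.smul_eval, eval_scalePoly, ← hf _ hz', eval_diffPoly, eval_diffPoly,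
    diffProd_smul, mul_pow]
  field_simp

lemma FaceKind.ctr_update (κ : FaceKind n) (y : Fin n → ℂ) (j : Fin n) (s : ℂ) : κ.ctr (update y j
    (y j + s)) = κ.ctr y + s * κ.ctr (single j 1) := by
  cases κ with
  | left | right => simp [ctr]
  | mid i =>
    by_cases h : i = j
    · subst h; simp [ctr]
    · simp [ctr, h]

lemma FaceKind.ctr_single (κ : FaceKind n) (j : Fin n) : κ.ctr (single j 1) = 0 ∨ κ.ctr (single j 1)
    = 1 := by
  cases κ with
  | left | right => simp [ctr]
  | mid i =>
    by_cases h : i = j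
    · subst h; simp [ctr]
    · simp [ctr, h]

/-- The functions `S v w'` are rational and are the sums of the series that define a face. -/
structure ScalarFace (M : Bimodule A gr) (κ : FaceKind n) (Ψ : Cochain V gr n) (p : V → V → ℕ)
    (S : (Fin (n + 1) → V) → GradedDual gr → (Fin (n + 1) → ℂ) → ℂ) : Prop where
  poleBound : ∀ v w', ∃ h : MvPolynomial (Fin (n + 1)) ℂ, ∀ z, Injective z → S v w' z * poleProd p v
    z = eval z h
  hasSum : ∀ u v w' t y, Injective y → κ.Reg t y → HasSum (fun k => faceTerm M κ Ψ k u v w' y * (t -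
    κ.ctr y) ^ (-k - 1)) (S (ins κ.pos u v) w' (ins κ.pos t y))

variable {S : (Fin (n + 1) → V) → GradedDual gr → (Fin (n + 1) → ℂ) → ℂ}

lemma ScalarFace.mem_regOff (hS : ScalarFace M κ Ψ p S) (v : Fin (n + 1) → V) (w' : GradedDual gr) :
    S v w' ∈ RatFun (n + 1) := by
  obtain ⟨h, hh⟩ := hS.poleBound v w'; exact poleProd_mem_regOff p v hh

lemma ScalarFace.lin (hS : ScalarFace M κ Ψ p S) {v v₁ v₂ : Fin (n + 1) → V} {a b : ℂ} {w' w₁ w₂ :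
    GradedDual gr} (h : ∀ k y, faceTerm M κ Ψ k (v κ.pos) (fun j => v (κ.pos.succAbove j)) w' y = a
    * faceTerm M κ Ψ k (v₁ κ.pos) (fun j => v₁ (κ.pos.succAbove j)) w₁ y + b * faceTerm M κ Ψ k (v₂
    κ.pos) (fun j => v₂ (κ.pos.succAbove j)) w₂ y) {z : Fin (n + 1) → ℂ} (hz : Injective z) : S v w'
    z = a * S v₁ w₁ z + b * S v₂ w₂ z := by
  refine κ.eq_of_reg (hS.mem_regOff v _) (add_mem (Subalgebra.smul_mem _ (hS.mem_regOff v₁ w₁) a)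
    (Subalgebra.smul_mem _ (hS.mem_regOff v₂ w₂) b)) (fun t y hy ht => ?_) hz
  have h1 := fun v : Fin (n + 1) → V => fun w' =>
    hS.hasSum (v κ.pos) (fun j => v (κ.pos.succAbove j)) w' t y hy ht
  simp only [ins_self] at h1
  refine (h1 v w').unique ((((h1 v₁ w₁).mul_left a).add ((h1 v₂ w₂).mul_left b)).of_eq fun k => ?_)
  rw [h]; ring

lemma ScalarFace.lin_left (hS : ScalarFace M κ Ψ p S) (v : Fin (n + 1) → V) (a b : ℂ) (w₁ w₂ :
    GradedDual gr) {z : Fin (n + 1) → ℂ} (hz : Injective z) : S v (a • w₁ + b • w₂) z = a * S v w₁ z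
    + b * S v w₂ z :=
  hS.lin (fun _ _ => faceTerm_lin_left ..) hz

lemma ScalarFace.lin_update (hS : ScalarFace M κ Ψ p S) (v : Fin (n + 1) → V) (i : Fin (n + 1)) (a b
    : ℂ) (x x' : V) (w' : GradedDual gr) {z : Fin (n + 1) → ℂ} (hz : Injective z) : S (update v i (a
    • x + b • x')) w' z = a * S (update v i x) w' z + b * S (update v i x') w' z := by
  refine hS.lin (fun k y => ?_) hz
  rw [← ins_self κ.pos v]; refine succAboveCases κ.pos ?_ (fun j => ?_) i
  · simp [faceTerm_lin_op]
  · simp [update_ins_succAbove, faceTerm_lin_update]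

lemma ScalarFace.homogeneous (hS : ScalarFace M κ Ψ p S) (hΨ : Regular M p Ψ) (v : Fin (n + 1) → V)
    (d : Fin (n + 1) → ℤ) (hv : ∀ i, v i ∈ grV (d i)) (c : ℂ) (φ : Dual ℂ (gr c)) (s : ℂ) (z : Fin
    (n + 1) → ℂ) (hs : s ≠ 0) (hz : Injective z) : s ^ c * S v (dualOf gr c φ) z = s ^ (∑ i, d i) *
    S v (dualOf gr c φ) (s • z) := by
  refine κ.eq_of_reg (F := fun z => s ^ c * S v (dualOf gr c φ) z) (G := fun z => s ^ (∑ i, d i) * S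
    v (dualOf gr c φ) (s • z)) (Subalgebra.smul_mem _ (hS.mem_regOff _ _) _) (Subalgebra.smul_mem _
    (RegOff.comp_smul (hS.mem_regOff _ _) hs) _) (fun t y hy ht => ?_) hz
  rw [← ins_self κ.pos v, smul_ins]
  have hsy : Injective (s • y) := fun i j hij => hy (by simpa [hs] using hij)
  refine ((hS.hasSum _ _ _ t y hy ht).mul_left _).unique ?_
  refine ((hS.hasSum _ _ (dualOf gr c φ) (s * t) (s • y) hsy (κ.reg_smul hs ht)).mul_left _).of_eq
    fun k => ?_
  rw [κ.ctr_smul, ← mul_sub, mul_zpow, ← mul_assoc (s ^ c), faceTerm_homogeneous hΨ (hv κ.pos) (fun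
    j => hv (κ.pos.succAbove j)) c φ hs hy k, sum_univ_succAbove d κ.pos]
  ring

lemma ScalarFace.eq_zero_iff (hS : ScalarFace M κ Ψ p S) (u : V) (v : Fin n → V) (w' : GradedDual
    gr) : (∀ q : ℤ × Conf n, faceTerm M κ Ψ q.1 u v w' q.2 = 0) ↔ ∀ z, Injective z → S (ins κ.pos u
    v) w' z = 0 := by
  constructor
  · intro h z hz
    refine κ.eq_of_reg (G := 0) (hS.mem_regOff _ _) (zero_mem _) (fun t y hy ht => ?_) hz
    refine (hS.hasSum u v w' t y hy ht).unique ?_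
    refine HasSum.of_eq (f := fun _ => 0) hasSum_zero fun k => ?_
    rw [show faceTerm M κ Ψ k u v w' y = 0 from h (k, ⟨y, hy⟩), zero_mul]
  · rintro h ⟨k, y⟩; obtain ⟨ρ, hρ, h1⟩ := κ.exists_circle y.injective; have h2 := h1.self_of_nhds
    refine congrFun (independent_zpow_neg hρ (fun k => faceTerm M κ Ψ k u v w' y) fun x hx => ?_) k
    have h3 := hS.hasSum u v w' _ _ y.injective (h2 x hx)
    rwa [h _ ((h2 x hx).injective y.injective), add_sub_cancel_left] at h3

lemma ScalarFace.exists_value (hS : ScalarFace M κ Ψ p S) (hΨ : Regular M p Ψ) (v : Fin (n + 1) → V)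
    (c : ℂ) {z : Fin (n + 1) → ℂ} (hz : Injective z) : ∃ x : gr c, ∀ φ, S v (dualOf gr c φ) z = φ x
    := by
  induction v using hom_induction grV with
  | hom v d hv =>
    obtain ⟨N, hN⟩ := exists_numerator p v
    obtain ⟨K, hK⟩ := exists_degree_finset (n + 1) c {((∑ i, d i : ℤ) : ℂ) - (diffDegree (n + 1) * N
      : ℕ)}
    have hl := fun (q : ℤ × Conf n) a b φ ψ => faceTerm_lin_left M Ψ κ q.1 (v κ.pos) (fun j => v
      (κ.pos.succAbove j)) a b (dualOf gr c φ) (dualOf gr c ψ) q.2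
    obtain ⟨e, he0, he⟩ := exists_rep_coeff (N := N) (F := fun φ z => S v (dualOf gr c φ) z) (fun φ
      ψ z hz => by simpa [dualOf_add] using hS.lin_left v 1 1 (dualOf gr c φ) _ hz) (fun a φ z hz =>
      by simpa [dualOf_smul] using hS.lin_left v a 0 (dualOf gr c φ) 0 hz) K (fun φ => by
        obtain ⟨h, hh⟩ := hS.poleBound v (dualOf gr c φ); obtain ⟨H, hH⟩ := hN _ h hh
        refine ⟨H, fun k hk => ?_, hH⟩; by_contra hne
        exact hk (hK k (Finset.mem_singleton.mpr (degree_numerator hH (fun t z ht hz =>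
          hS.homogeneous hΨ v d hv c φ t z ht hz) hne))))
      (J := ℤ × Conf n)
      (b := fun q =>
        { toFun := fun φ => faceTerm M κ Ψ q.1 (v κ.pos) (fun j => v (κ.pos.succAbove j))
            (dualOf gr c φ) q.2
          map_add' := fun φ ψ => by simpa [dualOf_add] using hl q 1 1 φ ψ
          map_smul' := fun a φ => by simpa [dualOf_smul] using hl q a 0 φ 0 })
      (fun q => faceTerm_rep _ _ _ _ _)
      (fun φ => by
        have := hS.eq_zero_iff (v κ.pos) (fun j => v (κ.pos.succAbove j)) (dualOf gr c φ)
        rwa [ins_self] at this)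
    exact exists_rep_value K he0 he hz
  | hadd v i a b ha hb =>
    obtain ⟨x, hx⟩ := ha; obtain ⟨y, hy⟩ := hb
    exact ⟨x + y, fun φ => by simpa [hx, hy] using hS.lin_update v i 1 1 a b (dualOf gr c φ) hz⟩

lemma ScalarFace.sum_D (hS : ScalarFace M κ Ψ p S) (hΨ : Regular M p Ψ) (v : Fin (n + 1) → V) (w' :
    GradedDual gr) {z : Fin (n + 1) → ℂ} (hz : Injective z) : S v (adj M.D w') z = ∑ i, S (update v
    i (A.D (v i))) w' z := by
  refine κ.eq_of_reg (G := fun z => ∑ i, S (update v i (A.D (v i))) w' z) (hS.mem_regOff _ _) ?_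
    (fun t y hy ht => ?_) hz
  · have : (fun z => ∑ i, S (update v i (A.D (v i))) w' z) = ∑ i, S (update v i (A.D (v i))) w' :=
      by
      funext z; rw [Finset.sum_apply]
    rw [this]; exact sum_mem fun i _ => hS.mem_regOff _ _
  · rw [← ins_self κ.pos v]; refine (hS.hasSum _ _ _ t y hy ht).unique ?_
    rw [sum_univ_succAbove _ κ.pos]
    simp only [update_ins_self, update_ins_succAbove, insertNth_apply_same,
      insertNth_apply_succAbove]
    refine ((hS.hasSum _ _ w' t y hy ht).add (hasSum_sum fun j (_ : j ∈ univ) => hS.hasSum (v κ.pos)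
      (update (fun j => v (κ.pos.succAbove j)) j (A.D (v (κ.pos.succAbove j)))) w' t y hy ht)).of_eq
      fun k => ?_
    rw [faceTerm_adj_D hΨ _ _ _ _ hy, add_mul, sum_mul]

lemma deriv_line_pos (hS : ScalarFace M κ Ψ p S) (u : V) (v : Fin n → V) (w' : GradedDual gr) {t :
    ℂ} {y : Fin n → ℂ} (hy : Injective y) (ht : κ.Reg t y) : deriv (fun s => S (ins κ.pos u v) w'
    (ins κ.pos (t + s) y)) 0 = S (ins κ.pos (A.D u) v) w' (ins κ.pos t y) := by
  obtain ⟨r₁, r₂, h0, h1, h2, h3⟩ := κ.exists_annulus ht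
  have h4 := hasSum_deriv_laurent (a := fun k => faceTerm M κ Ψ k u v w' y) (f := fun x => S (ins
    κ.pos u v) w' (ins κ.pos (κ.ctr y + x) y)) h0 (fun x hx hx' => by
      have := hS.hasSum u v w' _ y hy (h3.self_of_nhds x hx hx')
      rwa [add_sub_cancel_left] at this) h1 h2
  have h5 : deriv (fun x => S (ins κ.pos u v) w' (ins κ.pos (κ.ctr y + x) y)) (t - κ.ctr y) = deriv
    (fun s => S (ins κ.pos u v) w' (ins κ.pos (t + s) y)) 0 := by
    rw [← zero_add (t - κ.ctr y), ← deriv_comp_add_const]; congr 1; funext s; congr 2; ring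
  rw [h5] at h4; refine h4.unique ?_; have h6 := hS.hasSum (A.D u) v w' t y hy ht
  rw [← (Equiv.addRight (1 : ℤ)).hasSum_iff] at h6; refine h6.of_eq fun k => ?_
  simp only [comp, Equiv.coe_addRight, faceTerm_D, add_sub_cancel_right]
  rw [show -(k + 1) - 1 = -k - 1 - 1 by ring]; push_cast; ring

lemma deriv_line_succAbove (hS : ScalarFace M κ Ψ p S) (hΨ : Regular M p Ψ) (u : V) (v : Fin n → V)
    (w' : GradedDual gr) {t : ℂ} {y : Fin n → ℂ} (hy : Injective y) (ht : κ.Reg t y) (j : Fin n) :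
    deriv (fun s => S (ins κ.pos u v) w' (ins κ.pos (t + s * κ.ctr (single j 1)) (update y j (y j +
    s)))) 0 = S (ins κ.pos u (update v j (A.D (v j)))) w' (ins κ.pos t y) + κ.ctr (single j 1) * S
    (ins κ.pos (A.D u) v) w' (ins κ.pos t y) := by
  obtain ⟨r₁, r₂, h0, h1, h2, h3⟩ := κ.exists_annulus ht
  have hcont : ContinuousAt (fun s : ℂ => update y j (y j + s)) 0 := by
    refine ContinuousAt.update continuousAt_const j (by fun_prop)
  have h4 : ∀ᶠ s : ℂ in 𝓝 0, Injective (update y j (y j + s)) ∧ ∀ x : ℂ, r₁ ≤ ‖x‖ → ‖x‖ ≤ r₂ → κ.Reg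
    (κ.ctr (update y j (y j + s)) + x) (update y j (y j + s)) := by
    have h7 := (eventually_injective hy).and h3; rw [← update_eq_self j y, ← add_zero (y j)] at h7
    simpa using hcont.eventually h7
  obtain ⟨ε', hε', h5⟩ := Metric.eventually_nhds_iff_ball.mp h4
  obtain ⟨ε, hε, hεε'⟩ := exists_between hε'
  have h6 : ∀ s ∈ Metric.closedBall (0 : ℂ) ε, s ∈ Metric.ball (0 : ℂ) ε' := fun s hs =>
    Metric.closedBall_subset_ball hεε' hs
  set f : ℂ → ℂ → ℂ := fun s x => S (ins κ.pos u v) w' (ins κ.pos (κ.ctr (update y j (y j + s)) + x)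
    (update y j (y j + s))) with hf
  have hbd : ∃ C, ∀ s ∈ Metric.ball (0 : ℂ) ε, ∀ x : ℂ, r₁ ≤ ‖x‖ → ‖x‖ ≤ r₂ → ‖f s x‖ ≤ C := by
    obtain ⟨N, h, hh⟩ := hS.mem_regOff (ins κ.pos u v) w'
    set P : ℂ × ℂ → Fin (n + 1) → ℂ := fun q => ins κ.pos (κ.ctr (update y j (y j + q.1)) + q.2)
      (update y j (y j + q.1)) with hP
    have hPc : Continuous P := by
      refine Continuous.finInsertNth κ.pos ?_ (Continuous.update continuous_const j (by fun_prop))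
      simp only [κ.ctr_update]
      fun_prop
    have hK : IsCompact (Metric.closedBall (0 : ℂ) ε ×ˢ (Metric.closedBall (0 : ℂ) r₂ ∩ {x | r₁ ≤
      ‖x‖})) := (isCompact_closedBall _ _).prod ((isCompact_closedBall _ _).inter_right (isClosed_le
      continuous_const continuous_norm))
    have hne : ∀ q ∈ Metric.closedBall (0 : ℂ) ε ×ˢ (Metric.closedBall (0 : ℂ) r₂ ∩ {x | r₁ ≤ ‖x‖}),
      eval (P q) (diffPoly (Fin (n + 1))) ≠ 0 := by
      rintro ⟨s, x⟩ ⟨hs, hx, hx'⟩; have h7 := h5 s (h6 s hs)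
      exact eval_diffPoly_ne.mpr ((h7.2 x hx' (by simpa using hx)).injective h7.1)
    obtain ⟨C, hC⟩ := hK.exists_bound_of_continuousOn (f := fun q =>
      eval (P q) h / eval (P q) (diffPoly (Fin (n + 1))) ^ N)
      (ContinuousOn.div (((continuous_eval h).comp hPc).continuousOn) ((((continuous_eval _).comp
        hPc).pow N).continuousOn) fun q hq => pow_ne_zero _ (hne q hq))
    refine ⟨C, fun s hs x hx hx' => ?_⟩
    have hq : (s, x) ∈ Metric.closedBall (0 : ℂ) ε ×ˢ (Metric.closedBall (0 : ℂ) r₂ ∩ {x | r₁ ≤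
      ‖x‖}) := ⟨Metric.ball_subset_closedBall hs, by simpa using hx', hx⟩
    have h8 := hC (s, x) hq
    rw [← hh _ (hne _ hq), mul_div_cancel_right₀ _ (pow_ne_zero _ (hne _ hq))] at h8; exact h8
  obtain ⟨C, hC⟩ := hbd
  have hder : ∀ (k : ℤ) (s : ℂ), s ∈ Metric.ball (0 : ℂ) ε → DifferentiableAt ℂ (fun s => faceTerm M
    κ Ψ k u v w' (update y j (y j + s))) s := by
    intro k s hs; have h7 := h5 s (h6 s (Metric.ball_subset_closedBall hs))
    have h8 := (hasDerivAt_faceTerm (κ := κ) hΨ k u v w' h7.1 j).differentiableAt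
    simp only [update_idem, update_self] at h8
    exact DifferentiableAt.comp (f := fun s => y j + s) (g := fun t => faceTerm M κ Ψ k u v w'
      (update y j t)) s h8 (by fun_prop)
  have h9 := hasSum_deriv_param (a := fun k s =>
    faceTerm M κ Ψ k u v w' (update y j (y j + s))) (f := f) h0 hε
    (fun k s hs => (hder k s hs).differentiableWithinAt) (fun s hs x hx hx' => by
      have h7 := h5 s (h6 s (Metric.ball_subset_closedBall hs))
      have := hS.hasSum u v w' _ _ h7.1 (h7.2 x hx hx'); rwa [add_sub_cancel_left] at this) hC h1 h2
  have h10 : (fun s => f s (t - κ.ctr y)) = fun s => S (ins κ.pos u v) w' (ins κ.pos (t + s * κ.ctr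
    (single j 1)) (update y j (y j + s))) := by
    funext s; simp only [hf, κ.ctr_update]; congr 2; ring
  rw [h10] at h9; refine h9.unique ?_
  refine ((hS.hasSum u (update v j (A.D (v j))) w' t y hy ht).add ((hS.hasSum (A.D u) v w' t y hy
    ht).mul_left (κ.ctr (single j 1)))).of_eq fun k => ?_
  have h11 : deriv (fun s => faceTerm M κ Ψ k u v w' (update y j (y j + s))) 0 = faceTerm M κ Ψ k u
    (update v j (A.D (v j))) w' y + if κ.ctr (single j 1) = 0 then 0 else faceTerm M κ Ψ k (A.D u) v
    w' y := by
    have h12 := (hasDerivAt_faceTerm (κ := κ) hΨ k u v w' hy j).deriv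
    rw [← h12, deriv_comp_const_add (f := fun t => faceTerm M κ Ψ k u v w' (update y j t)),
      add_zero]
  rw [h11]; rcases κ.ctr_single j with h | h
  · simp [h]
  · simp [h]; ring

lemma ins_same {X : Type*} (q : Fin (n + 1)) (x : X) (y : Fin n → X) : ins q x y q = x := by simp

lemma ins_succAbove {X : Type*} (q : Fin (n + 1)) (x : X) (y : Fin n → X) (j : Fin n) : ins q x y
    (q.succAbove j) = y j := by simp

lemma finsum_single_mul {σ : Type*} [DecidableEq σ] (i : σ) (g : σ → ℂ) : ∑ᶠ j, (single i 1 : σ → ℂ)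
    j * g j = g i := by
  rw [finsum_eq_single _ i]
  · simp
  · intro j hj; simp [hj]

lemma ScalarFace.hasDerivAt (hS : ScalarFace M κ Ψ p S) (hΨ : Regular M p Ψ) (i : Fin (n + 1)) (v :
    Fin (n + 1) → V) (w' : GradedDual gr) (z : Fin (n + 1) → ℂ) (hz : Injective z) : HasDerivAt (fun
    t => S v w' (update z i t)) (S (update v i (A.D (v i))) w' z) (z i) := by
  obtain ⟨g, hg, hd⟩ := RegOff.exists_deriv (hS.mem_regOff v w')
  have key : ∀ i, ∀ z, Injective z → g i z = S (update v i (A.D (v i))) w' z := by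
    have hpos : ∀ z, Injective z → g κ.pos z = S (update v κ.pos (A.D (v κ.pos))) w' z := by
      intro z hz; refine κ.eq_of_reg (hg _) (hS.mem_regOff _ _) (fun t y hy ht => ?_) hz
      have h1 := (hd _ (eval_diffPoly_ne.mpr (ht.injective hy)) (single κ.pos 1)).deriv
      rw [finsum_single_mul] at h1
      have h2 := deriv_line_pos hS (v κ.pos) (fun j => v (κ.pos.succAbove j)) w' hy ht
      rw [← h1, ← ins_self κ.pos v, update_ins_self, ins_same, ← h2, ins_self]
      congr 1; funext s; congr 1; ext l; refine succAboveCases κ.pos ?_ (fun l => ?_) l <;> simp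
    intro i; refine succAboveCases κ.pos hpos (fun j => ?_) i; intro z hz
    refine κ.eq_of_reg (hg _) (hS.mem_regOff _ _) (fun t y hy ht => ?_) hz
    have h1 := (hd _ (eval_diffPoly_ne.mpr (ht.injective hy)) (ins κ.pos (κ.ctr (single j 1))
      (single j 1))).deriv
    rw [finsum_eq_sum_of_fintype, sum_univ_succAbove _ κ.pos] at h1
    simp only [insertNth_apply_same, insertNth_apply_succAbove] at h1
    rw [sum_eq_single j (fun l _ hl => by simp [hl]) (by simp), Pi.single_eq_same, one_mul, hpos _
      (ht.injective hy)] at h1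
    have h2 := deriv_line_succAbove hS hΨ (v κ.pos) (fun j => v (κ.pos.succAbove j)) w' hy ht j
    have h3 : (fun s => S (ins κ.pos (v κ.pos) fun j => v (κ.pos.succAbove j)) w' (ins κ.pos (t + s
      * κ.ctr (single j 1)) (update y j (y j + s)))) = fun s : ℂ => S v w' (ins κ.pos t y + s • ins
      κ.pos (κ.ctr (single j 1)) (single j 1)) := by
      funext s; rw [ins_self]; congr 1; ext l; refine succAboveCases κ.pos ?_ (fun l => ?_) l
      · simp
      · by_cases h : l = j
        · subst h; simp
        · simp [h]
    rw [h3, h1] at h2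
    have h4 : ins κ.pos (A.D (v κ.pos)) (fun j => v (κ.pos.succAbove j)) = update v κ.pos (A.D (v
      κ.pos)) := by
      conv_rhs => rw [← ins_self κ.pos v]
      rw [update_ins_self, ins_same]
    have h5 : ins κ.pos (v κ.pos) (update (fun j => v (κ.pos.succAbove j)) j (A.D (v
      (κ.pos.succAbove j)))) = update v (κ.pos.succAbove j) (A.D (v (κ.pos.succAbove j))) := by
      rw [← update_ins_succAbove, ins_self]
    rw [h4, h5, add_comm] at h2; exact add_right_cancel h2
  have h1 := hd z (eval_diffPoly_ne.mpr hz) (single i 1); rw [finsum_single_mul, key i z hz] at h1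
  have h2 : HasDerivAt (fun t : ℂ => t - z i) 1 (z i) := (hasDerivAt_id _).sub_const _
  have h3 := HasDerivAt.comp (z i) (h₂ := fun t : ℂ => S v w' (z + t • single i 1)) (h := fun t => t
    - z i) (by rwa [sub_self]) h2
  rw [mul_one] at h3; refine h3.congr_of_eventuallyEq (Filter.Eventually.of_forall fun t => ?_)
  simp only [comp]; congr 1; ext l
  by_cases h : l = i
  · subst h; simp
  · simp [h]

lemma ScalarFace.exists_cochain (hS : ScalarFace M κ Ψ p S) (hΨ : Regular M p Ψ) : ∃ Z : Cochain V
    gr (n + 1), Regular M p Z ∧ Face M κ Ψ Z := by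
  choose X hX using fun v c (z : Conf (n + 1)) => hS.exists_value hΨ v c z.injective
  have hlin : ∀ v i (a b : ℂ) (x y : V), X (update v i (a • x + b • y)) = fun c z => a • X (update v
    i x) c z + b • X (update v i y) c z := by
    intro v i a b x y; funext c z
    rw [← sub_eq_zero, ← Module.forall_dual_apply_eq_zero_iff ℂ]
    intro φ; simp [← hX, hS.lin_update v i a b x y _ z.injective]
  let Z : Cochain V gr (n + 1) :=
    { toFun := fun v z c => X v c z
      map_update_add' := fun {inst} v i a b => by
        cases Subsingleton.elim inst (instDecidableEqFin (n + 1)); funext z c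
        simpa using congr_fun₂ (hlin v i 1 1 a b) c z
      map_update_smul' := fun {inst} v i a b => by
        cases Subsingleton.elim inst (instDecidableEqFin (n + 1)); funext z c
        simpa using congr_fun₂ (hlin v i a 0 b 0) c z }
  have hZ : ∀ w' v z, Injective z → cor Z w' v z = S v w' z := by
    intro w' v z hz; rw [cor_of_injective _ _ _ hz]
    induction w' using gradedDual_induction with
    | h0 => simpa [barPairing_zero_left] using (hS.lin_left v 0 0 0 0 hz).symm
    | hof c φ => rw [barPairing_of]; exact (hX v c ⟨z, hz⟩ φ).symm
    | hadd x y hx hy =>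
      rw [barPairing_add_left, hx, hy]; simpa using (hS.lin_left v 1 1 x y hz).symm
  refine ⟨Z, ⟨fun v w' => ?_, fun i v w' z hz => ?_, fun v w' z hz => ?_, fun v d hd c φ t z ht hz
    => ?_⟩, fun u v w' t y hy ht => ?_⟩
  · obtain ⟨h, hh⟩ := hS.poleBound v w'; exact ⟨h, fun z hz => by rw [hZ _ _ _ hz, hh z hz]⟩
  · rw [hZ _ _ _ hz]; refine (hS.hasDerivAt hΨ i v w' z hz).congr_of_eventuallyEq ?_
    have hc : ContinuousAt (fun t => update z i t) (z i) := ContinuousAt.update continuousAt_const i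
      continuousAt_id
    have : ∀ᶠ t in 𝓝 (z i), Injective (update z i t) := by
      refine hc.eventually ?_; dsimp only; rw [update_eq_self]; exact eventually_injective hz
    filter_upwards [this] with t ht
    exact hZ _ _ _ ht
  · rw [hZ _ _ _ hz, hS.sum_D hΨ v w' hz]; exact sum_congr rfl fun i _ => (hZ _ _ _ hz).symm
  · have htz : Injective (t • z) := fun i j hij => hz (by simpa [ht] using hij)
    rw [hZ _ _ _ hz, hZ _ _ _ htz]; exact hS.homogeneous hΨ v d hd c φ t z ht hz
  · rw [hZ _ _ _ (ht.injective hy)]; exact hS.hasSum u v w' t y hy ht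

/-- Faces exist if the defining series converge locally to rational functions. -/
lemma exists_face (hΨ : Regular M p Ψ) (h : ∀ u v w', ∃ (h : MvPolynomial (Fin (n + 1)) ℂ) (y₀ : Fin
    n → ℂ), ∀ᶠ y in 𝓝 y₀, ∃ ρ > 0, ∀ x : ℂ, ‖x‖ = ρ → κ.Reg (κ.ctr y + x) y ∧ HasSum (fun k =>
    faceTerm M κ Ψ k u v w' y * x ^ (-k - 1)) (eval (ins κ.pos (κ.ctr y + x) y) h / poleProd p (ins
    κ.pos u v) (ins κ.pos (κ.ctr y + x) y))) : ∃ Z : Cochain V gr (n + 1), Regular M p Z ∧ Face M κ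
    Ψ Z := by
  choose h y₀ hh using h
  have hb : ∀ (v : Fin (n + 1) → V) (w' : GradedDual gr) (z : Fin (n + 1) → ℂ), Injective z → eval z
    (h (v κ.pos) (fun j => v (κ.pos.succAbove j)) w') / poleProd p v z * poleProd p v z = eval z (h
    (v κ.pos) (fun j => v (κ.pos.succAbove j)) w') := fun v w' z hz =>
    div_mul_cancel₀ _ (poleProd_ne_zero p v hz)
  refine ScalarFace.exists_cochain (κ := κ) (S := fun v w' z =>
    eval z (h (v κ.pos) (fun j => v (κ.pos.succAbove j)) w') / poleProd p v z)
    ⟨fun v w' => ⟨_, hb v w'⟩, fun u v w' t y hy ht => ?_⟩ hΨ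
  refine κ.extend (poleProd_mem_regOff p _ (hb (ins κ.pos u v) w')) (fun k => faceTerm_mem_regOff hΨ
    k u v w') (y₀ := y₀ u v w') ?_ hy ht
  filter_upwards [hh u v w'] with y hy
  simpa using hy

/-! ## Expansions in two variables -/

lemma HasLaurent.exists_coeff_pair {I : Set (Fin 2)} {Ω : Set (Fin 2 → ℂ)} {F : (Fin 2 → ℂ) → ℂ} (h
    : HasLaurent I Ω F) : ∃ c : ℤ × ℤ → ℂ, ∀ x ∈ Ω, HasSum (fun k => c k * (x 0 ^ (-k.1 - 1) * x 1 ^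
    (-k.2 - 1))) (F x) := by
  obtain ⟨c, hc⟩ := h.exists_coeff; refine ⟨fun k => c ![k.1, k.2], fun x hx => ?_⟩
  have h1 := hc x hx; rw [← (finTwoArrowEquiv ℤ).symm.hasSum_iff] at h1
  refine h1.of_eq fun k => ?_; simp [finTwoArrowEquiv]

lemma independent_pair {r₁ r₂ : ℝ} (h₁ : 0 < r₁) (h₂ : 0 < r₂) : Independent (fun (k : ℤ × ℤ) (x : ℂ
    × ℂ) => x.1 ^ (-k.1 - 1) * x.2 ^ (-k.2 - 1)) (circ r₁ ×ˢ circ r₂) := by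
  have := (independent_zpow_neg h₁).prod (independent_zpow_neg h₂); exact this

lemma Separated.pair {P : Type*} {𝓐 : Subalgebra ℂ (P → ℂ)} (q : Fin (n + 2)) (r : Fin (n + 1)) {S T
    : P → ℂ} (y : Fin n → ℂ) (hS : S ∈ 𝓐) (hT : T ∈ 𝓐) (hST : (fun x => (S x - T x)⁻¹) ∈ 𝓐) (hSy : ∀
    l, (fun x => (S x - y l)⁻¹) ∈ 𝓐) (hTy : ∀ l, (fun x => (T x - y l)⁻¹) ∈ 𝓐) : Separated 𝓐 fun i x
    => MOSVACohomology.ins q (S x) (MOSVACohomology.ins r (T x) y) i := by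
  have h : Separated 𝓐 fun i _ => y i := ⟨fun i => 𝓐.algebraMap_mem (y i), fun i j _ =>
    𝓐.algebraMap_mem (y i - y j)⁻¹⟩
  refine (h.ins hT hTy r).ins hS (fun j => succAboveCases r ?_ (fun j => ?_) j) q
  · simpa using hST
  · simpa using hSy j

lemma pair_injective {q : Fin (n + 2)} {r : Fin (n + 1)} {s t : ℂ} {y : Fin n → ℂ} (hy : Injective
    y) (hst : s ≠ t) (hs : ∀ l, s ≠ y l) (ht : ∀ l, t ≠ y l) : Injective (ins q s (ins r t y)) := by
  refine ins_injective (ins_injective hy fun j => (ht j).symm) fun j => ?_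
  refine succAboveCases r ?_ (fun j => ?_) j
  · simpa using hst.symm
  · simpa using (hs j).symm

/-! ## Homogeneous expansions in two variables -/

/-- The polynomial `s t (s - t)`. -/
def conePoly : MvPolynomial (Fin 2) ℂ := X 0 * X 1 * (X 0 - X 1)

lemma eval_conePoly (p : Fin 2 → ℂ) : eval p conePoly = p 0 * p 1 * (p 0 - p 1) := by
  simp [conePoly]

lemma eval_conePoly_ne {p : Fin 2 → ℂ} : eval p conePoly ≠ 0 ↔ p 0 ≠ 0 ∧ p 1 ≠ 0 ∧ p 0 ≠ p 1 := by
  rw [eval_conePoly, mul_ne_zero_iff, mul_ne_zero_iff, sub_ne_zero, and_assoc]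

lemma coord_ne_of_conePoly {p : Fin 2 → ℂ} (h : eval p conePoly ≠ 0) (i : Fin 2) : p i ≠ 0 := by
  rw [eval_conePoly_ne] at h; fin_cases i
  exacts [h.1, h.2.1]

lemma inv_coord_mem_regOff_conePoly (i : Fin 2) : (fun p : Fin 2 → ℂ => (p i)⁻¹) ∈ RegOff conePoly
    := by
  have : (X i : MvPolynomial (Fin 2) ℂ) ∣ conePoly := by
    rw [conePoly]; fin_cases i
    exacts [(dvd_mul_right _ _).mul_right _, (dvd_mul_left _ _).mul_right _]
  simpa using RegOff.inv_of_dvd this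

lemma inv_diff_mem_regOff_conePoly : (fun p : Fin 2 → ℂ => (p 0 - p 1)⁻¹) ∈ RegOff conePoly := by
  simpa using RegOff.inv_of_dvd (q := conePoly) (Dvd.intro_left _ rfl)

lemma RationalAwayZero.mem_regOff {f : (Fin 2 → ℂ) → ℂ} (hf : RationalAwayZero f) : f ∈ RegOff
    conePoly := by
  obtain ⟨N, h, hf⟩ := hf
  refine RegOff.div (r := ((∏ i, X i) * diffPoly (Fin 2)) ^ N) (p := h) (2 * N) ?_ fun z hz => ?_
  · rw [pow_mul]; refine pow_dvd_pow_of_dvd ⟨-(X 0 * X 1), ?_⟩ N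
    have : diffPoly (Fin 2) = (X 0 - X 1) * (X 1 - X 0) := by
      have h0 : (univ.erase (0 : Fin 2)) = {1} := by decide
      have h1 : (univ.erase (1 : Fin 2)) = {0} := by decide
      simp [diffPoly, prod_univ_two, h0, h1]
    rw [this, prod_univ_two, conePoly]; ring
  · have := hf z (fun i j hij => ?_) (coord_ne_of_conePoly hz)
    · rw [map_pow, map_mul, eval_diffPoly, map_prod]; simpa using this
    · have := (eval_conePoly_ne.mp hz).2.2; fin_cases i <;> fin_cases j
      exacts [rfl, absurd hij this, absurd hij.symm this, rfl]

lemma independent_zpow_neg_two {r : ℝ} (hr : 0 < r) : Independent (fun (k : ℤ) (x : ℂ) => x ^ (-k -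
    2)) (circ r) :=
  (independent_zpow hr).comp_equiv (⟨fun k => -k - 2, fun k => -k - 2, fun k => by ring, fun k => by
    ring⟩ : ℤ ≃ ℤ) id (fun x hx => ⟨x, hx, rfl⟩) (fun _ _ _ => rfl)

/-- The part of total degree `κ` of a family of coefficients. -/
def degPart (κ : ℤ) (D : ℤ × ℤ → ℂ) (k : ℤ × ℤ) : ℂ := if k.1 + k.2 = κ then D k else 0

/-- The double series with coefficients `D`. -/
abbrev pairTerm (D : ℤ × ℤ → ℂ) (s t : ℂ) (k : ℤ × ℤ) : ℂ := D k * (s ^ (-k.1 - 1) * t ^ (-k.2 - 1))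

lemma hasSum_group {D : ℤ × ℤ → ℂ} {s t l S : ℂ} (hl : l ≠ 0) (h : HasSum (pairTerm D (l * s) (l *
    t)) S) {f : ℤ → ℂ} (hf : ∀ κ, HasSum (pairTerm (degPart κ D) s t) (f κ)) : HasSum (fun κ => f κ
    * l ^ (-κ - 2)) S := by
  let σ : ℤ × ℤ ≃ ℤ × ℤ := ⟨fun p => (p.2, p.1 - p.2), fun k => (k.1 + k.2, k.1), fun p => by simp,
    fun k => by simp⟩
  rw [← σ.hasSum_iff] at h; refine h.prod_fiberwise fun κ => ?_
  have h1 := (hf κ).mul_right (l ^ (-κ - 2))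
  have hinj : Injective (fun k : ℤ => σ (κ, k)) := fun a b hab => by simpa using σ.injective hab
  rw [← hinj.hasSum_iff] at h1
  · refine h1.of_eq fun k => ?_
    simp only [comp, pairTerm, degPart, σ, Equiv.coe_fn_mk, add_sub_cancel, if_true, mul_zpow]
    rw [show (-κ - 2 : ℤ) = (-k - 1) + (-(κ - k) - 1) by ring, zpow_add₀ hl]; ring
  · intro k hk
    have : k.1 + k.2 ≠ κ := fun h => hk ⟨k.1, by
      refine Prod.ext rfl ?_; change κ - k.1 = k.2; omega⟩
    simp [pairTerm, degPart, this]

lemma summable_degPart {D : ℤ × ℤ → ℂ} {s t l : ℂ} (hl : l ≠ 0) (h : Summable (pairTerm D (l * s) (l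
    * t))) (κ : ℤ) : Summable (pairTerm (degPart κ D) s t) := by
  have h1 : Summable (pairTerm (degPart κ D) (l * s) (l * t)) := by
    refine Summable.of_norm_bounded h.norm fun k => ?_; simp only [pairTerm, degPart]; split_ifs
    · exact le_rfl
    · rw [zero_mul, norm_zero]; exact norm_nonneg _
  refine (h1.mul_right (l ^ (κ + 2))).congr fun k => ?_; simp only [pairTerm, degPart]
  split_ifs with hk
  · rw [← hk, mul_zpow, mul_zpow, show (k.1 + k.2 + 2 : ℤ) = -((-k.1 - 1) + (-k.2 - 1)) by ring,
      zpow_neg, zpow_add₀ hl]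
    have h2 := zpow_ne_zero (-k.1 - 1) hl; have h3 := zpow_ne_zero (-k.2 - 1) hl; field_simp
  · simp

/-- The double series with coefficients `D` and, after a linear change of variables, `C`, are the
expansions of the same rational function in two cones. -/
def TwoCone (σ : ℂ → ℂ → Fin 2 → ℂ) (D C : ℤ × ℤ → ℂ) : Prop :=
  ∃ f ∈ RegOff conePoly, (∀ p : Fin 2 → ℂ, 0 < ‖p 1‖ → 4 * ‖p 1‖ < ‖p 0‖ → HasSum (pairTerm D (p 0)
    (p 1)) (f p)) ∧ ∀ x τ : ℂ, 0 < ‖x‖ → 4 * ‖x‖ < ‖τ‖ → HasSum (pairTerm C x τ) (f (σ x τ))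

lemma coeff_eq_of_scaling {𝓕 : Filter ℝ} [𝓕.NeBot] (hpos : ∀ᶠ r in 𝓕, 0 < r) {F : (Fin 2 → ℂ) → ℂ}
    {D C C' : ℤ × ℤ → ℂ} {σ : ℂ → ℂ → Fin 2 → ℂ} (hσ0 : ∀ x τ : ℂ, 0 < ‖x‖ → 4 * ‖x‖ < ‖τ‖ → eval (σ
    x τ) conePoly ≠ 0) (hF : ∃ g : ℤ → (Fin 2 → ℂ) → ℂ, (∀ κ, g κ ∈ RegOff conePoly) ∧ ∀ p, eval p
    conePoly ≠ 0 → ∀ᶠ r in 𝓕, ∀ l : ℂ, ‖l‖ = r → HasSum (fun κ => g κ p * l ^ (-κ - 2)) (F (l • p)))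
    (hD : ∀ p : Fin 2 → ℂ, 0 < ‖p 1‖ → 4 * ‖p 1‖ < ‖p 0‖ → ∀ᶠ r in 𝓕, ∀ l : ℂ, ‖l‖ = r → HasSum
    (pairTerm D (l * p 0) (l * p 1)) (F (l • p))) (hC' : ∀ x τ : ℂ, 0 < ‖x‖ → 4 * ‖x‖ < ‖τ‖ → ∀ᶠ r
    in 𝓕, ∀ l : ℂ, ‖l‖ = r → HasSum (pairTerm C' (l * x) (l * τ)) (F (l • σ x τ))) (hf : ∀ κ,
    TwoCone σ (degPart κ D) (degPart κ C)) : C' = C := by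
  obtain ⟨g, hg, hgF⟩ := hF; choose f hfm hf1 hf2 using hf
  have hne : ∀ r > (0 : ℝ), ∀ l : ℂ, ‖l‖ = r → l ≠ 0 := fun r hr l hl h => by
    rw [h, norm_zero] at hl; exact hr.ne hl
  have key1 : ∀ κ p, eval p conePoly ≠ 0 → g κ p = f κ p := by
    intro κ p hp; refine RegOff.eq_of_eventually (hg κ) (hfm κ) (z₀ := ![5, 1]) ?_ hp
    have h1 : ∀ᶠ p : Fin 2 → ℂ in 𝓝 ![5, 1], 0 < ‖p 1‖ ∧ 4 * ‖p 1‖ < ‖p 0‖ := by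
      have h2 : IsOpen {p : Fin 2 → ℂ | 0 < ‖p 1‖} := isOpen_lt (by fun_prop) (by fun_prop)
      have h3 : IsOpen {p : Fin 2 → ℂ | 4 * ‖p 1‖ < ‖p 0‖} := isOpen_lt (by fun_prop) (by fun_prop)
      refine (h2.eventually_mem ?_).and (h3.eventually_mem ?_)
      · simp
      · simp only [Set.mem_ofPred_eq, cons_val_zero, cons_val_one]; norm_num
    filter_upwards [h1] with p hp hp0
    obtain ⟨r, hr, h2, h3⟩ := (hpos.and ((hgF p hp0).and (hD p hp.1 hp.2))).exists
    have := (independent_zpow_neg_two hr).eq (c := fun κ => g κ p) (d := fun κ => f κ p) (f := fun l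
      => F (l • p)) h2 (fun l hl => hasSum_group (hne r hr l hl) (h3 l hl) fun κ => hf1 κ p hp.1
      hp.2)
    exact congrFun this κ
  have key2 : ∀ x τ : ℂ, 0 < ‖x‖ → 4 * ‖x‖ < ‖τ‖ → ∀ κ, HasSum (pairTerm (degPart κ C') x τ) (f κ (σ
    x τ)) := by
    intro x τ hx hτ κ
    obtain ⟨r, hr, h2, h3⟩ := (hpos.and ((hgF _ (hσ0 x τ hx hτ)).and (hC' x τ hx hτ))).exists
    have hr' : ‖(r : ℂ)‖ = r := by simp [abs_of_pos hr]
    have hs := fun κ => (summable_degPart (hne r hr r hr') (h3 r hr').summable κ).hasSum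
    have := (independent_zpow_neg_two hr).eq (c := fun κ => g κ (σ x τ)) (d := fun κ => ∑' k,
      pairTerm (degPart κ C') x τ k) (f := fun l => F (l • σ x τ)) h2 (fun l hl => hasSum_group (hne
      r hr l hl) (h3 l hl) hs)
    rw [← key1 κ _ (hσ0 x τ hx hτ), congrFun this κ]; exact hs κ
  have key3 : ∀ κ, degPart κ C' = degPart κ C := by
    intro κ
    refine (independent_pair (r₁ := 1) (r₂ := 5) (by norm_num) (by norm_num)).eq
      (f := fun x => f κ (σ x.1 x.2)) (fun x hx => key2 _ _ ?_ ?_ κ)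
      (fun x hx => hf2 κ _ _ ?_ ?_) <;>
    · obtain ⟨h1, h2⟩ := hx; rw [show ‖x.1‖ = 1 from h1]
      try rw [show ‖x.2‖ = 5 from h2]
      norm_num
  funext k; have := congrFun (key3 (k.1 + k.2)) k; simpa [degPart] using this

/-- Expansion in a large scaling parameter. -/
lemma exists_scaling_atTop {f : (Fin (n + 2) → ℂ) → ℂ} (hf : f ∈ RatFun (n + 2)) (q : Fin (n + 2))
    (r : Fin (n + 1)) {y : Fin n → ℂ} (hy : Injective y) : ∃ g : ℤ → (Fin 2 → ℂ) → ℂ, (∀ κ, g κ ∈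
    RegOff conePoly) ∧ ∀ p, eval p conePoly ≠ 0 → ∀ᶠ R in atTop, ∀ l : ℂ, ‖l‖ = R → HasSum (fun κ =>
    g κ p * l ^ (-κ - 2)) (f (ins q (l * p 0) (ins r (l * p 1) y))) := by
  let Dom : Set ((Fin 2 → ℂ) × ℂ) := {a | eval a.1 conePoly ≠ 0 ∧ a.2 ≠ 0 ∧ ∀ j l, ‖y l * a.2‖ <
    ‖a.1 j‖}
  have h0 : ∀ p ξ, (p, ξ) ∈ Dom → ξ ≠ 0 := fun p ξ h => h.2.1
  have hvar : ∀ i : Fin 2, ExpOn (RegOff conePoly) Dom fun p ξ => ξ⁻¹ * p i := fun i =>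
    (ExpOn.var_inv h0).mul (ExpOn.coeff (coord_mem_regOff i))
  have hsub : ∀ (i : Fin 2) (l : Fin n), ExpOn (RegOff conePoly) Dom fun p ξ => (ξ⁻¹ * p i - y l)⁻¹
    := by
    intro i l
    have h1 := ExpOn.inv_sub (Dom := Dom) (a := fun p : Fin 2 → ℂ => p i) (b := fun _ => y l)
      (inv_coord_mem_regOff_conePoly i) ((RegOff conePoly).algebraMap_mem (y l)) fun p ξ h => h.2.2
      i l
    refine (ExpOn.var.mul h1).congr fun p ξ h => ?_; have h2 := h0 p ξ h
    rw [show ξ⁻¹ * p i - y l = ξ⁻¹ * (p i - y l * ξ) by field_simp, mul_inv, inv_inv]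
  have h1 := ExpOn.comp_regOff hf (Dom := Dom) (z := fun i p ξ =>
    ins q (ξ⁻¹ * p 0) (ins r (ξ⁻¹ * p 1) y) i)
    (.pair q r y (hvar 0) (hvar 1) ?_ (hsub 0) (hsub 1)) fun p ξ h => ?_
  · obtain ⟨a, ha, hs⟩ := h1.exists_coeff h0
    refine ⟨fun κ => a (κ + 2), fun κ => ha _, fun p hp => ?_⟩
    have h2 : ∀ᶠ R : ℝ in atTop, ∀ j l, ‖y l‖ / ‖p j‖ < R := by
      simp only [eventually_all]; exact fun j l => eventually_gt_atTop _
    filter_upwards [h2, eventually_gt_atTop 0] with R h3 hR l hl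
    have h4 := hs p l⁻¹ ⟨hp, inv_ne_zero (norm_pos_iff.mp (hl ▸ hR)), fun i j => by
      have h5 := h3 i j; rw [div_lt_iff₀ (norm_pos_iff.mpr (coord_ne_of_conePoly hp i))] at h5
      dsimp only; rwa [norm_mul, norm_inv, hl, ← div_eq_mul_inv, div_lt_iff₀ hR, mul_comm]⟩
    rw [inv_inv, ← (Equiv.addRight (2 : ℤ)).hasSum_iff] at h4; refine h4.of_eq fun κ => ?_
    simp only [comp, Equiv.coe_addRight, inv_zpow', neg_add, sub_eq_add_neg]
  · refine (ExpOn.var.mul (ExpOn.coeff inv_diff_mem_regOff_conePoly)).congr fun p ξ h => ?_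
    dsimp only; rw [← mul_sub, mul_inv, inv_inv]
  · have hξ := h0 p ξ h
    have key : ∀ j l, ξ⁻¹ * p j ≠ y l := fun j l e => by
      have : ‖y l * ξ‖ < ‖p j‖ := h.2.2 j l
      rw [← e, mul_comm, mul_inv_cancel_left₀ hξ] at this; exact lt_irrefl _ this
    exact pair_injective hy (fun e => (eval_conePoly_ne.mp h.1).2.2 (mul_left_cancel₀ (inv_ne_zero
      hξ) e)) (key 0) (key 1)

/-- Expansion in a small scaling parameter at the point `y i`. -/
lemma exists_scaling_zero {f : (Fin (n + 2) → ℂ) → ℂ} (hf : f ∈ RatFun (n + 2)) (q : Fin (n + 2)) (r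
    : Fin (n + 1)) {y : Fin n → ℂ} (hy : Injective y) (i : Fin n) : ∃ g : ℤ → (Fin 2 → ℂ) → ℂ, (∀ κ,
    g κ ∈ RegOff conePoly) ∧ ∀ p, eval p conePoly ≠ 0 → ∀ᶠ R in 𝓝[>] (0 : ℝ), ∀ l : ℂ, ‖l‖ = R →
    HasSum (fun κ => g κ p * l ^ (-κ - 2)) (f (ins q (y i + l * p 0) (ins r (y i + l * p 1) y))) :=
    by
  let Dom : Set ((Fin 2 → ℂ) × ℂ) := {a | eval a.1 conePoly ≠ 0 ∧ a.2 ≠ 0 ∧ ∀ j l, l ≠ i → ‖a.1 j *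
    a.2‖ < ‖y i - y l‖}
  have h0 : ∀ p ξ, (p, ξ) ∈ Dom → ξ ≠ 0 := fun p ξ h => h.2.1
  have hvar : ∀ j : Fin 2, ExpOn (RegOff conePoly) Dom fun p ξ => y i + ξ * p j := fun j =>
    (ExpOn.const _).add (ExpOn.var.mul (ExpOn.coeff (coord_mem_regOff j)))
  have hsub : ∀ (j : Fin 2) (l : Fin n), ExpOn (RegOff conePoly) Dom fun p ξ => (y i + ξ * p j - y
    l)⁻¹ := by
    intro j l
    by_cases hl : l = i
    · refine ((ExpOn.var_inv h0).mul (ExpOn.coeff (inv_coord_mem_regOff_conePoly j))).congr fun p ξ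
        h => ?_
      rw [hl, add_sub_cancel_left, mul_inv]
    · have h1 := ExpOn.inv_sub (𝓐 := RegOff conePoly) (Dom := Dom) (a := fun _ => y i - y l)
        (b := fun p : Fin 2 → ℂ => -p j)
        ((RegOff conePoly).algebraMap_mem (y i - y l)⁻¹) (neg_mem (coord_mem_regOff j))
        (fun p ξ h => by rw [neg_mul, norm_neg]; exact h.2.2 j l hl)
      refine h1.congr fun p ξ h => ?_; congr 1; ring
  have h1 := ExpOn.comp_regOff hf (Dom := Dom) (z := fun j p ξ =>
    ins q (y i + ξ * p 0) (ins r (y i + ξ * p 1) y) j)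
    (.pair q r y (hvar 0) (hvar 1) ?_ (hsub 0) (hsub 1)) fun p ξ h => ?_
  · obtain ⟨a, ha, hs⟩ := h1.exists_coeff h0
    refine ⟨fun κ => a (-κ - 2), fun κ => ha _, fun p hp => ?_⟩
    have hp' := fun j => norm_pos_iff.mpr (coord_ne_of_conePoly hp j)
    have h2 : ∀ᶠ R : ℝ in 𝓝[>] (0 : ℝ), ∀ j l, l ≠ i → R < ‖y i - y l‖ / ‖p j‖ := by
      simp only [eventually_all]; intro j l hl; refine eventually_nhdsWithin_of_eventually_nhds ?_
      exact eventually_lt_nhds (div_pos (norm_pos_iff.mpr (sub_ne_zero.mpr (hy.ne (Ne.symm hl)))) (hp' j))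
    filter_upwards [h2, self_mem_nhdsWithin] with R h3 hR l hl
    have h4 := hs p l ⟨hp, norm_pos_iff.mp (by rw [hl]; exact hR), fun j k hk => by
      have h5 := h3 j k hk; rw [lt_div_iff₀ (hp' j)] at h5; dsimp only
      rwa [norm_mul, hl, mul_comm]⟩
    let σ : ℤ ≃ ℤ := ⟨fun k => -k - 2, fun k => -k - 2, fun k => by ring, fun k => by ring⟩
    rw [← σ.hasSum_iff] at h4; exact h4
  · refine ((ExpOn.var_inv h0).mul (ExpOn.coeff inv_diff_mem_regOff_conePoly)).congr fun p ξ h => ?_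
    dsimp only; rw [add_sub_add_left_eq_sub, ← mul_sub, mul_inv]
  · have hξ := h0 p ξ h
    have key : ∀ j l, y i + ξ * p j ≠ y l := by
      intro j l e
      by_cases hl : l = i
      · exact mul_ne_zero hξ (coord_ne_of_conePoly h.1 j) (by simpa [hl] using e)
      · have : ‖p j * ξ‖ < ‖y i - y l‖ := h.2.2 j l hl
        rw [← e, sub_add_cancel_left, norm_neg, mul_comm] at this; exact lt_irrefl _ this
    exact pair_injective hy (fun e => (eval_conePoly_ne.mp h.1).2.2 (mul_left_cancel₀ hξ
      (add_left_cancel e))) (key 0) (key 1)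

/-! ## Iterated faces -/

/-- The kind of face obtained by relabelling the arguments. -/
def FaceKind.map {N : ℕ} (f : Fin n → Fin N) : FaceKind n → FaceKind N
  | .left => .left
  | .right => .right
  | .mid i => .mid (f i)

/-- The argument at which the additional vertex operator is inserted, if there is one. -/
def FaceKind.base : FaceKind n → Option (Fin n)
  | .left => none
  | .right => none
  | .mid i => some i

/-- The position of the original arguments after a sequence of faces at the original arguments;
the most recent face comes first. -/
def place : ∀ {J : ℕ} (_ : Fin J → FaceKind n), Fin n → Fin (n + J)
  | 0, _ => id
  | _ + 1, w => fun i => ((w 0).map (place (tail w))).pos.succAbove (place (tail w) i)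

/-- The tuple of all arguments after a sequence of faces. -/
def tuple {X : Type*} : ∀ {J : ℕ} (_ : Fin J → FaceKind n) (_ : Fin J → X) (_ : Fin n → X),
    Fin (n + J) → X
  | 0, _, _, v => v
  | _ + 1, w, u, v => ins ((w 0).map (place (tail w))).pos (u 0)
      (tuple (tail w) (tail u) v)

/-- The terms of the multiple series that belongs to a sequence of faces. -/
def wordTerm (M : Bimodule A gr) (Φ : Cochain V gr n) : ∀ {J : ℕ} (_ : Fin J → FaceKind n)
    (_ : Fin J → ℤ) (_ : Fin J → V) (_ : Fin n → V) (_ : GradedDual gr) (_ : Fin n → ℂ), ℂ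
  | 0, _, _, _, v, w', ζ => cor Φ w' v ζ
  | _ + 1, w, k, u, v, w', ζ => wordTerm M Φ (tail w) (tail k) (tail u)
      ((w 0).vT A (k 0) (u 0) v) ((w 0).wT M (k 0) (u 0) w') ζ

/-- `Z` is obtained from `Φ` by the sequence `w` of faces. -/
def IsWord (M : Bimodule A gr) (p : V → V → ℕ) (Φ : Cochain V gr n) :
    ∀ {J : ℕ} (_ : Fin J → FaceKind n) (_ : Cochain V gr (n + J)), Prop
  | 0, _, Z => Z = Φ ∧ Regular M p Z
  | _ + 1, w, Z => ∃ Y, IsWord M p Φ (tail w) Y ∧ Regular M p Z ∧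
      Face M ((w 0).map (place (tail w))) Y Z

lemma IsWord.regular {Z : Cochain V gr (n + J)} (h : IsWord M p Φ w Z) : Regular M p Z := by
  cases J with
  | zero => exact h.2
  | succ J => obtain ⟨Y, _, h, _⟩ := h; exact h

lemma tuple_map {X X' : Type*} (f : X → X') (w : Fin J → FaceKind n) (u : Fin J → X) (v : Fin n → X)
    : tuple w (f ∘ u) (f ∘ v) = f ∘ tuple w u v := by
  induction J with
  | zero => rfl
  | succ J ih =>
    have h : tuple (tail w) (tail (f ∘ u)) (f ∘ v) = f ∘ tuple (tail w) (tail u) v := ih (tail w)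
      (tail u)
    ext i; simp only [tuple, comp_apply]
    refine succAboveCases ((w 0).map (place (tail w))).pos ?_ (fun i => ?_) i
    · simp
    · simpa using congrFun h i

lemma tuple_place {X : Type*} (w : Fin J → FaceKind n) (u : Fin J → X) (v : Fin n → X) (i : Fin n) :
    tuple w u v (place w i) = v i := by
  induction J with
  | zero => rfl
  | succ J ih => simpa [tuple, place] using ih (tail w) (tail u)

lemma tuple_update {X : Type*} (w : Fin J → FaceKind n) (u : Fin J → X) (v : Fin n → X) (i : Fin n)
    (x : X) : tuple w u (update v i x) = update (tuple w u v) (place w i) x := by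
  induction J with
  | zero => rfl
  | succ J ih => simp only [tuple, place, ih]; rw [update_ins_succAbove]

/-- The index of each argument. -/
abbrev idx (w : Fin J → FaceKind n) : Fin (n + J) → Fin J ⊕ Fin n := tuple w Sum.inl Sum.inr

lemma tuple_eq {X : Type*} (w : Fin J → FaceKind n) (u : Fin J → X) (v : Fin n → X) : tuple w u v =
    elim u v ∘ idx w := by
  rw [← tuple_map]; rfl

lemma idx_injective (w : Fin J → FaceKind n) : Injective (idx w) := by
  induction J with
  | zero => exact fun i j h => Sum.inr_injective h
  | succ J ih =>
    have h : tuple (tail w) (tail Sum.inl) Sum.inr = Sum.map Fin.succ id ∘ idx (n := n) (tail w) :=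
      by
      rw [← tuple_map]; rfl
    simp only [idx, tuple]; rw [h]
    refine ins_injective ((Sum.map_injective.mpr ⟨Fin.succ_injective _, injective_id⟩).comp (ih _))
      fun j => ?_
    simp only [comp]; rcases idx (tail w) j with s | s
    · simp [Fin.succ_ne_zero]
    · simp

lemma idx_bijective (w : Fin J → FaceKind n) : Bijective (idx w) :=
  (Fintype.bijective_iff_injective_and_card _).mpr ⟨idx_injective w, by simp [add_comm]⟩

lemma vT_map (k : ℤ) (x : V) (κ : FaceKind n) (w : Fin J → FaceKind n) (u : Fin J → V) (v : Fin n →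
    V) : (κ.map (place w)).vT A k x (tuple w u v) = tuple w u (κ.vT A k x v) := by
  cases κ with
  | left | right => rfl
  | mid i =>
    change update (tuple w u v) (place w i) (A.Y k x (tuple w u v (place w i))) = _
    rw [tuple_place, ← tuple_update]; rfl

lemma wT_map {N : ℕ} (f : Fin n → Fin N) (k : ℤ) (x : V) (κ : FaceKind n) (w' : GradedDual gr) :
    (κ.map f).wT M k x w' = κ.wT M k x w' := by
  cases κ <;> rfl

/-! ### The region of convergence -/

/-- The block of each argument. -/
def cls {J : ℕ} (w : Fin J → FaceKind n) : Fin J ⊕ Fin n → Option (Fin n) :=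
  elim (fun t => (w t).base) some

/-- The original arguments count as the most recent ones. -/
def Newer {J : ℕ} : Fin J ⊕ Fin n → Fin J ⊕ Fin n → Prop
  | .inl s, .inl t => s < t
  | .inr _, .inl _ => True
  | _, .inr _ => False

/-- The centre of a block. -/
def blockCtr (ζ : Fin n → ℂ) (c : Option (Fin n)) : ℂ := c.elim 0 ζ

/-- The region of convergence for a sequence of faces, in terms of the distances of the arguments
from the centres of their blocks. -/
structure WordReg {J : ℕ} (w : Fin J → FaceKind n) (ζ : Fin n → ℂ) (x : Fin J ⊕ Fin n → ℂ) :
    Prop where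
  ne : ∀ t, x (.inl t) ≠ 0
  outer : ∀ a b, Newer a b → cls w a = none → cls w b = none → ‖x b‖ < ‖x a‖
  block : ∀ a b i, Newer a b → cls w a = some i → cls w b = some i → ‖x a‖ < ‖x b‖
  blocks : ∀ a b i j, i ≠ j → cls w a = some i → cls w b = some j → ‖x a‖ + ‖x b‖ < ‖ζ i - ζ j‖
  outer_block : ∀ a b i, cls w a = none → cls w b = some i → ‖ζ i‖ + ‖x b‖ < ‖x a‖

lemma newer_or (w : Fin J → FaceKind n) {a b : Fin J ⊕ Fin n} (hab : a ≠ b) (h : cls w a = cls w b)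
    : Newer a b ∨ Newer b a := by
  rcases a with s | i <;> rcases b with t | j
  · exact lt_or_gt_of_ne fun e => hab (by rw [e])
  · exact Or.inr trivial
  exacts [Or.inl trivial, absurd (by simpa [cls] using h) fun e : i = j => hab (by rw [e])]

/-- A property of pairs of arguments holds if it holds for the pairs in which the first one is
farther away from the common centre. -/
lemma pair_induction (w : Fin J → FaceKind n) {R : Fin J ⊕ Fin n → Fin J ⊕ Fin n → Prop} (hsymm : ∀
    a b, R a b → R b a) (h1 : ∀ s b, Newer (.inl s) b → cls w (.inl s) = none → cls w b = none → R
    (.inl s) b) (h2 : ∀ s b i, Newer b (.inl s) → cls w (.inl s) = some i → cls w b = some i → R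
    (.inl s) b) (h3 : ∀ a b i j, i ≠ j → cls w a = some i → cls w b = some j → R a b) (h4 : ∀ s b i,
    cls w (.inl s) = none → cls w b = some i → R (.inl s) b) (a b : Fin J ⊕ Fin n) (hab : a ≠ b) : R
    a b := by
  have key : ∀ a b, Newer a b → cls w a = cls w b → R a b := by
    intro a b h e; rcases ha : cls w a with _ | i
    · rcases a with s | s
      · exact h1 s b h ha (e ▸ ha)
      · simp [cls] at ha
    · rcases b with t | t
      · exact hsymm _ _ (h2 t a i h (e ▸ ha) ha)
      · rcases a <;> exact h.elim
  by_cases e : cls w a = cls w b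
  · rcases newer_or w hab e with h | h
    exacts [key a b h e, hsymm _ _ (key b a h e.symm)]
  · rcases ha : cls w a with _ | i <;> rcases hb : cls w b with _ | j
    · exact absurd (ha.trans hb.symm) e
    · rcases a with s | s
      · exact h4 s b j ha hb
      · simp [cls] at ha
    · rcases b with s | s
      · exact hsymm _ _ (h4 s a i hb ha)
      · simp [cls] at hb
    · exact h3 a b i j (fun h => e (by rw [ha, hb, h])) ha hb

lemma WordReg.injective {x : Fin J ⊕ Fin n → ℂ} (h : WordReg w ζ x) : Injective fun a => blockCtr ζ
    (cls w a) + x a := by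
  intro a b hab; by_contra hne
  revert hab
  refine pair_induction w (R := fun a b => ¬ (blockCtr ζ (cls w a) + x a = blockCtr ζ (cls w b) + x
    b)) (fun a b h e => h e.symm) ?_ ?_ ?_ ?_ a b hne
  · intro s b h1 h2 h3 e; have := h.outer _ _ h1 h2 h3; rw [h2, h3] at e
    rw [add_left_cancel e] at this; exact lt_irrefl _ this
  · intro s b i h1 h2 h3 e; have := h.block _ _ _ h1 h3 h2; rw [h2, h3] at e
    rw [add_left_cancel e] at this; exact lt_irrefl _ this
  · intro a b i j hij h1 h2 e; have := h.blocks _ _ _ _ hij h1 h2; rw [h1, h2] at e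
    change ζ i + x a = ζ j + x b at e
    rw [show ζ i - ζ j = x b - x a by linear_combination e] at this
    linarith [norm_sub_le (x b) (x a)]
  · intro s b i h1 h2 e; have := h.outer_block _ _ _ h1 h2; rw [h1, h2] at e
    change 0 + _ = ζ i + x b at e; rw [show x (.inl s) = ζ i + x b by linear_combination e] at this
    linarith [norm_add_le (ζ i) (x b)]

/-- Rational functions with diagonal poles have Laurent expansions in the region of convergence. -/
lemma WordReg.hasLaurent {J N : ℕ} {w : Fin J → FaceKind n} {κ : Type*} [Fintype κ] {I : Set κ} {Ω :
    Set (κ → ℂ)} (hΩ : ∀ x ∈ Ω, ∀ i ∉ I, x i ≠ 0) {x : Fin J ⊕ Fin n → (κ → ℂ) → ℂ} (hreg : ∀ y ∈ Ω,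
    WordReg w ζ fun a => x a y) (hx : ∀ a, LaurentOn I Ω (x a) fun y => ‖x a y‖) (hx' : ∀ s,
    LaurentOn I Ω (fun y => (x (.inl s) y)⁻¹) fun y => ‖x (.inl s) y‖⁻¹) {F : (Fin N → ℂ) → ℂ} (hF :
    F ∈ RatFun N) {e : Fin N → Fin J ⊕ Fin n} (he : Injective e) : HasLaurent I Ω fun y => F fun j
    => blockCtr ζ (cls w (e j)) + x (e j) y := by
  refine HasLaurent.comp_regOff hΩ hF (z := fun j y => blockCtr ζ (cls w (e j)) + x (e j) y) ⟨fun j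
    => (HasLaurent.const _).add ⟨_, hx _⟩, fun i j hij => ?_⟩ fun y hy => ((hreg y
    hy).injective).comp he
  refine pair_induction w (R := fun a b => HasLaurent I Ω fun y =>
    (blockCtr ζ (cls w a) + x a y - (blockCtr ζ (cls w b) + x b y))⁻¹) (fun a b h => ?_) ?_ ?_ ?_ ?_
    (e i) (e j) (he.ne hij)
  · refine ((HasLaurent.const (-1)).mul hΩ h).congr fun y _ => ?_
    rw [← neg_sub (blockCtr ζ (cls w a) + x a y), inv_neg]; ring
  · intro s b h1 h2 h3
    exact (HasLaurent.inv_sub hΩ (hx' s) (hx b) fun y hy =>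
      (hreg y hy).outer _ _ h1 h2 h3).congr fun y _ => by rw [h2, h3, add_sub_add_left_eq_sub]
  · intro s b i h1 h2 h3
    exact (HasLaurent.inv_sub hΩ (hx' s) (hx b) fun y hy =>
      (hreg y hy).block _ _ _ h1 h3 h2).congr fun y _ => by rw [h2, h3, add_sub_add_left_eq_sub]
  · intro a b i j hij h1 h2
    · have h3 : LaurentOn I Ω (fun _ => (ζ i - ζ j)⁻¹) fun _ => ‖ζ i - ζ j‖⁻¹ := by
        simpa using LaurentOn.const (I := I) (Ω := Ω) (ζ i - ζ j)⁻¹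
      refine (HasLaurent.inv_sub hΩ h3 ((hx b).add ((LaurentOn.const (-1)).mul hΩ (hx a))) fun y hy
        => ?_).congr fun y _ => ?_
      · rw [norm_neg, norm_one, one_mul, add_comm]
        exact (hreg y hy).blocks _ _ _ _ hij h1 h2
      · rw [h1, h2]; congr 1; simp only [blockCtr, Option.elim]; ring
  · intro s b i h1 h2
    refine (HasLaurent.inv_sub hΩ (hx' s) ((LaurentOn.const (ζ i)).add (hx b)) fun y hy =>
      (hreg y hy).outer_block _ _ _ h1 h2).congr fun y _ => ?_
    rw [h1, h2]; simp only [blockCtr, Option.elim, zero_add]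

/-- The tuple of coordinates. -/
def coords {J : ℕ} (w : Fin J → FaceKind n) (ζ : Fin n → ℂ) (x : Fin J ⊕ Fin n → ℂ) :
    Fin (n + J) → ℂ :=
  fun j => blockCtr ζ (cls w (idx w j)) + x (idx w j)

lemma WordReg.coords_injective {x : Fin J ⊕ Fin n → ℂ} (h : WordReg w ζ x) : Injective (coords w ζ
    x) :=
  h.injective.comp (idx_injective w)

lemma coords_eq_tuple (w : Fin J → FaceKind n) (ζ : Fin n → ℂ) (x : Fin J ⊕ Fin n → ℂ) : coords w ζ
    x = tuple w (fun t => blockCtr ζ (w t).base + x (.inl t)) (fun i => ζ i + x (.inr i)) := by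
  rw [tuple_eq]; ext j; simp only [coords, comp]; rcases idx w j <;> rfl

lemma WordReg.rest {w : Fin (J + 1) → FaceKind n} {x : Fin (J + 1) → ℂ} {ξ : Fin n → ℂ} (h : WordReg
    w ζ (elim x ξ)) : WordReg (tail w) ζ (elim (tail x) ξ) := by
  let f : Fin J ⊕ Fin n → Fin (J + 1) ⊕ Fin n := Sum.map Fin.succ id
  have hx : ∀ a, elim (tail x) ξ a = elim x ξ (f a) := by rintro (a | a) <;> rfl
  have hc : ∀ a, cls (tail w) a = cls w (f a) := by rintro (a | a) <;> rfl
  have hn : ∀ a b, Newer a b → Newer (f a) (f b) := by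
    rintro (a | a) (b | b) h
    exacts [Fin.succ_lt_succ_iff.mpr h, h.elim, by trivial, h.elim]
  refine ⟨fun t => h.ne t.succ, fun a b h1 => ?_, fun a b i h1 => ?_, fun a b i j => ?_, fun a b i
    => ?_⟩
  · rw [hx, hx, hc, hc]; exact h.outer _ _ (hn _ _ h1)
  · rw [hx, hx, hc, hc]; exact h.block _ _ _ (hn _ _ h1)
  · rw [hx, hx, hc, hc]; exact h.blocks _ _ _ _
  · rw [hx, hx, hc, hc]; exact h.outer_block _ _ _

lemma coords_succ (w : Fin (J + 1) → FaceKind n) (ζ : Fin n → ℂ) (x : Fin (J + 1) → ℂ) : coords w ζ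
    (elim x 0) = ins ((w 0).map (place (tail w))).pos (((w 0).map (place (tail w))).ctr (coords
    (tail w) ζ (elim (tail x) 0)) + x 0) (coords (tail w) ζ (elim (tail x) 0)) := by
  have h : ((w 0).map (place (tail w))).ctr (coords (tail w) ζ (elim (tail x) 0)) = blockCtr ζ (w
    0).base := by
    rw [coords_eq_tuple]; rcases w 0 with _ | _ | i
    · rfl
    · rfl
    · change tuple _ _ _ (place (tail w) i) = _; rw [tuple_place]; simp [blockCtr, base]
  rw [h, coords_eq_tuple, coords_eq_tuple]; rfl

lemma WordReg.reg {w : Fin (J + 1) → FaceKind n} {x : Fin (J + 1) → ℂ} (h : WordReg w ζ (elim x 0))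
    : ((w 0).map (place (tail w))).Reg (((w 0).map (place (tail w))).ctr (coords (tail w) ζ (elim
    (tail x) 0)) + x 0) (coords (tail w) ζ (elim (tail x) 0)) := by
  have h0 : x 0 ≠ 0 := h.ne 0
  have hout : (w 0).base = none → 0 + x 0 ≠ 0 ∧ ∀ j, ‖coords (tail w) ζ (elim (tail x) 0) j‖ < ‖0 +
    x 0‖ := by
    intro hb; rw [zero_add]; refine ⟨h0, fun j => ?_⟩; simp only [coords]
    rcases idx (tail w) j with t | i
    · rcases hc : (w t.succ).base with _ | i
      · have := h.outer (.inl 0) (.inl t.succ) (Fin.succ_pos t) hb hc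
        simpa [cls, tail, hc, blockCtr] using this
      · have := h.outer_block (.inl 0) (.inl t.succ) i hb hc
        simp only [cls, tail, hc, blockCtr, elim_inl, Option.elim]
        exact lt_of_le_of_lt (norm_add_le _ _) this
    · have := h.outer_block (.inl 0) (.inr i) i hb rfl
      simp only [cls, blockCtr, elim_inr, Option.elim]; exact lt_of_le_of_lt (norm_add_le _ _) this
  rcases hw : w 0 with _ | _ | i
  · exact hout (by rw [hw]; rfl)
  · exact hout (by rw [hw]; rfl)
  · have hb : (w 0).base = some i := by rw [hw]; rfl
    have hp : coords (tail w) ζ (elim (tail x) 0) (place (tail w) i) = ζ i := by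
      rw [coords_eq_tuple, tuple_place]; simp
    change coords _ _ _ _ + x 0 ≠ coords _ _ _ _ ∧ ∀ j, j ≠ place (tail w) i → ‖coords _ _ _ _ + x 0
      - coords _ _ _ _‖ < ‖_ - coords _ _ _ _‖
    rw [hp, add_sub_cancel_left]; refine ⟨fun e => h0 (by simpa using e), fun j hj => ?_⟩
    have hij : idx (tail w) j ≠ .inr i := fun e => hj (idx_injective _ (by
      rw [e]; exact (tuple_place _ _ _ _).symm))
    simp only [coords]; rcases hidx : idx (tail w) j with t | l
    · rcases hc : (w t.succ).base with _ | l
      · have := h.outer_block (.inl t.succ) (.inl 0) i hc hb; simp only [elim_inl] at this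
        simp only [cls, tail, hc, blockCtr, elim_inl, Option.elim, zero_add]
        linarith [norm_sub_norm_le (x t.succ) (ζ i)]
      · by_cases hl : l = i
        · have := h.block (.inl 0) (.inl t.succ) i (Fin.succ_pos t) hb (by rw [← hl]; exact hc)
          simpa [cls, tail, hc, hl, blockCtr] using this
        · have := h.blocks (.inl t.succ) (.inl 0) l i hl hc hb; simp only [elim_inl] at this
          simp only [cls, tail, hc, blockCtr, elim_inl, Option.elim]
          have h2 := norm_sub_norm_le (ζ l - ζ i) (-x t.succ); rw [norm_neg, sub_neg_eq_add] at h2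
          rw [show ζ l + x t.succ - ζ i = ζ l - ζ i + x t.succ by ring]; linarith
    · have hl : l ≠ i := fun e => hij (by rw [hidx, e])
      have := h.blocks (.inr l) (.inl 0) l i hl rfl hb; simpa [cls, blockCtr] using this

/-- The multiple series of a sequence of faces converges absolutely. -/
lemma IsWord.hasSum {Z : Cochain V gr (n + J)} (h : IsWord M p Φ w Z) (u : Fin J → V) (v : Fin n →
    V) (w' : GradedDual gr) {x : Fin J → ℂ} (hx : WordReg w ζ (elim x 0)) : HasSum (fun k : Fin J →
    ℤ => wordTerm M Φ w k u v w' ζ * ∏ t, x t ^ (-k t - 1)) (cor Z w' (tuple w u v) (coords w ζ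
    (elim x 0))) := by
  induction J generalizing v w' with
  | zero =>
    obtain ⟨rfl, _⟩ := h
    refine hasSum_of_single elim0 (fun k hk => absurd (Subsingleton.elim _ _) hk) ?_
    simp only [wordTerm, Finset.univ_eq_empty, prod_empty, mul_one]; congr 1; ext i
    simp [coords, idx, tuple, cls, blockCtr]
  | succ J ih =>
    obtain ⟨Y, hY, hZ, hF⟩ := h; let Ω : Set (Fin (J + 1) → ℂ) := {x | WordReg w ζ (elim x 0)}
    have hL : HasLaurent ∅ Ω fun x => cor Z w' (tuple w u v) (coords w ζ (elim x 0)) := by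
      refine WordReg.hasLaurent (κ := Fin (J + 1)) (w := w) (ζ := ζ) (x := fun a x => elim x 0 a)
        (fun x hx i _ => hx.ne i) (fun y hy => hy) ?_ (fun s => LaurentOn.coord_inv (by simp))
        (hZ.mem_regOff w' _) (idx_injective w)
      rintro (s | i)
      · exact LaurentOn.coord s
      · change LaurentOn ∅ Ω (fun _ => 0) (fun _ => ‖(0 : ℂ)‖); exact LaurentOn.const 0
    obtain ⟨c, hc⟩ := hL.exists_coeff
    let σ : (Fin J → ℤ) × ℤ ≃ (Fin (J + 1) → ℤ) := (prodComm _ _).trans (Fin.consEquiv fun _ => ℤ)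
    have hr : ∀ t, 0 < ‖x t‖ := fun t => norm_pos_iff.mpr (hx.ne t)
    have hreg : ∀ x' : Fin (J + 1) → ℂ, (∀ t, ‖x' t‖ = ‖x t‖) → WordReg w ζ (elim x' 0) := by
      intro x' hx'
      have hn : ∀ a, ‖elim x' 0 a‖ = ‖elim x (0 : Fin n → ℂ) a‖ := by
        rintro (a | a)
        exacts [hx' a, rfl]
      refine ⟨fun t => norm_pos_iff.mp (by simpa [hx' t] using hx.ne t), fun a b => ?_,
        fun a b i => ?_, fun a b i j => ?_, fun a b i => ?_⟩
      · rw [hn, hn]; exact hx.outer a b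
      · rw [hn, hn]; exact hx.block a b i
      · rw [hn, hn]; exact hx.blocks a b i j
      · rw [hn, hn]; exact hx.outer_block a b i
    have key : (fun q => c (σ q)) = fun q : (Fin J → ℤ) × ℤ =>
        wordTerm M Φ (tail w) q.1 (tail u) ((w 0).vT A q.2 (u 0) v) ((w 0).wT M q.2 (u 0) w') ζ :=
          by
      refine Independent.refine (independent_torus (r := fun t : Fin J => ‖x t.succ‖) fun t => hr _)
        (independent_zpow_neg (hr 0)) (F := fun x' x0 => cor Z w' (tuple w u v) (coords w ζ (elim
        (cons x0 x') 0))) (g := fun k x' => cor Y ((w 0).wT M k (u 0) w') (tuple (tail w) (tail u)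
        ((w 0).vT A k (u 0) v)) (coords (tail w) ζ (elim x' 0))) ?_ ?_ ?_
      · intro x' hx' x0 hx0
        have h1 := hc (cons x0 x') (hreg _ fun t => by
          refine Fin.cases ?_ (fun t => ?_) t
          exacts [hx0, hx' t])
        rw [← σ.hasSum_iff] at h1; refine h1.of_eq fun q => ?_; simp only [comp]
        rw [prod_univ_succ, mul_comm (∏ i, x' i ^ _)]; rfl
      · intro x' hx' x0 hx0
        have h1 := hreg (cons x0 x') fun t => by
          refine Fin.cases ?_ (fun t => ?_) t
          exacts [hx0, hx' t]
        have h2 := hF (u 0) (tuple (tail w) (tail u) v) w' _ _ h1.rest.coords_injective h1.reg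
        rw [← coords_succ] at h2
        simp only [vT_map, wT_map, add_sub_cancel_left, cons_zero, tail_cons] at h2; exact h2
      · intro x' hx' k
        have h1 := (hreg (cons (x 0) x') fun t => by
          refine Fin.cases rfl (fun t => ?_) t; exact hx' t).rest
        rw [tail_cons] at h1
        have h3 := ih hY (tail u) ((w 0).vT A k (u 0) v) ((w 0).wT M k (u 0) w') h1; exact h3
    have h1 := hc x hx; rw [← σ.hasSum_iff] at h1; rw [← σ.hasSum_iff]
    refine h1.of_eq fun q => ?_; exact congrArg (· * _) (congrFun key q)

lemma WordReg.of_norm_eq {x y : Fin J ⊕ Fin n → ℂ} (h : WordReg w ζ x) (hxy : ∀ a, ‖y a‖ = ‖x a‖) :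
    WordReg w ζ y := by
  refine ⟨fun t => norm_pos_iff.mp (by simpa [hxy] using h.ne t), fun a b => ?_,
    fun a b i => ?_, fun a b i j => ?_, fun a b i => ?_⟩
  · rw [hxy, hxy]; exact h.outer a b
  · rw [hxy, hxy]; exact h.block a b i
  · rw [hxy, hxy]; exact h.blocks a b i j
  · rw [hxy, hxy]; exact h.outer_block a b i

lemma WordReg.eventually {X : Type*} [TopologicalSpace X] {ζ : X → Fin n → ℂ} {x : X → Fin J ⊕ Fin n
    → ℂ} {a : X} (hζ : ContinuousAt ζ a) (hx : ContinuousAt x a) (h : WordReg w (ζ a) (x a)) : ∀ᶠ b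
    in 𝓝 a, WordReg w (ζ b) (x b) := by
  have hx' : ∀ s, ContinuousAt (fun b => ‖x b s‖) a := fun s => (continuousAt_pi.mp hx s).norm
  have hζ' : ∀ i, ContinuousAt (fun b => ζ b i) a := fun i => continuousAt_pi.mp hζ i
  have himp : ∀ {p : Prop} {q : X → Prop}, (p → ∀ᶠ b in 𝓝 a, q b) → ∀ᶠ b in 𝓝 a, p → q b := fun h =>
    Filter.eventually_imp_distrib_left.mpr h
  have h1 : ∀ᶠ b in 𝓝 a, ∀ t, x b (.inl t) ≠ 0 := eventually_all.mpr fun t =>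
    (continuousAt_pi.mp hx _).eventually_ne (h.ne t)
  have h2 : ∀ᶠ b in 𝓝 a, ∀ s t, Newer s t → cls w s = none → cls w t = none → ‖x b t‖ < ‖x b s‖ :=
    eventually_all.mpr fun s => Filter.eventually_all.mpr fun t =>
    himp fun e1 => himp fun e2 => himp fun e3 =>
      (hx' t).eventually_lt (hx' s) (h.outer s t e1 e2 e3)
  have h3 : ∀ᶠ b in 𝓝 a, ∀ s t i, Newer s t → cls w s = some i → cls w t = some i → ‖x b s‖ < ‖x b
    t‖ := eventually_all.mpr fun s => Filter.eventually_all.mpr fun t =>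
    eventually_all.mpr fun i => himp fun e1 => himp fun e2 => himp fun e3 =>
      (hx' s).eventually_lt (hx' t) (h.block s t i e1 e2 e3)
  have h4 : ∀ᶠ b in 𝓝 a, ∀ s t i j, i ≠ j → cls w s = some i → cls w t = some j → ‖x b s‖ + ‖x b t‖
    < ‖ζ b i - ζ b j‖ := eventually_all.mpr fun s =>
    eventually_all.mpr fun t => Filter.eventually_all.mpr fun i =>
    eventually_all.mpr fun j => himp fun e1 => himp fun e2 => himp fun e3 =>
      ((hx' s).add (hx' t)).eventually_lt ((hζ' i).sub (hζ' j)).norm (h.blocks s t i j e1 e2 e3)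
  have h5 : ∀ᶠ b in 𝓝 a, ∀ s t i, cls w s = none → cls w t = some i → ‖ζ b i‖ + ‖x b t‖ < ‖x b s‖ :=
    eventually_all.mpr fun s =>
    eventually_all.mpr fun t => Filter.eventually_all.mpr fun i =>
    himp fun e1 => himp fun e2 =>
      ((hζ' i).norm.add (hx' t)).eventually_lt (hx' s) (h.outer_block s t i e1 e2)
  filter_upwards [h1, h2, h3, h4, h5] with b e1 e2 e3 e4 e5
  exact ⟨e1, e2, e3, e4, e5⟩

lemma exists_wordReg (w : Fin J → FaceKind n) : ∃ ζ x, WordReg w ζ (elim x 0) := by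
  let x : Fin J → ℂ := fun t => match (w t).base with
    | none => ((n + 1 + (J - t) : ℝ) : ℂ)
    | some _ => (((t + 1) / (4 * (J + 1)) : ℝ) : ℂ)
  have hJ : (0 : ℝ) < J + 1 := by positivity
  have ht : ∀ t : Fin J, (t : ℝ) + 1 ≤ J := fun t => by exact_mod_cast t.2
  have h1 : ∀ t, (w t).base = none → ‖x t‖ = n + 1 + (J - t) := by
    intro t e; simp only [x, e]; rw [Complex.norm_real, Real.norm_of_nonneg]; have := ht t
    have : (0 : ℝ) ≤ n := by positivity
    linarith
  have h2 : ∀ t i, (w t).base = some i → ‖x t‖ = (t + 1) / (4 * (J + 1)) := by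
    intro t i e; simp only [x, e]; rw [Complex.norm_real, Real.norm_of_nonneg (by positivity)]
  have h3 : ∀ a i, cls w a = some i → ‖elim x (0 : Fin n → ℂ) a‖ < 1 / 4 := by
    rintro (t | l) i e
    · rw [elim_inl, h2 t i e, div_lt_div_iff₀ (by positivity) (by norm_num)]; linarith [ht t]
    · simp
  have h4 : ∀ i : Fin n, ‖((i : ℕ) : ℂ)‖ + 1 ≤ n := fun i => by
    rw [Complex.norm_natCast]; exact_mod_cast i.2
  refine ⟨fun i => ((i : ℕ) : ℂ), x, fun t => norm_pos_iff.mp ?_, ?_, ?_, ?_, ?_⟩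
  · rw [elim_inl]; rcases e : (w t).base with _ | i
    · rw [h1 t e]; have := ht t; have : (0 : ℝ) ≤ n := by positivity
      linarith
    · rw [h2 t i e]; positivity
  · rintro (s | s) (t | t) hn e1 e2
    · rw [elim_inl, elim_inl, h1 s e1, h1 t e2]; have : (s : ℝ) < t := by exact_mod_cast hn
      linarith
    · exact hn.elim
    · simp [cls] at e1
    · exact hn.elim
  · rintro (s | s) (t | t) i hn e1 e2
    · rw [elim_inl, elim_inl, h2 s i e1, h2 t i e2]; have : (s : ℝ) < t := by exact_mod_cast hn
      gcongr
    · exact hn.elim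
    · rw [elim_inl, elim_inr, h2 t i e2, Pi.zero_apply, norm_zero]; positivity
    · exact hn.elim
  · intro a b i j hij e1 e2
    have h5 : (1 : ℝ) ≤ ‖((i : ℕ) : ℂ) - ((j : ℕ) : ℂ)‖ := by
      have : (i : ℤ) - (j : ℤ) ≠ 0 := sub_ne_zero.mpr fun h => hij (Fin.ext (by exact_mod_cast h))
      have h6 : (1 : ℝ) ≤ ‖(((i : ℤ) - (j : ℤ) : ℤ) : ℂ)‖ := by
        rw [Complex.norm_intCast]; exact_mod_cast Int.one_le_abs this
      simpa using h6
    linarith [h3 a i e1, h3 b j e2]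
  · rintro (s | s) b i e1 e2
    · rw [elim_inl, h1 s e1]; linarith [h3 b i e2, h4 i, ht s]
    · simp [cls] at e1

/-- Points near which the most recent variable may move on a circle. -/
lemma exists_face_point (w : Fin (J + 1) → FaceKind n) : ∃ y₀ : Fin (n + J) → ℂ, ∀ᶠ y in 𝓝 y₀, ∃ ρ >
    0, ∃ ζ x, coords (tail w) ζ (elim x 0) = y ∧ ∀ x₀ : ℂ, ‖x₀‖ = ρ → WordReg w ζ (elim (cons x₀ x :
    Fin (J + 1) → ℂ) 0) := by
  obtain ⟨ζ₀, x₀, h₀⟩ := exists_wordReg w; let e := ofBijective _ (idx_bijective (n := n) (tail w))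
  let ζ : (Fin (n + J) → ℂ) → Fin n → ℂ := fun y i => y (e.symm (.inr i))
  let x : (Fin (n + J) → ℂ) → Fin J → ℂ := fun y t =>
    y (e.symm (.inl t)) - blockCtr (ζ y) (tail w t).base
  let y₀ := coords (tail w) ζ₀ (elim (tail x₀) 0)
  have hy : ∀ a, y₀ (e.symm a) = blockCtr ζ₀ (cls (tail w) a) + elim (tail x₀) 0 a := by
    intro a; have : idx (tail w) (e.symm a) = a := e.apply_symm_apply a
    simp only [y₀, coords, this]
  have hζ₀ : ζ y₀ = ζ₀ := by ext i; simp only [ζ, hy]; simp [cls, blockCtr]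
  have hx₀ : x y₀ = tail x₀ := by ext t; simp only [x, hy, hζ₀]; simp [cls]
  have hζc : Continuous ζ := by fun_prop
  have hxc : Continuous x := by
    refine continuous_pi fun t => ?_; simp only [x]; rcases (tail w t).base with _ | i
    · simp only [blockCtr, Option.elim]; fun_prop
    · simp only [blockCtr, Option.elim]; fun_prop
  have hc : Continuous fun y => (elim (cons (x₀ 0) (x y) : Fin (J + 1) → ℂ) 0 : Fin (J + 1) ⊕ Fin n
    → ℂ) := by
    refine continuous_pi fun a => ?_; rcases a with t | i
    · refine Fin.cases ?_ (fun t => ?_) t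
      exacts [continuous_const, (continuous_apply t).comp hxc]
    · exact continuous_const
  refine ⟨y₀, (WordReg.eventually (w := w) hζc.continuousAt hc.continuousAt ?_).mono fun y h => ⟨‖x₀
    0‖, norm_pos_iff.mpr (h₀.ne 0), ζ y, x y, ?_, fun x' hx' => ?_⟩⟩
  · rw [hζ₀, hx₀, Fin.cons_self_tail]; exact h₀
  · ext j; obtain ⟨a, rfl⟩ := e.symm.surjective j
    have : idx (tail w) (e.symm a) = a := e.apply_symm_apply a; simp only [coords, this]
    rcases a with t | i
    · simp [x, cls]
    · simp [ζ, cls, blockCtr]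
  · refine h.of_norm_eq ?_; rintro (t | i)
    · refine Fin.cases ?_ (fun t => ?_) t
      exacts [hx', rfl]
    · rfl

lemma hasSum_cons {f : (Fin (J + 1) → ℤ) → ℂ} {S : ℂ} (h : HasSum f S) {g : ℤ → ℂ} (hg : ∀ k, HasSum
    (fun l : Fin J → ℤ => f (cons k l)) (g k)) : HasSum g S := by
  rw [← (Fin.consEquiv fun _ => ℤ).hasSum_iff] at h; exact h.prod_fiberwise hg

lemma IsWord.hasSum_faceTerm {w : Fin (J + 1) → FaceKind n} {Y : Cochain V gr (n + J)} (hY : IsWord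
    M p Φ (tail w) Y) {u : Fin (J + 1) → V} {v : Fin n → V} {w' : GradedDual gr} {x : Fin (J + 1) →
    ℂ} (hx : WordReg w ζ (elim x 0)) {S : ℂ} (h : HasSum (fun k => wordTerm M Φ w k u v w' ζ * ∏ t,
    x t ^ (-k t - 1)) S) : HasSum (fun k => faceTerm M ((w 0).map (place (tail w))) Y k (u 0) (tuple
    (tail w) (tail u) v) w' (coords (tail w) ζ (elim (tail x) 0)) * x 0 ^ (-k - 1)) S := by
  refine hasSum_cons h fun k => ?_
  have h1 := (hY.hasSum (tail u) ((w 0).vT A k (u 0) v) ((w 0).wT M k (u 0) w') hx.rest).mul_right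
    (x 0 ^ (-k - 1))
  rw [faceTerm, vT_map, wT_map]; refine h1.of_eq fun l => ?_
  rw [prod_univ_succ, mul_assoc, mul_comm (∏ _, _)]; rfl

/-- A sequence of faces can be extended when the corresponding multiple series converge to rational
functions. -/
lemma IsWord.extend {w : Fin (J + 1) → FaceKind n} {Y : Cochain V gr (n + J)} (hY : IsWord M p Φ
    (tail w) Y) (h : ∀ u v w', ∃ h : MvPolynomial (Fin (n + (J + 1))) ℂ, ∀ ζ x, WordReg w ζ (elim x
    0) → HasSum (fun k => wordTerm M Φ w k u v w' ζ * ∏ t, x t ^ (-k t - 1)) (eval (coords w ζ (elim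
    x 0)) h / poleProd p (tuple w u v) (coords w ζ (elim x 0)))) : ∃ Z, IsWord M p Φ w Z := by
  suffices h : ∃ Z, Regular M p Z ∧ Face M ((w 0).map (place (tail w))) Y Z by
    obtain ⟨Z, h⟩ := h; exact ⟨Z, Y, hY, h⟩
  refine exists_face hY.regular fun u v w' => ?_
  let e := ofBijective _ (idx_bijective (n := n) (tail w))
  let v' : Fin n → V := fun i => v (e.symm (.inr i))
  let u' : Fin J → V := fun t => v (e.symm (.inl t))
  have hv : tuple (tail w) u' v' = v := by
    rw [tuple_eq]; ext j; have hj : e.symm (idx (tail w) j) = j := e.symm_apply_apply j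
    simp only [comp]; rcases hi : idx (tail w) j with t | i
    · rw [hi] at hj; simp [u', hj]
    · rw [hi] at hj; simp [v', hj]
  obtain ⟨g, hg⟩ := h (cons u u') v' w'; obtain ⟨y₀, hy₀⟩ := exists_face_point w
  refine ⟨g, y₀, hy₀.mono ?_⟩; rintro y ⟨ρ, hρ, ζ, x, rfl, hx⟩; refine ⟨ρ, hρ, fun x₀ hx₀ => ?_⟩
  have h1 := (hx x₀ hx₀).reg; have h2 := hY.hasSum_faceTerm (hx x₀ hx₀) (hg ζ _ (hx x₀ hx₀))
  rw [coords_succ] at h2; simp only [tail_cons, cons_zero] at h1 h2; rw [hv] at h2; refine ⟨h1, ?_⟩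
  have h3 : tuple w (cons u u') v' = ins ((w 0).map (place (tail w))).pos u v := by
    simp only [tuple, cons_zero, tail_cons, hv]
  rw [h3] at h2; exact h2

/-! ### Faces at different arguments commute -/

lemma val_succAbove (q : Fin (n + 1)) (i : Fin n) : (q.succAbove i : ℕ) = if (i : ℕ) < q then (i :
    ℕ) else i + 1 := by
  simp only [Fin.succAbove, Fin.lt_def, val_castSucc]; split_ifs <;> simp

lemma FaceKind.map_id (κ : FaceKind n) : κ.map id = κ := by cases κ <;> rfl

lemma FaceKind.map_place_zero (κ : FaceKind n) (w : Fin 0 → FaceKind n) : κ.map (place w) = κ :=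
  κ.map_id

lemma place_one (w : Fin 1 → FaceKind n) (i : Fin n) : place w i = (w 0).pos.succAbove i := by
  simp only [place, map_id]; rfl

lemma tuple_one {X : Type*} (w : Fin 1 → FaceKind n) (u : Fin 1 → X) (v : Fin n → X) : tuple w u v =
    ins (w 0).pos (u 0) v := by
  simp only [tuple, map_place_zero]

lemma tuple_two {X : Type*} (w : Fin 2 → FaceKind n) (u : Fin 2 → X) (v : Fin n → X) : tuple w u v =
    ins ((w 0).map (w 1).pos.succAbove).pos (u 0) (ins (w 1).pos (u 1) v) := by
  have : place (tail w) = (w 1).pos.succAbove := funext fun i => place_one _ i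
  rw [tuple, this, tuple_one]; rfl

lemma IsWord.one {X : Cochain V gr (n + 1)} {w : Fin 1 → FaceKind n} (hΨ : Regular M p Ψ) (hX :
    Regular M p X) (h : Face M (w 0) Ψ X) : IsWord M p Ψ w X :=
  ⟨Ψ, ⟨rfl, hΨ⟩, hX, by rwa [map_place_zero]⟩

lemma IsWord.two {X : Cochain V gr (n + 1)} {Z : Cochain V gr (n + 2)} {w : Fin 2 → FaceKind n} (hΨ
    : Regular M p Ψ) (hX : Regular M p X) (hZ : Regular M p Z) (h : Face M (w 1) Ψ X) (h' : Face M
    ((w 0).map (w 1).pos.succAbove) X Z) : IsWord M p Ψ w Z := by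
  refine ⟨X, IsWord.one hΨ hX h, hZ, ?_⟩
  have : place (tail w) = (w 1).pos.succAbove := funext fun i => place_one _ i; rwa [this]

lemma hasSum_two {f : (Fin 2 → ℤ) → ℂ} {S : ℂ} (h : HasSum f S) : HasSum (fun k : ℤ × ℤ => f ![k.1,
    k.2]) S :=
  (finTwoArrowEquiv ℤ).symm.hasSum_iff.mpr h

lemma ins_ins {X : Type*} {P P' : Fin (n + 2)} {q q' : Fin (n + 1)} (h1 : P.succAbove q = P') (h2 :
    P'.succAbove q' = P) (h3 : ∀ m, P.succAbove (q.succAbove m) = P'.succAbove (q'.succAbove m)) (a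
    b : X) (v : Fin n → X) : ins P a (ins q b v) = ins P' b (ins q' a v) := by
  ext l; refine succAboveCases P ?_ (fun l => ?_) l
  · rw [ins_same]
    conv_rhs => rw [← h2, ins_succAbove, ins_same]
  · refine succAboveCases q ?_ (fun l => ?_) l
    · rw [ins_succAbove, ins_same, h1, ins_same]
    · rw [ins_succAbove, ins_succAbove, h3, ins_succAbove, ins_succAbove]

lemma ins_comm {X : Type*} (κ : FaceKind n) {i : Fin n} (hi : κ.base ≠ some i) (a b : X) (v : Fin n
    → X) : ins (κ.map i.castSucc.succAbove).pos a (ins i.castSucc b v) = ins (κ.pos.succAbove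
    i).castSucc b (ins κ.pos a v) := by
  refine ins_ins ?_ ?_ (fun m => ?_) a b v
  all_goals
    rcases κ with _ | _ | j
    · simp only [map, pos, Fin.ext_iff, val_succAbove, val_castSucc, val_zero]
      grind
    · simp only [map, pos, Fin.ext_iff, val_succAbove, val_castSucc, val_last]
      split_ifs <;> omega
    · have hij : (j : ℕ) ≠ i := fun h => hi (by rw [base, Fin.ext h])
      simp only [map, pos, Fin.ext_iff, val_succAbove, val_castSucc]; split_ifs <;> omega

lemma WordReg.swap {w : Fin 2 → FaceKind n} (hw : (w 0).base ≠ (w 1).base) {x : Fin 2 → ℂ} {ξ : Fin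
    n → ℂ} (h : WordReg ![w 1, w 0] ζ (elim ![x 1, x 0] ξ)) : WordReg w ζ (elim x ξ) := by
  let f : Fin 2 ⊕ Fin n → Fin 2 ⊕ Fin n := Sum.map Fin.rev id
  have hx : ∀ a, elim x ξ a = elim ![x 1, x 0] ξ (f a) := by
    rintro (a | a)
    · fin_cases a <;> rfl
    · rfl
  have hc : ∀ a, cls w a = cls ![w 1, w 0] (f a) := by
    rintro (a | a)
    · fin_cases a <;> rfl
    · rfl
  have hn : ∀ a b, cls w a = cls w b → Newer a b → Newer (f a) (f b) := by
    rintro (a | a) (b | b) h1 h2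
    · exfalso
      have h3 : a < b := h2; have ha : a = 0 := by omega
      have hb : b = 1 := by omega
      subst ha hb; exact hw h1
    exacts [h2.elim, by trivial, h2.elim]
  refine ⟨fun t => ?_, fun a b h1 h2 h3 => ?_, fun a b i h1 h2 h3 => ?_, fun a b i j => ?_, fun a b
    i => ?_⟩
  · rw [hx]; exact h.ne t.rev
  · rw [hx, hx]; exact h.outer _ _ (hn _ _ (h2.trans h3.symm) h1) (hc a ▸ h2) (hc b ▸ h3)
  · rw [hx, hx]; exact h.block _ _ i (hn _ _ (h2.trans h3.symm) h1) (hc a ▸ h2) (hc b ▸ h3)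
  · rw [hx, hx, hc, hc]; exact h.blocks _ _ _ _
  · rw [hx, hx, hc, hc]; exact h.outer_block _ _ _

lemma Face.commute {X Y : Cochain V gr (n + 1)} {Z : Cochain V gr (n + 2)} {i : Fin n} (hi : κ.base
    ≠ some i) (hΨ : Regular M p Ψ) (hX : Regular M p X) (hY : Regular M p Y) (hZ : Regular M p Z)
    (h1 : Face M (.mid i) Ψ Y) (h2 : Face M (κ.map i.castSucc.succAbove) Y Z) (h3 : Face M κ Ψ X) :
    Face M (.mid (κ.pos.succAbove i)) X Z := by
  have hw : IsWord M p Ψ ![κ, .mid i] Z := IsWord.two hΨ hY hZ h1 h2; intro u v w' t y hy ht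
  obtain ⟨y₀, hy₀⟩ := exists_face_point (![.mid i, κ] : Fin 2 → FaceKind n)
  refine extend (.mid (κ.pos.succAbove i)) (hZ.mem_regOff w' _) (fun k => faceTerm_mem_regOff hX k u
    v w') (y₀ := y₀) (hy₀.mono ?_) hy ht
  rintro y ⟨ρ, hρ, ζ, x, rfl, hx⟩; refine ⟨ρ, hρ, fun x₀ hx₀ => ?_⟩; have e1 := hx x₀ hx₀
  have e2 : WordReg ![κ, .mid i] ζ (elim ![x 0, x₀] 0) := by
    refine WordReg.swap hi ?_
    have : (![x₀, x 0] : Fin 2 → ℂ) = cons x₀ x := by ext j; fin_cases j <;> rfl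
    rw [← this] at e1; exact e1
  have hw2 : IsWord M p Ψ (tail ![.mid i, κ]) X := IsWord.one hΨ hX h3
  have hκ : (mid i).map (place (tail ![.mid i, κ])) = .mid (κ.pos.succAbove i) := by
    rw [map, place_one]; rfl
  have e3 := e1.reg; have e6 := coords_succ ![.mid i, κ] ζ (cons x₀ x : Fin 2 → ℂ)
  simp only [tail_cons, cons_zero, cons_val_zero, hκ] at e3 e6; refine ⟨e3, ?_⟩
  have hv : ins κ.pos (v κ.pos) (fun j => v (κ.pos.succAbove j)) = v := ins_self _ _
  have e4 := hw.hasSum ![v κ.pos, u] (fun j => v (κ.pos.succAbove j)) w' e2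
  have hco : coords ![κ, .mid i] ζ (elim ![x 0, x₀] 0) = coords ![.mid i, κ] ζ (elim (cons x₀ x :
    Fin 2 → ℂ) 0) := by
    rw [coords_eq_tuple, coords_eq_tuple, tuple_two, tuple_two]; exact ins_comm κ hi _ _ _
  have htu : tuple ![κ, .mid i] ![v κ.pos, u] (fun j => v (κ.pos.succAbove j)) = ins
    (κ.pos.succAbove i).castSucc u v := by
    conv_rhs => rw [← hv]
    rw [tuple_two]; exact ins_comm κ hi _ _ _
  rw [hco, htu, e6] at e4; have e7 := hasSum_two e4; rw [← (prodComm ℤ ℤ).hasSum_iff] at e7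
  refine e7.prod_fiberwise fun k => ?_
  have e5 := (hw2.hasSum (fun _ => v κ.pos) ((mid i).vT A k u fun j => v (κ.pos.succAbove j)) w'
    e1.rest).mul_right (x₀ ^ (-k - 1))
  have hv2 : tuple (tail ![.mid i, κ]) (fun _ => v κ.pos) ((mid i).vT A k u fun j => v
    (κ.pos.succAbove j)) = (mid (κ.pos.succAbove i)).vT A k u v := by
    rw [tuple_one]
    conv_rhs => rw [← hv]
    simp only [vT, update_ins_succAbove, ins_succAbove]; rfl
  rw [hv2, tail_cons, ← (Equiv.funUnique (Fin 1) ℤ).symm.hasSum_iff] at e5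
  refine e5.of_eq fun l => ?_
  have hcomm : (mid i).vT A k u (κ.vT A l (v κ.pos) fun j => v (κ.pos.succAbove j)) = κ.vT A l (v
    κ.pos) ((mid i).vT A k u fun j => v (κ.pos.succAbove j)) := by
    rcases κ with _ | _ | j
    · rfl
    · rfl
    · have hij : i ≠ j := fun h => hi (by rw [h]; rfl)
      simp only [vT, update_of_ne hij, update_of_ne hij.symm]; rw [update_comm hij.symm]
  simp only [comp, prodComm_apply, Prod.swap, prod_univ_two, Fin.prod_univ_one]
  have h4 : wordTerm M Ψ ![κ, .mid i] ![l, k] ![v κ.pos, u] (fun j => v (κ.pos.succAbove j)) w' ζ =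
    cor Ψ (κ.wT M l (v κ.pos) w') ((mid i).vT A k u (κ.vT A l (v κ.pos) fun j => v (κ.pos.succAbove
    j))) ζ := rfl
  rw [h4, hcomm, mul_assoc]; rfl

/-! ## Binomial expansions -/

/-- The binomial coefficient `x (x - 1) ⋯ (x - r + 1) / r!`. -/
def gbinom (x : ℂ) (r : ℕ) : ℂ := (∏ q ∈ range r, (x - q)) / (factorial r : ℂ)

lemma gbinom_natCast (N r : ℕ) : gbinom N r = N.choose r := by
  rw [gbinom, ← descPochhammer_eval_eq_prod_range, descPochhammer_eval_eq_descFactorial,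
    Nat.descFactorial_eq_factorial_mul_choose, Nat.cast_mul, mul_div_cancel_left₀ _ (by
    exact_mod_cast Nat.factorial_ne_zero r)]

lemma gbinom_neg (m r : ℕ) : gbinom (r - m - 1) r = (-1) ^ r * m.choose r := by
  rw [← gbinom_natCast, gbinom, gbinom, ← Finset.prod_range_reflect, ← mul_div_assoc]; congr 1
  rw [← Finset.card_range r, ← Finset.prod_const, Finset.card_range, ← prod_mul_distrib]
  refine prod_congr rfl fun q hq => ?_; have : q + 1 ≤ r := Finset.mem_range.mp hq
  rw [show r - 1 - q = r - (q + 1) by omega, Nat.cast_sub this]; push_cast; ring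

lemma hasSum_sub_zpow (k : ℤ) {s t : ℂ} (h : ‖t‖ < ‖s‖) : HasSum (fun r : ℕ => gbinom (k + r) r * s
    ^ (-k - 1 - r) * t ^ r) ((s - t) ^ (-k - 1)) := by
  have hs : s ≠ 0 := norm_pos_iff.mp (lt_of_le_of_lt (norm_nonneg t) h)
  obtain ⟨m, rfl | rfl⟩ : ∃ m : ℕ, k = m ∨ k = -(m + 1 : ℤ) := by
    rcases le_or_gt 0 k with hk | hk
    exacts [⟨k.toNat, Or.inl (by omega)⟩, ⟨(-k - 1).toNat, Or.inr (by omega)⟩]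
  · have h1 : ‖t / s‖ < 1 := by rwa [norm_div, div_lt_one (norm_pos_iff.mpr hs)]
    have h2 := (hasSum_choose_mul_geometric_of_norm_lt_one m h1).mul_left (s ^ (-(m : ℤ) - 1))
    have h3 : s ^ (-(m : ℤ) - 1) * (1 / (1 - t / s) ^ (m + 1)) = (s - t) ^ (-(m : ℤ) - 1) := by
      rw [show (-(m : ℤ) - 1) = -((m + 1 : ℕ) : ℤ) by push_cast; ring, zpow_neg, zpow_neg,
        zpow_natCast, zpow_natCast, one_div, ← mul_inv, ← mul_pow, mul_sub, mul_one,
        mul_div_cancel₀ _ hs]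
    rw [h3] at h2; refine h2.of_eq fun r => ?_
    rw [show (((m : ℤ) : ℂ) + r) = ((m + r : ℕ) : ℂ) by push_cast; ring, gbinom_natCast,
      add_comm r m, Nat.choose_symm_add, zpow_sub₀ hs _ (r : ℤ), zpow_natCast, div_pow]
    ring
  · have h1 := add_pow (-t) s m
    rw [show -(-(m + 1 : ℤ)) - 1 = (m : ℤ) by ring, zpow_natCast, sub_eq_neg_add, h1]
    refine (hasSum_sum_of_ne_finset_zero (f := fun r : ℕ => (-t) ^ r * s ^ (m - r) * (m.choose r :
      ℂ)) fun r hr => ?_).of_eq fun r => ?_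
    · rw [Nat.choose_eq_zero_of_lt (by simpa using hr), Nat.cast_zero, mul_zero]
    · rw [show (((-(m + 1 : ℤ) : ℤ) : ℂ) + r) = r - m - 1 by push_cast; ring, gbinom_neg]
      rcases le_or_gt r m with hr | hr
      · rw [show (m : ℤ) - r = ((m - r : ℕ) : ℤ) by omega, zpow_natCast, neg_pow]; ring
      · rw [Nat.choose_eq_zero_of_lt hr]; simp

lemma hasSum_norm_sub_zpow (k : ℤ) {s t : ℂ} (h : ‖t‖ < ‖s‖) : HasSum (fun r : ℕ => ‖gbinom (k + r)
    r * s ^ (-k - 1 - r) * t ^ r‖) ((if 0 ≤ k then ‖s‖ - ‖t‖ else ‖s‖ + ‖t‖) ^ (-k - 1)) := by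
  rw [← Complex.hasSum_ofReal]; split_ifs with hk
  · have h1 := hasSum_sub_zpow k (s := (‖s‖ : ℂ)) (t := (‖t‖ : ℂ)) (by simpa using h)
    rw [Complex.ofReal_zpow, Complex.ofReal_sub]; refine h1.of_eq fun r => ?_
    obtain ⟨m, rfl⟩ := Int.eq_ofNat_of_zero_le hk
    rw [show (((m : ℤ) : ℂ) + r) = ((m + r : ℕ) : ℂ) by push_cast; ring, gbinom_natCast]; simp
  · have h1 := hasSum_sub_zpow k (s := (‖s‖ : ℂ)) (t := (-‖t‖ : ℂ)) (by simpa using h)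
    rw [Complex.ofReal_zpow, Complex.ofReal_add, ← sub_neg_eq_add]
    refine h1.of_eq fun r => ?_
    obtain ⟨m, rfl⟩ : ∃ m : ℕ, k = -(m + 1 : ℤ) := ⟨(-k - 1).toNat, by omega⟩
    rw [show (((-(m + 1 : ℤ) : ℤ) : ℂ) + r) = r - m - 1 by push_cast; ring, gbinom_neg,
      neg_pow]
    have : ((-1 : ℂ) ^ r) * (-1) ^ r = 1 := by rw [← mul_pow]; simp
    simp only [norm_mul, norm_pow, norm_neg, norm_one, one_pow, one_mul, norm_zpow,
      RCLike.norm_natCast, Complex.ofReal_mul, Complex.ofReal_natCast, Complex.ofReal_pow,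
      Complex.ofReal_zpow]
    linear_combination (((m.choose r : ℂ)) * (‖s‖ : ℂ) ^ (-(-(m + 1 : ℤ)) - 1 - (r : ℤ)) * (‖t‖ : ℂ)
      ^ r) * this

/-- Re-expansion of a double series in which the first variable is translated. -/
lemma hasSum_reexpand {a : ℤ × ℤ → ℂ} {g : ℂ → ℂ → ℂ} (h : ∀ z₁ z₂ : ℂ, 0 < ‖z₂‖ → ‖z₂‖ < ‖z₁‖ →
    HasSum (pairTerm a z₁ z₂) (g z₁ z₂)) {s t : ℂ} (ht : 0 < ‖t‖) (hst : 2 * ‖t‖ < ‖s‖) : HasSum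
    (fun q : (ℤ × ℤ) × ℕ => a q.1 * ((gbinom (q.1.1 + q.2) q.2 * s ^ (-q.1.1 - 1 - q.2) * t ^ q.2) *
    (-t) ^ (-q.1.2 - 1))) (g (s - t) (-t)) := by
  have hts : ‖t‖ < ‖s‖ := by linarith
  have h1 : ∀ k : ℤ × ℤ, HasSum (fun r : ℕ => a k * ((gbinom (k.1 + r) r * s ^ (-k.1 - 1 - r) * t ^
    r) * (-t) ^ (-k.2 - 1))) (pairTerm a (s - t) (-t) k) := fun k =>
    ((hasSum_sub_zpow k.1 hts).mul_right _).mul_left _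
  have h2 : ∀ k : ℤ × ℤ, HasSum (fun r : ℕ => ‖a k * ((gbinom (k.1 + r) r * s ^ (-k.1 - 1 - r) * t ^
    r) * (-t) ^ (-k.2 - 1))‖) (‖a k‖ * ((if 0 ≤ k.1 then ‖s‖ - ‖t‖ else ‖s‖ + ‖t‖) ^ (-k.1 - 1) *
    ‖t‖ ^ (-k.2 - 1))) := fun k => by
    simp only [norm_mul (a k), norm_mul _ ((-t) ^ (-k.2 - 1)), norm_zpow (-t), norm_neg t]
    exact ((hasSum_norm_sub_zpow k.1 hts).mul_right (‖t‖ ^ (-k.2 - 1))).mul_left ‖a k‖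
  have hn : ∀ r : ℝ, 0 ≤ r → ‖(r : ℂ)‖ = r := fun r hr => by simp [abs_of_nonneg hr]
  have e1 := hn (‖s‖ - ‖t‖) (by linarith); have e2 := hn (‖s‖ + ‖t‖) (by linarith)
  have e3 := hn ‖t‖ ht.le
  have h3 := (h ((‖s‖ - ‖t‖ : ℝ) : ℂ) (‖t‖ : ℂ) (by rwa [e3])
    (by rw [e1, e3]; linarith)).summable.norm
  have h4 := (h ((‖s‖ + ‖t‖ : ℝ) : ℂ) (‖t‖ : ℂ) (by rwa [e3])
    (by rw [e2, e3]; linarith)).summable.norm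
  have h5 : Summable fun k : ℤ × ℤ => ‖a k‖ * ((if 0 ≤ k.1 then ‖s‖ - ‖t‖ else ‖s‖ + ‖t‖) ^ (-k.1 -
    1) * ‖t‖ ^ (-k.2 - 1)) := by
    refine Summable.of_nonneg_of_le (fun k => ?_) (fun k => ?_) (h3.add h4)
    · have : 0 ≤ ‖s‖ - ‖t‖ := by linarith
      positivity
    · have e4 : 0 ≤ ‖pairTerm a ((‖s‖ - ‖t‖ : ℝ) : ℂ) (‖t‖ : ℂ) k‖ := norm_nonneg _
      have e5 : 0 ≤ ‖pairTerm a ((‖s‖ + ‖t‖ : ℝ) : ℂ) (‖t‖ : ℂ) k‖ := norm_nonneg _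
      simp only [pairTerm, norm_mul, norm_zpow, e1, e2, e3] at e4 e5 ⊢; split_ifs <;> linarith
  have h6 : Summable (fun q : (ℤ × ℤ) × ℕ => a q.1 * ((gbinom (q.1.1 + q.2) q.2 * s ^ (-q.1.1 - 1 -
    q.2) * t ^ q.2) * (-t) ^ (-q.1.2 - 1))) := by
    refine Summable.of_norm ((summable_prod_of_nonneg fun _ => norm_nonneg _).mpr ⟨fun k => (h2
      k).summable, ?_⟩)
    refine h5.congr fun k => ?_; rw [(h2 k).tsum_eq]
  have h7 := h6.hasSum
  rwa [(h7.prod_fiberwise h1).unique (h (s - t) (-t) (by rwa [norm_neg]) (by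
    rw [norm_neg]; linarith [norm_sub_norm_le s t]))] at h7

lemma hasSum_regroup {D : ℤ × ℤ → ℂ} {term : ℤ × ℤ → ℕ × ℕ → ℂ} {s t : ℂ} {φ : ℕ → ℂ} (h1 : ∀ k,
    HasSum (term k) (D k)) (h2 : ∀ k m r, J ≤ m → term k (m, r) = 0) (h3 : ∀ m < J, HasSum (fun q :
    (ℤ × ℤ) × ℕ => term q.1 (m, q.2) * (s ^ (-q.1.1 - 1) * t ^ (-q.1.2 - 1))) (φ m)) : HasSum
    (pairTerm D s t) (∑ m ∈ range J, φ m) := by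
  have h0 : ∀ k m, HasSum (fun r => term k (m, r)) (∑' r, term k (m, r)) := fun k m =>
    ((h1 k).summable.prod_factor m).hasSum
  have h4 : ∀ m ∈ range J, HasSum (fun k : ℤ × ℤ => (∑' r, term k (m, r)) * (s ^ (-k.1 - 1) * t ^
    (-k.2 - 1))) (φ m) := fun m hm => by
    have h5 := h3 m (Finset.mem_range.mp hm)
    have h6 : ∀ k : ℤ × ℤ, HasSum (fun r => term k (m, r) * (s ^ (-k.1 - 1) * t ^ (-k.2 - 1))) ((∑'
      r, term k (m, r)) * (s ^ (-k.1 - 1) * t ^ (-k.2 - 1))) := fun k => (h0 k m).mul_right _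
    exact h5.prod_fiberwise h6
  refine (hasSum_sum h4).of_eq fun k => ?_; rw [← sum_mul]; congr 1
  have h5 := (h1 k).prod_fiberwise (h0 k)
  refine HasSum.unique (hasSum_sum_of_ne_finset_zero fun m hm => ?_) h5
  simp only [mem_range, not_lt] at hm; simp [h2 k m _ hm]

/-! ## Products and iterates of two vertex operators -/

lemma RegOff.comp_conePoly {f : (Fin 2 → ℂ) → ℂ} (hf : f ∈ RegOff conePoly) (g : Fin 2 →
    MvPolynomial (Fin 2) ℂ) (hg : ∀ z, eval (fun i => eval z (g i)) conePoly = -eval z conePoly) :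
    (fun z => f fun i => eval z (g i)) ∈ RegOff conePoly := by
  obtain ⟨N, h, hf⟩ := mem_regOff.mp hf
  refine mem_regOff.mpr ⟨N, (-1) ^ N * MvPolynomial.bind₁ g h, fun z hz => ?_⟩
  have h1 := hf _ (by rw [hg]; exact neg_ne_zero.mpr hz)
  have h2 : eval z (MvPolynomial.bind₁ g h) = eval (fun i => eval z (g i)) h := by
    simp only [← MvPolynomial.coe_aeval_eq_eval, RingHom.coe_coe, MvPolynomial.aeval_bind₁]
  rw [map_mul, h2, ← h1, hg, map_pow, map_neg, map_one, neg_pow (eval z conePoly)]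
  have : ((-1 : ℂ) ^ N) * (-1) ^ N = 1 := by rw [← mul_pow]; simp
  linear_combination (-(f fun i => eval z (g i)) * eval z conePoly ^ N) * this

/-- The double series `a` in `z₁`, `z₂` and `b` in `z₁ - z₂`, `z₂` are expansions of a common
rational function. -/
def IterPair (a b : ℤ × ℤ → ℂ) : Prop :=
  ∃ f ∈ RegOff conePoly, (∀ z₁ z₂ : ℂ, 0 < ‖z₂‖ → ‖z₂‖ < ‖z₁‖ → HasSum (pairTerm a z₁ z₂) (f ![z₁,
    z₂])) ∧ ∀ z₁ z₂ : ℂ, 0 < ‖z₁ - z₂‖ → ‖z₁ - z₂‖ < ‖z₂‖ → HasSum (pairTerm b (z₁ - z₂) z₂) (f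
    ![z₁, z₂])

lemma IterPair.of_assoc {a b : ℤ × ℤ → ℂ} {f f' : (Fin 2 → ℂ) → ℂ} (hf : RationalAwayZero f) (hf' :
    RationalAwayZero f') (h1 : ∀ z₁ z₂ : ℂ, 0 < ‖z₂‖ → ‖z₂‖ < ‖z₁‖ → HasSum (pairTerm a z₁ z₂) (f
    ![z₁, z₂])) (h2 : ∀ z₁ z₂ : ℂ, 0 < ‖z₁ - z₂‖ → ‖z₁ - z₂‖ < ‖z₂‖ → HasSum (pairTerm b (z₁ - z₂)
    z₂) (f' ![z₁, z₂])) (h3 : ∀ z₁ z₂ : ℂ, ‖z₂‖ < ‖z₁‖ → ‖z₁ - z₂‖ < ‖z₂‖ → 0 < ‖z₁ - z₂‖ → ∑' k,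
    pairTerm a z₁ z₂ k = ∑' k, pairTerm b (z₁ - z₂) z₂ k) : IterPair a b := by
  refine ⟨f, hf.mem_regOff, h1, fun z₁ z₂ h h' => ?_⟩
  have key : f ![z₁, z₂] = f' ![z₁, z₂] := by
    refine RegOff.eq_of_eventually hf.mem_regOff hf'.mem_regOff (z₀ := ![3, 2]) ?_ ?_
    · have e : ∀ᶠ p : Fin 2 → ℂ in 𝓝 ![3, 2], ‖p 1‖ < ‖p 0‖ ∧ ‖p 0 - p 1‖ < ‖p 1‖ := by
        have e2 : IsOpen {p : Fin 2 → ℂ | ‖p 1‖ < ‖p 0‖} := isOpen_lt (by fun_prop) (by fun_prop)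
        have e3 : IsOpen {p : Fin 2 → ℂ | ‖p 0 - p 1‖ < ‖p 1‖} := isOpen_lt (by fun_prop) (by
          fun_prop)
        refine (e2.eventually_mem ?_).and (e3.eventually_mem ?_) <;>
        · simp only [Set.mem_ofPred_eq, cons_val_zero, cons_val_one]; norm_num
      filter_upwards [e] with p hp hc
      obtain ⟨-, hc1, hc2⟩ := eval_conePoly_ne.mp hc
      have e0 : 0 < ‖p 0 - p 1‖ := norm_pos_iff.mpr (sub_ne_zero.mpr hc2)
      have ep : p = ![p 0, p 1] := by ext i; fin_cases i <;> rfl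
      rw [ep, ← (h1 (p 0) (p 1) (norm_pos_iff.mpr hc1) hp.1).tsum_eq, ← (h2 (p 0) (p 1) e0
        hp.2).tsum_eq]
      exact h3 _ _ hp.1 hp.2 e0
    · refine eval_conePoly_ne.mpr ⟨fun h0 => ?_, fun h0 => ?_, fun h0 => ?_⟩
      · have h0 : z₁ = 0 := h0; simp [h0] at h'
      · have h0 : z₂ = 0 := h0; rw [h0, norm_zero] at h'
        exact absurd h' (not_lt.mpr (norm_nonneg _))
      · have h0 : z₁ = z₂ := h0; simp [h0] at h
  rw [key]; exact h2 z₁ z₂ h h'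

lemma IterPair.twoCone {a b : ℤ × ℤ → ℂ} (h : IterPair a b) : TwoCone (fun x τ => ![x + τ, τ]) a b
    := by
  obtain ⟨f, hf, h1, h2⟩ := h; refine ⟨f, hf, fun p hp hp' => ?_, fun x τ hx hτ => ?_⟩
  · have ep : ![p 0, p 1] = p := by ext i; fin_cases i <;> rfl
    have := h1 (p 0) (p 1) hp (by linarith); rwa [ep] at this
  · have := h2 (x + τ) τ (by simpa using hx) (by rw [add_sub_cancel_right]; linarith)
    rwa [add_sub_cancel_right] at this

lemma decreasing_two {z₁ z₂ : ℂ} (h : 0 < ‖z₂‖) (h' : ‖z₂‖ < ‖z₁‖) : Decreasing ![z₁, z₂] := by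
  refine ⟨fun i j hij => ?_, fun i => ?_⟩
  · fin_cases i <;> fin_cases j <;> simp_all
  · fin_cases i
    exacts [norm_pos_iff.mp (h.trans h'), norm_pos_iff.mp h]

lemma MOSVA.iterPair (A : MOSVA grV) (u a v : V) (v' : GradedDual grV) : IterPair (fun k => pairing
    grV v' (A.Y k.1 u (A.Y k.2 a v))) (fun k => pairing grV v' (A.Y k.2 (A.Y k.1 u a) v)) := by
  obtain ⟨f, hf, h1⟩ := A.rationality_prod 2 ![u, a] v v'
  obtain ⟨f', hf', h2⟩ := A.rationality_iter u a v v'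
  refine IterPair.of_assoc hf hf' (fun z₁ z₂ h h' => ?_) h2 (A.assoc u a v v')
  refine (hasSum_two (h1 _ (decreasing_two h h'))).of_eq fun k => ?_
  simp [foldr_succ, prod_univ_two]

lemma Bimodule.left_iterPair (M : Bimodule A gr) (u a : V) (w : W) (w' : GradedDual gr) : IterPair
    (fun k => pairing gr w' (M.YL k.1 u (M.YL k.2 a w))) (fun k => pairing gr w' (M.YL k.2 (A.Y k.1
    u a) w)) := by
  obtain ⟨f, hf, h1⟩ := M.left_rationality_prod 2 ![u, a] w w'
  obtain ⟨f', hf', h2⟩ := M.left_rationality_iter u a w w'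
  refine IterPair.of_assoc hf hf' (fun z₁ z₂ h h' => ?_) h2 (M.left_assoc u a w w')
  refine (hasSum_two (h1 _ (decreasing_two h h'))).of_eq fun k => ?_
  simp [foldr_succ, prod_univ_two]

lemma Bimodule.right_iterPair (M : Bimodule A gr) (w : W) (a b : V) (w' : GradedDual gr) : IterPair
    (fun k => pairing gr w' (M.YR k.1 w (A.Y k.2 a b))) (fun k => pairing gr w' (M.YR k.2 (M.YR k.1
    w a) b)) := by
  obtain ⟨f, hf, h1⟩ := M.right_rationality_prod 1 w ![a] b w'
  obtain ⟨f', hf', h2⟩ := M.right_rationality_iter w a b w'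
  refine IterPair.of_assoc hf hf' (fun z₁ z₂ h h' => ?_) h2 (M.right_assoc w a b w')
  refine (hasSum_two (h1 _ (decreasing_two h h'))).of_eq fun k => ?_
  simp [foldr_succ, prod_univ_two]

lemma Bimodule.compat_iterPair (M : Bimodule A gr) (u v : V) (w : W) (w' : GradedDual gr) : IterPair
    (fun k => pairing gr w' (M.YL k.1 u (M.YR k.2 w v))) (fun k => pairing gr w' (M.YR k.2 (M.YL k.1
    u w) v)) := by
  obtain ⟨f, hf, h1, h2⟩ := M.compat_assoc u v w w'
  exact ⟨f, hf.mem_regOff, fun z₁ z₂ h h' => h1 z₁ z₂ h' h, fun z₁ z₂ h h' => h2 z₁ z₂ h' h⟩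

lemma Bimodule.D_pow_mem_finOp (M : Bimodule A gr) (j : ℕ) : M.D ^ j ∈ FinOp gr :=
  (M.homOp_D_pow j).finOp

lemma Bimodule.adj_D_pow_eq_zero (M : Bimodule A gr) (w' : GradedDual gr) : ∃ J : ℕ, ∀ j ≥ J, adj
    (M.D ^ j) w' = 0 := by
  obtain ⟨B, hB⟩ := M.lower_bound
  refine gradedDual_induction (P := fun w' => ∃ J : ℕ, ∀ j ≥ J, adj (M.D ^ j) w' = 0) ⟨0, fun j _ =>
    gradedDual_ext fun x => by
      rw [barPairing_adj (M.D_pow_mem_finOp j), barPairing_zero_left, barPairing_zero_left]⟩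
    (fun c φ => ?_) (fun x y ⟨J, hJ⟩ ⟨K, hK⟩ => ⟨J + K, fun j hj => ?_⟩) w'
  · obtain ⟨J, hJ⟩ := exists_nat_gt (c.re - B); refine ⟨J, fun j hj => gradedDual_ext fun x => ?_⟩
    have h1 : gr (c - j) = ⊥ := hB _ (by
      have : (J : ℝ) ≤ j := by exact_mod_cast hj
      simp only [Complex.sub_re, Complex.natCast_re]; linarith)
    have h2 : ∀ y : gr (c - j), (y : W) = 0 := fun y => by
      have : ∀ z ∈ gr (c - j), z = 0 := by rw [h1]; exact fun z hz => hz
      exact this y y.2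
    rw [barPairing_adj (M.D_pow_mem_finOp j), barPairing_of, barPairing_zero_left]
    have h3 : extendOp gr (M.D ^ j : W →ₗ[ℂ] W) x c = 0 := Subtype.ext (by
      rw [(M.homOp_D_pow j).extendOp_apply, h2, map_zero]; rfl)
    rw [h3, map_zero]
  · rw [adj_add (M.D_pow_mem_finOp j), hJ j (by omega), hK j (by omega), add_zero]

lemma Bimodule.pairing_YS (M : Bimodule A gr) {w' : GradedDual gr} (hJ : ∀ j ≥ J, adj (M.D ^ j) w' =
    0) (l : ℤ) (v : V) (w : W) : pairing gr w' (M.YS l v w) = ∑ j ∈ range J, ysCoeff l j * pairing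
    gr (adj (M.D ^ j) w') (M.YR (l + j) w v) := by
  obtain ⟨K, hK, h⟩ := ((M.YS_eq_sum w v l).and (Filter.eventually_ge_atTop J)).exists
  rw [hK, ← pairingL_apply, map_sum]
  refine (Finset.sum_subset (Finset.range_mono h) fun j _ hj => ?_).symm.trans (sum_congr rfl fun j
    _ => ?_)
  · rw [map_smul, pairingL_apply, ← pairing_adj (M.D_pow_mem_finOp j),
      hJ j (by simpa using hj)]
    simp [pairing, barPairing_zero_left]
  · rw [map_smul, pairingL_apply, ← pairing_adj (M.D_pow_mem_finOp j), smul_eq_mul]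

lemma neg_one_zpow_mul (t : ℂ) (k : ℤ) : (-t) ^ k = (-1) ^ k * t ^ k := by
  rw [← mul_zpow, neg_one_mul]

/-- The expansion of `e^{τ D} Y^R(P, -τ) Q` in the cone of the iterate. -/
lemma Bimodule.hasSum_YS (M : Bimodule A gr) {w' : GradedDual gr} (hJ : ∀ j ≥ J, adj (M.D ^ j) w' =
    0) {P : ℤ → W} {Q : ℤ → V} {x τ : ℂ} (hτ : τ ≠ 0) {φ : ℕ → ℂ} (h : ∀ j, HasSum (fun k : ℤ × ℤ =>
      pairing gr (adj (M.D ^ j) w') (M.YR k.2 (P k.1) (Q k.1)) * (x ^ (-k.1 - 1) * (-τ) ^ (-k.2 -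
        1))) (φ j)) :
    HasSum (pairTerm (fun k => pairing gr w' (M.YS k.2 (Q k.1) (P k.1))) x τ) (∑ j ∈ range J, τ ^ j
      / (factorial j : ℂ) * φ j) := by
  have h1 : ∀ j ∈ range J, HasSum (fun k : ℤ × ℤ => ysCoeff k.2 j * pairing gr (adj (M.D ^ j) w')
    (M.YR (k.2 + j) (P k.1) (Q k.1)) * (x ^ (-k.1 - 1) * τ ^ (-k.2 - 1))) (τ ^ j / (factorial j : ℂ)
    * φ j) := by
    intro j _; have h2 := (h j).mul_left (τ ^ j / (factorial j : ℂ))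
    rw [← ((Equiv.refl ℤ).prodCongr (Equiv.addRight (j : ℤ))).hasSum_iff] at h2
    refine h2.of_eq fun k => ?_
    simp only [comp, Equiv.prodCongr_apply, Prod.map, Equiv.coe_refl, id, Equiv.coe_addRight]
    rw [neg_one_zpow_mul, ysCoeff, show -k.2 - 1 = (-(k.2 + j) - 1) + (j : ℤ) by ring, zpow_add₀ hτ,
      zpow_natCast]
    ring
  refine (hasSum_sum h1).of_eq fun k => ?_; rw [pairTerm, M.pairing_YS hJ, sum_mul]

lemma Bimodule.YR_D_pow (M : Bimodule A gr) (k : ℤ) (r : ℕ) (w : W) (v : V) : M.YR k ((M.D ^ r) w) v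
    = ((-1) ^ r * r.factorial * gbinom k r : ℂ) • M.YR (k - r) w v := by
  induction r generalizing k w with
  | zero => simp [gbinom]
  | succ r ih =>
    rw [pow_succ, Module.End.mul_apply, ih, ← M.right_D_deriv, smul_smul, gbinom, gbinom,
      Finset.prod_range_succ, factorial_succ, show k - (r : ℤ) - 1 = k - (r + 1 : ℕ) by
        push_cast; ring]
    congr 1; have : (r.factorial : ℂ) ≠ 0 := by exact_mod_cast r.factorial_ne_zero
    push_cast; have h2 : (r : ℂ) + 1 ≠ 0 := by exact_mod_cast r.succ_ne_zero
    field_simp; ring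

lemma Bimodule.YL_D_pow (M : Bimodule A gr) (k : ℤ) (j : ℕ) (u : V) (w : W) : M.YL k u ((M.D ^ j) w)
    = ∑ q ∈ Finset.HasAntidiagonal.antidiagonal j, ((j.factorial : ℂ) / q.1.factorial * gbinom k
    q.2) • (M.D ^ q.1) (M.YL (k - q.2) u w) := by
  let P : End ℂ (ℤ → W) := LinearMap.pi fun k => M.D ∘ₗ LinearMap.proj k
  let N : End ℂ (ℤ → W) := LinearMap.pi fun k => (k : ℂ) • LinearMap.proj (k - 1)
  have hP : ∀ F k, P F k = M.D (F k) := fun F k => rfl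
  have hN : ∀ F k, N F k = (k : ℂ) • F (k - 1) := fun F k => rfl
  have hPN : Commute P N := LinearMap.ext fun F => funext fun k => by
    rw [Module.End.mul_apply, Module.End.mul_apply, hP, hN, hN, hP, map_smul]
  have hPp : ∀ (m : ℕ) F k, (P ^ m) F k = (M.D ^ m) (F k) := fun m F k => by
    induction m generalizing F with
    | zero => rfl
    | succ m ih => rw [pow_succ, Module.End.mul_apply, ih, hP, pow_succ, Module.End.mul_apply]
  have hNp : ∀ (r : ℕ) F k, (N ^ r) F k = (r.factorial * gbinom k r : ℂ) • F (k - r) := fun r F k =>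
    by
    induction r generalizing F with
    | zero => simp [gbinom]
    | succ r ih =>
      have h1 : (r.factorial : ℂ) ≠ 0 := by exact_mod_cast r.factorial_ne_zero
      have h2 : (r : ℂ) + 1 ≠ 0 := by exact_mod_cast r.succ_ne_zero
      rw [pow_succ, Module.End.mul_apply, ih, hN, smul_smul, gbinom, gbinom, Finset.prod_range_succ,
        factorial_succ, show k - (r : ℤ) - 1 = k - (r + 1 : ℕ) by push_cast; ring]
      congr 1; push_cast; field_simp
  have hF : ∀ (j : ℕ) w, ((P + N) ^ j) (fun k => M.YL k u w) = fun k => M.YL k u ((M.D ^ j) w) :=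
    fun j => by
    induction j with
    | zero => exact fun w => rfl
    | succ j ih =>
      intro w; rw [pow_succ, Module.End.mul_apply, pow_succ]
      have : (P + N) (fun k => M.YL k u w) = fun k => M.YL k u (M.D w) := funext fun k => by
        rw [LinearMap.add_apply, Pi.add_apply, hP, hN]; have := M.left_D_comm k u w
        rw [neg_smul, ← sub_eq_zero] at this; rw [← sub_eq_zero, ← neg_eq_zero, ← this]
        abel
      rw [this, ih]; rfl
  have key := congrFun (hF j w) k; rw [← key, hPN.add_pow', LinearMap.sum_apply, Finset.sum_apply]
  refine sum_congr rfl fun q hq => ?_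
  rw [LinearMap.smul_apply, Pi.smul_apply, Module.End.mul_apply, hPp, hNp, map_smul, ←
    Nat.cast_smul_eq_nsmul ℂ, smul_smul]
  congr 1; rw [← Finset.HasAntidiagonal.mem_antidiagonal.mp hq, Nat.cast_add_choose]
  have h1 : (q.2.factorial : ℂ) ≠ 0 := by exact_mod_cast q.2.factorial_ne_zero
  field_simp

lemma hasSum_antidiagonal {f : ℕ × ℕ → ℂ} (h : ∀ q : ℕ × ℕ, J ≤ q.1 + q.2 → f q = 0) : HasSum f (∑ j
    ∈ range J, ∑ q ∈ Finset.HasAntidiagonal.antidiagonal j, f q) := by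
  rw [← Finset.sum_biUnion fun i _ j _ hij => Finset.disjoint_left.mpr fun q h1 h2 => hij (by
    rw [← Finset.HasAntidiagonal.mem_antidiagonal.mp h1, Finset.HasAntidiagonal.mem_antidiagonal.mp h2])]
  refine hasSum_sum_of_ne_finset_zero fun q hq => h q ?_; simpa using hq

/-- The shift of both indices by amounts that depend on a third index. -/
def shiftEquiv (a b : ℕ → ℤ) : (ℤ × ℤ) × ℕ ≃ (ℤ × ℤ) × ℕ where
  toFun q := ((q.1.1 + a q.2, q.1.2 + b q.2), q.2)
  invFun q := ((q.1.1 - a q.2, q.1.2 - b q.2), q.2)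
  left_inv q := by simp
  right_inv q := by simp

lemma mem_regOff_sum {f : ℕ → (Fin 2 → ℂ) → ℂ} (hf : ∀ j, f j ∈ RegOff conePoly) (i : Fin 2) (g :
    Fin 2 → MvPolynomial (Fin 2) ℂ) (hg : ∀ z, eval (fun i => eval z (g i)) conePoly = -eval z
    conePoly) (J : ℕ) : (fun z : Fin 2 → ℂ => ∑ j ∈ range J, z i ^ j / (factorial j : ℂ) * f j fun i
    => eval z (g i)) ∈ RegOff conePoly := by
  have h1 : ∑ j ∈ range J, (fun z : Fin 2 → ℂ => eval z (X i ^ j * MvPolynomial.C (factorial j :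
    ℂ)⁻¹)) * (fun z => f j fun i => eval z (g i)) ∈ RegOff conePoly := sum_mem fun j _ => mul_mem
    (RegOff.poly _) (RegOff.comp_conePoly (hf j) g hg)
  refine RegOff.congr h1 fun z _ => ?_; simp [div_eq_mul_inv]

lemma Bimodule.twoCone_left_right (M : Bimodule A gr) (u v : V) (w : W) (w' : GradedDual gr) :
    TwoCone (fun x τ => ![x, τ]) (fun k => pairing gr w' (M.YL k.1 u (M.YS k.2 v w))) (fun k =>
    pairing gr w' (M.YS k.2 v (M.YL k.1 u w))) := by
  obtain ⟨J, hJ⟩ := M.adj_D_pow_eq_zero w'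
  choose f hf h1 h2 using fun j => M.compat_iterPair u v w (adj (M.D ^ j) w')
  let g : Fin 2 → MvPolynomial (Fin 2) ℂ := ![X 0 - X 1, -X 1]
  have hg : ∀ z : Fin 2 → ℂ, (fun i => eval z (g i)) = ![z 0 - z 1, -z 1] := by
    intro z; ext i; fin_cases i <;> simp [g]
  refine ⟨_, mem_regOff_sum hf 1 g (fun z => ?_) J, fun q hq hq' => ?_, fun x τ hx hτ => ?_⟩
  · rw [hg, eval_conePoly, eval_conePoly]; simp; ring
  · simp only [hg]
    generalize q 0 = s at hq hq' ⊢
    generalize q 1 = t at hq hq' ⊢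
    obtain ⟨R, hR⟩ := M.YR_trunc w v; have ht := norm_pos_iff.mp hq
    refine hasSum_regroup (term := fun k q => (-1) ^ (-(k.2 + (q.1 + q.2 : ℕ)) - 1) / (q.1.factorial
      : ℂ) * gbinom k.1 q.2 * pairing gr (adj (M.D ^ q.1) w') (M.YL (k.1 - q.2) u (M.YR (k.2 + (q.1
      + q.2 : ℕ)) w v))) (fun k => ?_) (fun k m r hm => ?_) fun m hm => ?_
    · obtain ⟨K, hK, h⟩ := ((M.YS_eq_sum w v k.2).and (Filter.eventually_ge_atTop (R -
        k.2).toNat)).exists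
      rw [hK, map_sum, ← pairingL_apply, map_sum]
      have e1 := hasSum_antidiagonal (J := K) (f := fun q : ℕ × ℕ =>
        (-1) ^ (-(k.2 + (q.1 + q.2 : ℕ)) - 1) /
        (q.1.factorial : ℂ) * gbinom k.1 q.2 * pairing gr (adj (M.D ^ q.1) w')
        (M.YL (k.1 - q.2) u (M.YR (k.2 + (q.1 + q.2 : ℕ)) w v))) fun q hq => by
          rw [hR _ (by push_cast; omega), map_zero, ← pairingL_apply, map_zero, mul_zero]
      convert e1 using 1
      refine sum_congr rfl fun j _ => ?_; rw [map_smul, map_smul, M.YL_D_pow, map_sum, smul_sum]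
      refine sum_congr rfl fun q hq => ?_; have hj := Finset.HasAntidiagonal.mem_antidiagonal.mp hq
      have h3 : (j.factorial : ℂ) ≠ 0 := by exact_mod_cast j.factorial_ne_zero
      rw [pairing_adj (M.D_pow_mem_finOp _), map_smul, pairingL_apply, hj, ysCoeff, smul_eq_mul,
        smul_eq_mul]
      field_simp
    · simp only; rw [hJ m hm, pairing, barPairing_zero_left, mul_zero]
    · have e1 := (hasSum_reexpand (h1 m) hq (by linarith)).mul_left (t ^ m / (m.factorial : ℂ))
      rw [← (shiftEquiv (fun r => -(r : ℤ)) fun r => (m + r : ℕ)).hasSum_iff] at e1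
      simp only [cons_val_zero, cons_val_one]; refine e1.of_eq fun k => ?_
      simp only [comp, shiftEquiv, Equiv.coe_fn_mk]
      rw [neg_one_zpow_mul, show -k.1.2 - 1 = (-(k.1.2 + (m + k.2 : ℕ)) - 1) + (m + k.2 : ℕ) by ring,
        zpow_add₀ ht, zpow_natCast, pow_add,
        show -(k.1.1 + -(k.2 : ℤ)) - 1 - (k.2 : ℤ) = -k.1.1 - 1 by ring,
        show ((k.1.1 + -(k.2 : ℤ) : ℤ) : ℂ) + (k.2 : ℂ) = k.1.1 by push_cast; ring,
        ← sub_eq_add_neg]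
      ring
  · simp only [hg, cons_val_zero, cons_val_one]
    refine M.hasSum_YS hJ (P := fun k => M.YL k u w) (Q := fun _ => v) (norm_pos_iff.mp ((by
      positivity : 0 ≤ 4 * ‖x‖).trans_lt hτ)) fun j => ?_
    have := h2 j (x - τ) (-τ) (by simpa using hx) (by simp; linarith)
    rwa [show x - τ - -τ = x by ring] at this

lemma Bimodule.twoCone_right_right (M : Bimodule A gr) (a b : V) (w : W) (w' : GradedDual gr) :
    TwoCone (fun x τ => ![τ, x + τ]) (fun k => pairing gr w' (M.YS k.1 b (M.YS k.2 a w))) (fun k =>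
    pairing gr w' (M.YS k.2 (A.Y k.1 a b) w)) := by
  obtain ⟨J, hJ⟩ := M.adj_D_pow_eq_zero w'
  choose f hf h1 h2 using fun j => M.right_iterPair w a b (adj (M.D ^ j) w')
  let g : Fin 2 → MvPolynomial (Fin 2) ℂ := ![-X 0, X 1 - X 0]
  have hg : ∀ z : Fin 2 → ℂ, (fun i => eval z (g i)) = ![-z 0, z 1 - z 0] := by
    intro z; ext i; fin_cases i <;> simp [g]
  refine ⟨_, mem_regOff_sum hf 0 g (fun z => ?_) J, fun q hq hq' => ?_, fun x τ hx hτ => ?_⟩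
  · rw [hg, eval_conePoly, eval_conePoly]; simp; ring
  · simp only [hg]
    generalize q 0 = s at hq hq' ⊢
    generalize q 1 = t at hq hq' ⊢
    obtain ⟨R, hR⟩ := M.YR_trunc w a; have ht := norm_pos_iff.mp hq
    have hs := norm_pos_iff.mp ((by positivity : 0 ≤ 4 * ‖t‖).trans_lt hq')
    refine hasSum_regroup (term := fun k q => ysCoeff k.1 q.1 * ((-1) ^ (-(k.2 + q.2) - 1) * (-1) ^
      q.2 * gbinom ((k.1 + q.1 : ℤ) : ℂ) q.2) * pairing gr (adj (M.D ^ q.1) w') (M.YR (k.1 + q.1 -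
      q.2) (M.YR (k.2 + q.2) w a) b)) (fun k => ?_) (fun k m r hm => ?_) fun m hm => ?_
    · obtain ⟨K, hK, h⟩ := ((M.YS_eq_sum w a k.2).and (Filter.eventually_ge_atTop (R -
        k.2).toNat)).exists
      rw [M.pairing_YS hJ, hK]
      convert hasSum_sum_of_ne_finset_zero (s := range J ×ˢ range K) (f := fun q : ℕ × ℕ =>
        ysCoeff k.1 q.1 * ((-1) ^ (-(k.2 + q.2) - 1) *
        (-1) ^ q.2 * gbinom ((k.1 + q.1 : ℤ) : ℂ) q.2) * pairing gr (adj (M.D ^ q.1) w')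
        (M.YR (k.1 + q.1 - q.2) (M.YR (k.2 + q.2) w a) b)) fun q hq => ?_ using 1
      · rw [Finset.sum_product]; refine sum_congr rfl fun j _ => ?_
        rw [map_sum, LinearMap.sum_apply, ← pairingL_apply, map_sum, mul_sum]
        refine sum_congr rfl fun r _ => ?_
        have h3 : (r.factorial : ℂ) ≠ 0 := by exact_mod_cast r.factorial_ne_zero
        rw [map_smul, LinearMap.smul_apply, M.YR_D_pow, map_smul, map_smul, pairingL_apply, ysCoeff,
          ysCoeff, smul_eq_mul, smul_eq_mul]
        field_simp
      · rw [Finset.mem_product, not_and_or, mem_range, mem_range, not_lt, not_lt] at hq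
        rcases hq with hq | hq
        · rw [hJ _ hq, pairing, barPairing_zero_left, mul_zero]
        · rw [hR _ (by omega), map_zero, LinearMap.zero_apply, ← pairingL_apply, map_zero, mul_zero]
      · infer_instance
    · simp only; rw [hJ m hm, pairing, barPairing_zero_left, mul_zero]
    · have e1 := (hasSum_reexpand (a := fun k => (-1) ^ (-k.1 - 1) * pairing gr (adj (M.D ^ m) w')
        (M.YR k.1 (M.YR k.2 w a) b)) (g := fun z₁ z₂ => f m ![z₂ - z₁, -z₁]) (fun z₁ z₂ h h' => ?_)
        hq (by linarith : 2 * ‖t‖ < ‖s‖)).mul_left (s ^ m / (m.factorial : ℂ))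
      · rw [← (shiftEquiv (fun r => m - (r : ℤ)) fun r => (r : ℤ)).hasSum_iff, show -t - (s - t) =
          -s by ring, neg_sub] at e1
        simp only [cons_val_zero, cons_val_one]; refine e1.of_eq fun k => ?_
        simp only [comp, shiftEquiv, Equiv.coe_fn_mk]
        rw [neg_one_zpow_mul t, show -k.1.2 - 1 = (-(k.1.2 + (k.2 : ℤ)) - 1) + (k.2 : ℕ) by ring,
          zpow_add₀ ht, zpow_natCast, show -(k.1.1 + (m - (k.2 : ℤ))) - 1 - (k.2 : ℤ) = (-k.1.1 - 1)
          + -(m : ℤ) by ring, zpow_add₀ hs, zpow_neg, zpow_natCast, ysCoeff, show ((k.1.1 + (m -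
          (k.2 : ℤ)) : ℤ) : ℂ) + (k.2 : ℂ) = ((k.1.1 + m : ℤ) : ℂ) by
            push_cast; ring, show k.1.1 + (m - (k.2 : ℤ)) = k.1.1 + m - k.2 by ring,
          show (-1 : ℂ) ^ (-(k.1.1 + m - k.2) - 1) = (-1) ^ (-(k.1.1 + m) - 1) * (-1) ^ k.2 by
            rw [← zpow_natCast (-1 : ℂ) k.2, ← zpow_add₀ (by norm_num)]; congr 1; ring]
        have : s ^ m ≠ 0 := pow_ne_zero m hs; field_simp
      · have := h2 m (z₂ - z₁) (-z₁) (by simpa using h) (by simpa using h')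
        rw [show z₂ - z₁ - -z₁ = z₂ by ring, ← (prodComm ℤ ℤ).hasSum_iff] at this
        refine this.of_eq fun k => ?_; simp only [comp, prodComm_apply, Prod.swap, pairTerm]
        rw [neg_one_zpow_mul z₁]; ring
  · simp only [hg, cons_val_zero, cons_val_one]
    refine M.hasSum_YS hJ (P := fun _ => w) (Q := fun k => A.Y k a b) (norm_pos_iff.mp ((by
      positivity : 0 ≤ 4 * ‖x‖).trans_lt hτ)) fun j => ?_
    have := h1 j (-τ) x hx (by simp; linarith); rw [← (prodComm ℤ ℤ).hasSum_iff] at this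
    rw [add_sub_cancel_right]; refine this.of_eq fun k => ?_
    simp only [comp, prodComm_apply, Prod.swap, pairTerm]; ring

/-! ## Exchange relations for two faces at the same place -/

/-- The region in which two vertex operators at the same place, at distance `x` from each other, are
expanded in `x` and in the distance `τ` from the centre. -/
def PairReg : FaceKind n → (Fin n → ℂ) → ℂ → ℂ → Prop
  | .left, ζ, x, τ => 0 < ‖x‖ ∧ 4 * ‖x‖ < ‖τ‖ ∧ ∀ l, ‖ζ l‖ < ‖x‖
  | .right, ζ, x, τ => 0 < ‖x‖ ∧ 4 * ‖x‖ < ‖τ‖ ∧ ∀ l, ‖ζ l‖ < ‖x‖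
  | .mid i, ζ, x, τ => 0 < ‖x‖ ∧ 4 * ‖x‖ < ‖τ‖ ∧ ∀ l, l ≠ i → 4 * ‖τ‖ < ‖ζ i - ζ l‖

lemma PairReg.pos {x τ : ℂ} (h : PairReg κ ζ x τ) : 0 < ‖x‖ ∧ 4 * ‖x‖ < ‖τ‖ := by
  cases κ <;> exact ⟨h.1, h.2.1⟩

lemma pairReg_outer (hκ : κ.base = none) {x τ : ℂ} : PairReg κ ζ x τ ↔ 0 < ‖x‖ ∧ 4 * ‖x‖ < ‖τ‖ ∧ ∀
    l, ‖ζ l‖ < ‖x‖ := by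
  cases κ with
  | left | right => exact Iff.rfl
  | mid i => simp [base] at hκ

lemma FaceKind.ctr_outer (hκ : κ.base = none) (ζ : Fin n → ℂ) : κ.ctr ζ = 0 := by
  cases κ with
  | left | right => rfl
  | mid i => simp [base] at hκ

lemma PairReg.of_norm_eq {x x' τ : ℂ} (h : PairReg κ ζ x τ) (hx : ‖x'‖ = ‖x‖) : PairReg κ ζ x' τ :=
    by
  cases κ <;> simpa only [PairReg, hx] using h

lemma PairReg.reg {x τ : ℂ} (h : PairReg κ ζ x τ) : κ.Reg (κ.ctr ζ + τ) ζ := by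
  have h0 : τ ≠ 0 := norm_pos_iff.mp (by linarith [h.pos])
  cases κ with
  | left | right => exact ⟨by simpa [ctr], fun j => by
      simp only [ctr, zero_add]; linarith [h.2.2 j, h.1, h.2.1]⟩
  | mid i => exact ⟨by simpa [ctr], fun j hj => by
      simp only [ctr, add_sub_cancel_left, norm_sub_rev (ζ j)]
      linarith [h.2.2 j hj, norm_nonneg τ]⟩

lemma PairReg.reg_mid {x τ : ℂ} (h : PairReg κ ζ x τ) : (mid κ.pos).Reg (κ.ctr ζ + τ + x) (ins κ.pos
    (κ.ctr ζ + τ) ζ) := by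
  refine ⟨fun e => ?_, fun j => succAboveCases κ.pos (fun h => absurd rfl h) (fun j _ => ?_) j⟩
  · rw [ins_same, add_eq_left] at e; simpa [e] using h.pos.1
  · rw [ins_same, ins_succAbove, add_sub_cancel_left]
    cases κ with
    | left | right =>
      obtain ⟨h1, h2, h3⟩ := h; simp only [ctr, zero_add]
      linarith [h3 j, norm_sub_norm_le τ (ζ j), norm_sub_rev τ (ζ j)]
    | mid i =>
      obtain ⟨h1, h2, h3⟩ := h; simp only [ctr]
      by_cases hj : j = i
      · rw [hj, sub_add_cancel_left, norm_neg]; linarith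
      · have := norm_sub_norm_le (ζ i - ζ j) (-τ)
        rw [norm_neg, sub_neg_eq_add, show ζ i - ζ j + τ = -(ζ j - (ζ i + τ)) by ring, norm_neg]
          at this
        linarith [h3 j hj, norm_nonneg τ]

lemma exists_pairReg (κ : FaceKind n) : ∃ ζ : Fin n → ℂ, Injective ζ ∧ ∃ x τ, PairReg κ ζ x τ := by
  have hn : ∀ a : ℕ, ‖((a : ℝ) : ℂ)‖ = a := fun a => by simp
  have hout : ∃ x τ : ℂ, 0 < ‖x‖ ∧ 4 * ‖x‖ < ‖τ‖ ∧ ∀ l : Fin n, ‖(((l : ℕ) : ℝ) : ℂ)‖ < ‖x‖ := by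
    refine ⟨((n + 1 : ℕ) : ℝ), ((5 * (n + 1) : ℕ) : ℝ), ?_, ?_, fun l => ?_⟩
    · rw [hn]; positivity
    · rw [hn, hn]; push_cast; linarith
    · rw [hn, hn]; exact_mod_cast l.2.trans (Nat.lt_succ_self n)
  refine ⟨fun i => (((i : ℕ) : ℝ) : ℂ), fun i j h => Fin.ext (by simpa using h), ?_⟩
  cases κ with
  | left | right => exact hout
  | mid i =>
    refine ⟨1 / 64, 1 / 8, by norm_num, by norm_num, fun l hl => ?_⟩
    have h1 : (1 : ℤ) ≤ |((i : ℕ) : ℤ) - (l : ℕ)| := Int.one_le_abs (sub_ne_zero.mpr fun h => hl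
      (Fin.ext (by exact_mod_cast h.symm)))
    have h2 : (1 : ℝ) ≤ |((i : ℕ) : ℝ) - (l : ℕ)| := by exact_mod_cast h1
    rw [← Complex.ofReal_sub, Complex.norm_real, Real.norm_eq_abs]; norm_num; linarith

lemma isOpen_pairReg (κ : FaceKind n) {X : Type*} [TopologicalSpace X] {ζ : X → Fin n → ℂ} {x τ : X
    → ℂ} (hζ : ∀ l, Continuous fun a => ζ a l) (hx : Continuous x) (hτ : Continuous τ) : IsOpen {a |
    PairReg κ (ζ a) (x a) (τ a)} := by
  have h1 : IsOpen {a | 0 < ‖x a‖} := isOpen_lt (by fun_prop) (by fun_prop)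
  have h2 : IsOpen {a | 4 * ‖x a‖ < ‖τ a‖} := isOpen_lt (by fun_prop) (by fun_prop)
  have h3 : IsOpen {a | ∀ l, ‖ζ a l‖ < ‖x a‖} := by
    rw [Set.ofPred_forall]
    exact isOpen_iInter_of_finite fun l => isOpen_lt (hζ l).norm (by fun_prop)
  cases κ with
  | left | right => exact h1.inter (h2.inter h3)
  | mid i =>
    refine h1.inter (h2.inter ?_); change IsOpen {a | ∀ l, l ≠ i → 4 * ‖τ a‖ < ‖ζ a i - ζ a l‖}
    simp only [Set.ofPred_forall]
    exact isOpen_iInter_of_finite fun l => isOpen_iInter_of_finite fun _ =>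
      isOpen_lt (by fun_prop) ((hζ i).sub (hζ l)).norm

/-- The three linear changes of variables that occur. -/
def PairForm (κ : FaceKind n) (σ : ℂ → ℂ → Fin 2 → ℂ) : Prop :=
  σ = (fun x τ => ![x + τ, τ]) ∨ σ = (fun x τ => ![τ, x + τ]) ∨ κ.base = none ∧ σ = fun x τ => ![x,
    τ]

lemma hasLaurent_pair (κ : FaceKind n) {f : (Fin (n + 2) → ℂ) → ℂ} (hf : f ∈ RatFun (n + 2)) (q :
    Fin (n + 2)) (r : Fin (n + 1)) (hζ : Injective ζ) {σ : ℂ → ℂ → Fin 2 → ℂ} (hσ : PairForm κ σ) :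
    HasLaurent ∅ {x : Fin 2 → ℂ | PairReg κ ζ (x 0) (x 1)} fun x =>
      f (ins q (κ.ctr ζ + σ (x 0) (x 1) 0) (ins r (κ.ctr ζ + σ (x 0) (x 1) 1) ζ)) := by
  set Ω := {x : Fin 2 → ℂ | PairReg κ ζ (x 0) (x 1)} with hΩdef
  have hpos : ∀ x ∈ Ω, 0 < ‖x 0‖ ∧ 4 * ‖x 0‖ < ‖x 1‖ := fun x hx => PairReg.pos (κ := κ) (ζ := ζ) hx
  have hx0 : ∀ x ∈ Ω, x 0 ≠ 0 := fun x hx => norm_pos_iff.mp (hpos x hx).1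
  have hx1 : ∀ x ∈ Ω, x 1 ≠ 0 := fun x hx => norm_pos_iff.mp (by linarith [hpos x hx])
  have hΩ : ∀ x ∈ Ω, ∀ i ∉ (∅ : Set (Fin 2)), x i ≠ 0 := fun x hx i _ => by
    fin_cases i
    exacts [hx0 x hx, hx1 x hx]
  have c0 := LaurentOn.coord (I := ∅) (Ω := Ω) 0
  have c1 := LaurentOn.coord (I := ∅) (Ω := Ω) 1
  have i0 := LaurentOn.coord_inv (I := ∅) (Ω := Ω) (i := 0) (by simp)
  have i1 := LaurentOn.coord_inv (I := ∅) (Ω := Ω) (i := 1) (by simp)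
  have m1 := LaurentOn.const (I := ∅) (Ω := Ω) (-1)
  have cc := HasLaurent.const (I := ∅) (Ω := Ω) (κ.ctr ζ)
  -- inverse differences that involve the second variable
  have k1 : ∀ y : ℂ, (∀ x ∈ Ω, ‖y‖ + ‖x 0‖ < ‖x 1‖) → HasLaurent ∅ Ω (fun x => (x 1 - y)⁻¹) ∧
    HasLaurent ∅ Ω fun x => (x 0 + x 1 - y)⁻¹ := by
    intro y hy; constructor
    · exact HasLaurent.inv_sub hΩ i1 (LaurentOn.const y) fun x hx => by
        linarith [hy x hx, norm_nonneg (x 0)]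
    · exact (HasLaurent.inv_sub hΩ i1 ((LaurentOn.const y).add (m1.mul hΩ c0)) fun x hx => by
        simpa using hy x hx).congr fun x hx => by congr 1; ring
  have k2 : ∀ l, HasLaurent ∅ Ω (fun x => (κ.ctr ζ + x 1 - ζ l)⁻¹) ∧ HasLaurent ∅ Ω fun x => (κ.ctr
    ζ + (x 0 + x 1) - ζ l)⁻¹ := by
    intro l; rcases hb : κ.base with _ | i
    · have := k1 (ζ l) fun x hx => by
        linarith [((pairReg_outer hb).mp hx).2.2 l, hpos x hx]
      simpa [ctr_outer hb] using this
    · obtain rfl : κ = .mid i := by cases κ <;> simp_all [base]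
      by_cases hl : l = i
      · have := k1 0 fun x hx => by rw [norm_zero]; linarith [hpos x hx]
        subst hl; simpa [ctr] using this
      · have h3 : LaurentOn ∅ Ω (fun _ => (ζ i - ζ l)⁻¹) fun _ => ‖ζ i - ζ l‖⁻¹ := by
          simpa using LaurentOn.const (I := ∅) (Ω := Ω) (ζ i - ζ l)⁻¹
        constructor
        · refine (HasLaurent.inv_sub hΩ h3 (m1.mul hΩ c1) fun x hx => ?_).congr
            fun x hx => by congr 1; simp only [ctr]; ring
          rw [norm_neg, norm_one, one_mul]; linarith [hx.2.2 l hl, norm_nonneg (x 1)]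
        · refine (HasLaurent.inv_sub hΩ h3 ((m1.mul hΩ c1).add (m1.mul hΩ c0))
            fun x hx => ?_).congr fun x hx => by congr 1; simp only [ctr]; ring
          rw [norm_neg, norm_one, one_mul, one_mul]
          linarith [hx.2.2 l hl, hpos x hx, norm_nonneg (x 1)]
  have hinj : ∀ x ∈ Ω, ∀ s t : ℂ, s ≠ t → (∀ l, κ.ctr ζ + s ≠ ζ l) → (∀ l, κ.ctr ζ + t ≠ ζ l) →
    Injective (ins q (κ.ctr ζ + s) (ins r (κ.ctr ζ + t) ζ)) := fun x _ s t h h1 h2 =>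
    pair_injective hζ (fun e => h (add_left_cancel e)) h1 h2
  have n1 : ∀ x ∈ Ω, ∀ l, κ.ctr ζ + x 1 ≠ ζ l := fun x hx l e => by
    have := (PairReg.reg hx).injective hζ; have h2 := this.ne (Fin.succAbove_ne κ.pos l)
    rw [ins_same, ins_succAbove] at h2; exact h2 e.symm
  have n2 : ∀ x ∈ Ω, ∀ l, κ.ctr ζ + (x 0 + x 1) ≠ ζ l := fun x hx l e => by
    have := (PairReg.reg_mid hx).injective ((PairReg.reg hx).injective hζ)
    have h2 := this.ne (Fin.succAbove_ne (mid κ.pos).pos (κ.pos.succAbove l))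
    rw [ins_same, ins_succAbove, ins_succAbove] at h2; exact h2 (by rw [← e]; ring)
  have s1 : HasLaurent ∅ Ω fun x => κ.ctr ζ + x 1 := cc.add ⟨_, c1⟩
  have s2 : HasLaurent ∅ Ω fun x => κ.ctr ζ + (x 0 + x 1) := cc.add ⟨_, c0.add c1⟩
  rcases hσ with rfl | rfl | ⟨hb, rfl⟩ <;>
    simp only [cons_val_zero, cons_val_one]
  · refine HasLaurent.comp_regOff hΩ hf (.pair q r ζ s2 s1 ?_ (fun l => (k2 l).2) fun l => (k2 l).1)
      fun x hx =>
hinj x hx _ _ (by simpa using hx0 x hx) (n2 x hx) (n1 x hx)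
    exact HasLaurent.congr ⟨_, i0⟩ fun x hx => by congr 1; ring
  · refine HasLaurent.comp_regOff hΩ hf (.pair q r ζ s1 s2 ?_ (fun l => (k2 l).1) fun l => (k2 l).2)
      fun x hx => hinj x hx _ _ (by simpa using hx0 x hx) (n1 x hx) (n2 x hx)
    refine HasLaurent.congr ⟨_, m1.mul hΩ i0⟩ fun x hx => ?_
    rw [show κ.ctr ζ + x 1 - (κ.ctr ζ + (x 0 + x 1)) = -x 0 by ring, inv_neg]; ring
  · have hr : ∀ x ∈ Ω, _ := fun x hx => (pairReg_outer hb).mp hx; rw [ctr_outer hb] at *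
    have k3 : ∀ l, HasLaurent ∅ Ω fun x => (0 + x 0 - ζ l)⁻¹ := fun l =>
      (HasLaurent.inv_sub hΩ i0 (LaurentOn.const (ζ l)) fun x hx => (hr x hx).2.2 l).congr fun x _
        => by rw [zero_add]
    refine HasLaurent.comp_regOff hΩ hf (.pair q r ζ (cc.add ⟨_, c0⟩) s1 ?_ k3 fun l => (k2 l).1)
      fun x hx => hinj x hx _ _ (fun e => ?_) (fun l e => ?_) (n1 x hx)
    · refine ((HasLaurent.const (-1)).mul hΩ (HasLaurent.inv_sub hΩ i1 c0 fun x hx => by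
        linarith [hpos x hx])).congr fun x hx => ?_
      rw [show 0 + x 0 - (0 + x 1) = -(x 1 - x 0) by ring, inv_neg]; ring
    · have := hpos x hx; rw [e] at this; linarith [norm_nonneg (x 1)]
    · have := (hr x hx).2.2 l; rw [← e, zero_add] at this; exact lt_irrefl _ this

lemma PairForm.eval_conePoly_ne {σ : ℂ → ℂ → Fin 2 → ℂ} (hσ : PairForm κ σ) {x τ : ℂ} (hx : 0 < ‖x‖)
    (hτ : 4 * ‖x‖ < ‖τ‖) : eval (σ x τ) conePoly ≠ 0 := by
  have h0 : x ≠ 0 := norm_pos_iff.mp hx; have h1 : τ ≠ 0 := norm_pos_iff.mp (by linarith)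
  have h2 : x + τ ≠ 0 := fun h => by
    rw [eq_neg_of_add_eq_zero_left h, norm_neg] at hτ; linarith [norm_nonneg τ]
  have h3 : x ≠ τ := fun h => by rw [h] at hτ; linarith [norm_nonneg τ]
  rw [MOSVACohomology.eval_conePoly_ne]; rcases hσ with rfl | rfl | ⟨-, rfl⟩
  exacts [⟨h2, h1, by simpa using h0⟩, ⟨h1, h2, by simpa using h0⟩, ⟨h0, h1, h3⟩]

lemma hasSum_pair_of_scaling {𝓕 : Filter ℝ} [𝓕.NeBot] (hpos : ∀ᶠ r in 𝓕, 0 < r) {f : (Fin (n + 2) →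
    ℂ) → ℂ} (hf : f ∈ RatFun (n + 2)) {q : Fin (n + 2)} {r : Fin (n + 1)} (hζ : Injective ζ) {σ : ℂ
    → ℂ → Fin 2 → ℂ} (hσ : PairForm κ σ) {D C : ℤ × ℤ → ℂ} (hF : ∃ g : ℤ → (Fin 2 → ℂ) → ℂ, (∀ κ, g
    κ ∈ RegOff conePoly) ∧ ∀ p, eval p conePoly ≠ 0 → ∀ᶠ R in 𝓕, ∀ l : ℂ, ‖l‖ = R → HasSum (fun m =>
    g m p * l ^ (-m - 2)) (f (ins q (κ.ctr ζ + l * p 0) (ins r (κ.ctr ζ + l * p 1) ζ)))) (hev : ∀ a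
    b : ℂ, 0 < ‖a‖ → 4 * ‖a‖ < ‖b‖ → ∀ᶠ R in 𝓕, ∀ l : ℂ, ‖l‖ = R → PairReg κ ζ (l * a) (l * b)) (hD
    : ∀ s t : ℂ, PairReg κ ζ t s → HasSum (pairTerm D s t) (f (ins q (κ.ctr ζ + s) (ins r (κ.ctr ζ +
    t) ζ)))) (hTC : ∀ m, TwoCone σ (degPart m D) (degPart m C)) {x τ : ℂ} (h : PairReg κ ζ x τ) :
    HasSum (pairTerm C x τ) (f (ins q (κ.ctr ζ + σ x τ 0) (ins r (κ.ctr ζ + σ x τ 1) ζ))) := by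
  obtain ⟨C', hC'⟩ := (hasLaurent_pair κ hf q r hζ hσ).exists_coeff_pair
  have hC2 : ∀ x τ : ℂ, PairReg κ ζ x τ → HasSum (pairTerm C' x τ) (f (ins q (κ.ctr ζ + σ x τ 0)
    (ins r (κ.ctr ζ + σ x τ 1) ζ))) := fun x τ h =>
    hC' ![x, τ] h
  have hσl : ∀ l x τ : ℂ, σ (l * x) (l * τ) = l • σ x τ := by
    intro l x τ; rcases hσ with rfl | rfl | ⟨-, rfl⟩ <;>
    · ext i; fin_cases i <;> simp [mul_add]
  have key : C' = C := coeff_eq_of_scaling (𝓕 := 𝓕) hpos (σ := σ) (D := D) (F := fun p => f (ins q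
    (κ.ctr ζ + p 0) (ins r (κ.ctr ζ + p 1) ζ))) (fun x τ hx hτ => hσ.eval_conePoly_ne hx hτ) hF (fun
    p h1 h2 => (hev (p 1) (p 0) h1 h2).mono fun R hR l hl => hD _ _ (hR l hl)) (fun x τ h1 h2 =>
    (hev x τ h1 h2).mono fun R hR l hl => by rw [← hσl]; exact hC2 _ _ (hR l hl)) hTC
  rw [← key]; exact hC2 x τ h

lemma hasSum_pair_outer (hκ : κ.base = none) {f : (Fin (n + 2) → ℂ) → ℂ} (hf : f ∈ RatFun (n + 2))
    {q : Fin (n + 2)} {r : Fin (n + 1)} (hζ : Injective ζ) {σ : ℂ → ℂ → Fin 2 → ℂ} (hσ : PairForm κ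
    σ) {D C : ℤ × ℤ → ℂ} (hD : ∀ s t : ℂ, PairReg κ ζ t s → HasSum (pairTerm D s t) (f (ins q s (ins
    r t ζ)))) (hTC : ∀ m, TwoCone σ (degPart m D) (degPart m C)) {x τ : ℂ} (h : PairReg κ ζ x τ) :
    HasSum (pairTerm C x τ) (f (ins q (σ x τ 0) (ins r (σ x τ 1) ζ))) := by
  have hc := ctr_outer hκ ζ
  have := hasSum_pair_of_scaling (κ := κ) (𝓕 := atTop) (eventually_gt_atTop 0) hf hζ (q := q) (r :=
    r) hσ (D := D) (C := C) (by
      simp only [hc, zero_add]; exact exists_scaling_atTop hf q r hζ) (fun a b ha hb => ?_)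
    (by simpa only [hc, zero_add] using hD) hTC h
  · simpa only [hc, zero_add] using this
  · have h1 : ∀ᶠ R : ℝ in atTop, ∀ l, ‖ζ l‖ < R * ‖a‖ := eventually_all.mpr fun l =>
      (Filter.tendsto_id.atTop_mul_const ha).eventually_gt_atTop _
    filter_upwards [h1, eventually_gt_atTop 0] with R hR hR0 l hl
    rw [pairReg_outer hκ, norm_mul, norm_mul, hl]; exact ⟨by positivity, by nlinarith, hR⟩

lemma hasSum_pair_inner {i : Fin n} {f : (Fin (n + 2) → ℂ) → ℂ} (hf : f ∈ RatFun (n + 2)) {q : Fin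
    (n + 2)} {r : Fin (n + 1)} (hζ : Injective ζ) {σ : ℂ → ℂ → Fin 2 → ℂ} (hσ : PairForm (.mid i) σ)
    {D C : ℤ × ℤ → ℂ} (hD : ∀ s t : ℂ, PairReg (.mid i) ζ t s → HasSum (pairTerm D s t) (f (ins q (ζ
    i + s) (ins r (ζ i + t) ζ)))) (hTC : ∀ m, TwoCone σ (degPart m D) (degPart m C)) {x τ : ℂ} (h :
    PairReg (.mid i) ζ x τ) : HasSum (pairTerm C x τ) (f (ins q (ζ i + σ x τ 0) (ins r (ζ i + σ x τ
    1) ζ))) := by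
  refine hasSum_pair_of_scaling (κ := .mid i) (𝓕 := 𝓝[>] 0) self_mem_nhdsWithin hf hζ (q := q) (r :=
    r) hσ (D := D) (C := C) (exists_scaling_zero hf q r hζ i) (fun a b ha hb => ?_) hD hTC h
  have h1 : ∀ᶠ R : ℝ in 𝓝[>] 0, ∀ l, l ≠ i → 4 * (R * ‖b‖) < ‖ζ i - ζ l‖ := by
    refine eventually_all.mpr fun l => ?_
    by_cases hl : l = i
    · simp [hl]
    · have h2 : Filter.Tendsto (fun R : ℝ => 4 * (R * ‖b‖)) (𝓝[>] 0) (𝓝 (4 * (0 * ‖b‖))) :=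
        (Continuous.tendsto (by fun_prop) 0).mono_left nhdsWithin_le_nhds
      rw [zero_mul, mul_zero] at h2
      exact (h2.eventually_lt_const (norm_pos_iff.mpr (sub_ne_zero.mpr (hζ.ne (Ne.symm hl))))).mono
        fun R hR _ => hR
  filter_upwards [h1, self_mem_nhdsWithin] with R hR hR0 l hl
  have hR0 : 0 < R := hR0; refine ⟨?_, ?_, ?_⟩
  · rw [norm_mul, hl]; positivity
  · rw [norm_mul, norm_mul, hl]; nlinarith
  · rw [norm_mul, hl]; exact hR

lemma degPart_outer {x : Completion gr} {c : ℂ} {φ : Dual ℂ (gr c)} {L : ℤ × ℤ → W →ₗ[ℂ] W} {s : ℂ}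
    (hL : ∀ k, HomOp gr (s - k.1 - k.2) (L k)) (κ : ℤ) : degPart κ (fun k => barPairing gr (dualOf
    gr c φ) (extendOp gr (L k) x)) = fun k => pairing gr (dualOf gr c φ) (L k (x (c - (s - κ)))) :=
    by
  funext k; simp only [degPart, barPairing_of, pairing]; split_ifs with h
  · have hs : s - k.1 - k.2 = s - κ := by rw [← h]; push_cast; ring
    congr 1; refine Subtype.ext ?_; rw [(hL k).extendOp_apply, hs]
    have h1 : L k (x (c - (s - κ))) ∈ gr c := by
      have := hL k _ _ (x (c - (s - κ))).2; rwa [hs, sub_add_cancel] at this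
    exact (decompose_of_mem_same gr h1).symm
  · have h1 : (decompose gr (L k (x (c - (s - κ)))) c : gr c) = 0 := Subtype.ext (by
      refine decompose_of_mem_ne gr (hL k _ _ (x (c - (s - κ))).2) fun e => h ?_
      have : ((k.1 + k.2 : ℤ) : ℂ) = κ := by push_cast; linear_combination -e
      exact_mod_cast this)
    rw [h1, map_zero]

lemma degPart_inner {f : V →ₗ[ℂ] ℂ} {L : ℤ × ℤ → V} {s : ℤ} (hL : ∀ k, L k ∈ grV (s - k.1 - k.2)) (κ
    : ℤ) : degPart κ (fun k => f (L k)) = fun k => pairing grV (DirectSum.of (fun c => Dual ℂ (grV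
    c)) (s - κ) (f ∘ₗ (grV (s - κ)).subtype)) (L k) := by
  funext k
  simp only [degPart, barPairing_of, pairing, LinearMap.comp_apply, Submodule.subtype_apply]
  split_ifs with h
  · have h1 : L k ∈ grV (s - κ) := by
      have := hL k; rwa [show s - k.1 - k.2 = s - κ by rw [← h]; ring] at this
    rw [decompose_of_mem_same grV h1]
  · rw [decompose_of_mem_ne grV (hL k) fun e => h (by linear_combination -e), map_zero]

lemma cor_ins_add (Z : Cochain V gr (n + 1)) (w' : GradedDual gr) (q : Fin (n + 1)) (x y : V) (v :
    Fin n → V) (z : Fin (n + 1) → ℂ) : cor Z w' (ins q (x + y) v) z = cor Z w' (ins q x v) z + cor Z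
    w' (ins q y v) z := by
  have := cor_update_add Z w' (ins q 0 v) q x y z; simpa only [update_ins_self] using this

lemma cor_ins_zero (Z : Cochain V gr (n + 1)) (w' : GradedDual gr) (q : Fin (n + 1)) (v : Fin n → V)
    (z : Fin (n + 1) → ℂ) : cor Z w' (ins q 0 v) z = 0 :=
  cor_eq_zero Z w' q (by rw [ins_same]) z

lemma cor_ins_ins_add (Z : Cochain V gr (n + 2)) (w' : GradedDual gr) (q : Fin (n + 2)) (r : Fin (n
    + 1)) (u x y : V) (v : Fin n → V) (z : Fin (n + 2) → ℂ) : cor Z w' (ins q u (ins r (x + y) v)) z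
    = cor Z w' (ins q u (ins r x v)) z + cor Z w' (ins q u (ins r y v)) z := by
  have := cor_update_add Z w' (ins q u (ins r 0 v)) (q.succAbove r) x y z
  simpa only [update_ins_succAbove, update_ins_self] using this

lemma cor_ins_ins_zero (Z : Cochain V gr (n + 2)) (w' : GradedDual gr) (q : Fin (n + 2)) (r : Fin (n
    + 1)) (u : V) (v : Fin n → V) (z : Fin (n + 2) → ℂ) : cor Z w' (ins q u (ins r 0 v)) z = 0 :=
  cor_eq_zero Z w' (q.succAbove r) (by rw [ins_succAbove, ins_same]) z

/-- The modes of the operators of an outer face. -/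
def FaceKind.op (M : Bimodule A gr) : FaceKind n → ℤ → V →ₗ[ℂ] W →ₗ[ℂ] W
  | .left => M.YL
  | .right => M.YSL
  | .mid _ => fun _ => 0

lemma FaceKind.homOp_op (κ : FaceKind n) {k e : ℤ} {u : V} (hu : u ∈ grV e) : HomOp gr (e - k - 1)
    (κ.op M k u) := by
  cases κ with
  | left => exact M.homOp_YL hu
  | right => exact M.homOp_YS hu
  | mid i => exact fun c w _ => zero_mem _

lemma FaceKind.op_mem_finOp (κ : FaceKind n) (k : ℤ) (u : V) : κ.op M k u ∈ FinOp gr := by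
  cases κ with
  | left => exact M.YL_mem_finOp k u
  | right => exact M.YS_mem_finOp k u
  | mid i => exact zero_mem _

lemma FaceKind.wT_outer (hκ : κ.base = none) (k : ℤ) (u : V) (w' : GradedDual gr) : κ.wT M k u w' =
    adj (κ.op M k u) w' := by
  cases κ with
  | left | right => rfl
  | mid i => simp [base] at hκ

lemma FaceKind.vT_outer (hκ : κ.base = none) (k : ℤ) (u : V) (v : Fin n → V) : κ.vT A k u v = v :=
    by
  cases κ with
  | left | right => rfl
  | mid i => simp [base] at hκ

lemma cls_outer {w : Fin 2 → FaceKind n} (hw : ∀ i, (w i).base = none) {a : Fin 2 ⊕ Fin n} {i : Fin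
    n} (h : cls w a = some i) : a = .inr i := by
  rcases a with t | j
  · simp [cls, hw] at h
  · simpa [cls] using h

lemma hasSum_pairTerm_add {f g : ℤ × ℤ → ℂ} {x τ s t : ℂ} (hf : HasSum (pairTerm f x τ) s) (hg :
    HasSum (pairTerm g x τ) t) : HasSum (pairTerm (fun k => f k + g k) x τ) (s + t) :=
  (hf.add hg).of_eq fun k => by simp only [pairTerm, add_mul]

lemma hasSum_pairTerm_zero {x τ : ℂ} : HasSum (pairTerm (fun _ => 0) x τ) 0 :=
  hasSum_zero.of_eq fun k => by simp only [pairTerm, zero_mul]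

/-- Two outer vertex operators: from their product to the expansion in the other cone. -/
lemma IsWord.hasSum_outer {Z : Cochain V gr (n + 2)} {w : Fin 2 → FaceKind n} (hw : ∀ i, (w i).base
    = none) (hZ : IsWord M p Ψ w Z) {C : ℤ × ℤ → V →ₗ[ℂ] V →ₗ[ℂ] W →ₗ[ℂ] W} (hCf : ∀ k u a, C k u a
    ∈ FinOp gr) (hC : ∀ (k : ℤ × ℤ) (e d : ℤ), ∀ u ∈ grV e, ∀ a ∈ grV d, HomOp gr (e + d - 2 - k.1 -
    k.2) (C k u a)) {σ : ℂ → ℂ → Fin 2 → ℂ} (hσ : PairForm (w 0) σ) (hTC : ∀ u a x w', TwoCone σ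
    (fun k => pairing gr w' ((w 0).op M k.1 u ((w 1).op M k.2 a x))) (fun k => pairing gr w' (C k u
    a x))) (u a : V) (v : Fin n → V) (w' : GradedDual gr) (hζ : Injective ζ) {x τ : ℂ} (h : PairReg
    (w 0) ζ x τ) : HasSum (pairTerm (fun k => cor Ψ (adj (C k u a) w') v ζ) x τ) (cor Z w' (tuple w
    ![u, a] v) (tuple w (σ x τ) ζ)) := by
  simp only [tuple_two, cons_val_zero, cons_val_one]
  induction u using graded_induction grV with
  | hom e u hu =>
    induction a using graded_induction grV with
    | hom d a ha =>
      induction w' using gradedDual_induction with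
      | h0 =>
        simp only [cor_zero_left]
        refine (hasSum_pairTerm_zero (x := x) (τ := τ)).of_eq fun k => ?_
        simp only [pairTerm, cor_adj _ (hCf k u a), barPairing_zero_left]
      | hof c φ =>
        refine hasSum_pair_outer (hw 0) (f := cor Z (dualOf gr c φ) (ins _ u (ins _ a v)))
          (hZ.regular.mem_regOff _ _) hζ hσ (D := fun k => barPairing gr (dualOf gr c φ) (extendOp
          gr ((w 0).op M k.1 u ∘ₗ (w 1).op M k.2 a : W →ₗ[ℂ] W) (evalAt (Ψ v) ζ))) (fun s t hst =>
          ?_) (fun m => ?_) h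
        · rw [pairReg_outer (hw 0)] at hst
          have hreg : WordReg w ζ (elim ![s, t] 0) := by
            have hs : s ≠ 0 := norm_pos_iff.mp (by linarith)
            have hc : ∀ s', ‖t‖ ≤ ‖(![s, t] : Fin 2 → ℂ) s'‖ := fun s' => by
              fin_cases s'
              · change ‖t‖ ≤ ‖s‖; linarith
              · exact le_rfl
            refine ⟨fun s' => ?_, fun a b hab h1 h2 => ?_, fun a b i hab h1 h2 => ?_, fun a b i j
              hij h1 h2 => ?_, fun a b i h1 h2 => ?_⟩
            · exact norm_pos_iff.mp (lt_of_lt_of_le hst.1 (hc s'))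
            · rcases a with a | a
              · rcases b with b | b
                · have hab : a < b := hab
                  obtain ⟨rfl, rfl⟩ : a = 0 ∧ b = 1 := by fin_cases a <;> fin_cases b <;> simp_all
                  change ‖t‖ < ‖s‖; linarith
                · exact hab.elim
              · simp [cls] at h1
            · rw [cls_outer hw h1, cls_outer hw h2] at hab; exact hab.elim
            · rw [cls_outer hw h1, cls_outer hw h2]; simpa [sub_eq_zero] using hζ.ne hij
            · rw [cls_outer hw h2]; rcases a with a | a
              · have := hst.2.2 i
                simp only [elim_inr, Pi.zero_apply, norm_zero, add_zero, elim_inl]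
                exact lt_of_lt_of_le this (hc a)
              · simp [cls] at h1
          have h1 := hasSum_two (hZ.hasSum ![u, a] v (dualOf gr c φ) hreg)
          rw [coords_eq_tuple, tuple_two, tuple_two] at h1
          simp only [hw, blockCtr, Option.elim, zero_add, elim_inl, elim_inr, cons_val_zero,
            cons_val_one, Pi.zero_apply, add_zero] at h1
          refine h1.of_eq fun k => ?_
          have h2 : wordTerm M Ψ w ![k.1, k.2] ![u, a] v (dualOf gr c φ) ζ = cor Ψ ((w 1).wT M k.2 a
            ((w 0).wT M k.1 u (dualOf gr c φ))) ((w 1).vT A k.2 a ((w 0).vT A k.1 u v)) ζ := rfl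
          rw [h2, wT_outer (hw 1), wT_outer (hw 0), vT_outer (hw 1), vT_outer (hw 0), prod_univ_two,
            ← adj_comp ((w 0).op_mem_finOp _ _) ((w 1).op_mem_finOp _ _), cor_adj _ (FinOp.comp ((w
            0).op_mem_finOp _ _) ((w 1).op_mem_finOp _ _))]
          rfl
        · have e1 := degPart_outer (x := evalAt (Ψ v) ζ) (c := c) (φ := φ) (s := e + d - 2) (L :=
            fun k => (w 0).op M k.1 u ∘ₗ (w 1).op M k.2 a) (fun k => by
              have := ((w 0).homOp_op (M := M) (k := k.1) hu).comp ((w 1).homOp_op (M := M) (k := k.2) ha)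
              rwa [show (d : ℂ) - k.2 - 1 + (e - k.1 - 1) = e + d - 2 - k.1 - k.2 by ring] at this)
                m
          have e2 := degPart_outer (x := evalAt (Ψ v) ζ) (c := c) (φ := φ) (s := e + d - 2) (L :=
            fun k => C k u a) (fun k => hC k e d u hu a ha) m
          simp only [cor_adj Ψ (hCf _ u a)]; rw [e1, e2]; exact hTC u a _ _
      | hadd w₁ w₂ h1 h2 =>
        simp only [adj_add (hCf _ u a), cor_add_left]; exact hasSum_pairTerm_add h1 h2
    | hadd a₁ a₂ h1 h2 =>
      simp only [map_add, adj_add_op (hCf _ u _) (hCf _ u _), cor_add_left, cor_ins_ins_add]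
      exact hasSum_pairTerm_add h1 h2
    | h0 =>
      simp only [map_zero, adj_zero_op, cor_zero_left, cor_ins_ins_zero]; exact hasSum_pairTerm_zero
  | hadd u₁ u₂ h1 h2 =>
    simp only [map_add, LinearMap.add_apply, adj_add_op (hCf _ _ a) (hCf _ _ a), cor_add_left,
      cor_ins_add]
    exact hasSum_pairTerm_add h1 h2
  | h0 =>
    simp only [map_zero, LinearMap.zero_apply, adj_zero_op, cor_zero_left, cor_ins_zero]
    exact hasSum_pairTerm_zero

lemma cor_update_ins_add (Z : Cochain V gr (n + 2)) (w' : GradedDual gr) (q : Fin (n + 2)) (r : Fin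
    (n + 1)) (u a x y : V) (v : Fin n → V) (i : Fin n) (z : Fin (n + 2) → ℂ) : cor Z w' (ins q u
    (ins r a (update v i (x + y)))) z = cor Z w' (ins q u (ins r a (update v i x))) z + cor Z w'
    (ins q u (ins r a (update v i y))) z := by
  have := cor_update_add Z w' (ins q u (ins r a v)) (q.succAbove (r.succAbove i)) x y z
  simpa only [update_ins_succAbove] using this

lemma ins_mid {X : Type*} (i : Fin n) (a b : X) (v : Fin n → X) : ins ((mid i).map
    i.castSucc.succAbove).pos b (ins i.castSucc a v) = ins i.castSucc.castSucc a (ins i.castSucc b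
    v) := by
  refine ins_ins ?_ ?_ (fun m => ?_) b a v <;>
    simp only [map, pos, Fin.ext_iff, val_succAbove, val_castSucc] <;>
    grind

/-- Two vertex operators at the same argument: from their product to the expansion in the cone of
the iterate. -/
lemma IsWord.hasSum_inner {Z : Cochain V gr (n + 2)} {i : Fin n} (hZ : IsWord M p Ψ ![.mid i, .mid
    i] Z) (a u : V) (v : Fin n → V) (w' : GradedDual gr) (hζ : Injective ζ) {x τ : ℂ} (h : PairReg
    (.mid i) ζ x τ) : HasSum (pairTerm (fun k => cor Ψ w' (update v i (A.Y k.2 (A.Y k.1 a u) (v i)))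
    ζ) x τ) (cor Z w' (ins i.castSucc.castSucc a (ins i.castSucc u v)) (ins i.castSucc.castSucc (ζ i
    + (x + τ)) (ins i.castSucc (ζ i + τ) ζ))) := by
  let f : V →ₗ[ℂ] ℂ :=
    { toFun := fun b => cor Ψ w' (update v i b) ζ
      map_add' := fun _ _ => cor_update_add ..
      map_smul' := fun _ _ => cor_update_smul .. }
  suffices H : ∀ b, HasSum (pairTerm (fun k => f (A.Y k.2 (A.Y k.1 a u) b)) x τ) (cor Z w' (ins
    i.castSucc.castSucc a (ins i.castSucc u (update v i b))) (ins i.castSucc.castSucc (ζ i + (x +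
    τ)) (ins i.castSucc (ζ i + τ) ζ))) by
    have := H (v i); rwa [update_eq_self] at this
  intro b
  induction a using graded_induction grV with
  | hom d a ha =>
    induction u using graded_induction grV with
    | hom e u hu =>
      induction b using graded_induction grV with
      | hom l b hb =>
        refine hasSum_pair_inner (i := i) (σ := fun x τ => ![x + τ, τ]) (f := cor Z w' (ins _ a (ins
          _ u (update v i b)))) (hZ.regular.mem_regOff _ _) hζ (Or.inl rfl) (D := fun k => f (A.Y
          k.1 a (A.Y k.2 u b))) (fun s t hst => ?_) (fun m => ?_) h
        · obtain ⟨ht, hts, hl⟩ := hst; have hs : s ≠ 0 := norm_pos_iff.mp (by linarith)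
          have hc : ∀ s', ‖(![t, s] : Fin 2 → ℂ) s'‖ ≤ ‖s‖ := fun s' => by
            fin_cases s'
            · change ‖t‖ ≤ ‖s‖; linarith
            · exact le_rfl
          have hb' : ∀ s', ((![.mid i, .mid i] : Fin 2 → FaceKind n) s').base = some i := fun s' => by
            fin_cases s' <;> rfl
          have hcls : ∀ c j, cls ![.mid i, .mid i] c = some j → ‖elim ![t, s] (0 : Fin n → ℂ) c‖ ≤
            ‖s‖ ∧ (j ≠ i → c = .inr j) := by
            rintro (c | c) j hcj
            · refine ⟨hc c, fun hj => absurd ?_ hj.symm⟩; simpa [cls, hb'] using hcj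
            · exact ⟨by simp, fun _ => by simpa [cls] using hcj⟩
          have hnone : ∀ c, cls ![.mid i, .mid i] c ≠ none := by rintro (c | c) <;> simp [cls, hb']
          have hreg : WordReg ![.mid i, .mid i] ζ (elim ![t, s] 0) := by
            refine ⟨fun s' => ?_, fun a b hab h1 => absurd h1 (hnone a), fun a b j hab h1 h2 => ?_,
              fun a b j k hjk h1 h2 => ?_, fun a b j h1 => absurd h1 (hnone a)⟩
            · fin_cases s'
              exacts [norm_pos_iff.mp ht, hs]
            · rcases b with b | b
              · rcases a with a | a
                · have hab : a < b := hab
                  obtain ⟨rfl, rfl⟩ : a = 0 ∧ b = 1 := by fin_cases a <;> fin_cases b <;> simp_all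
                  change ‖t‖ < ‖s‖; linarith
                · have : b = 0 ∨ b = 1 := by fin_cases b <;> simp
                  rcases this with rfl | rfl
                  · simpa using ht
                  · simpa using hs
              · exact (by rcases a with a | a <;> exact hab.elim)
            · by_cases hj : j = i
              · subst hj; have e1 := (hcls a _ h1).1; rw [(hcls b _ h2).2 hjk.symm]
                have := hl k hjk.symm; simp only [elim_inr, Pi.zero_apply, norm_zero, add_zero]
                linarith [norm_nonneg s]
              · rw [(hcls a _ h1).2 hj]
                by_cases hk : k = i
                · subst hk; have e1 := (hcls b _ h2).1; have := hl j hj; rw [norm_sub_rev] at this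
                  simp only [elim_inr, Pi.zero_apply, norm_zero, zero_add]; linarith [norm_nonneg s]
                · rw [(hcls b _ h2).2 hk]; simpa [sub_eq_zero] using hζ.ne hjk
          have h1 := hasSum_two (hZ.hasSum ![u, a] (update v i b) w' hreg)
          rw [coords_eq_tuple, tuple_two, tuple_two] at h1
          simp only [blockCtr, Option.elim, elim_inl, elim_inr, cons_val_zero, cons_val_one,
            Pi.zero_apply, add_zero] at h1
          have e2 : (mid i).pos = i.castSucc := rfl
          rw [e2, ins_mid, ins_mid, ← (prodComm ℤ ℤ).hasSum_iff] at h1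
          refine h1.of_eq fun k => ?_
          have h2 : wordTerm M Ψ ![.mid i, .mid i] ![k.2, k.1] ![u, a] (update v i b) w' ζ = cor Ψ
            w' (update (update (update v i b) i (A.Y k.2 u (update v i b i))) i (A.Y k.1 a (update
            (update v i b) i (A.Y k.2 u (update v i b i)) i))) ζ := rfl
          simp only [comp, prodComm_apply, Prod.swap, prod_univ_two]; rw [h2]
          simp only [update_self, update_idem]; rw [mul_comm (_ ^ _)]; rfl
        · have e1 := degPart_inner (f := f) (s := d + e + l - 2) (grV := grV) (L := fun k => A.Y k.1
            a (A.Y k.2 u b)) (fun k => by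
              have := A.Y_mem (k := k.1) ha (A.Y_mem (k := k.2) hu hb)
              rwa [show l + (e - k.2 - 1) + (d - k.1 - 1) = d + e + l - 2 - k.1 - k.2 by ring]
                at this) m
          have e2 := degPart_inner (f := f) (s := d + e + l - 2) (grV := grV) (L := fun k => A.Y k.2
            (A.Y k.1 a u) b) (fun k => by
              have := A.Y_mem (k := k.2) (A.Y_mem (k := k.1) ha hu) hb
              rwa [show l + (e + (d - k.1 - 1) - k.2 - 1) = d + e + l - 2 - k.1 - k.2 by ring]
                at this) m
          rw [e1, e2]; exact (A.iterPair a u b _).twoCone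
      | hadd a₁ a₂ h1 h2 => simp only [map_add, cor_update_ins_add]; exact hasSum_pairTerm_add h1 h2
      | h0 =>
        simp only [map_zero]
        rw [cor_eq_zero Z w' (i.castSucc.castSucc.succAbove (i.castSucc.succAbove i)) (by
          rw [ins_succAbove, ins_succAbove, update_self])]
        exact hasSum_pairTerm_zero
    | hadd a₁ a₂ h1 h2 =>
      simp only [map_add, LinearMap.add_apply, cor_ins_ins_add]; exact hasSum_pairTerm_add h1 h2
    | h0 => simp only [map_zero, LinearMap.zero_apply, cor_ins_ins_zero]; exact hasSum_pairTerm_zero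
  | hadd a₁ a₂ h1 h2 =>
    simp only [map_add, LinearMap.add_apply, cor_ins_add]; exact hasSum_pairTerm_add h1 h2
  | h0 => simp only [map_zero, LinearMap.zero_apply, cor_ins_zero]; exact hasSum_pairTerm_zero

lemma Face.mid_of_hasSum {X : Cochain V gr (n + 1)} {Z : Cochain V gr (n + 2)} (hX : Regular M p X)
    (hZ : Regular M p Z) (h : Face M κ Ψ X) (hs : ∀ a b v w' ζ x τ, Injective ζ → PairReg κ ζ x τ →
    HasSum (pairTerm (fun k => cor Ψ (κ.wT M k.2 (A.Y k.1 a b) w') (κ.vT A k.2 (A.Y k.1 a b) v) ζ) x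
    τ) (cor Z w' (ins κ.pos.castSucc a (ins κ.pos b v)) (ins κ.pos.castSucc (κ.ctr ζ + (x + τ)) (ins
    κ.pos (κ.ctr ζ + τ) ζ)))) : Face M (.mid κ.pos) X Z := by
  intro u v w' t y hy ht; obtain ⟨ζ₀, hζ₀, x₀, τ₀, h₀⟩ := exists_pairReg κ
  let ζ : (Fin (n + 1) → ℂ) → Fin n → ℂ := fun y j => y (κ.pos.succAbove j)
  have hy0 : ∀ y : Fin (n + 1) → ℂ, ins κ.pos (κ.ctr (ζ y) + (y κ.pos - κ.ctr (ζ y))) (ζ y) = y :=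
    fun y => by rw [add_sub_cancel]; exact ins_self _ _
  have hζc : ∀ l, Continuous fun y : Fin (n + 1) → ℂ => ζ y l := fun l => continuous_apply _
  have hctr : Continuous fun y : Fin (n + 1) → ℂ => κ.ctr (ζ y) := by
    cases κ with
    | left | right => exact continuous_const
    | mid i => exact hζc i
  let y₀ := ins κ.pos (κ.ctr ζ₀ + τ₀) ζ₀
  have hζy₀ : ζ y₀ = ζ₀ := funext fun j => ins_succAbove _ _ _ _
  have h1 : ∀ᶠ y in 𝓝 y₀, PairReg κ (ζ y) x₀ (y κ.pos - κ.ctr (ζ y)) := (isOpen_pairReg κ hζc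
    continuous_const ((continuous_apply _).sub hctr)).eventually_mem (by
      change PairReg κ (ζ y₀) x₀ (y₀ κ.pos - κ.ctr (ζ y₀))
      rw [hζy₀, show y₀ κ.pos = κ.ctr ζ₀ + τ₀ from ins_same _ _ _, add_sub_cancel_left]; exact h₀)
  have h2 : ∀ᶠ y in 𝓝 y₀, Injective (ζ y) :=
    ((continuous_pi hζc).tendsto y₀).eventually (by rw [hζy₀]; exact eventually_injective hζ₀)
  refine extend (.mid κ.pos) (hZ.mem_regOff w' _) (fun k => faceTerm_mem_regOff hX k u v w') (y₀ :=
    y₀) ?_ hy ht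
  filter_upwards [h1, h2] with y hy1 hy2
  refine ⟨‖x₀‖, hy1.pos.1, fun x hx => ?_⟩; have hP := hy1.of_norm_eq hx
  have e0 : (mid κ.pos).ctr y = κ.ctr (ζ y) + (y κ.pos - κ.ctr (ζ y)) := by rw [add_sub_cancel]; rfl
  have e1 := hP.reg_mid; rw [hy0] at e1; rw [e0]; refine ⟨e1, ?_⟩
  have e2 := hs u (v κ.pos) (fun j => v (κ.pos.succAbove j)) w' (ζ y) x _ hy2 hP
  rw [hy0, ins_self] at e2; rw [add_assoc, add_comm _ x]; refine e2.prod_fiberwise fun k => ?_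
  have e3 := (h (A.Y k u (v κ.pos)) (fun j => v (κ.pos.succAbove j)) w' _ (ζ y) hy2
    hP.reg).mul_right (x ^ (-k - 1))
  rw [hy0, add_sub_cancel_left] at e3
  have e4 : ins κ.pos (A.Y k u (v κ.pos)) (fun j => v (κ.pos.succAbove j)) = (mid κ.pos).vT A k u v
    := by
    conv_rhs => rw [vT, ← ins_self κ.pos v, update_ins_self, ins_same]
  rw [e4] at e3; refine e3.of_eq fun l => ?_; simp only [pairTerm]; ring

lemma tuple_left_left {X : Type*} (a b : X) (v : Fin n → X) : tuple ![.left, .left] ![a, b] v = ins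
    (Fin.castSucc 0) a (ins 0 b v) := by
  rw [tuple_two]; rfl

lemma tuple_right_right {X : Type*} (a b : X) (v : Fin n → X) : tuple ![.right, .right] ![b, a] v =
    ins (last n).castSucc a (ins (last n) b v) := by
  rw [tuple_two]
  refine ins_ins ?_ ?_ (fun m => ?_) b a v <;>
    simp only [map, pos, Fin.ext_iff, val_succAbove, val_castSucc,
      val_last, cons_val_zero, cons_val_one] <;>
    grind

lemma tuple_left_right {X : Type*} (a b : X) (v : Fin n → X) : tuple ![.left, .right] ![a, b] v =
    ins (last (n + 1)) b (ins 0 a v) := by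
  rw [tuple_two]
  refine ins_ins ?_ ?_ (fun m => ?_) a b v <;>
    simp only [map, pos, Fin.ext_iff, val_succAbove, val_zero,
      val_last, cons_val_zero, cons_val_one] <;>
    grind

lemma Face.left_left {X : Cochain V gr (n + 1)} {Z : Cochain V gr (n + 2)} (hΨ : Regular M p Ψ) (hX
    : Regular M p X) (hZ : Regular M p Z) (h : Face M .left Ψ X) (h' : Face M .left X Z) : Face M
    (.mid 0) X Z := by
  have hw : IsWord M p Ψ ![.left, .left] Z := IsWord.two hΨ hX hZ h h'
  refine Face.mid_of_hasSum (κ := .left) hX hZ h fun a b v w' ζ x τ hζ hP => ?_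
  have := hw.hasSum_outer (fun i => by fin_cases i <;> rfl)
    (C := fun k => (A.Y k.1).compr₂ (M.YL k.2)) (σ := fun x τ => ![x + τ, τ])
    (fun k u a => M.YL_mem_finOp _ _) (fun k e d u hu a ha => by
      have := M.homOp_YL (k := k.2) (A.Y_mem (k := k.1) hu ha); push_cast at this
      rwa [show (d : ℂ) + (e - k.1 - 1) - k.2 - 1 = e + d - 2 - k.1 - k.2 by ring] at this)
    (Or.inl rfl) (fun u a x w' => (M.left_iterPair u a x w').twoCone) a b v w' hζ hP
  rw [tuple_left_left, tuple_left_left] at this; simp only [ctr, zero_add]; exact this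

lemma Face.right_right {X : Cochain V gr (n + 1)} {Z : Cochain V gr (n + 2)} (hΨ : Regular M p Ψ)
    (hX : Regular M p X) (hZ : Regular M p Z) (h : Face M .right Ψ X) (h' : Face M .right X Z) :
    Face M (.mid (last n)) X Z := by
  have hw : IsWord M p Ψ ![.right, .right] Z := IsWord.two hΨ hX hZ h h'
  refine Face.mid_of_hasSum (κ := .right) hX hZ h fun a b v w' ζ x τ hζ hP => ?_
  have := hw.hasSum_outer (fun i => by fin_cases i <;> rfl)
    (C := fun k => ((A.Y k.1).compr₂ (M.YSL k.2)).flip) (σ := fun x τ => ![τ, x + τ])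
    (fun k u a => M.YS_mem_finOp _ _) (fun k e d u hu a ha => by
      have := M.homOp_YS (k := k.2) (A.Y_mem (k := k.1) ha hu); push_cast at this
      rwa [show (e : ℂ) + (d - k.1 - 1) - k.2 - 1 = e + d - 2 - k.1 - k.2 by ring] at this)
    (Or.inr (Or.inl rfl)) (fun u a x w' => M.twoCone_right_right a u x w') b a v w' hζ hP
  rw [tuple_right_right, tuple_right_right] at this; simp only [ctr, zero_add]; exact this

lemma Face.mid_mid {X : Cochain V gr (n + 1)} {Z : Cochain V gr (n + 2)} {i : Fin n} (hΨ : Regular M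
    p Ψ) (hX : Regular M p X) (hZ : Regular M p Z) (h : Face M (.mid i) Ψ X) (h' : Face M (.mid
    i.succ) X Z) : Face M (.mid i.castSucc) X Z := by
  have hi : i.castSucc.succAbove i = i.succ := succAbove_castSucc_self i
  have hw : IsWord M p Ψ ![.mid i, .mid i] Z := IsWord.two hΨ hX hZ h (by
    change Face M (.mid (i.castSucc.succAbove i)) X Z; rwa [hi])
  exact Face.mid_of_hasSum (κ := .mid i) hX hZ h fun a b v w' ζ x τ hζ hP =>
    hw.hasSum_inner a b v w' hζ hP

lemma Face.left_right {X Y : Cochain V gr (n + 1)} {Z : Cochain V gr (n + 2)} (hΨ : Regular M p Ψ)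
    (hX : Regular M p X) (hY : Regular M p Y) (hZ : Regular M p Z) (h1 : Face M .right Ψ Y) (h2 :
    Face M .left Y Z) (h3 : Face M .left Ψ X) : Face M .right X Z := by
  have hw : IsWord M p Ψ ![.left, .right] Z := IsWord.two hΨ hY hZ h1 h2; intro u v w' t y hy ht
  obtain ⟨ζ₀, hζ₀, x₀, τ₀, h₀⟩ := exists_pairReg (.left : FaceKind n)
  let y₀ : Fin (n + 1) → ℂ := ins 0 x₀ ζ₀
  let ζ : (Fin (n + 1) → ℂ) → Fin n → ℂ := fun y j => y j.succ
  have hζc : ∀ l, Continuous fun y : Fin (n + 1) → ℂ => ζ y l := fun l => continuous_apply _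
  have hζy₀ : ζ y₀ = ζ₀ := funext fun j => ins_succAbove 0 _ _ _
  have hy0 : ∀ y : Fin (n + 1) → ℂ, ins 0 (y 0) (ζ y) = y := fun y => ins_self 0 _
  have e1 : ∀ᶠ y in 𝓝 y₀, PairReg .left (ζ y) (y 0) τ₀ := (isOpen_pairReg .left hζc
    (continuous_apply 0) continuous_const).eventually_mem (by
      change PairReg .left (ζ y₀) (y₀ 0) τ₀; rwa [hζy₀])
  have e2 : ∀ᶠ y in 𝓝 y₀, Injective (ζ y) :=
    ((continuous_pi hζc).tendsto y₀).eventually (by rw [hζy₀]; exact eventually_injective hζ₀)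
  refine extend .right (hZ.mem_regOff w' _) (fun k => faceTerm_mem_regOff hX k u v w') (y₀ := y₀) ?_
    hy ht
  filter_upwards [e1, e2] with y hy1 hy2
  have hτ₀ : 0 < ‖τ₀‖ := by linarith [hy1.pos]
  refine ⟨‖τ₀‖, hτ₀, fun τ hτ => ?_⟩
  have hP : PairReg .left (ζ y) (y 0) τ := ⟨hy1.1, by rw [hτ]; exact hy1.2.1, hy1.2.2⟩
  change right.Reg (0 + τ) y ∧ HasSum _ (cor Z w' _ (ins _ (0 + τ) y)); rw [zero_add]
  refine ⟨⟨norm_pos_iff.mp (by rwa [hτ]), fun j => ?_⟩, ?_⟩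
  · have := hP.pos; refine Fin.cases ?_ (fun j => ?_) j
    · linarith
    · linarith [hP.2.2 j]
  · have e3 := hw.hasSum_outer (fun i => by fin_cases i <;> rfl)
      (C := fun k => LinearMap.mk₂ ℂ (fun u a => M.YSL k.2 a ∘ₗ M.YL k.1 u)
        (fun _ _ _ => by simp [LinearMap.comp_add]) (fun _ _ _ => by simp [LinearMap.comp_smul])
        (fun _ _ _ => by simp [LinearMap.add_comp]) (fun _ _ _ => by simp [LinearMap.smul_comp]))
      (σ := fun x τ => ![x, τ])
      (fun k u a => FinOp.comp (M.YS_mem_finOp _ _) (M.YL_mem_finOp _ _))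
      (fun k e d u hu a ha => by
        have := (M.homOp_YS (k := k.2) ha).comp (M.homOp_YL (k := k.1) hu)
        rwa [show (e : ℂ) - k.1 - 1 + (d - k.2 - 1) = e + d - 2 - k.1 - k.2 by ring] at this)
      (Or.inr (Or.inr ⟨rfl, rfl⟩)) (fun u a x w' => M.twoCone_left_right u a x w')
      (v 0) u (fun j => v j.succ) w' hy2 hP
    have hv : ins 0 (v 0) (fun j => v j.succ) = v := ins_self 0 v
    rw [tuple_left_right, tuple_left_right, hv, hy0, ← (prodComm ℤ ℤ).hasSum_iff] at e3
    refine e3.prod_fiberwise fun l => ?_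
    have e4 := (h3 (v 0) (fun j => v j.succ) (adj (M.YSL l u) w') _ (ζ y) hy2 (⟨norm_pos_iff.mp
      hP.1, hP.2.2⟩ : left.Reg (y 0) (ζ y))).mul_right (τ ^ (-l - 1))
    simp only [pos, ctr, sub_zero] at e4; rw [hv, hy0] at e4; refine e4.of_eq fun k => ?_
    simp only [comp, prodComm_apply, Prod.swap, pairTerm, LinearMap.mk₂_apply, wT, vT]
    rw [adj_comp (M.YS_mem_finOp _ _) (M.YL_mem_finOp _ _)]; ring

lemma list_eq_of_pairwise {X : Type*} {R : X → X → Prop} (hR : ∀ a b, R a b → ¬ R b a) {l l' : List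
    X} (h : l.Pairwise R) (h' : l'.Pairwise R) (hm : ∀ a, a ∈ l ↔ a ∈ l') : l = l' := by
  have hne : ∀ {a b}, R a b → a ≠ b := fun {a b} e1 e2 => by subst e2; exact hR _ _ e1 e1
  exact List.Perm.eq_of_pairwise (fun a b _ _ e1 e2 => absurd e2 (hR _ _ e1)) h h'
    ((List.perm_ext_iff_of_nodup (h.imp hne) (h'.imp hne)).mpr hm)

/-- The action of a mode on the completion. -/
def FaceKind.act (M : Bimodule A gr) : FaceKind n → ℤ → V → Completion gr → Completion gr
  | left, k, u, x => extendOp gr (M.YL k u) x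
  | right, k, u, x => extendOp gr (M.YSL k u) x
  | mid _, _, _, x => x

lemma FaceKind.act_wT (κ : FaceKind n) (k : ℤ) (u : V) (w' : GradedDual gr) (x : Completion gr) :
    barPairing gr (κ.wT M k u w') x = barPairing gr w' (κ.act M k u x) := by
  cases κ with
  | left => exact barPairing_adj (M.YL_mem_finOp k u) _ _
  | right => exact barPairing_adj (M.YS_mem_finOp k u) _ _
  | mid i => rfl

lemma FaceKind.vT_apply (κ : FaceKind n) (k : ℤ) (u : V) (v : Fin n → V) (i : Fin n) : κ.vT A k u v
    i = if κ.base = some i then A.Y k u (v i) else v i := by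
  cases κ with
  | left | right => rfl
  | mid j =>
    by_cases h : j = i
    · subst h; simp [vT, base]
    · simp [vT, base, h, update_of_ne (Ne.symm h)]

lemma wordTerm_eq (w : Fin J → FaceKind n) (k : Fin J → ℤ) (u : Fin J → V) (v : Fin n → V) (w' :
    GradedDual gr) (ζ : Conf n) : wordTerm M Φ w k u v w' ζ = barPairing gr w' (foldr J (fun t x =>
    (w t).act M (k t) (u t) x) (Φ (fun i => Fin.foldl J (fun y t => if (w t).base = some i then A.Y
    (k t) (u t) y else y) (v i)) ζ)) := by
  induction J generalizing v w' with
  | zero => simp [wordTerm, cor_conf]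
  | succ J ih => rw [wordTerm, ih, act_wT, foldr_succ]; simp only [vT_apply, Fin.foldl_succ]; rfl

/-- The operators of a sequence of faces are those of a composition of vertex operators with a
cochain, in the order in which they are applied. -/
structure Shape (w : Fin J → FaceKind n) {a : ℕ} {α : Fin n → ℕ} (l : ℕ)
    (G : (Fin a ⊕ Σ i, Fin (α i)) ≃ Fin J ⊕ Fin n) : Prop where
  outer : ∀ j, cls w (G (.inl j)) = none
  block : ∀ s, cls w (G (.inr s)) = some s.1
  outer_newer : ∀ j j', j < j' → Newer (G (.inl j)) (G (.inl j'))
  block_newer : ∀ i j j', j < j' → Newer (G (.inr ⟨i, j'⟩)) (G (.inr ⟨i, j⟩))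
  left_iff : ∀ j t, G (.inl j) = .inl t → (w t = .left ↔ (j : ℕ) < l)

/-- The terms of the multiple series of a sequence of faces, when the original arguments are created
from the vacuum. -/
def fullTerm (M : Bimodule A gr) (Φ : Cochain V gr n) (w : Fin J → FaceKind n)
    (K : Fin J ⊕ Fin n → ℤ) (U : Fin J ⊕ Fin n → V) (w' : GradedDual gr) (ζ : Fin n → ℂ) : ℂ :=
  wordTerm M Φ w (fun t => K (.inl t)) (fun t => U (.inl t)) (fun i => A.Y (K (.inr i)) (U (.inr i))
    A.vac) w' ζ

lemma newer_asymm (a b : Fin J ⊕ Fin n) (h : Newer a b) : ¬ Newer b a := by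
  rcases a with s | s <;> rcases b with t | t
  exacts [(lt_asymm (α := Fin J) h), h.elim, id, h.elim]

variable {a l : ℕ} {α : Fin n → ℕ} {G : (Fin a ⊕ Σ i, Fin (α i)) ≃ Fin J ⊕ Fin n}

/-- The terms of the multiple series of a composition of vertex operators with a cochain. -/
abbrev composeTerm (M : Bimodule A gr) (Φ : Cochain V gr n) (l : ℕ) (u₀ : Fin a → V)
    (u : ∀ i, Fin (α i) → V) (k : (Fin a → ℤ) × (∀ i, Fin (α i) → ℤ)) (w' : GradedDual gr)
    (ζ : Conf n) : ℂ :=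
  barPairing gr w' (foldr a (fun j x => extendOp gr (fun w =>
      if (j : ℕ) < l then M.YL (k.1 j) (u₀ j) w else M.YS (k.1 j) (u₀ j) w) x)
    (Φ (fun i => foldr (α i) (fun j x => A.Y (k.2 i j) (u i j) x) A.vac) ζ))

lemma Shape.fullTerm_eq (h : Shape w l G) {K : Fin J ⊕ Fin n → ℤ} {U : Fin J ⊕ Fin n → V} {k : (Fin
    a → ℤ) × (∀ i, Fin (α i) → ℤ)} {u₀ : Fin a → V} {u : ∀ i, Fin (α i) → V} (hK : ∀ s, K (G s) =
    joinVars k.1 k.2 s) (hU : ∀ s, U (G s) = joinVars u₀ u s) (w' : GradedDual gr) (ζ : Conf n) :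
    composeTerm M Φ l u₀ u k w' ζ = fullTerm M Φ w K U w' ζ := by
  rw [composeTerm, fullTerm, wordTerm_eq]
  have hin : ∀ i, foldr (α i) (fun j x => A.Y (k.2 i j) (u i j) x) A.vac = Fin.foldl J (fun y t =>
    if (w t).base = some i then
        A.Y (K (.inl t)) (U (.inl t)) y else y) (A.Y (K (.inr i)) (U (.inr i)) A.vac) := by
    intro i
    have e1 : (List.finRange (α i)).map (fun j => G (.inr ⟨i, j⟩)) = (((List.finRange J).reverse.map
      Sum.inl) ++ [Sum.inr i]).filter (fun s => cls w s = some i) := by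
      refine list_eq_of_pairwise (R := fun a b => Newer b a) (fun a b => newer_asymm b a) ?_ ?_ ?_
      · exact List.pairwise_map.mpr ((List.pairwise_lt_finRange _).imp fun e => h.block_newer i _ _ e)
      · refine List.Pairwise.filter _ (List.pairwise_append.mpr ⟨?_, by simp, ?_⟩)
        · exact List.pairwise_map.mpr (List.pairwise_reverse.mpr (List.pairwise_lt_finRange _))
        · intro x hx y hy; obtain ⟨t, -, rfl⟩ := List.mem_map.mp hx; rw [List.mem_singleton.mp hy]
          trivial
      · intro s
        simp only [List.mem_map, List.mem_finRange, true_and, List.mem_filter, List.mem_append,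
          List.mem_reverse, List.mem_singleton, decide_eq_true_eq]
        constructor
        · rintro ⟨j, rfl⟩; refine ⟨?_, h.block _⟩; have := h.block ⟨i, j⟩
          rcases e : G (.inr ⟨i, j⟩) with t | t
          · exact Or.inl ⟨t, rfl⟩
          · rw [e] at this; simp only [cls, elim_inr, Option.some.injEq] at this
            exact Or.inr (by rw [this])
        · rintro ⟨-, hs⟩; obtain ⟨q, rfl⟩ := G.surjective s; rcases q with q | ⟨i', j⟩
          · rw [h.outer] at hs; cases hs
          · rw [h.block] at hs; simp only [Option.some.injEq] at hs; subst hs; exact ⟨j, rfl⟩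
    have e2 : ∀ j, A.Y (k.2 i j) (u i j) = A.Y (K (G (.inr ⟨i, j⟩))) (U (G (.inr ⟨i, j⟩))) :=
      fun j => by rw [hK, hU]; rfl
    simp only [e2]
    rw [Fin.foldr_eq_finRange_foldr, ← List.foldr_map (f := fun j => G (.inr ⟨i, j⟩)) (g := fun s x
      => A.Y (K s) (U s) x), e1, List.foldr_filter, List.foldr_append, List.foldr_map,
      List.foldr_reverse, Fin.foldl_eq_finRange_foldl]
    have hr : cls w (.inr i) = some i := rfl
    simp only [List.foldr_cons, List.foldr_nil, hr, decide_true, if_true]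
    refine congrArg (fun f => List.foldl f _ _) (funext fun y => funext fun t => ?_)
    by_cases hd : (w t).base = some i
    · rw [if_pos hd, if_pos (decide_eq_true (show cls w (.inl t) = some i from hd))]
    · rw [if_neg hd, if_neg (by rwa [decide_eq_true_eq])]
  simp only [hin]; congr 1
  have ht : ∀ j, ∃ t, G (.inl j) = .inl t := by
    intro j; have := h.outer j; rcases e : G (.inl j) with t | t
    · exact ⟨t, rfl⟩
    · rw [e] at this; cases this
  choose t ht using ht
  have e1 : (List.finRange a).map t = (List.finRange J).filter (fun s => (w s).base = none) := by
    refine list_eq_of_pairwise (R := (· < ·)) (fun a b e => lt_asymm e) ?_ (List.Pairwise.filter _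
      (List.pairwise_lt_finRange _)) fun s => ?_
    · refine List.pairwise_map.mpr ((List.pairwise_lt_finRange _).imp fun {j j'} e => ?_)
      have := h.outer_newer j j' e; rw [ht, ht] at this; exact this
    · simp only [List.mem_map, List.mem_finRange, true_and, List.mem_filter, decide_eq_true_eq]
      constructor
      · rintro ⟨j, rfl⟩; have := h.outer j; rw [ht] at this; exact this
      · intro hs; obtain ⟨q, hq⟩ := G.surjective (.inl s); rcases q with q | q
        · exact ⟨q, Sum.inl_injective ((ht q).symm.trans hq)⟩
        · have := h.block q; rw [hq] at this; exact absurd (hs.symm.trans this) (by simp)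
  have e2 : ∀ (j : Fin a) (x : Completion gr), extendOp gr (fun w =>
      if (j : ℕ) < l then M.YL (k.1 j) (u₀ j) w else M.YS (k.1 j) (u₀ j) w) x =
      (w (t j)).act M (K (.inl (t j))) (U (.inl (t j))) x := by
    intro j x; rw [← ht, hK, hU]; have h1 := h.left_iff j _ (ht j); have h2 := h.outer j
    rw [ht] at h2; rcases hw : w (t j) with _ | _ | i
    · simp only [if_pos (h1.mp hw)]; rfl
    · have : ¬ (j : ℕ) < l := fun e => by rw [h1.mpr e] at hw; cases hw
      simp only [if_neg this]; rfl
    · exact absurd h2 (by simp [cls, hw, base])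
  simp only [e2]
  rw [Fin.foldr_eq_finRange_foldr, ← List.foldr_map (f := t) (g := fun s x => (w s).act M (K (.inl
    s)) (U (.inl s)) x), e1, List.foldr_filter, Fin.foldr_eq_finRange_foldr]
  congr 1; funext s x; rcases hw : w s with _ | _ | i <;> simp [base, act]

lemma Shape.outer_eq (h : Shape w l G) {z₀ : Fin a → ℂ} {z : ∀ i, Fin (α i) → ℂ} {X : Fin J ⊕ Fin n
    → ℂ} (hX : ∀ s, blockCtr ζ (cls w (G s)) + X (G s) = joinVars z₀ z s) (j : Fin a) : z₀ j = X (G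
    (.inl j)) := by
  have := hX (.inl j); rw [h.outer] at this; simpa [blockCtr, joinVars] using this.symm

lemma Shape.block_eq (h : Shape w l G) {z₀ : Fin a → ℂ} {z : ∀ i, Fin (α i) → ℂ} {X : Fin J ⊕ Fin n
    → ℂ} (hX : ∀ s, blockCtr ζ (cls w (G s)) + X (G s) = joinVars z₀ z s) (i : Fin n) (j : Fin (α
    i)) : z i j - ζ i = X (G (.inr ⟨i, j⟩)) := by
  have := hX (.inr ⟨i, j⟩); rw [h.block] at this
  rw [sub_eq_iff_eq_add']; simpa [blockCtr, joinVars] using this.symm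

/-- The modes of a composition of vertex operators with a cochain, as modes of a sequence of
faces. -/
def shapeEquiv (G : (Fin a ⊕ Σ i, Fin (α i)) ≃ Fin J ⊕ Fin n) :
    (Fin J ⊕ Fin n → ℤ) ≃ (Fin a → ℤ) × (∀ i, Fin (α i) → ℤ) where
  toFun K := (fun j => K (G (.inl j)), fun i j => K (G (.inr ⟨i, j⟩)))
  invFun k s := joinVars k.1 k.2 (G.symm s)
  left_inv K := by
    funext s; obtain ⟨q, rfl⟩ := G.surjective s; change joinVars _ _ (G.symm (G q)) = _
    rw [G.symm_apply_apply]; rcases q with q | ⟨i, j⟩ <;> rfl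
  right_inv k := by simp only [G.symm_apply_apply]; rfl

/-- The multiple series of a composition of vertex operators with a cochain is that of a sequence of
faces. -/
lemma Shape.hasSum_iff (h : Shape w l G) {U : Fin J ⊕ Fin n → V} {u₀ : Fin a → V} {u : ∀ i, Fin (α
    i) → V} (hU : ∀ s, U (G s) = joinVars u₀ u s) {z₀ : Fin a → ℂ} {z : ∀ i, Fin (α i) → ℂ} {ζ :
    Conf n} {X : Fin J ⊕ Fin n → ℂ} (hX : ∀ s, blockCtr ζ (cls w (G s)) + X (G s) = joinVars z₀ z s)
    (w' : GradedDual gr) (S : ℂ) : HasSum (fun k => composeTerm M Φ l u₀ u k w' ζ * ((∏ j, z₀ j ^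
    (-k.1 j - 1)) * ∏ i, ∏ j, (z i j - ζ i) ^ (-k.2 i j - 1))) S ↔ HasSum (fun K : Fin J ⊕ Fin n → ℤ
    => fullTerm M Φ w K U w' ζ * ∏ s, X s ^ (-K s - 1)) S := by
  rw [← (shapeEquiv G).hasSum_iff]; refine Iff.of_eq (congrArg (HasSum · S) (funext fun K => ?_))
  simp only [comp]
  rw [h.fullTerm_eq (K := K) (U := U) (fun s => by rcases s with s | ⟨i, j⟩ <;> rfl) hU,
    ← G.prod_comp, Fintype.prod_sum_type, Fintype.prod_sigma]
  simp only [h.outer_eq hX, h.block_eq hX]; rfl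

lemma Shape.region_iff (h : Shape w l G) {z₀ : Fin a → ℂ} {z : ∀ i, Fin (α i) → ℂ} {X : Fin J ⊕ Fin
    n → ℂ} (hn : 0 < n) (hX : ∀ s, blockCtr ζ (cls w (G s)) + X (G s) = joinVars z₀ z s) :
    ComposableRegion z₀ z ζ ↔ WordReg w ζ X := by
  simp only [ComposableRegion, h.outer_eq hX, h.block_eq hX]
  have hout : ∀ {q}, cls w q = none → ∃ j, q = G (.inl j) := by
    intro q hq; obtain ⟨q, rfl⟩ := G.surjective q; rcases q with q | q
    · exact ⟨q, rfl⟩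
    · rw [h.block] at hq; cases hq
  have hin : ∀ {q i}, cls w q = some i → ∃ j, q = G (.inr ⟨i, j⟩) := by
    intro q i hq; obtain ⟨q, rfl⟩ := G.surjective q; rcases q with q | ⟨i', j⟩
    · rw [h.outer] at hq; cases hq
    · rw [h.block] at hq; cases hq; exact ⟨j, rfl⟩
  constructor
  · rintro ⟨c1, c2, c3, c4⟩
    have o : ∀ a b, Newer a b → cls w a = none → cls w b = none → ‖X b‖ < ‖X a‖ := by
      intro a b hn ha hb; obtain ⟨j, rfl⟩ := hout ha; obtain ⟨j', rfl⟩ := hout hb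
      refine c1 _ _ (lt_of_not_ge fun e => ?_); rcases e.lt_or_eq with e | e
      · exact newer_asymm _ _ hn (h.outer_newer _ _ e)
      · subst e; exact newer_asymm _ _ hn hn
    have bl : ∀ a b i, Newer a b → cls w a = some i → cls w b = some i → ‖X a‖ < ‖X b‖ := by
      intro a b i hn ha hb; obtain ⟨j, rfl⟩ := hin ha; obtain ⟨j', rfl⟩ := hin hb
      refine c3 _ _ _ (lt_of_not_ge fun e => ?_); rcases e.lt_or_eq with e | e
      · exact newer_asymm _ _ hn (h.block_newer _ _ _ e)
      · subst e; exact newer_asymm _ _ hn hn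
    have ob : ∀ a b i, cls w a = none → cls w b = some i → ‖ζ i‖ + ‖X b‖ < ‖X a‖ := by
      intro a b i ha hb; obtain ⟨j, rfl⟩ := hout ha; obtain ⟨j', rfl⟩ := hin hb; exact c2 _ _ _
    refine ⟨fun t e => ?_, o, bl, fun a b i j hij ha hb => ?_, ob⟩
    · rcases hc : (w t).base with _ | i
      · have := ob (.inl t) (.inr ⟨0, hn⟩) ⟨0, hn⟩ hc rfl; rw [e, norm_zero] at this
        linarith [norm_nonneg (ζ ⟨0, hn⟩), norm_nonneg (X (.inr ⟨0, hn⟩))]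
      · have := bl (.inr i) (.inl t) i trivial rfl hc; rw [e, norm_zero] at this
        linarith [norm_nonneg (X (.inr i))]
    · obtain ⟨s, rfl⟩ := hin ha; obtain ⟨t, rfl⟩ := hin hb; exact c4 _ _ _ _ hij
  · intro r
    exact ⟨fun s t e => r.outer _ _ (h.outer_newer _ _ e) (h.outer _) (h.outer _), fun s i t =>
      r.outer_block _ _ _ (h.outer _) (h.block _), fun i s t e => r.block _ _ i (h.block_newer _ _ _
      e) (h.block _) (h.block _), fun i j s t e => r.blocks _ _ _ _ e (h.block _) (h.block _)⟩

/-- The coordinates, in terms of a shape. -/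
def Shape.index (w : Fin J → FaceKind n) (G : (Fin a ⊕ Σ i, Fin (α i)) ≃ Fin J ⊕ Fin n) :
    Fin (n + J) ≃ Fin a ⊕ Σ i, Fin (α i) :=
  (ofBijective _ (idx_bijective w)).trans G.symm

lemma Shape.coords_eq {z₀ : Fin a → ℂ} {z : ∀ i, Fin (α i) → ℂ} {X : Fin J ⊕ Fin n → ℂ} (hX : ∀ s,
    blockCtr ζ (cls w (G s)) + X (G s) = joinVars z₀ z s) : coords w ζ X = joinVars z₀ z ∘
    Shape.index w G := by
  funext j; rw [comp, ← hX]; simp [Shape.index, coords]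

lemma Shape.tuple_eq {Y : Type*} {u₀ : Fin a → Y} {u : ∀ i, Fin (α i) → Y} {U : Fin J ⊕ Fin n → Y}
    (hU : ∀ s, U (G s) = joinVars u₀ u s) : tuple w (fun t => U (.inl t)) (fun i => U (.inr i)) =
    joinVars u₀ u ∘ Shape.index w G := by
  funext j; rw [MOSVACohomology.tuple_eq, comp, comp, ← hU]
  simp only [Shape.index, trans_apply, Equiv.apply_symm_apply, Equiv.ofBijective_apply]
  rcases idx w j <;> rfl

/-- The order of the kinds of faces in a normal form. -/
def FaceKind.rank : FaceKind n → ℕ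
  | left => 0
  | right => 1
  | mid _ => 2

lemma exists_threshold {a : ℕ} (P : Fin a → Prop) (h : ∀ i j, i ≤ j → P j → P i) : ∃ l ≤ a, ∀ j, P j
    ↔ (j : ℕ) < l := by
  classical
  by_cases hP : ∃ l : ℕ, ∃ h : l < a, ¬ P ⟨l, h⟩
  · obtain ⟨h1, h2⟩ := Nat.find_spec hP
    refine ⟨Nat.find hP, h1.le, fun j => ⟨fun hj => lt_of_not_ge fun e => h2 (h _ j e hj), fun hj =>
      ?_⟩⟩
    by_contra hc; exact Nat.find_min hP hj ⟨j.2, hc⟩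
  · push Not at hP; exact ⟨a, le_rfl, fun j => ⟨fun _ => j.2, fun _ => hP j j.2⟩⟩

lemma exists_shape (hw : Monotone fun t => (w t).rank) : ∃ (a : ℕ) (α : Fin n → ℕ) (l : ℕ) (G : (Fin
    a ⊕ Σ i, Fin (α i)) ≃ Fin J ⊕ Fin n), Shape w l G ∧ (∀ i, 1 ≤ α i) ∧ l ≤ a := by
  let E : Fin J ⊕ Fin n ≃ Fin (n + J) := (Equiv.sumComm _ _).trans finSumFinEquiv
  have hE : ∀ s t, cls w s = cls w t → E s < E t → Newer s t := by
    rintro (s | s) (t | t) h1 h2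
    · exact (by simpa [E] using h2 : s < t)
    · simp only [E, trans_apply, Equiv.sumComm_apply, Sum.swap_inl, Sum.swap_inr,
        finSumFinEquiv_apply_left, finSumFinEquiv_apply_right, Fin.lt_def, Fin.val_natAdd,
        Fin.val_castAdd] at h2
      omega
    · trivial
    · simp only [cls, elim_inr, Option.some.injEq] at h1; subst h1; exact absurd h2 (lt_irrefl _)
  let F : Option (Fin n) → Finset (Fin (n + J)) := fun c =>
    Finset.univ.filter fun x => cls w (E.symm x) = c
  let o : ∀ c, Fin (F c).card ≃o F c := fun c => (F c).orderIsoOfFin rfl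
  let g : (Fin (F none).card ⊕ Σ i, Fin (F (some i)).card) → Fin J ⊕ Fin n := elim (fun j => E.symm
    (o none j)) fun s => E.symm (o (some s.1) s.2.rev)
  have ho : ∀ c j, cls w (E.symm (o c j)) = c := fun c j => by
    exact (Finset.mem_filter.mp (o c j).2).2
  have hlt : ∀ c j j', j < j' → Newer (E.symm (o c j)) (E.symm (o c j')) := by
    intro c j j' e; refine hE _ _ (by rw [ho, ho]) ?_; rw [E.apply_symm_apply, E.apply_symm_apply]
    exact (o c).lt_iff_lt.mpr e
  have hg : Bijective g := by
    constructor
    · rintro (j | ⟨i, j⟩) (j' | ⟨i', j'⟩) e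
      · rw [(o none).injective (Subtype.ext (E.symm.injective e))]
      iterate 2 have := congrArg (cls w) e; simp [g, ho] at this
      · have := congrArg (cls w) e; simp only [g, elim_inr, ho, Option.some.injEq] at this
        subst this
        have h1 : j = j' := Fin.rev_injective ((o (some i)).injective (Subtype.ext (E.symm.injective
          e)))
        rw [h1]
    · have hs : ∀ c s, cls w s = c → ∃ j, E.symm (o c j) = s := by
        rintro c s hc; obtain ⟨j, hj⟩ := (o c).surjective ⟨E s, by simp [F, hc]⟩
        exact ⟨j, by rw [hj]; simp⟩
      intro s; rcases hc : cls w s with _ | i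
      · obtain ⟨j, hj⟩ := hs _ _ hc; exact ⟨.inl j, hj⟩
      · obtain ⟨j, hj⟩ := hs _ _ hc; exact ⟨.inr ⟨i, j.rev⟩, by simpa [g] using hj⟩
  let G := ofBijective g hg
  have h1 : ∀ i : Fin n, 1 ≤ (F (some i)).card := fun i =>
    Finset.card_pos.mpr ⟨E (.inr i), Finset.mem_filter.mpr ⟨mem_univ _, by rw [E.symm_apply_apply]; rfl⟩⟩
  have hR : ∀ i j : Fin (F none).card, i ≤ j → (∃ t, G (.inl j) = .inl t ∧ w t = .left) → ∃ t, G
    (.inl i) = .inl t ∧ w t = .left := by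
    rintro i j hij ⟨t, ht, hl⟩; rcases hij.eq_or_lt with rfl | hij
    · exact ⟨t, ht, hl⟩
    · have h2 := hlt none i j hij; change Newer (G (.inl i)) (G (.inl j)) at h2
      have h3 := ho none i; change cls w (G (.inl i)) = none at h3; rw [ht] at h2
      rcases e : G (.inl i) with s | s
      · rw [e] at h2; refine ⟨s, rfl, ?_⟩; have h4 := hw (le_of_lt (show s < t from h2))
        simp only [hl] at h4; cases hs : w s <;> first | rfl | simp [hs, rank] at h4
      · rw [e] at h3; cases h3
  obtain ⟨l, hl, hl'⟩ := exists_threshold _ hR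
  refine ⟨_, _, l, G, ⟨fun j => ho _ _, fun s => ho _ _, fun j j' e => hlt _ _ _ e, fun i j j' e =>
    hlt _ _ _ (Fin.rev_lt_rev.mpr e), fun j t e => ?_⟩, h1, hl⟩
  rw [← hl']
  exact ⟨fun h => ⟨t, e, h⟩, fun ⟨s, h2, h3⟩ => by
    rw [e] at h2; rw [Sum.inl_injective h2]; exact h3⟩

/-- The multiple series of a sequence of faces converge to rational functions. -/
def RationalWord (M : Bimodule A gr) (p : V → V → ℕ) (Φ : Cochain V gr n)
    (w : Fin J → FaceKind n) : Prop :=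
  ∀ u v w', ∃ h : MvPolynomial (Fin (n + J)) ℂ, ∀ ζ x, WordReg w ζ (elim x 0) → HasSum (fun k =>
    wordTerm M Φ w k u v w' ζ * ∏ t, x t ^ (-k t - 1)) (eval (coords w ζ (elim x 0)) h / poleProd p
    (tuple w u v) (coords w ζ (elim x 0)))

lemma WordReg.injective_centre {x : Fin J ⊕ Fin n → ℂ} (h : WordReg w ζ x) : Injective ζ := by
  intro i j e; by_contra hij; have := h.blocks (.inr i) (.inr j) i j hij rfl rfl
  rw [e, sub_self, norm_zero] at this; linarith [norm_nonneg (x (.inr i)), norm_nonneg (x (.inr j))]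

/-- At the centres of the blocks, only the constant terms in the corresponding variables remain. -/
lemma hasSum_centre_iff {a : (Fin J ⊕ Fin n → ℤ) → ℂ} {x : Fin J → ℂ} {S : ℂ} : HasSum (fun K => a K
    * ∏ s, elim x 0 s ^ (-K s - 1)) S ↔ HasSum (fun k => a (elim k fun _ => -1) * ∏ t, x t ^ (-k t -
    1)) S := by
  let c : (Fin J → ℤ) → (Fin J ⊕ Fin n → ℤ) := fun k => elim k fun _ => -1
  have hc : Injective c := fun k k' e => by funext t; exact congrFun e (.inl t)
  rw [← hc.hasSum_iff]
  · refine Iff.of_eq (congrArg (HasSum · S) (funext fun k => ?_)); simp [c, Fintype.prod_sum_type]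
  · intro K hK
    have : ∃ i, K (.inr i) ≠ -1 := by
      by_contra! h
      exact hK ⟨fun t => K (.inl t), funext fun s => by
        rcases s with s | s
        exacts [rfl, (h s).symm]⟩
    obtain ⟨i, hi⟩ := this; rw [Finset.prod_eq_zero (i := Sum.inr i) (mem_univ _), mul_zero]
    simp only [elim_inr, Pi.zero_apply]; exact zero_zpow _ (by omega)

/-- `Φ` is composable with `m` vertex operators, with pole orders bounded by `p`. -/
def ComposableWith (M : Bimodule A gr) (p : V → V → ℕ) (m : ℕ) (Φ : Cochain V gr n) : Prop :=
  ∀ (a : ℕ) (α : Fin n → ℕ), (∀ i, 1 ≤ α i) → a + ∑ i, α i = m + n → ∀ l ≤ a, ∀ (u₀ : Fin a → V) (u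
    : ∀ i, Fin (α i) → V) (w' : GradedDual gr), ∃ h : MvPolynomial (Fin a ⊕ (Σ i, Fin (α i))) ℂ, ∀
    (z₀ : Fin a → ℂ) (z : ∀ i, Fin (α i) → ℂ) (ζ : Conf n), ComposableRegion z₀ z ζ → HasSum (fun k
    => composeTerm M Φ l u₀ u k w' ζ * ((∏ j, z₀ j ^ (-k.1 j - 1)) * ∏ i, ∏ j, (z i j - ζ i) ^ (-k.2
    i j - 1))) (eval (joinVars z₀ z) h / poleProd p (joinVars u₀ u) (joinVars z₀ z))

lemma ComposableWith.rationalWord (hn : 0 < n) {m : ℕ} (hp : ComposableWith M p m Φ) {w : Fin m →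
    FaceKind n} (hw : Monotone fun t => (w t).rank) : RationalWord M p Φ w := by
  intro u v w'; obtain ⟨a, α, l, G, hG, hα, hl⟩ := exists_shape hw
  have hcard : a + ∑ i, α i = m + n := by simpa using Fintype.card_congr G
  let U : Fin m ⊕ Fin n → V := elim u v
  obtain ⟨h, hh⟩ := hp a α hα hcard l hl (fun j => U (G (.inl j))) (fun i j => U (G (.inr ⟨i, j⟩))) w'
  have hU : ∀ s, U (G s) = joinVars (fun j => U (G (.inl j))) (fun i j => U (G (.inr ⟨i, j⟩))) s := by
    rintro (s | s) <;> rfl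
  let e := Shape.index w G; refine ⟨MvPolynomial.rename e.symm h, fun ζ x hx => ?_⟩
  let c : Fin m ⊕ Fin n → ℂ := fun s => blockCtr ζ (cls w s) + elim x 0 s
  have hX : ∀ s, blockCtr ζ (cls w (G s)) + elim x (0 : Fin n → ℂ) (G s) = joinVars (fun j => c (G
    (.inl j))) (fun i j => c (G (.inr ⟨i, j⟩))) s := by
    rintro (s | s) <;> rfl
  have h1 := hh _ _ ⟨ζ, hx.injective_centre⟩ ((hG.region_iff hn hX).mpr hx)
  rw [hG.hasSum_iff (ζ := ⟨ζ, hx.injective_centre⟩) hU hX] at h1; have h2 := hasSum_centre_iff.mp h1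
  simp only [fullTerm, elim_inl, elim_inr, A.creation_lim] at h2
  have h3 := Shape.tuple_eq (w := w) hU
  rw [Shape.coords_eq hX, eval_rename, comp_assoc, Equiv.self_comp_symm, comp_id]
  change tuple w u v = _ at h3; rw [h3, poleProd_comp_equiv]; exact h2

/-! ### Removing a vacuum vector -/

lemma prod_erase_eq {ι : Type*} [Fintype ι] [DecidableEq ι] (f : ι → ℂ) (x : ι) : ∏ y ∈ univ.erase
    x, f y = ∏ y, if y = x then 1 else f y := by
  rw [← Finset.filter_ne', Finset.prod_filter]
  exact prod_congr rfl fun y _ => by split_ifs <;> simp_all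

open Polynomial in
lemma exists_poleProd_cons {N : ℕ} (p : V → V → ℕ) (b : V) (T : Fin N → V) : ∃ (d : ℕ) (s : ℂ), s ≠
    0 ∧ ∀ c : Fin N → ℂ, ∃ R : ℂ[X], R.coeff d = s ∧ ∀ t : ℂ, poleProd p (cons b T : Fin (N + 1) →
    V) (cons t c : Fin (N + 1) → ℂ) = R.eval t * poleProd p T c := by
  refine ⟨∑ j, (p b (T j) + p (T j) b), (-1) ^ ∑ j, p (T j) b, by simp, fun c => ?_⟩
  let R : ℂ[X] := ∏ j, (Polynomial.X - C (c j)) ^ (p b (T j) + p (T j) b)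
  have hR : ∀ j ∈ univ, ((Polynomial.X - C (c j)) ^ (p b (T j) + p (T j) b)).Monic := fun j _ =>
    (monic_X_sub_C _).pow _
  have h1 : R.coeff (∑ j, (p b (T j) + p (T j) b)) = 1 := by
    have h2 : R.natDegree = ∑ j, (p b (T j) + p (T j) b) := by
      rw [natDegree_prod_of_monic _ _ hR]; simp
    rw [← h2]; exact monic_prod_of_monic _ _ hR
  refine ⟨C ((-1) ^ ∑ j, p (T j) b) * R, by rw [coeff_C_mul, h1, mul_one], fun t => ?_⟩
  simp only [poleProd, prod_erase_eq, prod_univ_succ, cons_zero, Fin.cons_succ, Fin.succ_ne_zero,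
    if_true, if_false, one_mul, prod_mul_distrib, (Fin.succ_ne_zero _).symm, Fin.succ_inj, eval_mul,
    Polynomial.eval_C, R, eval_prod, eval_pow, eval_sub, Polynomial.eval_X, pow_add]
  have h3 : ∏ j, (c j - t) ^ p (T j) b = (-1) ^ (∑ j, p (T j) b) * ∏ j, (t - c j) ^ p (T j) b := by
    rw [← prod_pow_eq_pow_sum, ← prod_mul_distrib]
    exact prod_congr rfl fun j _ => by rw [← mul_pow]; congr 1; ring
  rw [h3]; ring

lemma WordReg.cons_left {x : Fin J → ℂ} (h : WordReg w ζ (elim x 0)) {t : ℂ} (ht : 1 + ∑ i, ‖ζ i‖ +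
    ∑ j, ‖x j‖ ≤ ‖t‖) : WordReg (cons .left w : Fin (J + 1) → FaceKind n) ζ (elim (cons t x : Fin (J
    + 1) → ℂ) 0) := by
  have hζ : ∀ i, ‖ζ i‖ ≤ ∑ i, ‖ζ i‖ := fun i =>
    single_le_sum (f := fun i => ‖ζ i‖) (fun _ _ => norm_nonneg _) (mem_univ i)
  have hx : ∀ j, ‖x j‖ ≤ ∑ j, ‖x j‖ := fun j =>
    single_le_sum (f := fun j => ‖x j‖) (fun _ _ => norm_nonneg _) (mem_univ j)
  have h1 : (0 : ℝ) ≤ ∑ i, ‖ζ i‖ := Finset.sum_nonneg fun _ _ => norm_nonneg _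
  have h2 : (0 : ℝ) ≤ ∑ j, ‖x j‖ := Finset.sum_nonneg fun _ _ => norm_nonneg _
  have h0 : t ≠ 0 := norm_pos_iff.mp (by linarith)
  have hs : ∀ a : Fin (J + 1) ⊕ Fin n, a = .inl 0 ∨ ∃ b : Fin J ⊕ Fin n, a = Sum.map Fin.succ id b := by
    rintro (a | a)
    · refine Fin.cases (Or.inl rfl) (fun a => Or.inr ⟨.inl a, rfl⟩) a
    · exact Or.inr ⟨.inr a, rfl⟩
  have hX : ∀ b : Fin J ⊕ Fin n, elim (cons t x : Fin (J + 1) → ℂ) (0 : Fin n → ℂ)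
      (Sum.map Fin.succ id b) = elim x 0 b := by rintro (b | b) <;> rfl
  have hc : ∀ b : Fin J ⊕ Fin n, cls (cons .left w : Fin (J + 1) → FaceKind n)
      (Sum.map Fin.succ id b) = cls w b := by rintro (b | b) <;> rfl
  have hc0 : cls (cons .left w : Fin (J + 1) → FaceKind n) (.inl 0) = none := rfl
  have hX0 : elim (cons t x : Fin (J + 1) → ℂ) (0 : Fin n → ℂ) (.inl 0) = t := rfl
  have hN : ∀ b b' : Fin J ⊕ Fin n, Newer (Sum.map Fin.succ id b : Fin (J + 1) ⊕ Fin n) (Sum.map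
    Fin.succ id b') → Newer b b' := by
    rintro (b | b) (b' | b') e
    exacts [Fin.succ_lt_succ_iff.mp e, e, e, e]
  have hN0 : ∀ b : Fin J ⊕ Fin n, ∀ i, cls w b = i → Newer (Sum.map Fin.succ id b) (.inl 0) → i ≠
    none := by
    rintro (b | b) i e h
    · exact absurd h (Fin.not_lt_zero _)
    · subst e; simp [cls]
  have hb : ∀ b : Fin J ⊕ Fin n, ‖elim x (0 : Fin n → ℂ) b‖ ≤ ∑ j, ‖x j‖ := by
    rintro (b | b)
    · exact hx b
    · simpa using h2
  refine ⟨fun s => Fin.cases h0 (fun s => h.ne s) s, fun a b => ?_, fun a b i => ?_,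
    fun a b i j => ?_, fun a b i => ?_⟩ <;>
    rcases hs a with rfl | ⟨a, rfl⟩ <;> rcases hs b with rfl | ⟨b, rfl⟩ <;>
    simp only [hX, hc, hc0, hX0]
  · exact fun e => absurd e (lt_irrefl _)
  · intro _ _ _; linarith [hb b]
  · intro e e1; exact absurd rfl (hN0 _ _ e1 e)
  · exact fun e => h.outer _ _ (hN _ _ e)
  iterate 3 simp
  · exact fun e => h.block _ _ _ (hN _ _ e)
  iterate 3 simp
  · exact h.blocks _ _ _ _
  · simp
  · intro _ _; linarith [hb b, hζ i]
  exacts [by simp, h.outer_block _ _ _]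

lemma wordTerm_zero (k : Fin J → ℤ) (u : Fin J → V) (v : Fin n → V) (ζ : Conf n) : wordTerm M Φ w k
    u v 0 ζ = 0 := by
  rw [wordTerm_eq, barPairing_zero_left]

lemma Bimodule.adj_YL_vac (M : Bimodule A gr) (k : ℤ) (w' : GradedDual gr) : adj (M.YL k A.vac) w' =
    if k = -1 then w' else 0 := by
  split_ifs with hk
  · have h1 : M.YL k A.vac = LinearMap.id := LinearMap.ext fun w => by
      rw [M.left_identity, if_pos hk]; rfl
    have h2 : HomOp gr 0 (LinearMap.id : W →ₗ[ℂ] W) := fun c w hw => by simpa using hw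
    rw [h1]; refine gradedDual_ext fun x => ?_; rw [barPairing_adj h2.finOp]; congr 1
    funext c; refine Subtype.ext ?_; rw [h2.extendOp_apply]
    exact congrArg (fun c => ((x c : gr c) : W)) (sub_zero c)
  · have h1 : M.YL k A.vac = 0 := LinearMap.ext fun w => by
      rw [M.left_identity, if_neg hk]; rfl
    rw [h1, adj_zero_op]

lemma RationalWord.of_cons (h : RationalWord M p Φ (cons .left w : Fin (J + 1) → FaceKind n)) :
    RationalWord M p Φ w := by
  intro u v w'; obtain ⟨h, hh⟩ := h (cons A.vac u) v w'
  obtain ⟨d, s, hs, hR⟩ := exists_poleProd_cons p A.vac (tuple w u v)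
  refine ⟨MvPolynomial.C s⁻¹ * (MvPolynomial.finSuccEquiv ℂ (n + J) h).coeff d, fun ζ x hx => ?_⟩
  obtain ⟨R, hR1, hR2⟩ := hR (coords w ζ (elim x 0))
  have htuple : ∀ {X : Type _} (a : X) (u : Fin J → X) (v : Fin n → X), tuple (cons .left w : Fin (J
    + 1) → FaceKind n) (cons a u) v = (cons a (tuple w u v) : Fin (n + J + 1) → X) := fun a u v =>
    Fin.insertNth_zero' _ _
  have hco : ∀ t, coords (cons .left w : Fin (J + 1) → FaceKind n) ζ (elim (cons t x : Fin (J + 1) →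
    ℂ) 0) = (cons t (coords w ζ (elim x 0)) : Fin (n + J + 1) → ℂ) := fun t => by
    rw [coords_succ]; refine (Fin.insertNth_zero' _ _).trans ?_
    simp only [tail_cons, cons_zero, map, ctr, zero_add]
  have hinj : Injective (coords w ζ (elim x 0)) := hx.coords_injective
  have hP := poleProd_ne_zero p (tuple w u v) hinj
  let T := {t : ℂ | 1 + ∑ i, ‖ζ i‖ + ∑ j, ‖x j‖ ≤ ‖t‖}
  have hsum : ∀ t ∈ T, HasSum (fun k => wordTerm M Φ w k u v w' ζ * ∏ t, x t ^ (-k t - 1)) (eval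
    (cons t (coords w ζ (elim x 0)) : Fin (n + J + 1) → ℂ) h / (R.eval t * poleProd p (tuple w u v)
    (coords w ζ (elim x 0)))) := by
    intro t ht; have h1 := hh ζ _ (hx.cons_left ht); rw [hco, htuple, hR2] at h1
    have hc : Injective fun k : Fin J → ℤ => (cons (-1) k : Fin (J + 1) → ℤ) :=
      Fin.cons_right_injective (α := fun _ => ℤ) (-1)
    have hterm : ∀ K : Fin (J + 1) → ℤ, wordTerm M Φ (cons .left w : Fin (J + 1) → FaceKind n) K
      (cons A.vac u) v w' ζ = wordTerm M Φ w (tail K) u v (if K 0 = -1 then w' else 0) ζ := fun K =>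
      by
      rw [← M.adj_YL_vac]; rfl
    rw [← hc.hasSum_iff] at h1
    · refine h1.of_eq fun k => ?_
      simp only [comp, hterm, cons_zero, tail_cons, if_true, prod_univ_succ, Fin.cons_succ]
      simp
    · intro K hK; have : K 0 ≠ -1 := fun e => hK ⟨tail K, by rw [← e]; exact Fin.cons_self_tail K⟩
      have h0 : wordTerm M Φ w (tail K) u v 0 ζ = 0 := wordTerm_zero _ _ _ ⟨ζ, hx.injective_centre⟩
      rw [hterm, if_neg this, h0, zero_mul]
  have hT : T.Infinite := by
    refine Set.infinite_of_injective_forall_mem (f := fun m : ℕ =>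
      (((1 + ∑ i, ‖ζ i‖ + ∑ j, ‖x j‖ + m : ℝ)) : ℂ)) (fun a b e => ?_) fun m => ?_
    · simpa using e
    · simp only [T, Set.mem_ofPred_eq, Complex.norm_real]; rw [Real.norm_of_nonneg (by positivity)]
      linarith [(Nat.cast_nonneg m : (0 : ℝ) ≤ m)]
  obtain ⟨t₀, ht₀⟩ := hT.nonempty
  have hR0 : ∀ t ∈ T, R.eval t ≠ 0 := fun t ht => by
    have h1 := poleProd_ne_zero p (cons A.vac (tuple w u v) : Fin (n + J + 1) → V) (hco t ▸
      (hx.cons_left ht).coords_injective)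
    rw [hR2] at h1; exact left_ne_zero_of_mul h1
  set S := ∑' k, wordTerm M Φ w k u v w' ζ * ∏ t, x t ^ (-k t - 1) with hS
  have hpoly : Polynomial.C (S * poleProd p (tuple w u v) (coords w ζ (elim x 0))) * R =
    (MvPolynomial.finSuccEquiv ℂ (n + J) h).map (eval (coords w ζ (elim x 0))) := by
    refine Polynomial.eq_of_infinite_eval_eq _ _ (hT.mono fun t ht => ?_)
    have h1 := (hsum t ht).tsum_eq; have h2 := hR0 t ht
    simp only [Set.mem_ofPred_eq, Polynomial.eval_mul, Polynomial.eval_C]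
    rw [← MvPolynomial.eval_eq_eval_mv_eval', hS, h1]; field_simp
  have h3 := congrArg (fun q => q.coeff d) hpoly
  simp only [Polynomial.coeff_C_mul, Polynomial.coeff_map, hR1] at h3
  have h4 := (hsum t₀ ht₀).summable.hasSum; rw [← hS] at h4; convert h4 using 1
  rw [map_mul, ← h3, eval_C]; field_simp

lemma ComposableWith.rationalWord_of_le (hn : 0 < n) {m : ℕ} (hp : ComposableWith M p m Φ) {d : ℕ}
    (hJ : J + d = m) (hw : Monotone fun t => (w t).rank) : RationalWord M p Φ w := by
  induction d generalizing J with
  | zero => subst hJ; exact hp.rationalWord hn hw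
  | succ d ih =>
    refine RationalWord.of_cons (ih (J := J + 1) (by omega) fun s t => ?_)
    refine Fin.cases (fun _ => Nat.zero_le _) (fun s => ?_) s
    refine Fin.cases (fun e => absurd e (by simp)) (fun t e => ?_) t
    exact hw (Fin.succ_le_succ_iff.mp e)

lemma RationalWord.poleBound {w : Fin 0 → FaceKind n} (h : RationalWord M p Φ w) : PoleBound p Φ :=
    by
  intro v w'; obtain ⟨h, hh⟩ := h elim0 v w'; refine ⟨h, fun z hz => ?_⟩
  have hco : coords w z (elim (elim0 : Fin 0 → ℂ) 0) = z := by rw [coords_eq_tuple]; simp [tuple]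
  have h1 := hh z elim0 ⟨fun t => t.elim0, ?_, ?_, ?_, ?_⟩
  · rw [hco] at h1
    have h2 := h1.unique (hasSum_of_single elim0 (fun k hk => absurd (Subsingleton.elim _ _) hk)
      rfl)
    simp only [wordTerm, Finset.univ_eq_empty, prod_empty, mul_one] at h2; rw [← h2]
    exact div_mul_cancel₀ _ (poleProd_ne_zero p v hz)
  · rintro (a | a) b - h1
    · exact a.elim0
    · simp [cls] at h1
  · rintro (a | a) (b | b) i h
    exacts [a.elim0, a.elim0, b.elim0, h.elim]
  · rintro (a | a) (b | b) i j hij h1 h2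
    · exact a.elim0
    · exact a.elim0
    · exact b.elim0
    · simp only [cls, elim_inr, Option.some.injEq] at h1 h2; subst h1 h2
      simpa [sub_eq_zero] using hz.ne hij
  · rintro (a | a) b i h1
    · exact a.elim0
    · simp [cls] at h1

lemma Regular.of_properties (hp : PoleBound p Φ) (hD : DDerivativeProperty M Φ) (hd :
    DConjugationProperty grV Φ) : Regular M p Φ := by
  have h1 : ∀ i v w' z, Injective z → HasDerivAt (fun t => cor Φ w' v (update z i t)) (cor Φ w'
    (update v i (A.D (v i))) z) (z i) := fun i v w' z hz => by
    rw [cor_of_injective _ _ _ hz]; exact hD.1 i v w' ⟨z, hz⟩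
  refine ⟨hp, h1, fun v w' z hz => ?_, fun v d hv c φ t z ht hz => ?_⟩
  · rw [cor_adj _ M.D_mem_finOp, evalAt_of_injective _ hz, hD.2 v w' ⟨z, hz⟩]
    exact sum_congr rfl fun i _ => (h1 i v w' z hz).deriv
  · have hz' : Injective (t • z) := fun i j e => hz (mul_left_cancel₀ ht e)
    have h2 := hd v (dualOf gr c φ) t ⟨z, hz⟩ ⟨t • z, hz'⟩ ht fun i => rfl
    rw [barPairing_of, map_smul, smul_eq_mul] at h2
    rw [cor_of_injective _ _ _ hz, cor_of_injective _ _ _ hz', barPairing_of, h2]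
    have h3 : (fun i => scaleOp grV (fun k : ℤ => t ^ k) (v i)) = fun i => t ^ d i • v i := funext
      fun i => scaleOp_of_mem _ (hv i)
    rw [h3, MultilinearMap.map_smul_univ, Pi.smul_apply, barPairing_smul]; congr 1
    refine Finset.induction_on univ (by simp) fun a s ha ih => ?_
    rw [prod_insert ha, sum_insert ha, ih, zpow_add₀ ht]

lemma IsWord.unique {Z Z' : Cochain V gr (n + J)} (h : IsWord M p Φ w Z) (h' : IsWord M p Φ w Z') :
    Z = Z' := by
  induction J with
  | zero => exact h.1.trans h'.1.symm
  | succ J ih =>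
    obtain ⟨Y, hY, hZ, hF⟩ := h; obtain ⟨Y', hY', hZ', hF'⟩ := h'; obtain rfl := ih hY hY'
    exact hF.unique hF' hZ.poleBound hZ'.poleBound

lemma monotone_rank_tail {w : Fin (J + 1) → FaceKind n} (hw : Monotone fun t => (w t).rank) :
    Monotone fun t => (tail w t).rank :=
  fun _ _ h => hw (Fin.succ_le_succ_iff.mpr h)

lemma monotone_rank_cons (hw : Monotone fun t => (w t).rank) (h : ∀ t, κ.rank ≤ (w t).rank) :
    Monotone fun t => ((cons κ w : Fin (J + 1) → FaceKind n) t).rank := by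
  intro s t; refine Fin.cases (fun _ => ?_) (fun s => ?_) s
  · exact Fin.cases le_rfl (fun t => h t) t
  · refine Fin.cases (fun e => absurd e (by simp)) (fun t e => ?_) t
    exact hw (Fin.succ_le_succ_iff.mp e)

lemma FaceKind.map_map {N L : ℕ} (κ : FaceKind n) (f : Fin n → Fin N) (g : Fin N → Fin L) : (κ.map
    f).map g = κ.map (g ∘ f) := by
  cases κ <;> rfl

lemma FaceKind.succAbove_comm (κ : FaceKind n) {i : Fin n} (hi : κ.base ≠ some i) (m : Fin n) :
    (κ.map i.castSucc.succAbove).pos.succAbove (i.castSucc.succAbove m) = (κ.pos.succAbove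
    i).castSucc.succAbove (κ.pos.succAbove m) := by
  rcases κ with _ | _ | j
  · simp only [map, pos, Fin.ext_iff, val_succAbove, val_castSucc, val_zero]
    grind
  · simp only [map, pos, Fin.ext_iff, val_succAbove, val_castSucc, val_last]
    split_ifs <;> omega
  · have hij : (j : ℕ) ≠ i := fun h => hi (by rw [base, Fin.ext h])
    simp only [map, pos, Fin.ext_iff, val_succAbove, val_castSucc]; split_ifs <;> omega

/-- The face of a sequence of faces in normal form is again given by a normal form. -/
structure FaceWord (M : Bimodule A gr) (p : V → V → ℕ) (Φ : Cochain V gr n) {J : ℕ}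
    (w : Fin J → FaceKind n) (Z : Cochain V gr (n + J)) (κ : FaceKind (n + J))
    (w' : Fin (J + 1) → FaceKind n) (Z' : Cochain V gr (n + J + 1)) : Prop where
  monotone : Monotone fun t => (w' t).rank
  isWord : IsWord M p Φ w' Z'
  face : Face M κ Z Z'
  place_eq : ∀ i, place w' i = κ.pos.succAbove (place w i)
  rank_le : ∀ r, (∀ t, r ≤ (w t).rank) → r ≤ κ.rank → ∀ t, r ≤ (w' t).rank

lemma exists_faceWord_map (hex : ∀ w : Fin (J + 1) → FaceKind n, Monotone (fun t => (w t).rank) → ∃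
    Z, IsWord M p Φ w Z) (hw : Monotone fun t => (w t).rank) {Z : Cochain V gr (n + J)} (hZ : IsWord
    M p Φ w Z) (h : ∀ t, κ.rank ≤ (w t).rank) : ∃ w' Z', FaceWord M p Φ w Z (κ.map (place w)) w' Z'
    := by
  have hm := monotone_rank_cons hw h; obtain ⟨Z', Y, hY, hZ', hF⟩ := hex _ hm
  obtain rfl := hY.unique hZ
  refine ⟨cons κ w, Z', hm, ⟨Y, hY, hZ', hF⟩, hF, fun i => rfl, fun r h1 h2 t => ?_⟩
  refine Fin.cases ?_ (fun t => h1 t) t; rcases κ <;> exact h2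

lemma exists_faceWord {m : ℕ} (hex : ∀ J ≤ m, ∀ w : Fin J → FaceKind n, Monotone (fun t => (w
    t).rank) → ∃ Z, IsWord M p Φ w Z) (hJ : J < m) (hw : Monotone fun t => (w t).rank) {Z : Cochain
    V gr (n + J)} (hZ : IsWord M p Φ w Z) (κ : FaceKind (n + J)) : ∃ w' Z', FaceWord M p Φ w Z κ w'
    Z' := by
  induction J with
  | zero =>
    have := exists_faceWord_map (hex _ hJ) hw hZ (κ := κ) fun t => t.elim0
    rwa [map_place_zero] at this
  | succ J ih =>
    obtain ⟨Y, hY, hZr, hF⟩ := hZ; have hZ : IsWord M p Φ w Z := ⟨Y, hY, hZr, hF⟩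
    have hwt := monotone_rank_tail hw
    have hw0 : ∀ t, (w 0).rank ≤ (w t).rank := fun t => hw (Fin.zero_le t)
    have ih' := ih (by omega) hwt hY
    have hext : ∀ (κ' : FaceKind (n + J)) w₁ Y', FaceWord M p Φ (tail w) Y κ' w₁ Y' → (w 0).rank ≤
      κ'.rank → ∃ Z', Monotone (fun t =>
          ((cons (w 0) w₁ : Fin (J + 1 + 1) → FaceKind n) t).rank) ∧
          IsWord M p Φ (cons (w 0) w₁ : Fin (J + 1 + 1) → FaceKind n) Z' ∧
          Face M ((w 0).map (place w₁)) Y' Z' := by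
      intro κ' w₁ Y' h1 h2
      have hm := monotone_rank_cons h1.monotone (κ := w 0) (h1.rank_le _ (fun t => hw0 t.succ) h2)
      obtain ⟨Z', Y'', hY'', hZ', hF'⟩ := hex _ hJ _ hm; obtain rfl := hY''.unique h1.isWord
      exact ⟨Z', hm, ⟨_, hY'', hZ', hF'⟩, hF'⟩
    have hrank : ∀ {w₁ : Fin (J + 1) → FaceKind n} {r : ℕ}, (∀ t, r ≤ (w t).rank) → (∀ t, r ≤ (w₁
      t).rank) → ∀ t, r ≤ ((cons (w 0) w₁ : Fin (J + 1 + 1) → FaceKind n) t).rank := fun h1 h2 t =>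
      Fin.cases (h1 0) h2 t
    rcases κ with _ | _ | c
    · exact exists_faceWord_map (hex _ hJ) hw hZ (κ := .left) fun t => Nat.zero_le _
    · by_cases h0 : 1 ≤ (w 0).rank
      · exact exists_faceWord_map (hex _ hJ) hw hZ (κ := .right) fun t => h0.trans (hw0 t)
      · have hl : w 0 = .left := by
          rcases e : w 0 with _ | _ | i
          · rfl
          · exact absurd (by rw [e]; exact le_rfl) h0
          · exact absurd (by rw [e]; exact Nat.le_succ 1) h0
        obtain ⟨w₁, Y', h1⟩ := ih' .right
        obtain ⟨Z', hm, hZ', hF'⟩ := hext _ _ _ h1 (by rw [hl]; exact Nat.zero_le _)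
        rw [hl] at hF hF'
        refine ⟨_, Z', hm, hZ', Face.left_right hY.regular hZr h1.isWord.regular hZ'.regular h1.face
          hF' hF, fun i => ?_, fun r h2 h3 => ?_⟩
        · have h2 : place (cons (w 0) w₁ : Fin (J + 1 + 1) → FaceKind n) i = ((w 0).map (place
            w₁)).pos.succAbove (place w₁ i) := rfl
          have h3 : place w i = ((w 0).map (place (tail w))).pos.succAbove (place (tail w) i) := rfl
          rw [h2, h3, h1.place_eq, hl]
          simp only [map, pos, Fin.ext_iff, val_succAbove, val_last, val_zero]
          grind
        · have : r = 0 := Nat.le_zero.mp (by simpa [hl, rank] using h2 0); intro t; rw [this]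
          exact Nat.zero_le _
    · refine succAboveCases ((w 0).map (place (tail w))).pos ?_ (fun c' => ?_) c
      · have hm := monotone_rank_cons hw hw0; obtain ⟨Z', Y', hY', hZ', hF'⟩ := hex _ hJ _ hm
        obtain rfl := hY'.unique hZ
        have hp : place (tail (cons (w 0) w : Fin (J + 1 + 1) → FaceKind n)) = ((w 0).map (place
          (tail w))).pos.succAbove ∘ place (tail w) := rfl
        have h0 : (cons (w 0) w : Fin (J + 1 + 1) → FaceKind n) 0 = w 0 := rfl
        refine ⟨_, Z', hm, ⟨_, hY', hZ', hF'⟩, ?_, fun i => ?_, fun r h2 h3 => hrank h2 h2⟩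
        · rw [hp, h0, ← map_map] at hF'
          generalize (w 0).map (place (tail w)) = κ' at hF hF'
          rcases κ' with _ | _ | i
          · exact Face.left_left hY.regular hZr hZ' hF hF'
          · exact Face.right_right hY.regular hZr hZ' hF hF'
          · refine Face.mid_mid hY.regular hZr hZ' hF ?_
            rwa [map, show (mid i).pos.succAbove i = i.succ from succAbove_castSucc_self i] at hF'
        · have h2 : place (cons (w 0) w : Fin (J + 1 + 1) → FaceKind n) i = ((w 0).map (place
            w)).pos.succAbove (place w i) := rfl
          have h3 : place w = ((w 0).map (place (tail w))).pos.succAbove ∘ place (tail w) := rfl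
          rw [h2, h3, ← map_map, comp]
          generalize (w 0).map (place (tail w)) = κ'
          generalize place (tail w) i = y
          rcases κ' with _ | _ | i
          · rfl
          · simp only [map, pos, Fin.ext_iff, val_succAbove, val_last, val_castSucc]
            split_ifs <;> omega
          · simp only [map, pos, Fin.ext_iff, val_succAbove, val_castSucc]; split_ifs <;> omega
      · by_cases hc : ((w 0).map (place (tail w))).base = some c'
        · rcases e : w 0 with _ | _ | i
          · rw [e] at hc; cases hc
          · rw [e] at hc; cases hc
          · rw [e] at hc; have hi : place (tail w) i = c' := by simpa [map, base] using hc
            have h1 : mid (((mid i).map (place (tail w))).pos.succAbove c') = (mid i).map (place w)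
              := by
              change _ = mid (((w 0).map (place (tail w))).pos.succAbove (place (tail w) i))
              rw [← hi, e]
            rw [h1]
            exact exists_faceWord_map (hex _ hJ) hw hZ fun t => by have := hw0 t; rwa [e] at this
        · obtain ⟨w₁, Y', h1⟩ := ih' (.mid c')
          obtain ⟨Z', hm, hZ', hF'⟩ := hext _ _ _ h1 (by rcases w 0 <;> simp [rank])
          have hpl : place w₁ = c'.castSucc.succAbove ∘ place (tail w) := funext h1.place_eq
          rw [hpl, ← map_map] at hF'
          refine ⟨_, Z', hm, hZ', Face.commute hc hY.regular hZr h1.isWord.regular hZ'.regular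
            h1.face hF' hF, fun i => ?_, fun r h2 h3 => hrank h2 (h1.rank_le r (fun t => h2 t.succ)
            h3)⟩
          have h2 : place (cons (w 0) w₁ : Fin (J + 1 + 1) → FaceKind n) i = ((w 0).map (place
            w₁)).pos.succAbove (place w₁ i) := rfl
          rw [h2, hpl, ← map_map]; exact succAbove_comm _ hc _

/-- The faces of a cochain exist up to a given depth. -/
def Good (M : Bimodule A gr) (p : V → V → ℕ) : ℕ → ∀ {n : ℕ}, Cochain V gr n → Prop
  | 0, _, Ψ => Regular M p Ψ
  | j + 1, _, Ψ => Regular M p Ψ ∧ ∀ κ, ∃ Z, Face M κ Ψ Z ∧ Good M p j Z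

lemma Good.regular {j : ℕ} (h : Good M p j Ψ) : Regular M p Ψ := by
  cases j with
  | zero => exact h
  | succ j => exact h.1

lemma ComposableWith.good (hn : 0 < n) {m : ℕ} (hp : ComposableWith M p m Φ) (hD :
    DDerivativeProperty M Φ) (hd : DConjugationProperty grV Φ) : Good M p m Φ := by
  have hr : ∀ {J : ℕ}, J ≤ m → ∀ {w : Fin J → FaceKind n}, Monotone (fun t => (w t).rank) →
    RationalWord M p Φ w := fun hJ _ hw =>
    hp.rationalWord_of_le hn (Nat.add_sub_of_le hJ) hw
  have hΦ : Regular M p Φ := Regular.of_properties (RationalWord.poleBound (hr (Nat.zero_le m) (w :=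
    elim0) fun t => t.elim0)) hD hd
  have hex : ∀ J ≤ m, ∀ w : Fin J → FaceKind n, Monotone (fun t => (w t).rank) → ∃ Z, IsWord M p Φ w
    Z := by
    intro J
    induction J with
    | zero => exact fun _ w _ => ⟨Φ, rfl, hΦ⟩
    | succ J ih =>
      intro hJ w hw; obtain ⟨Y, hY⟩ := ih (by omega) _ (monotone_rank_tail hw)
      exact hY.extend (hr hJ hw)
  have key : ∀ d J : ℕ, J + d = m → ∀ (w : Fin J → FaceKind n) Z, Monotone (fun t => (w t).rank) →
    IsWord M p Φ w Z → Good M p d Z := by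
    intro d
    induction d with
    | zero => exact fun J _ w Z _ hZ => hZ.regular
    | succ d ih =>
      intro J hJ w Z hw hZ; refine ⟨hZ.regular, fun κ => ?_⟩
      obtain ⟨w', Z', h⟩ := exists_faceWord hex (by omega) hw hZ κ
      exact ⟨Z', h.face, ih (J + 1) (by omega) w' Z' h.monotone h.isWord⟩
  exact key m 0 (Nat.zero_add m) elim0 Φ (fun t => t.elim0) ⟨rfl, hΦ⟩

/-! ### Taylor expansion at the centres of the blocks -/

lemma MOSVA.Y_vac (A : MOSVA grV) (r : ℕ) (v : V) : A.Y (-r - 1) v A.vac = (r.factorial : ℂ)⁻¹ •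
    A.D^[r] v := by
  induction r generalizing v with
  | zero => simp [A.creation_lim]
  | succ r ih =>
    have h := A.D_deriv (-r - 1) v A.vac
    have h0 : (r : ℂ) + 1 ≠ 0 := by exact_mod_cast r.succ_ne_zero
    rw [← MOSVA.D, ih, show -(r : ℤ) - 1 - 1 = -(r + 1 : ℕ) - 1 by push_cast; ring] at h
    rw [iterate_succ_apply, factorial_succ, Nat.cast_mul, mul_inv, mul_smul, ← h, smul_smul]
    push_cast; rw [show -(-(r : ℂ) - 1) = r + 1 by ring, inv_mul_cancel₀ h0, one_smul]

lemma Regular.hasSum_taylor (h : Regular M p Ψ) (v : Fin n → V) (w' : GradedDual gr) {z : Fin n → ℂ}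
    {i : Fin n} {ρ : ℝ} (hz : ∀ t ∈ Metric.ball (z i) ρ, Injective (update z i t)) {ξ : ℂ} (hξ : ‖ξ‖
    < ρ) : HasSum (fun r : ℤ => cor Ψ w' (update v i (A.Y r (v i) A.vac)) z * ξ ^ (-r - 1)) (cor Ψ
    w' v (update z i (z i + ξ))) := by
  have hd : ∀ (v : Fin n → V), ∀ t ∈ Metric.ball (z i) ρ, HasDerivAt (fun t => cor Ψ w' v (update z
    i t)) (cor Ψ w' (update v i (A.D (v i))) (update z i t)) t := fun v t ht => by
    simpa using h.hasDerivAt i v w' (update z i t) (hz t ht)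
  have hk : ∀ (k : ℕ) (v : Fin n → V), ∀ t ∈ Metric.ball (z i) ρ, iteratedDeriv k (fun t => cor Ψ w'
    v (update z i t)) t = cor Ψ w' (update v i (A.D^[k] (v i))) (update z i t) := by
    intro k
    induction k with
    | zero => intro v t _; simp
    | succ k ih =>
      intro v t ht
      have h1 : deriv (fun t => cor Ψ w' v (update z i t)) =ᶠ[𝓝 t] fun t =>
          cor Ψ w' (update v i (A.D (v i))) (update z i t) := by
        filter_upwards [Metric.isOpen_ball.mem_nhds ht] with s hs
        exact (hd v s hs).deriv
      rw [iteratedDeriv_succ', h1.iteratedDeriv_eq, ih _ t ht]; simp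
  have h0 : z i ∈ Metric.ball (z i) ρ := Metric.mem_ball_self (lt_of_le_of_lt (norm_nonneg _) hξ)
  have h1 := Complex.hasSum_taylorSeries_on_ball (c := z i) (r := ρ) (z := z i + ξ)
    (f := fun t => cor Ψ w' v (update z i t))
    (fun t ht => (hd v t ht).differentiableAt.differentiableWithinAt) (by simpa using hξ)
  have hj : Injective fun r : ℕ => -(r : ℤ) - 1 := fun a b e => by simpa using e
  rw [← hj.hasSum_iff]
  · refine h1.of_eq fun r => ?_; rw [hk r v _ h0, update_eq_self]
    simp only [comp, A.Y_vac, cor_update_smul, add_sub_cancel_left, smul_eq_mul]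
    rw [show -(-(r : ℤ) - 1) - 1 = r by ring, zpow_natCast]; ring
  · intro k hk
    have : 0 ≤ k := by by_contra hc; exact hk ⟨(-k - 1).toNat, by simp only; omega⟩
    rw [A.creation_reg k _ this, cor_update_zero, zero_mul]

lemma WordReg.mono {x y : Fin J ⊕ Fin n → ℂ} (h : WordReg w ζ x) (h1 : ∀ t, ‖y (.inl t)‖ = ‖x (.inl
    t)‖) (h2 : ∀ i, ‖y (.inr i)‖ ≤ ‖x (.inr i)‖) : WordReg w ζ y := by
  have h3 : ∀ a, ‖y a‖ ≤ ‖x a‖ := by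
    rintro (a | a)
    exacts [(h1 a).le, h2 a]
  refine ⟨fun t => norm_pos_iff.mp (by simpa [h1] using h.ne t), ?_, ?_, fun a b i j e1 e2 e3 =>
    (add_le_add (h3 a) (h3 b)).trans_lt (h.blocks a b i j e1 e2 e3), ?_⟩
  · rintro (a | a) b e1 e2 e3
    · exact (h3 b).trans_lt ((h.outer _ _ e1 e2 e3).trans_eq (h1 a).symm)
    · cases e2
  · rintro a (b | b) i e1 e2 e3
    · exact (h3 a).trans_lt ((h.block _ _ i e1 e2 e3).trans_eq (h1 b).symm)
    · rcases a <;> exact e1.elim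
  · rintro (a | a) b i e1 e2
    · exact (add_le_add le_rfl (h3 b)).trans_lt ((h.outer_block _ _ i e1 e2).trans_eq (h1 a).symm)
    · cases e1

lemma independent_torus' {ι : Type*} [Fintype ι] {r : ι → ℝ} (hr : ∀ i, 0 < r i) : Independent (fun
    (k : ι → ℤ) (x : ι → ℂ) => ∏ i, x i ^ (-k i - 1)) {x | ∀ i, ‖x i‖ = r i} := by
  let e := (Fintype.equivFin ι).symm
  refine (independent_torus fun i => hr (e i)).comp_equiv (e.symm.arrowCongr (Equiv.refl ℤ)) (fun x
    => x ∘ e) (fun x hx => ⟨x ∘ e.symm, fun i => ?_, ?_⟩) fun k x _ => ?_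
  · simpa using hx (e.symm i)
  · funext i; simp
  · rw [← e.prod_comp]; rfl

lemma prod_split {ι : Type*} [Fintype ι] [DecidableEq ι] (s : ι) (f : ι → ℂ) : ∏ x, f x = f s * ∏ x
    : {x // x ≠ s}, f x := by
  rw [← Finset.mul_prod_erase _ f (mem_univ s), Finset.prod_subtype (p := (· ≠ s)) (univ.erase s)
    (by simp)]

/-- Shifting a creation operator of an original argument into this argument. -/
lemma creation_coeff {ι X : Type*} [Fintype ι] [DecidableEq ι] {c : X → (ι → ℤ) → ℂ} {F : X → (ι →
    ℂ) → ℂ} {r : ι → ℝ} (hr : ∀ j, 0 < r j) {s : ι} {T : ℤ → X → X} (hc : ∀ v x, (∀ j ≠ s, ‖x j‖ = r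
    j) → ‖x s‖ ≤ r s → HasSum (fun k => c v k * ∏ j, x j ^ (-k j - 1)) (F v x)) (hT : ∀ v x, (∀ j,
    ‖x j‖ = r j) → HasSum (fun k => F (T k v) (update x s 0) * x s ^ (-k - 1)) (F v x)) (v : X) (k :
    ι → ℤ) : c v k = c (T (k s) v) (update k s (-1)) := by
  let σ : ({j // j ≠ s} → ℤ) × ℤ ≃ (ι → ℤ) := (prodComm _ _).trans (funSplitAt s ℤ).symm
  let τ : ({j // j ≠ s} → ℂ) → ℂ → ι → ℂ := fun x t => (funSplitAt s ℂ).symm (t, x)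
  have hσs : ∀ q, σ q s = q.2 := fun q => by simp [σ, funSplitAt]
  have hσ : ∀ q (j : {j // j ≠ s}), σ q j = q.1 j := fun q j => by simp [σ, funSplitAt, j.2]
  have hτs : ∀ x t, τ x t s = t := fun x t => by simp [τ, funSplitAt]
  have hτ : ∀ x t (j : {j // j ≠ s}), τ x t j = x j := fun x t j => by simp [τ, funSplitAt, j.2]
  have hτn : ∀ x : {j // j ≠ s} → ℂ, (∀ j : {j // j ≠ s}, ‖x j‖ = r j) → ∀ t, ∀ j ≠ s, ‖τ x t j‖ = r
    j := fun x hx t j hj => by rw [← hx ⟨j, hj⟩, ← hτ x t ⟨j, hj⟩]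
  have hup : ∀ x t, update (τ x t) s 0 = τ x 0 := fun x t => funext fun j => by
    by_cases hj : j = s
    · subst hj; rw [update_self, hτs]
    · rw [update_of_ne hj, hτ x t ⟨j, hj⟩, hτ x 0 ⟨j, hj⟩]
  have key : (fun q => c v (σ q)) = fun q => c (T q.2 v) (σ (q.1, -1)) := by
    refine Independent.refine (independent_torus' fun j : {j // j ≠ s} => hr j)
      (independent_zpow_neg (hr s)) (F := fun x t => F v (τ x t)) (g := fun k x => F (T k v) (τ x
      0)) (fun x hx t ht => ?_) (fun x hx t ht => ?_) fun x hx k => ?_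
    · have h1 := hc v (τ x t) (hτn x hx t) (by rw [hτs]; exact le_of_eq ht)
      rw [← σ.hasSum_iff] at h1; refine h1.of_eq fun q => ?_
      simp only [comp, prod_split s, hσs, hσ, hτs, hτ]; ring
    · have h1 := hT v (τ x t) fun j => by
        by_cases hj : j = s
        · subst hj; rw [hτs]; exact ht
        · exact hτn x hx t j hj
      rwa [hup, hτs] at h1
    · have h1 := hc (T k v) (τ x 0) (hτn x hx 0) (by rw [hτs, norm_zero]; exact (hr s).le)
      have hj : Injective fun q : {j // j ≠ s} → ℤ => σ (q, -1) := fun a b e =>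
        (Prod.ext_iff.mp (σ.injective e)).1
      rw [← hj.hasSum_iff] at h1
      · refine h1.of_eq fun q => ?_; simp only [comp, prod_split s, hσs, hσ, hτs, hτ]; simp
      · intro K hK; obtain ⟨q, rfl⟩ := σ.surjective K
        have : -q.2 - 1 ≠ 0 := fun e => hK ⟨q.1, by
          rw [show q = (q.1, -1) from Prod.ext rfl (by simp only; omega)]⟩
        rw [prod_split s, hσs, hτs, zero_zpow _ this, zero_mul, mul_zero]
  obtain ⟨q, rfl⟩ := σ.surjective k; rw [hσs]
  refine (congrFun key q).trans (congrArg _ (funext fun j => ?_))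
  by_cases hj : j = s
  · subst hj; rw [update_self, hσs]
  · rw [update_of_ne hj, hσ _ ⟨j, hj⟩, hσ _ ⟨j, hj⟩]

/-- The multiple series of a sequence of faces, with the original arguments created from the vacuum,
converges absolutely. -/
lemma IsWord.hasSum_full {Z : Cochain V gr (n + J)} (h : IsWord M p Φ w Z) (U : Fin J ⊕ Fin n → V)
    (w' : GradedDual gr) {X : Fin J ⊕ Fin n → ℂ} (hX : WordReg w ζ X) : HasSum (fun K : Fin J ⊕ Fin
    n → ℤ => fullTerm M Φ w K U w' ζ * ∏ s, X s ^ (-K s - 1)) (cor Z w' (tuple w (fun t => U (.inl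
    t)) (fun i => U (.inr i))) (coords w ζ X)) := by
  let F : (Fin n → V) → (Fin J ⊕ Fin n → ℂ) → ℂ := fun v X =>
    cor Z w' (tuple w (fun t => U (.inl t)) v) (coords w ζ X)
  have hL : ∀ v, HasLaurent (Set.range Sum.inr) {X | WordReg w ζ X} (F v) := fun v => by
    refine WordReg.hasLaurent (w := w) (ζ := ζ) (x := fun a x => x a) (fun x hx i hi => ?_) (fun y
      hy => hy) (fun a => LaurentOn.coord a) (fun s => LaurentOn.coord_inv (by simp))
      (h.regular.mem_regOff w' _) (idx_injective w)
    rcases i with i | i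
    exacts [hx.ne i, absurd ⟨i, rfl⟩ hi]
  choose c hc using fun v => (hL v).exists_coeff
  obtain ⟨ε, hε, hreg⟩ : ∃ ε > 0, WordReg w ζ (elim (fun t => X (.inl t)) fun _ => (2 * ε : ℝ)) := by
    have h0 : WordReg w ζ (elim (fun t => X (.inl t)) fun _ => ((2 * (0 : ℝ) : ℝ) : ℂ)) := hX.mono
      (fun t => rfl) fun i => by simp
    have h1 := WordReg.eventually (w := w) (ζ := fun _ : ℝ => ζ) (a := (0 : ℝ)) continuousAt_const
      (x := fun ε : ℝ => elim (fun t => X (.inl t)) fun _ => ((2 * ε : ℝ) : ℂ)) (continuousAt_pi.mpr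
      fun a => by
        rcases a with a | a
        · exact continuousAt_const
        · simp only [elim_inr]; fun_prop) h0
    have h2 : ∀ᶠ ε in 𝓝[>] (0 : ℝ), 0 < ε := self_mem_nhdsWithin
    exact (h2.and (h1.filter_mono nhdsWithin_le_nhds)).exists
  let r : Fin J ⊕ Fin n → ℝ := elim (fun t => ‖X (.inl t)‖) fun _ => ε
  have hr : ∀ s, 0 < r s := by
    rintro (s | s)
    exacts [norm_pos_iff.mpr (hX.ne s), hε]
  have hreg' : ∀ Y : Fin J ⊕ Fin n → ℂ, (∀ t, ‖Y (.inl t)‖ = r (.inl t)) → (∀ i, ‖Y (.inr i)‖ ≤ 2 *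
    ε) → WordReg w ζ Y := fun Y h1 h2 =>
    hreg.mono h1 fun i => by
      rw [elim_inr, Complex.norm_real, Real.norm_of_nonneg (by linarith)]; exact h2 i
  have hco : ∀ (Y : Fin J ⊕ Fin n → ℂ) i t, coords w ζ (update Y (.inr i) t) = update (coords w ζ Y)
    (place w i) (ζ i + t) := fun Y i t => by
    rw [coords_eq_tuple, coords_eq_tuple, ← tuple_update]; congr 1; funext j
    by_cases hj : j = i
    · subst hj; simp
    · rw [update_of_ne hj, update_of_ne (by simpa using hj)]
  have hcoi : ∀ (Y : Fin J ⊕ Fin n → ℂ) i, coords w ζ Y (place w i) = ζ i + Y (.inr i) := fun Y i =>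
    by rw [coords_eq_tuple, tuple_place]
  have hstep : ∀ (i : Fin n) (v : Fin n → V) (K : Fin J ⊕ Fin n → ℤ), c v K = c (update v i (A.Y (K
    (.inr i)) (v i) A.vac)) (update K (.inr i) (-1)) := by
    intro i
    refine creation_coeff (F := F) hr (T := fun k v => update v i (A.Y k (v i) A.vac)) (fun v Y h1
      h2 => hc v Y (hreg' Y (fun t => h1 _ (by simp)) fun j => ?_)) fun v Y h1 => ?_
    · by_cases hj : j = i
      · subst hj; exact h2.trans (by simp [r]; linarith)
      · exact (h1 (.inr j) (by simpa using hj)).le.trans (by simp [r]; linarith)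
    · have hup : ∀ t : ℂ, ‖t‖ ≤ 2 * ε → WordReg w ζ (update Y (.inr i) t) := fun t ht => by
        refine hreg' _ (fun s => by rw [update_of_ne (by simp)]; exact h1 _) fun j => ?_
        by_cases hj : j = i
        · subst hj; simpa using ht
        · rw [update_of_ne (by simpa using hj), h1]; simp [r]; linarith
      have h2 := h.regular.hasSum_taylor (tuple w (fun t => U (.inl t)) v) w' (i := place w i)
        (z := coords w ζ (update Y (.inr i) 0)) (ρ := 2 * ε) (ξ := Y (.inr i))
        (fun t ht => ?_) (by rw [h1]; simp [r]; linarith)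
      · simp only [hco, update_self, add_zero, update_idem, tuple_place, ← tuple_update] at h2
        rw [← hcoi, update_eq_self] at h2; simp only [F, hco, add_zero]; exact h2
      · rw [hco, add_zero, update_idem, show t = ζ i + (t - ζ i) by ring, ← hco]
        refine (hup _ ?_).coords_injective
        rw [hcoi, update_self, add_zero, mem_ball_iff_norm] at ht; exact ht.le
  have hbase : ∀ (v : Fin n → V) (k : Fin J → ℤ), c v (elim k fun _ => -1) = wordTerm M Φ w k (fun t
    => U (.inl t)) v w' ζ := by
    intro v k
    refine congrFun ((independent_torus fun t => hr (.inl t)).eq (c := fun k => c v (elim k fun _ =>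
      -1)) (f := fun x => F v (elim x 0)) (fun x hx => ?_) fun x hx => h.hasSum _ v w' (hreg' _ hx
      fun i => by simpa using hε.le)) k
    exact (hasSum_centre_iff (a := c v)).mp (hc v _ (hreg' _ hx fun i => by simpa using hε.le))
  have key : ∀ (S : Finset (Fin n)) (v : Fin n → V) (K : Fin J ⊕ Fin n → ℤ), (∀ i ∉ S, K (.inr i) =
    -1) → c v K = wordTerm M Φ w (fun t => K (.inl t)) (fun t => U (.inl t)) (fun i => A.Y (K (.inr
    i)) (v i) A.vac) w' ζ := by
    intro S
    induction S using Finset.induction_on with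
    | empty =>
      intro v K hK
      have : K = elim (fun t => K (.inl t)) fun _ => -1 := by
        funext s; rcases s with s | s
        exacts [rfl, hK s (by simp)]
      have h1 := hbase v fun t => K (.inl t); rw [← this] at h1
      simp only [h1, fun i => hK i (Finset.notMem_empty i), A.creation_lim]
    | insert i S hi ih =>
      intro v K hK; rw [hstep i, ih _ _ fun j hj => ?_]
      · congr 1; funext j
        by_cases hj : j = i
        · subst hj; simp [A.creation_lim]
        · rw [update_of_ne hj, update_of_ne (by simpa using hj)]
      · by_cases hj' : j = i
        · subst hj'; simp
        · rw [update_of_ne (by simpa using hj')]; exact hK j (by simp [hj, hj'])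
  refine (hc (fun i => U (.inr i)) X hX).of_eq fun K => ?_; rw [key univ _ K (by simp)]; rfl

lemma Good.exists_isWord {J d : ℕ} (h : Good M p (J + d) Φ) (w : Fin J → FaceKind n) : ∃ Z, IsWord M
    p Φ w Z ∧ Good M p d Z := by
  induction J generalizing d with
  | zero => exact ⟨Φ, ⟨rfl, h.regular⟩, by rwa [Nat.zero_add] at h⟩
  | succ J ih =>
    obtain ⟨Y, hY, h1⟩ := ih (d := d + 1) (by rwa [Nat.add_right_comm] at h) (tail w)
    obtain ⟨Z, hZ, h2⟩ := h1.2 ((w 0).map (place (tail w))); exact ⟨Z, ⟨Y, hY, h2.regular, hZ⟩, h2⟩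

lemma exists_word {a J : ℕ} {c : Fin n → ℕ} (hJ : a + ∑ i, c i = J) (l : ℕ) : ∃ (w : Fin J →
    FaceKind n) (G : (Fin a ⊕ Σ i, Fin (c i + 1)) ≃ Fin J ⊕ Fin n), Shape w l G := by
  subst hJ
  let f : (Fin a ⊕ Σ i, Fin (c i)) ⊕ Fin n → Fin a ⊕ Σ i, Fin (c i + 1) := elim (Sum.map id fun s =>
    ⟨s.1, s.2.rev.castSucc⟩) fun i => .inr ⟨i, last _⟩
  have hf : Bijective f := by
    refine (Fintype.bijective_iff_surjective_and_card f).mpr ⟨?_, ?_⟩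
    · rintro (j | ⟨i, j⟩)
      · exact ⟨.inl (.inl j), rfl⟩
      · refine lastCases ⟨.inr i, rfl⟩ (fun j => ⟨.inl (.inr ⟨i, j.rev⟩), ?_⟩) j; simp [f]
    · simp [sum_add_distrib, add_assoc]
  let H := ofBijective f hf
  let e : (Fin a ⊕ Σ i, Fin (c i)) ≃ Fin (a + ∑ i, c i) := ((Equiv.refl _).sumCongr
    finSigmaFinEquiv).trans finSumFinEquiv
  let w : Fin (a + ∑ i, c i) → FaceKind n := fun s =>
    elim (fun j : Fin a => if (j : ℕ) < l then .left else .right) (fun s => .mid s.1) (e.symm s)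
  let G := H.symm.trans (e.sumCongr (Equiv.refl _))
  have h1 : ∀ j, G (.inl j) = .inl (e (.inl j)) := fun j => by
    simp only [G, trans_apply, show Sum.inl j = H (.inl (.inl j)) from rfl,
      Equiv.symm_apply_apply]; rfl
  have h2 : ∀ i (j : Fin (c i)), G (.inr ⟨i, j.castSucc⟩) = .inl (e (.inr ⟨i, j.rev⟩)) := fun i j =>
    by
      have : (.inr ⟨i, j.castSucc⟩ : Fin a ⊕ Σ i, Fin (c i + 1)) = H (.inl (.inr ⟨i, j.rev⟩)) := by
        simp [H, f]
      simp only [G, trans_apply, this, Equiv.symm_apply_apply]; rfl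
  have h3 : ∀ i, G (.inr ⟨i, last _⟩) = .inr i := fun i => by
    simp only [G, trans_apply, show (.inr ⟨i, last _⟩ : Fin a ⊕ Σ i, Fin (c i + 1)) =
      H (.inr i) from rfl, Equiv.symm_apply_apply]; rfl
  have hw : ∀ s, w (e s) = elim (fun j : Fin a => if (j : ℕ) < l then .left else .right) (fun s =>
    .mid s.1) s := fun s => by simp only [w, Equiv.symm_apply_apply]
  refine ⟨w, G, fun j => ?_, fun s => ?_, fun j j' hj => ?_, fun i j j' hj => ?_, fun j t ht => ?_⟩
  · rw [h1]; change (w _).base = none; rw [hw, elim_inl]; split_ifs <;> rfl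
  · obtain ⟨i, j⟩ := s; refine lastCases (by rw [h3]; rfl) (fun j => ?_) j; rw [h2]
    change (w _).base = some i; rw [hw]; rfl
  · rw [h1, h1]; exact hj
  · revert hj
    refine lastCases (fun hj => absurd hj (Fin.le_last _).not_gt) (fun j => ?_) j
    refine lastCases (fun _ => by rw [h2, h3]; trivial) (fun j' hj => ?_) j'; rw [h2, h2]
    have : (j : ℕ) < j' := hj; simp [e, Newer, Fin.lt_def, finSigmaFinEquiv_apply]; omega
  · rw [h1] at ht; rw [← Sum.inl_injective ht, hw, elim_inl]; split_ifs with h <;> simp [h]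

lemma Good.composableWith (hn : 0 < n) {m : ℕ} (h : Good M p m Φ) : ComposableWith M p m Φ := by
  intro a α hα hs l hl u₀ u w'
  obtain ⟨c, rfl⟩ : ∃ c : Fin n → ℕ, α = fun i => c i + 1 := ⟨fun i => α i - 1, funext fun i =>
    (Nat.sub_add_cancel (hα i)).symm⟩
  have hm : a + ∑ i, c i = m := by
    simp only [sum_add_distrib, Finset.sum_const, Finset.card_univ, Fintype.card_fin, smul_eq_mul,
      mul_one] at hs
    omega
  obtain ⟨w, G, hG⟩ := exists_word hm l; obtain ⟨Z, hZ, -⟩ := Good.exists_isWord (d := 0) h w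
  let U : Fin m ⊕ Fin n → V := fun s => joinVars u₀ u (G.symm s)
  have hU : ∀ s, U (G s) = joinVars u₀ u s := fun s => by simp [U]
  obtain ⟨q, hq⟩ := hZ.regular.poleBound (tuple w (fun t => U (.inl t)) fun i => U (.inr i)) w'
  refine ⟨MvPolynomial.rename (Shape.index w G) q, fun z₀ z ζ hz => ?_⟩
  let X : Fin m ⊕ Fin n → ℂ := fun s => joinVars z₀ z (G.symm s) - blockCtr ζ (cls w s)
  have hX : ∀ s, blockCtr ζ (cls w (G s)) + X (G s) = joinVars z₀ z s := fun s => by simp [X]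
  have hr := (hG.region_iff hn hX).mp hz; refine (hG.hasSum_iff (Φ := Φ) hU hX w' _).mpr ?_
  have h1 := hq _ hr.coords_injective; have h2 := hZ.hasSum_full U w' hr
  rw [← mul_div_cancel_right₀ (cor Z w' _ _) (poleProd_ne_zero p _ hr.coords_injective), h1] at h2
  rw [Shape.coords_eq hX, Shape.tuple_eq hU, poleProd_comp_equiv] at h2; rwa [eval_rename]

lemma Face.add_smul {X Y : Cochain V gr (n + 1)} (h : Face M κ Φ X) (h' : Face M κ Ψ Y) (a : ℂ) :
    Face M κ (Φ + a • Ψ) (X + a • Y) := by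
  intro u v w' t y hy ht; rw [cor_add, cor_smul]
  refine ((h u v w' t y hy ht).add ((h' u v w' t y hy ht).mul_left a)).of_eq fun k => ?_
  rw [cor_add, cor_smul]; ring

lemma Regular.add_smul (h : Regular M p Φ) (h' : Regular M p Ψ) (a : ℂ) : Regular M p (Φ + a • Ψ) :=
    by
  refine ⟨fun v w' => ?_, fun i v w' z hz => ?_, fun v w' z hz => ?_, fun v d hv c φ t z ht hz =>
    ?_⟩
  · obtain ⟨f, hf⟩ := h.poleBound v w'; obtain ⟨g, hg⟩ := h'.poleBound v w'
    refine ⟨f + MvPolynomial.C a * g, fun z hz => ?_⟩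
    rw [map_add, map_mul, eval_C, ← hf z hz, ← hg z hz, cor_add, cor_smul]; ring
  · simp only [cor_add, cor_smul]
    exact (h.hasDerivAt i v w' z hz).add ((h'.hasDerivAt i v w' z hz).const_mul a)
  · simp only [cor_add, cor_smul, h.sum_D v w' z hz, h'.sum_D v w' z hz, sum_add_distrib, mul_sum]
  · simp only [cor_add, cor_smul, mul_add]
    rw [h.homogeneous v d hv c φ t z ht hz, mul_left_comm, h'.homogeneous v d hv c φ t z ht hz,
      mul_left_comm]

lemma Good.add_smul {m : ℕ} (h : Good M p m Φ) (h' : Good M p m Ψ) (a : ℂ) : Good M p m (Φ + a • Ψ)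
    := by
  induction m generalizing n with
  | zero => exact Regular.add_smul h h' a
  | succ m ih =>
    refine ⟨h.regular.add_smul h'.regular a, fun κ => ?_⟩; obtain ⟨X, hX, h1⟩ := h.2 κ
    obtain ⟨Y, hY, h2⟩ := h'.2 κ; exact ⟨_, hX.add_smul hY a, ih h1 h2⟩

lemma cor_adj_of_injective (Ψ : Cochain V gr n) {L : W →ₗ[ℂ] W} (h : L ∈ FinOp gr) (w' : GradedDual
    gr) (v : Fin n → V) {z : Fin n → ℂ} (hz : Injective z) : cor Ψ (adj L w') v z = barPairing gr w'
    (extendOp gr L (Ψ v ⟨z, hz⟩)) := by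
  rw [cor_adj _ h, evalAt_of_injective _ hz]

lemma Regular.dDerivativeProperty (h : Regular M p Φ) : DDerivativeProperty M Φ := by
  refine ⟨fun i v w' z => ?_, fun v w' z => ?_⟩
  · rw [← cor_conf]; exact h.hasDerivAt i v w' z z.injective
  · refine ((cor_adj_of_injective Φ M.D_mem_finOp w' v z.injective).symm.trans (h.sum_D v w' z z.injective)).trans ?_
    exact sum_congr rfl fun i _ => (h.hasDerivAt i v w' z z.injective).deriv.symm

lemma Regular.dConjugationProperty (h : Regular M p Φ) : DConjugationProperty grV Φ := by
  intro v w' t z y ht hy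
  induction w' using gradedDual_induction with
  | h0 => rw [barPairing_zero_left, barPairing_zero_left]
  | hof c φ =>
    induction v using hom_induction grV with
    | hom v d hv =>
      have h1 := h.homogeneous v d hv c φ t z ht z.injective
      rw [show (t • ⇑z) = y from funext fun i => (hy i).symm, cor_conf, cor_conf, barPairing_of,
        barPairing_of] at h1
      simp only [barPairing_of, map_smul, smul_eq_mul, scaleOp_of_mem _ (hv _)]
      rw [h1, MultilinearMap.map_smul_univ, Pi.smul_apply, Pi.smul_apply, map_smul, smul_eq_mul]
      congr 1; refine Finset.induction_on univ (by simp) fun a s ha ih => ?_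
      rw [prod_insert ha, sum_insert ha, ← ih, zpow_add₀ ht]
    | hadd v i x x' h1 h2 =>
      have h3 : ∀ x, (fun j => scaleOp grV (fun k : ℤ => t ^ k) (update v i x j)) = update (fun j =>
        scaleOp grV (fun k : ℤ => t ^ k) (v j)) i (scaleOp grV (fun k : ℤ => t ^ k) x) := fun x =>
        by
        funext j; exact apply_update (fun _ => scaleOp grV (fun k : ℤ => t ^ k)) v i x j
      simp only [h3, barPairing_of, map_add, MultilinearMap.map_update_add, Pi.add_apply,
        smul_add] at h1 h2 ⊢
      rw [h1, h2]
  | hadd a b ha hb => rw [barPairing_add_left, barPairing_add_left, ha, hb]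

lemma IsBarRational.mem_regOff {f : Conf n → Completion gr} (h : IsBarRational gr f) (w' :
    GradedDual gr) : (fun z => barPairing gr w' (evalAt f z)) ∈ RatFun n := by
  obtain ⟨p, g, hg⟩ := h; obtain ⟨q, -, hq⟩ := hg w'
  refine poleProd_mem_regOff (h := q) (fun i j => if i < j then p i j else 0) id fun z hz => ?_
  refine Eq.trans ?_ (hq ⟨z, hz⟩); rw [evalAt_of_injective _ hz, mul_comm]; congr 1
  refine prod_congr rfl fun i _ => (Finset.prod_subset (fun j hj => ?_) fun j _ hj => ?_).symm.trans
    (prod_congr rfl fun j hj => ?_)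
  · exact Finset.mem_erase.mpr ⟨(Finset.mem_Ioi.mp hj).ne', mem_univ j⟩
  · have : ¬ i < j := by simpa using hj
    simp [this]
  · simp [Finset.mem_Ioi.mp hj]

/-- `Z` is the composition of a cochain with a vertex operator. -/
def IsComp (M : Bimodule A gr) (Φ : Cochain V gr n) : FaceKind n → Cochain V gr (n + 1) → Prop
  | .left => IsLeftComp M Φ
  | .right => IsRightComp M Φ
  | .mid i => IsMidComp A i Φ

lemma IsComp.isBarRational {Z : Cochain V gr (n + 1)} (h : IsComp M Φ κ Z) (v : Fin (n + 1) → V) :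
    IsBarRational gr (Z v) := by
  cases κ <;> exact (h v).1

lemma ins_last_castSucc {X : Type*} (x : X) (y : Fin n → X) (i : Fin n) : ins (last n) x y
    i.castSucc = y i := by
  rw [← Fin.succAbove_last, ins_succAbove]

lemma ins_castSucc_succ {X : Type*} (i : Fin n) (x : X) (y : Fin n → X) : ins i.castSucc x y i.succ
    = y i := by
  rw [← succAbove_castSucc_self, ins_succAbove]

lemma succ_succAbove {i j : Fin n} (h : j ≠ i) : i.succ.succAbove j = i.castSucc.succAbove j := by
  have := Fin.val_ne_of_ne h; simp only [Fin.ext_iff, val_succAbove, val_castSucc, Fin.val_succ]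
  split_ifs <;> omega

lemma IsComp.face {Z : Cochain V gr (n + 1)} (h : IsComp M Φ κ Z) : Face M κ Φ Z := by
  intro u v w' t y hy ht; have hz := ht.injective hy; rw [cor_of_injective _ _ _ hz]
  rcases κ with _ | _ | i
  · refine ((h (ins 0 u v)).2 ⟨_, hz⟩ ht.2 w').of_eq fun k => ?_
    rw [wT, cor_adj_of_injective Φ (M.YL_mem_finOp k u) w' _ hy, ctr, sub_zero]; rfl
  · refine ((h (ins (last n) u v)).2 ⟨_, hz⟩ (fun i => ?_) w').of_eq fun k => ?_
    · simpa [pos, ins_last_castSucc] using ht.2 i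
    · rw [wT, cor_adj_of_injective Φ (M.YS_mem_finOp k u) w' _ hy, ctr, sub_zero]
      have : (Fin.castSuccEmb.trans ⟨_, hz⟩ : Conf n) = ⟨y, hy⟩ := DFunLike.ext _ _ fun i =>
        ins_last_castSucc t y i
      simp only [ins_last_castSucc, this, vT]
      simp only [pos, Embedding.coeFn_mk, insertNth_apply_same]; rfl
  · have h0 : ins i.castSucc t y i.succ - y i = 0 := by rw [ins_castSucc_succ, sub_self]
    have h2 : 0 < ‖t - y i‖ := norm_pos_iff.mpr (sub_ne_zero.mpr ht.1)
    have h1 := (h (ins i.castSucc u v)).2 ⟨_, hz⟩ ⟨y, hy⟩ (fun j hj => by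
        change y j = ins i.castSucc t y _; rw [succ_succAbove hj, ins_succAbove])
      (by
        change ‖ins i.castSucc t y i.succ - y i‖ < ‖ins i.castSucc t y i.castSucc - y i‖
        rwa [h0, norm_zero, ins_same])
      (fun j hj => by
        change ‖ins i.castSucc t y i.castSucc - y i‖ < ‖y j - y i‖; rw [ins_same]
        exact ht.2 j hj) w'
    let c : ℤ → ℤ × ℤ := fun k => (k, -1); have hc : Injective c := fun k l e => congrArg Prod.fst e
    rw [← hc.hasSum_iff] at h1
    · refine h1.of_eq fun k => ?_
      change barPairing gr w' (Φ (update (fun j => ins i.castSucc u v (i.succ.succAbove j)) i (A.Y k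
        (ins i.castSucc u v i.castSucc) (A.Y (-1) (ins i.castSucc u v i.succ) A.vac))) _) * ((ins
        i.castSucc t y i.castSucc - y i) ^ (-k - 1) * (ins i.castSucc t y i.succ - y i) ^ (-(-1) - 1
        : ℤ)) = _
      rw [h0, show (-(-1) - 1 : ℤ) = 0 by norm_num, zpow_zero, mul_one, A.creation_lim,
        ins_castSucc_succ, ins_same, ins_same, cor_of_injective _ _ _ hy, show update (fun j => ins
        i.castSucc u v (i.succ.succAbove j)) i (A.Y k u (v i)) = (mid i).vT A k u v from
          funext fun j => by
            by_cases hj : j = i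
            · subst hj; simp [vT]
            · rw [update_of_ne hj, succ_succAbove hj, vT, update_of_ne hj, ins_succAbove]]
      rfl
    · intro k hk; have : -k.2 - 1 ≠ 0 := fun e => hk ⟨k.1, Prod.ext rfl (by simp only [c]; omega)⟩
      change _ * (_ * (ins i.castSucc t y i.succ - y i) ^ (-k.2 - 1)) = 0
      rw [h0, zero_zpow _ this, mul_zero, mul_zero]

lemma Face.isComp (hn : 0 < n) (hΦ : Regular M p Φ) {Z : Cochain V gr (n + 1)} (h : Face M κ Φ Z)
    (hZ : Regular M p Z) : IsComp M Φ κ Z := by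
  rcases κ with _ | _ | i <;> refine fun v => ⟨hZ.isBarRational v, ?_⟩
  · intro z hz w'
    have hi : Injective fun i : Fin n => z i.succ := injective_removeNth 0 z.injective
    have h1 := h (v 0) (fun i => v i.succ) w' (z 0) (fun i => z i.succ) hi ⟨norm_pos_iff.mp
      ((norm_nonneg _).trans_lt (hz ⟨0, hn⟩)), hz⟩
    rw [pos, show ins 0 (v 0) (fun i => v i.succ) = v from ins_self 0 v, show ins 0 (z 0) (fun i =>
      z i.succ) = z from ins_self 0 z, cor_conf] at h1
    refine h1.of_eq fun k => ?_
    rw [wT, cor_adj_of_injective Φ (M.YL_mem_finOp k _) w' _ hi, ctr, sub_zero]; rfl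
  · intro z hz w'
    have hi : Injective fun i : Fin n => z i.castSucc := z.injective.comp (Fin.castSucc_injective n)
    have h1 := h (v (last n)) (fun i => v i.castSucc) w' (z (last n)) (fun i => z i.castSucc) hi
      ⟨norm_pos_iff.mp ((norm_nonneg _).trans_lt (hz ⟨0, hn⟩)), hz⟩
    have e1 := ins_self (last n) v; have e2 := ins_self (last n) z
    simp only [Fin.succAbove_last] at e1 e2; rw [pos, e1, e2, cor_conf] at h1
    refine h1.of_eq fun k => ?_
    rw [wT, cor_adj_of_injective Φ (M.YS_mem_finOp k _) w' _ hi, ctr, sub_zero]; rfl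
  · intro z y hy h1 h2 w'; let a : Fin n → V := fun j => v (i.castSucc.succAbove j)
    have hw : IsWord M p Φ ![.mid i] Z := IsWord.one hΦ hZ h
    have hsi : i.castSucc.succAbove i = i.succ := succAbove_castSucc_self i
    let x : Fin n → ℂ := update 0 i (z i.succ - y i)
    have hx : ∀ j, j ≠ i → x j = 0 := fun j hj => update_of_ne hj _ _
    have hxi : x i = z i.succ - y i := update_self ..
    have hr : WordReg ![.mid i] y (elim ![z i.castSucc - y i] x) := by
      have hc0 : ∀ t : Fin 1, cls ![mid i] (.inl t) = some i := fun t => by fin_cases t; rfl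
      have hn0 : ∀ s, cls ![mid i] s ≠ none := by
        rintro (s | s)
        · simp [hc0]
        · exact nofun
      refine ⟨fun t => ?_, fun s _ _ e => absurd e (hn0 s), ?_, ?_, fun s _ _ e => absurd e (hn0 s)⟩
      · fin_cases t
        exact norm_pos_iff.mp ((norm_nonneg _).trans_lt h1)
      · rintro (s | s) (t | t) l e1 e2 e3
        · exact absurd (Subsingleton.elim s t) e1.ne
        · exact e1.elim
        · fin_cases t
          obtain rfl : s = i := Option.some.inj (e2.trans e3.symm); rw [elim_inr, hxi]; exact h1
        · exact e1.elim
      · have hi : ∀ s l, cls ![mid i] s = some l → ‖elim ![z i.castSucc - y i] x s‖ ≤ if l = i then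
          ‖z i.castSucc - y i‖ else 0 := by
          rintro (s | s) l e
          · obtain rfl : i = l := Option.some.inj ((hc0 s).symm.trans e); rw [if_pos rfl]
            fin_cases s
            exact le_rfl
          · obtain rfl : s = l := Option.some.inj e; rw [elim_inr]; split_ifs with e'
            · rw [e', hxi]; exact h1.le
            · rw [hx s e', norm_zero]
        intro s t j l hjl e1 e2; refine (add_le_add (hi s j e1) (hi t l e2)).trans_lt ?_
        by_cases hj : j = i
        · have hl : l ≠ i := fun e => hjl (hj.trans e.symm)
          rw [if_pos hj, if_neg hl, add_zero, hj, norm_sub_rev (y i)]; exact h2 l hl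
        · rw [if_neg hj, zero_add]; split_ifs with hl
          · rw [hl]; exact h2 j hj
          · exact norm_pos_iff.mpr (sub_ne_zero.mpr (y.injective.ne hjl))
    have h3 := hw.hasSum_full (elim ![v i.castSucc] a) w' hr
    let c : ℤ × ℤ → Fin 1 ⊕ Fin n → ℤ := fun k => elim ![k.1] (update (fun _ => -1) i k.2)
    have hc : Injective c := fun k l e => Prod.ext (congrFun e (.inl 0))
      (by simpa only [c, elim_inr, update_self] using congrFun e (.inr i))
    have e1 : tuple ![mid i] ![v i.castSucc] a = v := by rw [tuple_one]; exact ins_self _ v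
    have e2 : coords ![mid i] y (elim ![z i.castSucc - y i] x) = z := by
      rw [coords_eq_tuple, tuple_one]; refine Eq.trans ?_ (ins_self i.castSucc z); congr 1
      · exact add_sub_cancel _ _
      · funext j
        by_cases hj : j = i
        · subst hj; rw [elim_inr, hxi, hsi]; ring
        · rw [elim_inr, hx j hj, ← succ_succAbove hj, hy j hj, add_zero]
    rw [e2] at h3; change HasSum _ (cor Z w' (tuple ![mid i] ![v i.castSucc] a) z) at h3
    have hci : ∀ k, c k (.inr i) = k.2 := fun k => by simp only [c, elim_inr, update_self]
    have hcj : ∀ k j, j ≠ i → c k (.inr j) = -1 := fun k j hj => by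
      simp only [c, elim_inr, update_of_ne hj]
    rw [e1, cor_conf, ← hc.hasSum_iff] at h3
    · refine h3.of_eq fun k => ?_
      have e3 : ∏ s, elim ![z i.castSucc - y i] x s ^ (-c k s - 1) = (z i.castSucc - y i) ^ (-k.1 -
        1) * (z i.succ - y i) ^ (-k.2 - 1) := by
        rw [Fintype.prod_sum_type, Fintype.prod_subsingleton _ 0, Finset.prod_eq_single i]
        · rw [hci, elim_inr, hxi]; rfl
        · intro j _ hj; rw [hcj k j hj, show (-(-1) - 1 : ℤ) = 0 by norm_num, zpow_zero]
        · exact fun e => absurd (mem_univ i) e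
      have e4 : fullTerm M Φ ![.mid i] (c k) (elim ![v i.castSucc] a) w' y = barPairing gr w' (Φ
        (update (fun j => v (i.succ.succAbove j)) i (A.Y k.1 (v i.castSucc) (A.Y k.2 (v i.succ)
        A.vac))) y) := by
        rw [← cor_conf]; change cor Φ w' (update _ i (A.Y k.1 (v i.castSucc) _)) y = _; congr 1
        funext j
        by_cases hj : j = i
        · subst hj; rw [update_self, update_self, ← hci k, ← hsi]; rfl
        · rw [update_of_ne hj, update_of_ne hj, hcj k j hj, A.creation_lim, succ_succAbove hj]
          rfl
      rw [comp, e3, e4]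
    · intro K hK
      have : ∃ j, j ≠ i ∧ K (.inr j) ≠ -1 := by
        by_contra! e
        refine hK ⟨(K (.inl 0), K (.inr i)), funext fun s => ?_⟩; rcases s with s | j
        · fin_cases s; rfl
        · by_cases hj : j = i
          · rw [hj, hci]
          · rw [hcj _ j hj, e j hj]
      obtain ⟨j, hj, hK'⟩ := this; rw [Finset.prod_eq_zero (mem_univ (Sum.inr j)), mul_zero]
      rw [elim_inr, hx j hj, zero_zpow _ (by omega)]

lemma IsComp.unique {Z Z' : Cochain V gr (n + 1)} (h : IsComp M Φ κ Z) (h' : IsComp M Φ κ Z') : Z =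
    Z' := by
  refine cochain_ext fun w' v z hz => ?_
  refine κ.eq_of_reg ((h.isBarRational v).mem_regOff w') ((h'.isBarRational v).mem_regOff w') (fun t
    y hy ht => ?_) hz
  have h1 := h.face (v κ.pos) (fun j => v (κ.pos.succAbove j)) w' t y hy ht
  have h2 := h'.face (v κ.pos) (fun j => v (κ.pos.succAbove j)) w' t y hy ht; rw [ins_self] at h1 h2
  exact h1.unique h2

/-- The faces in the order in which they occur in the coboundary. -/
def FaceKind.of (j : Fin (n + 2)) : FaceKind n :=
  if (j : ℕ) = 0 then .left else if h : (j : ℕ) - 1 < n then .mid ⟨j - 1, h⟩ else .right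

lemma FaceKind.of_left {j : Fin (n + 2)} (h : (j : ℕ) = 0) : of j = left := if_pos h

lemma FaceKind.of_mid {j : Fin (n + 2)} {i : Fin n} (h : (j : ℕ) = i + 1) : of j = mid i := by
  simp [of, h]

lemma FaceKind.of_right {j : Fin (n + 2)} (h : (j : ℕ) = n + 1) : of j = right := by simp [of, h]

lemma compositionsDefined_and_coboundary_eq (hn : 0 < n) (hΦ : Regular M p Φ) {X : FaceKind n →
    Cochain V gr (n + 1)} (hX : ∀ κ, Face M κ Φ (X κ)) (hr : ∀ κ, Regular M p (X κ)) :
    CompositionsDefined M Φ ∧ coboundary M Φ = ∑ j : Fin (n + 2), (-1 : ℂ) ^ (j : ℕ) • X (.of j) :=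
    by
  have h : ∀ κ, IsComp M Φ κ (X κ) := fun κ => (hX κ).isComp hn hΦ (hr κ)
  have hu : ∀ κ, ∃! Z, IsComp M Φ κ Z := fun κ => ⟨X κ, h κ, fun Z hZ => hZ.unique (h κ)⟩
  refine ⟨⟨hu .left, fun i => hu (.mid i), hu .right⟩, ?_⟩
  have h1 : leftComp M Φ = X .left := by
    have : ∃ Z, IsLeftComp M Φ Z := (hu .left).exists; rw [leftComp, dif_pos this]
    exact IsComp.unique (κ := .left) this.choose_spec (h .left)
  have h2 : rightComp M Φ = X .right := by
    have : ∃ Z, IsRightComp M Φ Z := (hu .right).exists; rw [rightComp, dif_pos this]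
    exact IsComp.unique (κ := .right) this.choose_spec (h .right)
  have h3 : ∀ i, midComp A i Φ = X (.mid i) := fun i => by
    have : ∃ Z, IsMidComp A i Φ Z := (hu (.mid i)).exists; rw [midComp, dif_pos this]
    exact IsComp.unique (M := M) (κ := .mid i) this.choose_spec (h (.mid i))
  have e : ∀ i : Fin n, of i.castSucc.succ = .mid i := fun i => of_mid rfl
  rw [Fin.sum_univ_succ, Fin.sum_univ_castSucc, of_left rfl, of_right rfl]
  simp only [coboundary, h1, h2, h3, e, val_zero, pow_zero, one_smul, Fin.val_succ, val_castSucc,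
    val_last, add_assoc]

lemma Face.of_succ (hΦ : Regular M p Φ) {X Y : Cochain V gr (n + 1)} {Z Z' : Cochain V gr (n + 2)}
    {j k : Fin (n + 2)} (hjk : j ≤ k) (hX : Face M (.of j) Φ X) (hY : Face M (.of k) Φ Y) (hZ : Face
    M (.of j.castSucc) Y Z) (hZ' : Face M (.of k.succ) X Z') (rX : Regular M p X) (rY : Regular M p
    Y) (rZ : Regular M p Z) (rZ' : Regular M p Z') : Z = Z' := by
  have hc : ∀ j : Fin (n + 2), (j : ℕ) = 0 ∨ (∃ i : Fin n, (j : ℕ) = i + 1) ∨ (j : ℕ) = n + 1 := fun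
    j => by
      rcases Nat.eq_zero_or_pos j with h | h
      · exact .inl h
      · by_cases h' : (j : ℕ) = n + 1
        · exact .inr (.inr h')
        · exact .inr (.inl ⟨⟨j - 1, by omega⟩, by simp only; omega⟩)
  have hu : j = k → X = Y := fun e => by subst e; exact hX.unique hY rX.poleBound rY.poleBound
  rcases hc j with h | ⟨i, h⟩ | h
  · rw [of_left (by simpa using h)] at hX hZ; rcases hc k with h' | ⟨l, h'⟩ | h'
    · obtain rfl := hu (Fin.ext (h.trans h'.symm)); rw [of_mid (i := 0) (by simp [h'])] at hZ'
      exact (Face.left_left hΦ rX rZ hX hZ).unique hZ' rZ.poleBound rZ'.poleBound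
    · rw [of_mid h'] at hY; rw [of_mid (i := l.succ) (by simp [h'])] at hZ'
      exact (Face.commute (κ := .left) nofun hΦ rX rY rZ hY hZ hX).unique hZ' rZ.poleBound
        rZ'.poleBound
    · rw [of_right h'] at hY; rw [of_right (by simp [h'])] at hZ'
      exact (Face.left_right hΦ rX rY rZ hY hZ hX).unique hZ' rZ.poleBound rZ'.poleBound
  · rw [of_mid h] at hX; rw [of_mid (i := i.castSucc) (by simp [h])] at hZ
    rcases hc k with h' | ⟨l, h'⟩ | h'
    · exact absurd (Fin.le_def.mp hjk) (by omega)
    · rw [of_mid h'] at hY; rw [of_mid (i := l.succ) (by simp [h'])] at hZ'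
      by_cases e : j = k
      · obtain rfl := hu e; obtain rfl : i = l := Fin.ext (by omega)
        exact hZ.unique (Face.mid_mid hΦ rX rZ' hX hZ') rZ.poleBound rZ'.poleBound
      · have hil : i < l := by omega
        have := Face.commute (κ := .mid i) (i := l) (by simp [base, hil.ne]) hΦ rX rY rZ hY (by rwa
          [map, Fin.succAbove_of_castSucc_lt _ _ hil]) hX
        rw [pos, Fin.succAbove_of_le_castSucc _ _ hil.le] at this
        exact this.unique hZ' rZ.poleBound rZ'.poleBound
    · rw [of_right h'] at hY; rw [of_right (by simp [h'])] at hZ'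
      have := Face.commute (κ := .right) (i := i) nofun hΦ rY rX rZ' hX hZ' hY
      rw [pos, Fin.succAbove_last] at this; exact hZ.unique this rZ.poleBound rZ'.poleBound
  · have h' : (k : ℕ) = n + 1 := by have := Fin.le_def.mp hjk; omega
    obtain rfl := hu (Fin.ext (h.trans h'.symm)); rw [of_right h] at hX
    rw [of_mid (i := last n) (by simp [h])] at hZ; rw [of_right (by simp [h'])] at hZ'
    exact hZ.unique (Face.right_right hΦ rX rZ' hX hZ') rZ.poleBound rZ'.poleBound

lemma sum_split {N : ℕ} {B : Type*} [AddCommGroup B] (T : Fin (N + 1) → B) (j : Fin N) : ∑ k, T k =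
    ∑ k : Fin N, ((if k ≤ j then T k.castSucc else 0) + if j ≤ k then T k.succ else 0) := by
  have h : ∀ k : Fin N, ((if k ≤ j then T k.castSucc else 0) + if j ≤ k then T k.succ else 0) = (if
    k = j then T k.castSucc else 0) + T (j.castSucc.succAbove k) := fun k => by
    rcases lt_trichotomy k j with e | e | e
    · rw [if_pos e.le, if_neg e.not_ge, if_neg e.ne, Fin.succAbove_of_castSucc_lt _ _ e]; abel
    · subst e; simp
    · rw [if_neg e.not_ge, if_pos e.le, if_neg e.ne', Fin.succAbove_of_le_castSucc _ _ e.le]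
  simp only [h, sum_add_distrib, Finset.sum_ite_eq', mem_univ, if_true]
  exact sum_univ_succAbove T j.castSucc

lemma alternating_sum_eq_zero {N : ℕ} {B : Type*} [AddCommGroup B] [Module ℂ B] (Z : Fin N → Fin (N
    + 1) → B) (h : ∀ j k, j ≤ k → Z k j.castSucc = Z j k.succ) : ∑ k : Fin (N + 1), (-1 : ℂ) ^ (k :
    ℕ) • ∑ j : Fin N, (-1 : ℂ) ^ (j : ℕ) • Z j k = 0 := by
  simp only [smul_sum]; rw [Finset.sum_comm]
  simp only [fun j : Fin N => sum_split (fun k : Fin (N + 1) => (-1 : ℂ) ^ (k : ℕ) • (-1 : ℂ) ^ (j :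
    ℕ) • Z j k) j, sum_add_distrib]
  rw [Finset.sum_comm, ← sum_add_distrib]; refine Finset.sum_eq_zero fun j _ => ?_
  rw [← sum_add_distrib]; refine Finset.sum_eq_zero fun k _ => ?_; split_ifs with hjk
  · rw [h j k hjk, smul_smul, smul_smul, ← _root_.add_smul, val_castSucc, Fin.val_succ, pow_succ]
    ring_nf; simp
  · simp

lemma Face.sum {N : ℕ} {X : Fin N → Cochain V gr n} {Z : Fin N → Cochain V gr (n + 1)} (c : Fin N →
    ℂ) (h : ∀ j, Face M κ (X j) (Z j)) : Face M κ (∑ j, c j • X j) (∑ j, c j • Z j) := by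
  refine Finset.induction_on univ ?_ fun a s ha ih => ?_
  · intro u v w' t y _ _; simp only [Finset.sum_empty, cor_zero, zero_mul]; exact hasSum_zero
  · rw [sum_insert ha, sum_insert ha, add_comm, add_comm (_ • Z a)]; exact ih.add_smul (h a) _

lemma Good.sum {N m : ℕ} {X : Fin (N + 1) → Cochain V gr n} (c : Fin (N + 1) → ℂ) (h : ∀ j, Good M p
    m (X j)) : Good M p m (∑ j, c j • X j) := by
  have h0 : Good M p m (0 : Cochain V gr n) := by
    rw [show (0 : Cochain V gr n) = X 0 + (-1 : ℂ) • X 0 from cochain_ext fun w' v z _ => by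
      rw [cor_add, cor_smul, cor_zero]; ring]
    exact (h 0).add_smul (h 0) (-1)
  refine Finset.induction_on univ h0 fun a s ha ih => ?_; rw [sum_insert ha, add_comm]
  exact ih.add_smul (h a) _

lemma Good.exists_faces {m : ℕ} (h : Good M p (m + 1) Φ) : ∃ X : FaceKind n → Cochain V gr (n + 1),
    ∀ κ, Face M κ Φ (X κ) ∧ Good M p m (X κ) :=
  Classical.axiom_of_choice h.2

lemma Good.coboundary {m : ℕ} (hn : 0 < n) (h : Good M p (m + 2) Φ) : CompositionsDefined M Φ ∧ Good
    M p (m + 1) (coboundary M Φ) ∧ CompositionsDefined M (MOSVACohomology.coboundary M Φ) ∧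
    MOSVACohomology.coboundary M (MOSVACohomology.coboundary M Φ) = 0 := by
  obtain ⟨X, hX⟩ := h.exists_faces
  obtain ⟨h1, h2⟩ := compositionsDefined_and_coboundary_eq hn h.regular (fun κ => (hX κ).1) fun κ =>
    (hX κ).2.regular
  choose Z hZ using fun κ => (hX κ).2.exists_faces
  have h3 := Good.sum (fun j : Fin (n + 2) => (-1 : ℂ) ^ (j : ℕ)) fun j => (hX (.of j)).2; rw [h2]
  obtain ⟨h4, h5⟩ := compositionsDefined_and_coboundary_eq n.succ_pos h3.regular (fun κ => Face.sum
    _ fun j => (hZ (.of j) κ).1) fun κ => (Good.sum (fun j : Fin (n + 2) => (-1 : ℂ) ^ (j : ℕ)) fun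
    j => (hZ (.of j) κ).2).regular
  refine ⟨h1, h3, h4, h5.trans ?_⟩
  exact alternating_sum_eq_zero (fun j k => Z (.of j) (.of k)) fun j k hjk =>
    Face.of_succ h.regular hjk (hX _).1 (hX _).1 (hZ _ _).1 (hZ _ _).1 (hX _).2.regular (hX
      _).2.regular (hZ _ _).2.regular (hZ _ _).2.regular

end MOSVACohomology

end

theorem mainTheorem2 {V : Type*} [AddCommGroup V] [Module ℂ V] (grV : ℤ → Submodule ℂ V)
    [DirectSum.Decomposition grV] {W : Type*} [AddCommGroup W] [Module ℂ W] (gr : ℂ → Submodule ℂ W)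
    [DirectSum.Decomposition gr] (A : MOSVACohomology.MOSVA grV) (hA : A.PoleOrderCondition) (M :
    MOSVACohomology.Bimodule A gr) (hM : M.PoleOrderCondition) (m n : ℕ) (hm : 2 ≤ m) (hn : 1 ≤ n) :
    ∀ Φ ∈ MOSVACohomology.cochains M m n, MOSVACohomology.CompositionsDefined M Φ ∧
    MOSVACohomology.coboundary M Φ ∈ MOSVACohomology.cochains M (m - 1) (n + 1) ∧
    MOSVACohomology.CompositionsDefined M (MOSVACohomology.coboundary M Φ) ∧
    MOSVACohomology.coboundary M (MOSVACohomology.coboundary M Φ) = 0 := by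
  rintro Φ ⟨-, hD, hd, hc⟩; obtain ⟨p, hp⟩ := hc (by omega)
  obtain ⟨m, rfl⟩ := Nat.exists_eq_add_of_le' hm
  obtain ⟨h1, h2, h3⟩ := (MOSVACohomology.ComposableWith.good hn hp hD hd).coboundary hn
  exact ⟨h1, ⟨h2.regular.isBarRational, h2.regular.dDerivativeProperty,
    h2.regular.dConjugationProperty, fun _ => ⟨p, h2.composableWith n.succ_pos⟩⟩, h3⟩
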